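/- Let $\lambda\in\mathbb R$. For functions on $\mathbb R$ write $\langle x\rangle=\sqrt{1+x^2}$, let $$\mathcal F f(\xi)=\widehat f(\xi)=\frac1{\sqrt{2\pi}}\int_{\mathbb R} f(x)e^{-ix\xi}\,dx$$ (extended to $L^2(\mathbb R)$), and let $U(t)=e^{i\frac t2\partial_x^2}$ be the free Schrödinger group. Let $$\Sigma=\{f\in H^1(\mathbb R):\ \|f\|_\Sigma:=\|f\|_{L^2}+\|\partial_xf\|_{L^2}+\|xf\|_{L^2}<\infty\},$$ $$\mathcal H=\{f\in H^1(\mathbb R):\ \|f\|_{\mathcal H}:=\|\langle x\rangle\partial_xf\|_{L^2}+\|\langle x\rangle^3f\|_{L^2}<\infty\}.$$ Given $u_-\in\mathcal H$, set, for $t\le -10$, $$u_2(t)=U(t)\mathcal F^{-1}\left(\widehat u_-\,e^{i\lambda|\widehat u_-|^2\log|t|}\right).$$ **Proposition.** There exist $\delta_0>0$, $C>0$ and a polynomial $P$ (which may depend on $\lambda$, but not on $u_-$) such that the following holds. For every $u_-\in\mathcal H$ with $\|\widehat u_-\|_{H^1}\le\delta_0$, there exists a unique $u_0\in\Sigma$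 such that the (unique, global) solution $u\in C(\mathbb R,\Sigma)$ of $$i\partial_tu+\tfrac12\partial_x^2u=\lambda|u|^2u,\qquad u_{|t=0}=u_0,$$ satisfies, for all $t\le-10$, $$\left\|U(-t)\bigl(u(t)-u_2(t)\bigr)\right\|_\Sigma\le C\,\|u_-\|_{\mathcal H}^3\,P\bigl(\|u_-\|_{\mathcal H}\bigr)\,\frac{(\log|t|)^4}{|t|}.$$ -/

import Mathlib

open MeasureTheory Filter Topology Real
open scoped ENNReal FourierTransform LineDeriv SchwartzMap

noncomputable section

namespace CubicNLS

/-- The complex Hilbert space `L²(ℝ)` (classes of functions modulo equality a.e.). -/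
abbrev L2 : Type := Lp ℂ 2 (volume : Measure ℝ)

/-! ### Three operations that preserve `L²` -/

/-- Dilations preserve `L²`. -/
theorem memLp_dilation (f : L2) {a : ℝ} (ha : a ≠ 0) (c : ℂ) :
    MemLp (fun x : ℝ => c * f (a * x)) 2 volume := by
  have hmap : Measure.map (fun x : ℝ => a * x) volume = ENNReal.ofReal |a⁻¹| • volume :=
    Real.map_volume_mul_left ha
  have h1 : MemLp (f : ℝ → ℂ) 2 (Measure.map (fun x : ℝ => a * x) volume) := by
    rw [hmap]
    exact (Lp.memLp f).smul_measure ENNReal.ofReal_ne_top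
  exact (h1.comp_of_map (by fun_prop)).const_mul c

/-- Multiplication by a measurable phase `e^{iθ}`, `θ` real, preserves `L²`. -/
theorem memLp_phase (f : L2) {θ : ℝ → ℝ} (hθ : AEStronglyMeasurable θ volume) :
    MemLp (fun x : ℝ => Complex.exp (Complex.I * (θ x : ℂ)) * f x) 2 volume := by
  have hm : AEStronglyMeasurable (fun x : ℝ => Complex.exp (Complex.I * (θ x : ℂ))) volume :=
    (by fun_prop : Continuous fun y : ℝ => Complex.exp (Complex.I * (y : ℂ)))
      |>.comp_aestronglyMeasurable hθ
  refine (Lp.memLp f).of_le (hm.mul (Lp.memLp f).1) (Eventually.of_forall fun x => ?_)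
  rw [norm_mul, mul_comm Complex.I, Complex.norm_exp_ofReal_mul_I, one_mul]

/-- The function `x ↦ c f(a x)`, for `a ≠ 0`. -/
def dilation (a : ℝ) (ha : a ≠ 0) (c : ℂ) (f : L2) : L2 :=
  (memLp_dilation f ha c).toLp

/-- The function `x ↦ e^{iθ(x)} f(x)`. -/
def phaseMul (θ : ℝ → ℝ) (hθ : AEStronglyMeasurable θ volume) (f : L2) : L2 :=
  (memLp_phase f hθ).toLp

/-! ### Fourier transform and Schrödinger group

Mathlib's Fourier transform on `L²(ℝ)` has the kernel `e^{-2πixξ}`. -/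

/-- The Fourier transform `f̂(ξ) = (2π)^{-1/2} ∫ f(x) e^{-ixξ} dx` on `L²(ℝ)`. -/
def fourierHat (f : L2) : L2 :=
  dilation (2 * π)⁻¹ (by positivity) ((√(2 * π))⁻¹ : ℝ) (𝓕 f : L2)

/-- The inverse `(2π)^{-1/2} ∫ g(ξ) e^{ixξ} dξ` of the transform `fourierHat` on `L²(ℝ)`. -/
def fourierHatInv (g : L2) : L2 :=
  (𝓕⁻ (dilation (2 * π) (by positivity) (√(2 * π) : ℝ) g) : L2)

/-- The free Schrödinger group `U(t) = e^{i(t/2)∂ₓ²}` on `L²(ℝ)`: under Mathlib's Fourier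
transform `∂ₓ` is multiplication by `2πiξ`, so `U(t)` is multiplication by `e^{-i(t/2)(2πξ)²}`. -/
def U (t : ℝ) (f : L2) : L2 :=
  (𝓕⁻ (phaseMul (fun ξ => -(t / 2) * (2 * π * ξ) ^ 2)
    (by fun_prop : Continuous fun ξ : ℝ => -(t / 2) * (2 * π * ξ) ^ 2).aestronglyMeasurable
    (𝓕 f : L2)) : L2)

/-! ### Function spaces -/

/-- `g ∈ L²` is the distributional derivative of `f ∈ L²`. Such a `g` is unique. -/
def IsWeakDeriv (f g : L2) : Prop :=
  ∂_{(1 : ℝ)} (f : 𝓢'(ℝ, ℂ)) = (g : 𝓢'(ℝ, ℂ))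

/-- The weighted norm `‖w ∂ₓf‖_{L²}`, with the value `∞` if `∂ₓf ∉ L²` or `w ∂ₓf ∉ L²`. -/
def weightedDerivNorm (w : ℝ → ℝ) (f : L2) : ℝ≥0∞ :=
  ⨅ (g : L2) (_ : IsWeakDeriv f g), eLpNorm (fun x : ℝ => (w x : ℂ) * g x) 2 volume

/-- `⟨x⟩ = (1 + x²)^{1/2}`. -/
def japanese (x : ℝ) : ℝ := √(1 + x ^ 2)

/-- The norm of `H¹(ℝ)`, `(‖f‖_{L²}² + ‖∂ₓf‖_{L²}²)^{1/2}`, possibly infinite. -/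
def h1ENorm (f : L2) : ℝ≥0∞ :=
  (‖f‖ₑ ^ 2 + weightedDerivNorm (fun _ => 1) f ^ 2) ^ (1 / 2 : ℝ)

/-- The norm `‖f‖_{L²} + ‖∂ₓf‖_{L²} + ‖x f‖_{L²}` of `Σ`, possibly infinite. -/
def sigmaENorm (f : L2) : ℝ≥0∞ :=
  ‖f‖ₑ + weightedDerivNorm (fun _ => 1) f + eLpNorm (fun x : ℝ => (x : ℂ) * f x) 2 volume

/-- Membership in `Σ = H¹ ∩ 𝓕(H¹)`. -/
def MemSigma (f : L2) : Prop := sigmaENorm f < ∞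

/-- The norm of `Σ` as a real number (meaningful on `Σ`). -/
def sigmaNorm (f : L2) : ℝ := (sigmaENorm f).toReal

/-- The norm `‖⟨x⟩∂ₓf‖_{L²} + ‖⟨x⟩³f‖_{L²}` of `𝓗`, possibly infinite. -/
def calHENorm (f : L2) : ℝ≥0∞ :=
  weightedDerivNorm japanese f + eLpNorm (fun x : ℝ => (japanese x ^ 3 : ℂ) * f x) 2 volume

/-- Membership in `𝓗 = {f ∈ H¹ : ⟨x⟩∂ₓf, ⟨x⟩³f ∈ L²}`. -/
def MemCalH (f : L2) : Prop := calHENorm f < ∞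

/-- The norm of `𝓗` as a real number (meaningful on `𝓗`). -/
def calHNorm (f : L2) : ℝ := (calHENorm f).toReal

/-! ### The cubic equation `i∂ₜu + ½∂ₓ²u = λ|u|²u` -/

open scoped Classical in
/-- `|f|²f`, an element of `L²` whenever `f ∈ Σ`, because then `f` is bounded
(the value `0` for the other `f` is never used). -/
def cubic (f : L2) : L2 :=
  if h : MemLp (fun x : ℝ => (‖f x‖ ^ 2 : ℂ) * f x) 2 volume then h.toLp else 0

/-- `u ∈ C(ℝ, Σ)`. -/
def IsContinuousInSigma (u : ℝ → L2) : Prop :=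
  (∀ t, MemSigma (u t)) ∧ ∀ t₀, Tendsto (fun t => sigmaENorm (u t - u t₀)) (𝓝 t₀) (𝓝 0)

/-- `u ∈ C(ℝ, Σ)` is a global solution of `i∂ₜu + ½∂ₓ²u = λ|u|²u` with initial value `u(0)`, in the
usual sense of Duhamel's formula
`u(t) = U(t)u(0) - iλ ∫₀ᵗ U(t-τ)(|u|²u)(τ) dτ`, `t ∈ ℝ`. -/
def IsGlobalSolution (lam : ℝ) (u : ℝ → L2) : Prop :=
  IsContinuousInSigma u ∧
    ∀ t : ℝ, u t = U t (u 0) - (Complex.I * (lam : ℂ)) • ∫ τ in (0 : ℝ)..t, U (t - τ) (cubic (u τ))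

/-! ### The approximate solution -/

/-- The profile `ŵ(t) = û₋ e^{iλ|û₋|² log|t|}`. -/
def wHat (lam : ℝ) (um : L2) (t : ℝ) : L2 :=
  phaseMul (fun ξ => lam * ‖fourierHat um ξ‖ ^ 2 * Real.log |t|)
    ((((Lp.aestronglyMeasurable (fourierHat um)).norm.pow 2).const_mul lam).mul_const
      (Real.log |t|))
    (fourierHat um)

/-- The approximate solution `u₂(t) = U(t)𝓕⁻¹(û₋ e^{iλ|û₋|² log|t|})`. -/
def u₂ (lam : ℝ) (um : L2) (t : ℝ) : L2 :=
  U t (fourierHatInv (wHat lam um t))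

/-- `‖U(-t)(u(t) - u₂(t))‖_Σ ≤ C ‖u₋‖_𝓗³ P(‖u₋‖_𝓗) (log|t|)⁴ / |t|` for all `t ≤ -10`
(in particular `U(-t)(u(t) - u₂(t))` belongs to `Σ`). -/
def WaveEstimate (lam C : ℝ) (P : Polynomial ℝ) (um : L2) (u : ℝ → L2) : Prop :=
  ∀ t : ℝ, t ≤ -10 →
    MemSigma (U (-t) (u t - u₂ lam um t)) ∧
    sigmaNorm (U (-t) (u t - u₂ lam um t)) ≤
      C * calHNorm um ^ 3 * P.eval (calHNorm um) * (Real.log |t| ^ 4 / |t|)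

end CubicNLS

end

open CubicNLS

/-!
The free flow is removed by passing to `f(t) = U(-t)u(t)`. In the Banach space `Σ` (`Sig`, with the
components `vS`, `dS`, `xS` for `f`, `∂f`, `xf`), the equation becomes the ordinary differential
equation `f' = -iλ U(-t)(|U(t)f|²U(t)f)` (`vf`, `NS`), whose right-hand side is locally Lipschitz
because `U(t)` acts on `Σ` and elements of `Σ` are bounded functions. Solutions are global
(`exists_global_vf`): mass and energy are conserved, and the weighted norm is controlled through
`x u = U(t)(x - it∂)f`. Integral curves and solutions of Duhamel's formula are the same
(`isGlobalSolution_of_hasDerivAt`, `IsGlobalSolution.exists_hasDerivAt`).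

The asymptotics come from the factorization of `U(t)𝓕⁻¹` into a phase, a dilation and `U(-1/t)`
(`U_fourierL_symm`). The cubic term commutes with phases, and scales under dilations, so on the
Fourier side the nonlinearity is `|t|⁻¹ U(1/t)(|v|²v)` with `v = U(-1/t)f̂` (`FS_NS`). For large `t`
the operators `U(±1/t)` are close to the identity, and dropping them leaves
`v' = -iλ|t|⁻¹|v|²v`, for which `|v|` is constant; its solution is the modified profile
`û₋e^{iλ|û₋|² log|t|}` (`hasDerivAt_profileS`). Its inverse Fourier transform `W` is an approximate
solution (`hasDerivAt_W`), equal to `U(-t)u₂(t)`. The remainder is `O(log⁴|t|/t²)` (`norm_R_le`):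
each use of `U(±1/t) - 1` gains `1/t` and costs two derivatives, and each derivative of the profile
costs a logarithm. The weight `⟨x⟩³` in the norm of `𝓗` provides three derivatives of `û₋`. The
derivative of `ξû₋`, which is what `⟨x⟩∂u₋ ∈ L²` provides, suffices for the weighted part of the
remainder, owing to the commutator estimate `norm_commutator_le`.

For `|t|` larger than a power of `1 + ‖u₋‖_𝓗`, the difference of a solution and `W` is found by
Picard iteration from `-∞` (`exists_solution_of_contracting`, `exists_asymptotic_solution`). The
bounds `Bnd` have a smaller power of the logarithm in `L²` than in the other norms; this absorbs the
linear growth of `xW` in `log|t|`. The nonlinearity decays only like `1/|t|`, so the contraction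
constant has to come from the smallness of `û₋` in `H¹`, whereas the large norm of `𝓗` only enters
the threshold and the size of the remainder. Between the threshold and `t = -10`, all quantities are
bounded by polynomials in `‖u₋‖_𝓗`, by the conservation laws (`norm_sub_W_le`), and the differential
equation for the difference supplies the factor `‖u₋‖_𝓗³` (`norm_sum_le`, `polyBd_estimate`).

For uniqueness (`eq_of_asymptotic`), two solutions `f`, `g` satisfying the estimate have sup norms
`O(δ₀|t|^{-1/2})`, so that `|t|‖f(t) - g(t)‖²` is monotone near `-∞`; it tends to `0` by the
estimate, hence vanishes.
-/

open scoped BoundedContinuousFunction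

noncomputable section

namespace CubicNLS

/-! ### Multiplication of `L²` functions by bounded continuous functions -/

theorem memLp_bcf_mul (φ : ℝ →ᵇ ℂ) (f : L2) : MemLp (fun x => φ x * f x) 2 volume := by
  refine (Lp.memLp f).of_le_mul (c := ‖φ‖)
    (φ.continuous.aestronglyMeasurable.mul (Lp.aestronglyMeasurable f))
    (Eventually.of_forall fun x => ?_)
  rw [norm_mul]
  exact mul_le_mul_of_nonneg_right (φ.norm_coe_le_norm x) (norm_nonneg _)

theorem norm_le_mul_norm_of_ae {f g : L2} {c : ℝ} (h : ∀ᵐ x, ‖f x‖ ≤ c * ‖g x‖) :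
    ‖f‖ ≤ c * ‖g‖ :=
  Lp.norm_le_mul_norm_of_ae_le_mul h

/-- Multiplication by a bounded continuous function, as a bounded bilinear map. -/
def mulL2 : (ℝ →ᵇ ℂ) →L[ℂ] L2 →L[ℂ] L2 :=
  LinearMap.mkContinuous₂
    (LinearMap.mk₂ ℂ (fun φ f => (memLp_bcf_mul φ f).toLp)
      (fun φ ψ f => by
        rw [← MemLp.toLp_add]
        exact MemLp.toLp_congr _ _ (Eventually.of_forall fun x => by simp [add_mul]))
      (fun c φ f => by
        rw [← MemLp.toLp_const_smul]
        exact MemLp.toLp_congr _ _ (Eventually.of_forall fun x => by simp [mul_assoc]))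
      (fun φ f g => by
        rw [← MemLp.toLp_add]
        refine MemLp.toLp_congr _ _ ?_
        filter_upwards [Lp.coeFn_add f g] with x hx
        rw [hx, Pi.add_apply, Pi.add_apply, mul_add])
      (fun c φ f => by
        rw [← MemLp.toLp_const_smul]
        refine MemLp.toLp_congr _ _ ?_
        filter_upwards [Lp.coeFn_smul c f] with x hx
        simp only [hx, Pi.smul_apply, smul_eq_mul]
        ring))
    1 (fun φ f => by
      rw [one_mul]
      refine norm_le_mul_norm_of_ae ?_
      filter_upwards [(memLp_bcf_mul φ f).coeFn_toLp] with x hx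
      simp only [LinearMap.mk₂_apply]
      rw [hx, norm_mul]
      exact mul_le_mul_of_nonneg_right (φ.norm_coe_le_norm x) (norm_nonneg _))

theorem coeFn_mulL2 (φ : ℝ →ᵇ ℂ) (f : L2) : mulL2 φ f =ᵐ[volume] fun x => φ x * f x :=
  (memLp_bcf_mul φ f).coeFn_toLp

theorem norm_mulL2_le (φ : ℝ →ᵇ ℂ) (f : L2) : ‖mulL2 φ f‖ ≤ ‖φ‖ * ‖f‖ := by
  refine norm_le_mul_norm_of_ae ?_
  filter_upwards [coeFn_mulL2 φ f] with x hx
  rw [hx, norm_mul]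
  exact mul_le_mul_of_nonneg_right (φ.norm_coe_le_norm x) (norm_nonneg _)

theorem mulL2_mul (φ ψ : ℝ →ᵇ ℂ) (f : L2) : mulL2 (φ * ψ) f = mulL2 φ (mulL2 ψ f) := by
  apply Lp.ext
  filter_upwards [coeFn_mulL2 (φ * ψ) f, coeFn_mulL2 φ (mulL2 ψ f), coeFn_mulL2 ψ f]
    with x h1 h2 h3
  rw [h1, h2, h3]
  simp [mul_assoc]

theorem mulL2_one (f : L2) : mulL2 1 f = f := by
  apply Lp.ext
  filter_upwards [coeFn_mulL2 1 f] with x h1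
  simp [h1]

theorem norm_sq_eq_integral (f : L2) : ‖f‖ ^ 2 = ∫ x, ‖f x‖ ^ 2 := by
  have h := inner_self_eq_norm_sq_to_K (𝕜 := ℂ) f
  rw [L2.inner_def] at h
  have h2 : ∀ x, (inner ℂ (f x) (f x) : ℂ) = ((‖f x‖ ^ 2 : ℝ) : ℂ) := fun x => by
    rw [inner_self_eq_norm_sq_to_K]; norm_cast
  simp_rw [h2] at h
  rw [integral_complex_ofReal] at h
  exact Complex.ofReal_injective (by rw [h]; push_cast; rfl)

theorem integrable_norm_sq (f : L2) : Integrable (fun x => ‖f x‖ ^ 2) :=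
  (memLp_two_iff_integrable_sq_norm (Lp.aestronglyMeasurable f)).1 (Lp.memLp f)

/-- If uniformly bounded multipliers converge pointwise, the multiplication operators converge
strongly. -/
theorem tendsto_mulL2 {ι : Type*} {l : Filter ι} [l.IsCountablyGenerated] {φ : ι → ℝ →ᵇ ℂ}
    {ψ : ℝ →ᵇ ℂ} {C : ℝ} (hC : ∀ᶠ i in l, ‖φ i‖ ≤ C)
    (h : ∀ x, Tendsto (fun i => φ i x) l (𝓝 (ψ x))) (f : L2) :
    Tendsto (fun i => mulL2 (φ i) f) l (𝓝 (mulL2 ψ f)) := by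
  rw [tendsto_iff_norm_sub_tendsto_zero]
  have hsq : Tendsto (fun i => ‖mulL2 (φ i) f - mulL2 ψ f‖ ^ 2) l (𝓝 0) := by
    have h1 : ∀ i, ‖mulL2 (φ i) f - mulL2 ψ f‖ ^ 2 = ∫ x, ‖(φ i x - ψ x) * f x‖ ^ 2 := by
      intro i
      rw [norm_sq_eq_integral]
      refine integral_congr_ae ?_
      filter_upwards [Lp.coeFn_sub (mulL2 (φ i) f) (mulL2 ψ f), coeFn_mulL2 (φ i) f,
        coeFn_mulL2 ψ f] with x h1 h2 h3
      rw [h1, Pi.sub_apply, h2, h3, sub_mul]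
    simp_rw [h1]
    rw [← integral_zero ℝ ℝ (μ := volume)]
    refine tendsto_integral_filter_of_dominated_convergence
      (fun x => (C + ‖ψ‖) ^ 2 * ‖f x‖ ^ 2) ?_ ?_ ((integrable_norm_sq f).const_mul _) ?_
    · exact Eventually.of_forall fun i =>
        ((((φ i).continuous.sub ψ.continuous).aestronglyMeasurable.mul
          (Lp.aestronglyMeasurable f)).norm.pow 2)
    · filter_upwards [hC] with i hi
      refine Eventually.of_forall fun x => ?_
      rw [norm_pow, norm_norm, norm_mul, mul_pow]
      have : ‖φ i x - ψ x‖ ≤ C + ‖ψ‖ :=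
        (norm_sub_le _ _).trans (add_le_add (((φ i).norm_coe_le_norm x).trans hi)
          (ψ.norm_coe_le_norm x))
      gcongr
    · refine Eventually.of_forall fun x => ?_
      have := (((h x).sub_const (ψ x)).mul_const (f x)).norm.pow 2
      simpa using this
  have := hsq.sqrt
  simpa [Real.sqrt_sq] using this

/-- The bounded continuous function `e^{iθ}`. -/
def phase (θ : ℝ → ℝ) (hθ : Continuous θ) : ℝ →ᵇ ℂ :=
  BoundedContinuousFunction.ofNormedAddCommGroup
    (fun x => Complex.exp (Complex.I * (θ x : ℂ))) (by fun_prop) 1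
    (fun x => by rw [mul_comm, Complex.norm_exp_ofReal_mul_I])

@[simp] theorem phase_apply (θ : ℝ → ℝ) (hθ : Continuous θ) (x : ℝ) :
    phase θ hθ x = Complex.exp (Complex.I * (θ x : ℂ)) := rfl

theorem norm_phase_apply (θ : ℝ → ℝ) (hθ : Continuous θ) (x : ℝ) : ‖phase θ hθ x‖ = 1 := by
  rw [phase_apply, mul_comm, Complex.norm_exp_ofReal_mul_I]

theorem norm_phase_le (θ : ℝ → ℝ) (hθ : Continuous θ) : ‖phase θ hθ‖ ≤ 1 :=
  (BoundedContinuousFunction.norm_le zero_le_one).2 fun x => (norm_phase_apply θ hθ x).le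

theorem phaseMul_eq_mulL2 (θ : ℝ → ℝ) (hθ : Continuous θ) (f : L2) :
    phaseMul θ hθ.aestronglyMeasurable f = mulL2 (phase θ hθ) f := by
  apply Lp.ext
  filter_upwards [coeFn_mulL2 (phase θ hθ) f, (memLp_phase f hθ.aestronglyMeasurable).coeFn_toLp]
    with x h1 h2
  rw [h1]
  exact h2

theorem norm_mulL2_phase (θ : ℝ → ℝ) (hθ : Continuous θ) (f : L2) :
    ‖mulL2 (phase θ hθ) f‖ = ‖f‖ := by
  have h : ∀ᵐ x, ‖mulL2 (phase θ hθ) f x‖ = ‖f x‖ := by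
    filter_upwards [coeFn_mulL2 (phase θ hθ) f] with x h1
    rw [h1, norm_mul, norm_phase_apply, one_mul]
  refine le_antisymm ?_ ?_
  · exact Lp.norm_le_norm_of_ae_le (h.mono fun x hx => hx.le)
  · exact Lp.norm_le_norm_of_ae_le (h.mono fun x hx => hx.ge)

theorem phase_mul_phase {θ₁ θ₂ θ₃ : ℝ → ℝ} (h₁ : Continuous θ₁) (h₂ : Continuous θ₂)
    (h₃ : Continuous θ₃) (h : ∀ x, θ₁ x + θ₂ x = θ₃ x) :
    phase θ₁ h₁ * phase θ₂ h₂ = phase θ₃ h₃ := by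
  ext x
  simp [← h, mul_add, Complex.exp_add]

/-- Complex conjugation on `L²`. -/
def conjL2 : L2 →L[ℝ] L2 := (Complex.conjCLE : ℂ →L[ℝ] ℂ).compLpL 2 volume

theorem coeFn_conjL2 (f : L2) : conjL2 f =ᵐ[volume] fun x => star (f x) :=
  ContinuousLinearMap.coeFn_compLpL _ f

theorem norm_conjL2 (f : L2) : ‖conjL2 f‖ = ‖f‖ := by
  have h : ∀ᵐ x, ‖conjL2 f x‖ = ‖f x‖ := by
    filter_upwards [coeFn_conjL2 f] with x hx
    rw [hx, norm_star]
  exact le_antisymm (Lp.norm_le_norm_of_ae_le (h.mono fun x hx => hx.le))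
    (Lp.norm_le_norm_of_ae_le (h.mono fun x hx => hx.ge))

/-! ### The unitary Fourier transform and the Schrödinger group -/

theorem coeFn_dilation (a : ℝ) (ha : a ≠ 0) (c : ℂ) (f : L2) :
    dilation a ha c f =ᵐ[volume] fun x => c * f (a * x) :=
  (memLp_dilation f ha c).coeFn_toLp

theorem ae_comp_mul_left {a : ℝ} (ha : a ≠ 0) {p : ℝ → Prop} (h : ∀ᵐ x, p x) :
    ∀ᵐ x : ℝ, p (a * x) := by
  have hq : Measure.QuasiMeasurePreserving (fun x : ℝ => a * x) volume volume := by
    refine ⟨by fun_prop, ?_⟩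
    rw [Real.map_volume_mul_left ha]
    exact Measure.smul_absolutelyContinuous
  exact hq.ae h

theorem norm_dilation (a : ℝ) (ha : a ≠ 0) (c : ℂ) (f : L2) :
    ‖dilation a ha c f‖ ^ 2 = ‖c‖ ^ 2 * |a⁻¹| * ‖f‖ ^ 2 := by
  rw [norm_sq_eq_integral, norm_sq_eq_integral]
  have : ∫ x, ‖dilation a ha c f x‖ ^ 2 = ∫ x, (fun y => ‖c‖ ^ 2 * ‖f y‖ ^ 2) (a * x) := by
    refine integral_congr_ae ?_
    filter_upwards [coeFn_dilation a ha c f] with x hx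
    rw [hx, norm_mul, mul_pow]
  rw [this, Measure.integral_comp_mul_left (fun y => ‖c‖ ^ 2 * ‖f y‖ ^ 2), integral_const_mul, smul_eq_mul]
  ring

theorem dilation_dilation {a b : ℝ} (ha : a ≠ 0) (hb : b ≠ 0) (c d : ℂ) (f : L2) :
    dilation a ha c (dilation b hb d f) = dilation (b * a) (mul_ne_zero hb ha) (c * d) f := by
  apply Lp.ext
  filter_upwards [coeFn_dilation a ha c (dilation b hb d f),
    ae_comp_mul_left ha (coeFn_dilation b hb d f),
    coeFn_dilation (b * a) (mul_ne_zero hb ha) (c * d) f] with x h1 h2 h3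
  rw [h1, h2, h3, mul_assoc, mul_assoc]

theorem dilation_one (f : L2) : dilation 1 one_ne_zero 1 f = f := by
  apply Lp.ext
  filter_upwards [coeFn_dilation 1 one_ne_zero 1 f] with x h1
  rw [h1, one_mul, one_mul]

/-- A dilation with `‖c‖² = |a|`, as a unitary operator. -/
def dilationEquiv (a : ℝ) (ha : a ≠ 0) (c : ℂ) (hc : ‖c‖ ^ 2 = |a|) : L2 ≃ₗᵢ[ℂ] L2 where
  toFun := dilation a ha c
  invFun := dilation a⁻¹ (inv_ne_zero ha) c⁻¹
  left_inv f := by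
    have hc0 : c ≠ 0 := by
      rintro rfl
      simp at hc
      exact ha (abs_eq_zero.1 hc.symm)
    rw [dilation_dilation]
    conv_rhs => rw [← dilation_one f]
    congr 1
    · field_simp
    · field_simp
  right_inv f := by
    have hc0 : c ≠ 0 := by
      rintro rfl
      simp at hc
      exact ha (abs_eq_zero.1 hc.symm)
    rw [dilation_dilation]
    conv_rhs => rw [← dilation_one f]
    congr 1
    · field_simp
    · field_simp
  map_add' f g := by
    apply Lp.ext
    filter_upwards [coeFn_dilation a ha c (f + g), coeFn_dilation a ha c f,
      coeFn_dilation a ha c g, Lp.coeFn_add (dilation a ha c f) (dilation a ha c g),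
      ae_comp_mul_left ha (Lp.coeFn_add f g)] with x h1 h2 h3 h4 h5
    rw [h1, h4, Pi.add_apply, h2, h3, h5, Pi.add_apply, mul_add]
  map_smul' r f := by
    apply Lp.ext
    filter_upwards [coeFn_dilation a ha c (r • f), coeFn_dilation a ha c f,
      Lp.coeFn_smul r (dilation a ha c f),
      ae_comp_mul_left ha (Lp.coeFn_smul r f)] with x h1 h2 h3 h5
    simp only [RingHom.id_apply]
    rw [h1, h3, Pi.smul_apply, h2, h5, Pi.smul_apply]
    simp only [smul_eq_mul]
    ring
  norm_map' f := by
    have h := norm_dilation a ha c f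
    rw [hc, ← abs_mul, mul_inv_cancel₀ ha, abs_one, one_mul] at h
    exact (pow_left_inj₀ (norm_nonneg _) (norm_nonneg _) two_ne_zero).1 h

theorem norm_inv_sqrt_two_pi_sq :
    ‖(((√(2 * π))⁻¹ : ℝ) : ℂ)‖ ^ 2 = |(2 * π)⁻¹| := by
  rw [Complex.norm_real, norm_eq_abs, sq_abs, inv_pow, Real.sq_sqrt (by positivity),
    abs_of_pos (by positivity)]

/-- The Fourier transform `fourierHat` as a unitary operator. -/
def fourierL : L2 ≃ₗᵢ[ℂ] L2 :=
  (Lp.fourierTransformₗᵢ ℝ ℂ).trans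
    (dilationEquiv (2 * π)⁻¹ (by positivity) ((√(2 * π))⁻¹ : ℝ) norm_inv_sqrt_two_pi_sq)

theorem fourierHat_eq (f : L2) : fourierHat f = fourierL f := rfl

theorem dilation_congr {a b : ℝ} (ha : a ≠ 0) (hb : b ≠ 0) {c d : ℂ} (hab : a = b) (hcd : c = d)
    (f : L2) : dilation a ha c f = dilation b hb d f := by
  subst hab hcd; rfl

theorem fourierHatInv_eq (g : L2) : fourierHatInv g = fourierL.symm g := by
  have : fourierL.symm g = (Lp.fourierTransformₗᵢ ℝ ℂ).symm
      (dilation (2 * π)⁻¹⁻¹ (by positivity) (((√(2 * π))⁻¹ : ℝ) : ℂ)⁻¹ g) := rfl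
  rw [this]
  unfold fourierHatInv
  rw [dilation_congr (b := (2 * π)⁻¹⁻¹) (d := (((√(2 * π))⁻¹ : ℝ) : ℂ)⁻¹) _ (by positivity)
    (by simp) (by simp)]
  rfl

theorem dilation_mulL2_phase {a : ℝ} (ha : a ≠ 0) (c : ℂ) (θ : ℝ → ℝ) (hθ : Continuous θ)
    (f : L2) : dilation a ha c (mulL2 (phase θ hθ) f) =
      mulL2 (phase (fun x => θ (a * x)) (by fun_prop)) (dilation a ha c f) := by
  apply Lp.ext
  filter_upwards [coeFn_dilation a ha c (mulL2 (phase θ hθ) f), coeFn_dilation a ha c f,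
    ae_comp_mul_left ha (coeFn_mulL2 (phase θ hθ) f),
    coeFn_mulL2 (phase (fun x => θ (a * x)) (by fun_prop)) (dilation a ha c f)] with x h1 h2 h3 h4
  rw [h1, h4, h2, h3]
  simp only [phase_apply]
  ring

/-- The multiplier `e^{-itξ²/2}` of the free Schrödinger group. -/
def freePhase (t : ℝ) : ℝ →ᵇ ℂ := phase (fun ξ => -(t / 2) * ξ ^ 2) (by fun_prop)

theorem fourierL_U (t : ℝ) (f : L2) : fourierL (U t f) = mulL2 (freePhase t) (fourierL f) := by
  have h1 : fourierL (U t f) = dilation (2 * π)⁻¹ (by positivity) ((√(2 * π))⁻¹ : ℝ)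
      (mulL2 (phase (fun ξ => -(t / 2) * (2 * π * ξ) ^ 2) (by fun_prop)) (𝓕 f : L2)) := by
    rw [← fourierHat_eq]
    unfold fourierHat U
    rw [FourierTransform.fourier_fourierInv_eq, phaseMul_eq_mulL2]
  rw [h1, dilation_mulL2_phase]
  have h2 : fourierL f = dilation (2 * π)⁻¹ (by positivity) ((√(2 * π))⁻¹ : ℝ) (𝓕 f : L2) := rfl
  rw [h2]
  congr 2
  unfold freePhase
  congr 1
  ext ξ
  have := Real.pi_pos
  field_simp

theorem U_eq (t : ℝ) (f : L2) : U t f = fourierL.symm (mulL2 (freePhase t) (fourierL f)) := by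
  rw [← fourierL_U, LinearIsometryEquiv.symm_apply_apply]

theorem freePhase_zero : freePhase 0 = 1 := by
  ext x; simp [freePhase]

theorem freePhase_mul (s t : ℝ) : freePhase s * freePhase t = freePhase (s + t) :=
  phase_mul_phase _ _ _ fun x => by ring

theorem U_zero (f : L2) : U 0 f = f := by
  rw [U_eq, freePhase_zero, mulL2_one, LinearIsometryEquiv.symm_apply_apply]

theorem U_U (s t : ℝ) (f : L2) : U s (U t f) = U (s + t) f := by
  rw [U_eq, fourierL_U, ← mulL2_mul, freePhase_mul, ← U_eq]

theorem U_neg_U (t : ℝ) (f : L2) : U (-t) (U t f) = f := by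
  rw [U_U, neg_add_cancel, U_zero]

theorem U_U_neg (t : ℝ) (f : L2) : U t (U (-t) f) = f := by
  rw [U_U, add_neg_cancel, U_zero]

theorem norm_U (t : ℝ) (f : L2) : ‖U t f‖ = ‖f‖ := by
  rw [U_eq, LinearIsometryEquiv.norm_map, freePhase, norm_mulL2_phase,
    LinearIsometryEquiv.norm_map]

/-- `U(t)` as a unitary operator on `L²`. -/
def UL (t : ℝ) : L2 ≃ₗᵢ[ℂ] L2 where
  toFun := U t
  invFun := U (-t)
  left_inv := U_neg_U t
  right_inv := U_U_neg t
  map_add' f g := by simp only [U_eq, map_add]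
  map_smul' c f := by simp only [U_eq, map_smul, RingHom.id_apply]
  norm_map' := norm_U t

@[simp] theorem UL_apply (t : ℝ) (f : L2) : UL t f = U t f := rfl

theorem U_add (t : ℝ) (f g : L2) : U t (f + g) = U t f + U t g := map_add (UL t) f g
theorem U_sub (t : ℝ) (f g : L2) : U t (f - g) = U t f - U t g := map_sub (UL t) f g
theorem U_smul (t : ℝ) (c : ℂ) (f : L2) : U t (c • f) = c • U t f := map_smul (UL t) c f

theorem continuous_U (f : L2) : Continuous fun t => U t f := by
  simp_rw [U_eq]
  refine fourierL.symm.continuous.comp ?_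
  rw [continuous_iff_continuousAt]
  intro t
  refine tendsto_mulL2 (C := 1) (Eventually.of_forall fun i => norm_phase_le _ _) ?_ _
  intro x
  have : Continuous fun s : ℝ => freePhase s x := by
    simp only [freePhase, phase_apply]
    fun_prop
  exact this.tendsto t

/-- The Schrödinger group is jointly continuous. -/
theorem continuous_U_uncurry : Continuous fun p : ℝ × L2 => U p.1 p.2 := by
  rw [continuous_iff_continuousAt]
  rintro ⟨t, f⟩
  unfold ContinuousAt
  rw [tendsto_iff_norm_sub_tendsto_zero]
  have hb : ∀ p : ℝ × L2, ‖U p.1 p.2 - U t f‖ ≤ ‖p.2 - f‖ + ‖U p.1 f - U t f‖ := fun p => by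
    have : U p.1 p.2 - U t f = U p.1 (p.2 - f) + (U p.1 f - U t f) := by rw [U_sub]; abel
    rw [this]
    exact (norm_add_le _ _).trans_eq (by rw [norm_U])
  refine squeeze_zero (fun _ => norm_nonneg _) hb ?_
  have hc : Continuous fun p : ℝ × L2 => ‖p.2 - f‖ + ‖U p.1 f - U t f‖ := by
    have := continuous_U f
    fun_prop
  simpa using hc.tendsto (t, f)

/-! ### Integral formulas for the Fourier transform -/

/-- Locally integrable functions are determined by their integrals against Schwartz functions. -/
theorem ae_eq_of_integral_schwartz {F G : ℝ → ℂ} (hF : LocallyIntegrable F)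
    (hG : LocallyIntegrable G) (h : ∀ φ : 𝓢(ℝ, ℂ), HasCompactSupport φ →
      ∫ x, φ x • F x = ∫ x, φ x • G x) : F =ᵐ[volume] G := by
  have h0 : ∀ᵐ x, (F - G) x = 0 := by
    refine ae_eq_zero_of_integral_contDiff_smul_eq_zero (hF.sub hG) ?_
    intro g hg hc
    have hg1 : HasCompactSupport (Complex.ofRealCLM ∘ g) := hc.comp_left rfl
    have hg2 : ContDiff ℝ (↑(⊤ : ℕ∞)) (Complex.ofRealCLM ∘ g) := by fun_prop
    have h1 := h (hg1.toSchwartzMap hg2) hg1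
    have hcont : Continuous (Complex.ofRealCLM ∘ g) := hg2.continuous
    have e1 : ∀ H : ℝ → ℂ, (∫ x, (hg1.toSchwartzMap hg2) x • H x) = ∫ x, g x • H x := by
      intro H; rfl
    rw [e1, e1] at h1
    have i1 : ∀ {H : ℝ → ℂ}, LocallyIntegrable H → Integrable (fun x => g x • H x) := fun hH =>
      hH.integrable_smul_left_of_hasCompactSupport hg.continuous hc
    have : ∫ x, g x • (F - G) x = (∫ x, g x • F x) - ∫ x, g x • G x := by
      rw [← integral_sub (i1 hF) (i1 hG)]
      simp [smul_sub]
    rw [this, h1, sub_self]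
  filter_upwards [h0] with x hx
  exact sub_eq_zero.1 hx

theorem locallyIntegrable_L2 (f : L2) : LocallyIntegrable f :=
  (Lp.memLp f).locallyIntegrable (by norm_num)

theorem fourier_ae_eq_of_integrable (f : L2) (hf : Integrable f) :
    (𝓕 f : L2) =ᵐ[volume] (𝓕 (⇑f) : ℝ → ℂ) := by
  have hcont : Continuous (𝓕 (⇑f) : ℝ → ℂ) :=
    VectorFourier.fourierIntegral_continuous Real.continuous_fourierChar
      (by fun_prop) hf
  refine ae_eq_of_integral_schwartz (locallyIntegrable_L2 _) hcont.locallyIntegrable ?_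
  intro φ _
  rw [← Lp.toTemperedDistribution_apply, ← Lp.fourier_toTemperedDistribution_eq,
    TemperedDistribution.fourier_apply, Lp.toTemperedDistribution_apply]
  have := VectorFourier.integral_fourierIntegral_smul_eq_flip (𝕜 := ℝ) (e := 𝐞)
    (L := innerₗ ℝ) (μ := volume) (ν := volume) Real.continuous_fourierChar
    (by fun_prop) φ.integrable hf
  rw [flip_innerₗ] at this
  simpa [SchwartzMap.fourier_coe] using! this

/-- The integral `(2π)^{-1/2} ∫ f(x) e^{iσxξ} dx`; the sign is `σ = -1` for the Fourier transform
and `σ = 1` for its inverse. -/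
def fourierIntegralSgn (σ : ℝ) (f : ℝ → ℂ) (ξ : ℝ) : ℂ :=
  ((√(2 * π))⁻¹ : ℝ) * ∫ x : ℝ, Complex.exp (Complex.I * (σ * x * ξ : ℝ)) * f x

theorem fourierL_ae_eq (f : L2) (hf : Integrable f) :
    fourierL f =ᵐ[volume] fourierIntegralSgn (-1) f := by
  have h2 : fourierL f = dilation (2 * π)⁻¹ (by positivity) ((√(2 * π))⁻¹ : ℝ) (𝓕 f : L2) := rfl
  rw [h2]
  have hpi : (2 * π)⁻¹ ≠ 0 := by positivity
  filter_upwards [coeFn_dilation (2 * π)⁻¹ hpi ((√(2 * π))⁻¹ : ℝ) (𝓕 f : L2),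
    ae_comp_mul_left hpi (fourier_ae_eq_of_integrable f hf)] with x h1 h3
  rw [h1, h3, fourierIntegralSgn, Real.fourier_real_eq_integral_exp_smul]
  congr 1
  refine integral_congr_ae (Eventually.of_forall fun y => ?_)
  simp only [smul_eq_mul]
  congr 2
  push_cast
  have := Real.pi_pos.ne'
  have : (π : ℂ) ≠ 0 := by exact_mod_cast this
  field_simp

theorem fourierL_symm_ae_eq (f : L2) (hf : Integrable f) :
    fourierL.symm f =ᵐ[volume] fourierIntegralSgn 1 f := by
  rw [← fourierHatInv_eq]
  have hpi : 2 * π ≠ 0 := by positivity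
  set g := dilation (2 * π) hpi (√(2 * π) : ℝ) f with hg
  have hgi : Integrable g := by
    refine Integrable.congr ?_ (coeFn_dilation (2 * π) hpi (√(2 * π) : ℝ) f).symm
    exact (hf.comp_mul_left' hpi).const_mul _
  have hinv : (𝓕⁻ g : L2) =ᵐ[volume] (𝓕⁻ (⇑g) : ℝ → ℂ) := by
    have hcont : Continuous (𝓕⁻ (⇑g) : ℝ → ℂ) := by
      rw [Real.fourierInv_eq_fourier_comp_neg]
      exact VectorFourier.fourierIntegral_continuous Real.continuous_fourierChar
        (by fun_prop) hgi.comp_neg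
    refine ae_eq_of_integral_schwartz (locallyIntegrable_L2 _) hcont.locallyIntegrable ?_
    intro φ _
    rw [← Lp.toTemperedDistribution_apply, ← Lp.fourierInv_toTemperedDistribution_eq,
      TemperedDistribution.fourierInv_apply, Lp.toTemperedDistribution_apply]
    have := VectorFourier.integral_fourierIntegral_smul_eq_flip (𝕜 := ℝ) (e := 𝐞)
      (L := -innerₗ ℝ) (μ := volume) (ν := volume) Real.continuous_fourierChar
      (by simp only [LinearMap.neg_apply, innerₗ_apply_apply]; fun_prop) φ.integrable hgi
    have hfl : (-innerₗ ℝ).flip = -innerₗ ℝ := by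
      ext; simp
    rw [hfl] at this
    simpa [SchwartzMap.fourierInv_coe] using! this
  filter_upwards [hinv] with x h1
  have h2 : (fourierHatInv f) x = (𝓕⁻ g : L2) x := rfl
  rw [h2, h1, fourierIntegralSgn, Real.fourierInv_eq']
  have h3 : ∀ᵐ y, g y = (√(2 * π) : ℝ) * f (2 * π * y) := coeFn_dilation (2 * π) hpi _ f
  have h4 : ∫ v : ℝ, Complex.exp ((2 * π * inner ℝ v x : ℝ) * Complex.I) • g v =
      ∫ v : ℝ, (fun y : ℝ => (√(2 * π) : ℝ) * (Complex.exp (Complex.I * (1 * y * x : ℝ)) * f y))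
        (2 * π * v) := by
    refine integral_congr_ae ?_
    filter_upwards [h3] with y hy
    rw [hy]
    simp only [RCLike.inner_apply, conj_trivial, smul_eq_mul]
    have : ((2 * π * (x * y) : ℝ) * Complex.I) = Complex.I * (1 * (2 * π * y) * x : ℝ) := by
      push_cast; ring
    rw [this]
    ring
  rw [h4, Measure.integral_comp_mul_left (fun y : ℝ => ((√(2 * π) : ℝ) : ℂ) *
    (Complex.exp (Complex.I * (1 * y * x : ℝ)) * f y)), integral_const_mul]
  rw [abs_of_pos (by positivity), Complex.real_smul, ← mul_assoc, ← Complex.ofReal_mul]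
  congr 2
  have : √(2 * π) * √(2 * π) = 2 * π := Real.mul_self_sqrt (by positivity)
  have h0 : √(2 * π) ≠ 0 := by positivity
  field_simp
  nlinarith

/-- Reflection `f(x) ↦ f(-x)` as a unitary operator. -/
def reflect : L2 ≃ₗᵢ[ℂ] L2 := dilationEquiv (-1) (by norm_num) 1 (by norm_num)

theorem coeFn_reflect (f : L2) : reflect f =ᵐ[volume] fun x => f (-x) := by
  have := coeFn_dilation (-1) (by norm_num) 1 f
  filter_upwards [this] with x hx
  rw [show reflect f = dilation (-1) (by norm_num) 1 f from rfl, hx]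
  simp

theorem denseRange_schwartz : DenseRange fun φ : 𝓢(ℝ, ℂ) => (φ.toLp 2 volume : L2) :=
  SchwartzMap.denseRange_toLpCLM (p := 2) ENNReal.ofNat_ne_top

theorem integrable_schwartz_toLp (φ : 𝓢(ℝ, ℂ)) : Integrable (φ.toLp 2 volume : L2) :=
  φ.integrable.congr (φ.coeFn_toLp 2 volume).symm

/-- `𝓕f(ξ) = 𝓕⁻¹f(-ξ)`. -/
theorem fourierL_eq_reflect (f : L2) : fourierL f = reflect (fourierL.symm f) := by
  refine DenseRange.induction_on (p := fun f => fourierL f = reflect (fourierL.symm f))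
    denseRange_schwartz f ?_ ?_
  · exact isClosed_eq fourierL.continuous (reflect.continuous.comp fourierL.symm.continuous)
  · intro φ
    apply Lp.ext
    have hi := integrable_schwartz_toLp φ
    filter_upwards [fourierL_ae_eq _ hi, coeFn_reflect (fourierL.symm (φ.toLp 2 volume)),
      ae_comp_mul_left (a := -1) (by norm_num) (fourierL_symm_ae_eq _ hi)] with x h1 h2 h3
    rw [h1, h2]
    simp only [neg_mul, one_mul] at h3
    rw [h3]
    simp [fourierIntegralSgn]

theorem mulL2_phase_reflect (θ : ℝ → ℝ) (hθ : Continuous θ) (he : ∀ x, θ (-x) = θ x) (f : L2) :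
    mulL2 (phase θ hθ) (reflect f) = reflect (mulL2 (phase θ hθ) f) := by
  have h1 : (-1 : ℝ) ≠ 0 := by norm_num
  have := dilation_mulL2_phase h1 1 θ hθ f
  change _ = dilation (-1) h1 1 _
  rw [this]
  congr 2
  ext x
  simp [he]

theorem fourierL_fourierL (f : L2) : fourierL (fourierL f) = reflect f := by
  rw [fourierL_eq_reflect, LinearIsometryEquiv.symm_apply_apply]

/-- Conjugation of an even phase by the Fourier transform does not depend on the direction. -/
theorem fourierL_phase_symm (θ : ℝ → ℝ) (hθ : Continuous θ) (he : ∀ x, θ (-x) = θ x) (f : L2) :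
    fourierL (mulL2 (phase θ hθ) (fourierL.symm f)) =
      fourierL.symm (mulL2 (phase θ hθ) (fourierL f)) := by
  rw [fourierL_eq_reflect f, mulL2_phase_reflect _ _ he, ← fourierL_fourierL,
    LinearIsometryEquiv.symm_apply_apply]

/-! ### Factorization of the Schrödinger group -/

/-- The Fourier transform of a Gaussian with complex parameter `b`, `Re b > 0`, moved by Fubini from
`ψ = φ̂` to `φ`. -/
theorem gaussian_regularized (φ ψ : ℝ → ℂ) (hφ : Integrable φ)
    (h : ∀ᵐ ξ, ψ ξ = fourierIntegralSgn (-1) φ ξ) (x : ℝ) {b : ℂ} (hb : 0 < b.re) :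
    ∫ ξ : ℝ, Complex.exp (Complex.I * (x * ξ : ℝ)) * Complex.exp (-b * (ξ : ℂ) ^ 2) * ψ ξ =
      ((√(2 * π))⁻¹ : ℝ) * ((π / b) ^ (1 / 2 : ℂ) *
        ∫ y : ℝ, Complex.exp (-((x - y : ℝ) : ℂ) ^ 2 / (4 * b)) * φ y) := by
  have h1 : ∫ ξ : ℝ, Complex.exp (Complex.I * (x * ξ : ℝ)) * Complex.exp (-b * (ξ : ℂ) ^ 2) * ψ ξ =
      ((√(2 * π))⁻¹ : ℝ) * ∫ ξ : ℝ, ∫ y : ℝ, Complex.exp (-b * (ξ : ℂ) ^ 2) *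
        Complex.exp (Complex.I * (x - y : ℝ) * ξ) * φ y := by
    rw [← integral_const_mul]
    refine integral_congr_ae ?_
    filter_upwards [h] with ξ hξ
    rw [hξ, fourierIntegralSgn]
    rw [mul_left_comm, ← integral_const_mul]
    congr 1
    refine integral_congr_ae (Eventually.of_forall fun y => ?_)
    simp only
    rw [mul_comm (Complex.exp (Complex.I * _)) (Complex.exp (-b * _)), mul_assoc, ← mul_assoc,
      ← mul_assoc, mul_assoc (Complex.exp (-b * _)), ← Complex.exp_add]
    congr 3
    push_cast
    ring
  rw [h1]
  congr 1
  rw [integral_integral_swap]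
  · rw [← integral_const_mul]
    refine integral_congr_ae (Eventually.of_forall fun y => ?_)
    simp only
    rw [integral_mul_const]
    have hg := fourierIntegral_gaussian hb ((x - y : ℝ) : ℂ)
    rw [← mul_assoc, ← hg]
    congr 1
    refine integral_congr_ae (Eventually.of_forall fun ξ => ?_)
    simp only
    ring
  · have hg : Integrable fun ξ : ℝ => Complex.exp (-b * (ξ : ℂ) ^ 2) := integrable_cexp_neg_mul_sq hb
    have := (hg.mul_prod hφ).norm
    refine (hg.mul_prod hφ).mono ?_ (Eventually.of_forall fun z => ?_)
    · refine (Continuous.aestronglyMeasurable (by fun_prop)).mul ?_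
      exact hφ.1.comp_snd
    · simp only [Function.uncurry, norm_mul]
      have : ‖Complex.exp (Complex.I * ((x - z.2 : ℝ) : ℂ) * (z.1 : ℂ))‖ = 1 := by
        rw [mul_assoc, ← Complex.ofReal_mul, mul_comm, Complex.norm_exp_ofReal_mul_I]
      rw [this, mul_one]

/-- The limiting case `Re b → 0` of `gaussian_regularized`, by dominated convergence: the integral
kernel of the Schrödinger group. -/
theorem oscillatory_gaussian (φ ψ : ℝ → ℂ) (hφ : Integrable φ) (hψ : Integrable ψ)
    (h : ∀ᵐ ξ, ψ ξ = fourierIntegralSgn (-1) φ ξ) (x : ℝ) {t : ℝ} (ht : t ≠ 0) :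
    ∫ ξ : ℝ, Complex.exp (Complex.I * (x * ξ : ℝ)) *
        Complex.exp (-(Complex.I * t / 2) * (ξ : ℂ) ^ 2) * ψ ξ =
      ((√(2 * π))⁻¹ : ℝ) * ((π / (Complex.I * t / 2)) ^ (1 / 2 : ℂ) *
        ∫ y : ℝ, Complex.exp (-((x - y : ℝ) : ℂ) ^ 2 / (4 * (Complex.I * t / 2))) * φ y) := by
  set b : ℝ → ℂ := fun ε => ε + Complex.I * t / 2 with hbdef
  have hb0 : b 0 = Complex.I * t / 2 := by simp [hbdef]
  have hbc : Continuous b := by fun_prop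
  have hbre : ∀ ε, (b ε).re = ε := fun ε => by simp [hbdef]
  have htC : (t : ℂ) ≠ 0 := by exact_mod_cast ht
  have hbne : b 0 ≠ 0 := by
    rw [hb0]; simp [ht]
  have hbt : Tendsto b (𝓝[>] 0) (𝓝 (b 0)) := (hbc.tendsto 0).mono_left nhdsWithin_le_nhds
  rw [← hb0]
  refine tendsto_nhds_unique (f := fun ε : ℝ => ∫ ξ : ℝ, Complex.exp (Complex.I * (x * ξ : ℝ)) *
        Complex.exp (-b ε * (ξ : ℂ) ^ 2) * ψ ξ) (l := 𝓝[>] (0 : ℝ)) ?_ ?_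
  · refine tendsto_integral_filter_of_dominated_convergence (fun ξ => ‖ψ ξ‖) ?_ ?_ hψ.norm ?_
    · exact Eventually.of_forall fun ε =>
        (Continuous.aestronglyMeasurable (by fun_prop)).mul hψ.1
    · filter_upwards [self_mem_nhdsWithin] with ε hε
      refine Eventually.of_forall fun ξ => ?_
      rw [norm_mul, norm_mul]
      have h1 : ‖Complex.exp (Complex.I * ((x * ξ : ℝ) : ℂ))‖ = 1 := by
        rw [mul_comm, Complex.norm_exp_ofReal_mul_I]
      have h2 : ‖Complex.exp (-b ε * (ξ : ℂ) ^ 2)‖ ≤ 1 := by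
        rw [Complex.norm_exp, Real.exp_le_one_iff, ← Complex.ofReal_pow, Complex.re_mul_ofReal,
          Complex.neg_re, hbre]
        have : (0 : ℝ) < ε := hε
        nlinarith [sq_nonneg ξ, mul_nonneg this.le (sq_nonneg ξ)]
      rw [h1, one_mul]
      exact mul_le_of_le_one_left (norm_nonneg _) h2
    · refine Eventually.of_forall fun ξ => ?_
      exact ((hbt.neg.mul_const _).cexp.const_mul _).mul_const _
  · have heq : ∀ᶠ ε in 𝓝[>] (0 : ℝ), ((√(2 * π))⁻¹ : ℝ) * ((π / b ε) ^ (1 / 2 : ℂ) *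
        ∫ y : ℝ, Complex.exp (-((x - y : ℝ) : ℂ) ^ 2 / (4 * b ε)) * φ y) =
        ∫ ξ : ℝ, Complex.exp (Complex.I * (x * ξ : ℝ)) *
        Complex.exp (-b ε * (ξ : ℂ) ^ 2) * ψ ξ := by
      filter_upwards [self_mem_nhdsWithin] with ε hε
      exact (gaussian_regularized φ ψ hφ h x (by rw [hbre]; exact hε)).symm
    refine Tendsto.congr' heq ?_
    refine Tendsto.const_mul _ (Tendsto.mul ?_ ?_)
    · have h1 : Tendsto (fun ε => (π : ℂ) / b ε) (𝓝[>] 0) (𝓝 (π / b 0)) :=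
        tendsto_const_nhds.div hbt hbne
      refine Tendsto.cpow h1 tendsto_const_nhds (Complex.mem_slitPlane_iff.2 (Or.inr ?_))
      rw [hb0]
      have : (π : ℂ) / (Complex.I * t / 2) = ((-(2 * π / t) : ℝ) : ℂ) * Complex.I := by
        push_cast
        field_simp
        rw [Complex.I_sq]
        ring
      rw [this, Complex.mul_I_im, Complex.ofReal_re]
      have := Real.pi_pos.ne'
      exact neg_ne_zero.2 (by positivity)
    · refine tendsto_integral_filter_of_dominated_convergence (fun y => ‖φ y‖) ?_ ?_ hφ.norm ?_
      · exact Eventually.of_forall fun ε =>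
          (Continuous.aestronglyMeasurable (by fun_prop)).mul hφ.1
      · filter_upwards [self_mem_nhdsWithin] with ε hε
        refine Eventually.of_forall fun y => ?_
        rw [norm_mul]
        refine mul_le_of_le_one_left (norm_nonneg _) ?_
        rw [Complex.norm_exp, Real.exp_le_one_iff]
        have hpos : (0 : ℝ) < ε := hε
        have e1 : -((x - y : ℝ) : ℂ) ^ 2 / (4 * b ε) = ((-(x - y) ^ 2 / 4 : ℝ) : ℂ) * (b ε)⁻¹ := by
          push_cast
          rw [div_eq_mul_inv, mul_inv]
          ring
        rw [e1, Complex.re_ofReal_mul, Complex.inv_re, hbre]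
        have : 0 ≤ ε / Complex.normSq (b ε) := div_nonneg hpos.le (Complex.normSq_nonneg _)
        nlinarith [sq_nonneg (x - y), mul_nonneg (sq_nonneg (x - y)) this]
      · refine Eventually.of_forall fun y => ?_
        refine Tendsto.mul_const _ (Tendsto.cexp ?_)
        exact tendsto_const_nhds.div (hbt.const_mul _) (by simpa using hbne)

/-- The unimodular constant of the factorization of `U(t)`. -/
def schrodingerConst (t : ℝ) : ℂ :=
  ((√(2 * π))⁻¹ : ℝ) * (π / (Complex.I * t / 2)) ^ (1 / 2 : ℂ) * (√|t| : ℝ)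

theorem norm_schrodingerConst {t : ℝ} (ht : t ≠ 0) : ‖schrodingerConst t‖ = 1 := by
  unfold schrodingerConst
  have h1 : ‖((π : ℂ) / (Complex.I * t / 2)) ^ (1 / 2 : ℂ)‖ = √(2 * π / |t|) := by
    have : (1 / 2 : ℂ) = ((1 / 2 : ℝ) : ℂ) := by push_cast; rfl
    rw [this, Complex.norm_cpow_real, Real.sqrt_eq_rpow]
    congr 1
    rw [norm_div, norm_div, norm_mul, Complex.norm_I, Complex.norm_real, Complex.norm_real,
      norm_eq_abs, norm_eq_abs, abs_of_pos Real.pi_pos]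
    simp
    field_simp
  rw [norm_mul, norm_mul, h1, Complex.norm_real, Complex.norm_real, norm_eq_abs, norm_eq_abs,
    abs_of_nonneg (Real.sqrt_nonneg |t|), abs_of_nonneg (a := (√(2 * π))⁻¹) (by positivity),
    Real.sqrt_div (by positivity)]
  have := Real.pi_pos
  have : √(2 * π) ≠ 0 := by positivity
  have : √|t| ≠ 0 := (Real.sqrt_pos.2 (abs_pos.2 ht)).ne'
  field_simp

theorem norm_sqrt_abs_inv_sq (t : ℝ) : ‖(((√|t|)⁻¹ : ℝ) : ℂ)‖ ^ 2 = |t⁻¹| := by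
  rw [Complex.norm_real, norm_eq_abs, sq_abs, inv_pow, Real.sq_sqrt (abs_nonneg _), abs_inv]

/-- The unitary dilation `g ↦ |t|^{-1/2} g(x/t)`. -/
def dilT (t : ℝ) (ht : t ≠ 0) : L2 ≃ₗᵢ[ℂ] L2 :=
  dilationEquiv t⁻¹ (inv_ne_zero ht) ((√|t|)⁻¹ : ℝ) (norm_sqrt_abs_inv_sq t)

theorem coeFn_dilT (t : ℝ) (ht : t ≠ 0) (f : L2) :
    dilT t ht f =ᵐ[volume] fun x => ((√|t|)⁻¹ : ℝ) * f (t⁻¹ * x) :=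
  coeFn_dilation t⁻¹ (inv_ne_zero ht) _ f

theorem integrable_mulL2 (φ : ℝ →ᵇ ℂ) {f : L2} (hf : Integrable f) : Integrable (mulL2 φ f) :=
  (hf.bdd_mul φ.continuous.aestronglyMeasurable
    (Eventually.of_forall φ.norm_coe_le_norm)).congr (coeFn_mulL2 φ f).symm

/-- The factorization `U(t) = c M_t D_t 𝓕 M_t` with `M_t = e^{ix²/(2t)}`. -/
theorem U_eq_factorization {t : ℝ} (ht : t ≠ 0) (f : L2) :
    U t f = schrodingerConst t • mulL2 (freePhase (-t⁻¹))
      (dilT t ht (fourierL (mulL2 (freePhase (-t⁻¹)) f))) := by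
  have hcont : Continuous fun f : L2 => schrodingerConst t • mulL2 (freePhase (-t⁻¹))
      (dilT t ht (fourierL (mulL2 (freePhase (-t⁻¹)) f))) := by fun_prop
  refine DenseRange.induction_on (p := fun f => U t f = schrodingerConst t •
    mulL2 (freePhase (-t⁻¹)) (dilT t ht (fourierL (mulL2 (freePhase (-t⁻¹)) f))))
    denseRange_schwartz f ?_ ?_
  · exact isClosed_eq (UL t).continuous hcont
  intro φ
  set f : L2 := φ.toLp 2 volume with hf
  have hfi : Integrable f := integrable_schwartz_toLp φ
  have hFi : Integrable (fourierL f) := by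
    have h2 : fourierL f = dilation (2 * π)⁻¹ (by positivity) ((√(2 * π))⁻¹ : ℝ) (𝓕 f : L2) := rfl
    rw [h2]
    refine Integrable.congr ?_ (coeFn_dilation _ _ _ _).symm
    refine Integrable.const_mul (Integrable.comp_mul_left' ?_ (by positivity)) _
    rw [hf, SchwartzMap.toLp_fourier_eq]
    exact integrable_schwartz_toLp _
  have hM := integrable_mulL2 (freePhase (-t⁻¹)) hfi
  apply Lp.ext
  rw [U_eq]
  have htC : (t : ℂ) ≠ 0 := by exact_mod_cast ht
  set G := fourierL (mulL2 (freePhase (-t⁻¹)) f) with hG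
  filter_upwards [fourierL_symm_ae_eq _ (integrable_mulL2 (freePhase t) hFi),
    Lp.coeFn_smul (schrodingerConst t) (mulL2 (freePhase (-t⁻¹)) (dilT t ht G)),
    coeFn_mulL2 (freePhase (-t⁻¹)) (dilT t ht G), coeFn_dilT t ht G,
    ae_comp_mul_left (inv_ne_zero ht) (fourierL_ae_eq _ hM)] with x h1 h2 h3 h4 h5
  rw [h1, h2, Pi.smul_apply, h3, h4, h5]
  unfold fourierIntegralSgn
  have e1 : ∫ ξ : ℝ, Complex.exp (Complex.I * (1 * ξ * x : ℝ)) *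
      (mulL2 (freePhase t) (fourierL f)) ξ = ∫ ξ : ℝ, Complex.exp (Complex.I * (x * ξ : ℝ)) *
        Complex.exp (-(Complex.I * t / 2) * (ξ : ℂ) ^ 2) * (fourierL f) ξ := by
    refine integral_congr_ae ?_
    filter_upwards [coeFn_mulL2 (freePhase t) (fourierL f)] with ξ hξ
    rw [hξ, ← mul_assoc]
    simp only [freePhase, phase_apply]
    congr 3
    · push_cast; ring
    · push_cast; ring
  have e2 : ∫ y : ℝ, Complex.exp (Complex.I * (-1 * y * (t⁻¹ * x) : ℝ)) *
      (mulL2 (freePhase (-t⁻¹)) f) y = Complex.exp (-Complex.I * (x : ℂ) ^ 2 / (2 * t)) *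
        ∫ y : ℝ, Complex.exp (-((x - y : ℝ) : ℂ) ^ 2 / (4 * (Complex.I * t / 2))) * f y := by
    rw [← integral_const_mul]
    refine integral_congr_ae ?_
    filter_upwards [coeFn_mulL2 (freePhase (-t⁻¹)) f] with y hy
    rw [hy, ← mul_assoc]
    simp only [freePhase, phase_apply]
    rw [← mul_assoc (Complex.exp (-Complex.I * _ / _)), ← Complex.exp_add, ← Complex.exp_add]
    congr 2
    push_cast
    field_simp
    rw [Complex.I_sq]
    ring
  rw [e1, e2, oscillatory_gaussian f (fourierL f) hfi hFi (fourierL_ae_eq f hfi) x ht]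
  simp only [freePhase, phase_apply, schrodingerConst, smul_eq_mul]
  have e3 : Complex.exp (Complex.I * ((-(-t⁻¹ / 2) * x ^ 2 : ℝ) : ℂ)) *
      Complex.exp (-Complex.I * (x : ℂ) ^ 2 / (2 * t)) = 1 := by
    rw [← Complex.exp_add, Complex.exp_eq_one_iff]
    refine ⟨0, ?_⟩
    push_cast
    field_simp
    ring
  have e4 : ((√|t| : ℝ) : ℂ) * (((√|t|)⁻¹ : ℝ) : ℂ) = 1 := by
    rw [← Complex.ofReal_mul, mul_inv_cancel₀ (Real.sqrt_pos.2 (abs_pos.2 ht)).ne',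
      Complex.ofReal_one]
  generalize Complex.exp (Complex.I * ((-(-t⁻¹ / 2) * x ^ 2 : ℝ) : ℂ)) = A at *
  generalize Complex.exp (-Complex.I * (x : ℂ) ^ 2 / (2 * t)) = B at *
  generalize ((√|t| : ℝ) : ℂ) = S at *
  generalize (((√|t|)⁻¹ : ℝ) : ℂ) = S' at *
  generalize (∫ y : ℝ, Complex.exp (-((x - y : ℝ) : ℂ) ^ 2 / (4 * (Complex.I * t / 2))) * f y) = J
  generalize (π / (Complex.I * t / 2) : ℂ) ^ (1 / 2 : ℂ) = Q
  linear_combination (-(((√(2 * π))⁻¹ : ℝ) : ℂ) ^ 2 * Q * J * A * B) * e4 -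
    (((√(2 * π))⁻¹ : ℝ) : ℂ) ^ 2 * Q * J * e3

/-- On the Fourier side `U(t)` becomes, up to modulation and dilation, `U(-1/t)`. -/
theorem U_fourierL_symm {t : ℝ} (ht : t ≠ 0) (g : L2) :
    U t (fourierL.symm g) = schrodingerConst t • mulL2 (freePhase (-t⁻¹))
      (dilT t ht (U (-t⁻¹) g)) := by
  rw [U_eq_factorization ht, freePhase, fourierL_phase_symm _ _ (fun x => by ring)]
  rw [U_eq, freePhase]

/-! ### Absolutely continuous functions -/

/-- `F` is (locally absolutely continuous and) a primitive of the locally integrable function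
`g`. -/
def HasAC (F g : ℝ → ℂ) : Prop :=
  LocallyIntegrable g ∧ ∀ a b : ℝ, F b - F a = ∫ x in a..b, g x

theorem HasAC.intervalIntegrable {F g : ℝ → ℂ} (h : HasAC F g) (a b : ℝ) :
    IntervalIntegrable g volume a b :=
  (h.1.integrableOn_isCompact isCompact_uIcc).intervalIntegrable

theorem HasAC.continuous {F g : ℝ → ℂ} (h : HasAC F g) : Continuous F := by
  have h1 : F = fun x => F 0 + ∫ y in (0 : ℝ)..x, g y := by
    ext x
    rw [← h.2 0 x]; ring
  rw [h1]
  exact continuous_const.add (intervalIntegral.continuous_primitive h.intervalIntegrable 0)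

theorem HasAC.congr_right {F g g' : ℝ → ℂ} (h : HasAC F g) (hg : g =ᵐ[volume] g') :
    HasAC F g' := by
  refine ⟨h.1.congr hg, fun a b => ?_⟩
  rw [h.2 a b]
  exact intervalIntegral.integral_congr_ae (hg.mono fun x hx _ => hx)

theorem HasAC.add {F g G k : ℝ → ℂ} (h : HasAC F g) (h' : HasAC G k) :
    HasAC (fun x => F x + G x) (fun x => g x + k x) := by
  refine ⟨h.1.add h'.1, fun a b => ?_⟩
  rw [intervalIntegral.integral_add (h.intervalIntegrable a b) (h'.intervalIntegrable a b),
    ← h.2, ← h'.2]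
  ring

theorem HasAC.const_mul {F g : ℝ → ℂ} (h : HasAC F g) (c : ℂ) :
    HasAC (fun x => c * F x) (fun x => c * g x) := by
  refine ⟨h.1.smul c, fun a b => ?_⟩
  rw [intervalIntegral.integral_const_mul, ← h.2]
  ring

theorem HasAC.conj {F g : ℝ → ℂ} (h : HasAC F g) :
    HasAC (fun x => star (F x)) (fun x => star (g x)) := by
  refine ⟨?_, fun a b => ?_⟩
  · intro x
    obtain ⟨s, hs, hi⟩ := h.1 x
    exact ⟨s, hs, Complex.conjCLE.toContinuousLinearMap.integrable_comp hi⟩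
  · rw [← star_sub, h.2 a b, intervalIntegral, intervalIntegral, star_sub]
    simp only [RCLike.star_def]
    rw [← integral_conj, ← integral_conj]

theorem hasAC_of_hasDerivAt {F g : ℝ → ℂ} (h : ∀ x, HasDerivAt F (g x) x) (hg : Continuous g) :
    HasAC F g :=
  ⟨hg.locallyIntegrable, fun a b => (intervalIntegral.integral_eq_sub_of_hasDerivAt
    (fun x _ => h x) (hg.intervalIntegrable a b)).symm⟩

theorem HasAC.hasDerivAt {F g : ℝ → ℂ} (h : HasAC F g) (hg : Continuous g) (x : ℝ) :
    HasDerivAt F (g x) x := by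
  have h1 : F = fun x => F 0 + ∫ y in (0 : ℝ)..x, g y := by
    ext x
    rw [← h.2 0 x]; ring
  rw [h1]
  exact (intervalIntegral.integral_hasDerivAt_right (hg.intervalIntegrable 0 x)
    hg.aestronglyMeasurable.stronglyMeasurableAtFilter hg.continuousAt).const_add _

theorem absolutelyContinuousOnInterval_const {E : Type*} [PseudoMetricSpace E] (c : E) (a b : ℝ) :
    AbsolutelyContinuousOnInterval (fun _ : ℝ => c) a b :=
  (LipschitzWith.const c).lipschitzOnWith.absolutelyContinuousOnInterval

theorem HasAC.absolutelyContinuousOnInterval {F g : ℝ → ℂ} (h : HasAC F g) (a b : ℝ) :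
    AbsolutelyContinuousOnInterval F a b := by
  have hi := h.intervalIntegrable a b
  have hre : IntervalIntegrable (fun x => (g x).re) volume a b :=
    ⟨hi.1.re, hi.2.re⟩
  have him : IntervalIntegrable (fun x => (g x).im) volume a b :=
    ⟨hi.1.im, hi.2.im⟩
  have h1 := hre.absolutelyContinuousOnInterval_intervalIntegral (c := a) (by simp)
  have h2 := him.absolutelyContinuousOnInterval_intervalIntegral (c := a) (by simp)
  have h3 := ((absolutelyContinuousOnInterval_const (F a) a b).add
    (h1.smul (absolutelyContinuousOnInterval_const (1 : ℂ) a b))).add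
    (h2.smul (absolutelyContinuousOnInterval_const Complex.I a b))
  suffices key : ∀ x, F x = F a + (∫ y in a..x, (g y).re) • (1 : ℂ) +
      (∫ y in a..x, (g y).im) • Complex.I by
    rw [show F = _ from funext key]
    exact h3
  intro x
  have h4 := h.2 a x
  have h5 := h.intervalIntegrable a x
  have hr : (∫ y in a..x, g y).re = ∫ y in a..x, (g y).re := by
    exact (Complex.reCLM.intervalIntegral_comp_comm h5).symm
  have hm : (∫ y in a..x, g y).im = ∫ y in a..x, (g y).im := by
    exact (Complex.imCLM.intervalIntegral_comp_comm h5).symm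
  simp only [Complex.real_smul, mul_one]
  rw [← hr, ← hm, ← h4, add_assoc, Complex.re_add_im]
  ring

theorem HasAC.ae_hasDerivAt {F g : ℝ → ℂ} (h : HasAC F g) : ∀ᵐ x, HasDerivAt F (g x) x := by
  have h1 : F = fun x => F 0 + ∫ y in (0 : ℝ)..x, g y := by
    ext x
    rw [← h.2 0 x]; ring
  filter_upwards [LocallyIntegrable.ae_hasDerivAt_integral h.1] with x hx
  rw [h1]
  exact (hx 0).const_add _

theorem locallyIntegrable_mul_continuous {g F : ℝ → ℂ} (hg : LocallyIntegrable g)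
    (hF : Continuous F) : LocallyIntegrable fun x => g x * F x := by
  rw [locallyIntegrable_iff]
  intro K hK
  exact (hg.integrableOn_isCompact hK).mul_continuousOn hF.continuousOn hK

/-- The product rule for absolutely continuous functions. -/
theorem HasAC.mul {F g G k : ℝ → ℂ} (h : HasAC F g) (h' : HasAC G k) :
    HasAC (fun x => F x * G x) (fun x => g x * G x + F x * k x) := by
  have hloc : LocallyIntegrable fun x => g x * G x + F x * k x := by
    refine (locallyIntegrable_mul_continuous h.1 h'.continuous).add ?_
    simpa only [mul_comm] using locallyIntegrable_mul_continuous h'.1 h.continuous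
  refine ⟨hloc, fun a b => ?_⟩
  set P : ℝ → ℂ := fun x => ∫ y in a..x, (g y * G y + F y * k y) with hP
  have hPac : HasAC P (fun x => g x * G x + F x * k x) := by
    refine ⟨hloc, fun c d => ?_⟩
    rw [hP]
    have hii : ∀ u v, IntervalIntegrable (fun x => g x * G x + F x * k x) volume u v := fun u v =>
      (hloc.integrableOn_isCompact isCompact_uIcc).intervalIntegrable
    exact intervalIntegral.integral_interval_sub_left (hii _ _) (hii _ _)
  have hac : AbsolutelyContinuousOnInterval (fun x => F x * G x - P x) a b :=
    ((h.absolutelyContinuousOnInterval a b).smul (h'.absolutelyContinuousOnInterval a b)).sub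
      (hPac.absolutelyContinuousOnInterval a b)
  obtain ⟨C, hC⟩ := hac.const_of_ae_hasDerivAt_zero (by
    filter_upwards [h.ae_hasDerivAt, h'.ae_hasDerivAt, hPac.ae_hasDerivAt] with x h1 h2 h3 _
    have := (h1.mul h2).sub h3
    rw [sub_self] at this
    exact this)
  have ha := hC a (by simp)
  have hb := hC b (by simp)
  have hPa : P a = 0 := by simp [hP]
  change F b * G b - F a * G a = P b
  rw [hPa] at ha
  linear_combination hb - ha

theorem hasAC_const (c : ℂ) : HasAC (fun _ => c) (fun _ => 0) :=
  hasAC_of_hasDerivAt (fun x => hasDerivAt_const x c) continuous_const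

/-- The Sobolev inequality `‖F‖_∞² ≤ 2 ‖F‖_{L²} ‖F'‖_{L²}`. -/
theorem HasAC.norm_sq_le {F g : ℝ → ℂ} (h : HasAC F g) {f f' : L2} (hf : f =ᵐ[volume] F)
    (hf' : f' =ᵐ[volume] g) (x : ℝ) : ‖F x‖ ^ 2 ≤ 2 * ‖f‖ * ‖f'‖ := by
  have hFi : Integrable fun x => ‖F x‖ ^ 2 := by
    refine (integrable_norm_sq f).congr ?_
    filter_upwards [hf] with x hx
    rw [hx]
  have hinner : Integrable fun x => ‖g x‖ * ‖F x‖ := by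
    have h1 := (MemLp.integrable_mul (p := 2) (q := 2) (Lp.memLp f').norm (Lp.memLp f).norm)
    refine h1.congr ?_
    filter_upwards [hf, hf'] with x hx hx'
    simp [hx, hx']
  have hCS : ∫ x, ‖g x‖ * ‖F x‖ ≤ ‖f'‖ * ‖f‖ := by
    have h1 := integral_mul_le_Lp_mul_Lq_of_nonneg (μ := volume) (p := 2) (q := 2)
      (f := fun x => ‖f' x‖) (g := fun x => ‖f x‖) Real.HolderConjugate.two_two
      (Eventually.of_forall fun _ => norm_nonneg _) (Eventually.of_forall fun _ => norm_nonneg _)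
      (by simpa using (Lp.memLp f').norm) (by simpa using (Lp.memLp f).norm)
    have h2 : ∀ u : L2, (∫ x, ‖u x‖ ^ (2 : ℝ)) ^ (1 / 2 : ℝ) = ‖u‖ := fun u => by
      have : ∫ x, ‖u x‖ ^ (2 : ℝ) = ‖u‖ ^ 2 := by
        rw [norm_sq_eq_integral]
        simp
      rw [this, ← Real.sqrt_eq_rpow, Real.sqrt_sq (norm_nonneg _)]
    rw [h2, h2] at h1
    refine le_trans (le_of_eq ?_) h1
    refine integral_congr_ae ?_
    filter_upwards [hf, hf'] with x hx hx'
    simp [hx, hx']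
  have hsq : HasAC (fun x => F x * star (F x)) (fun x => g x * star (F x) + F x * star (g x)) :=
    h.mul h.conj
  have hFF : ∀ y, F y * star (F y) = ((‖F y‖ ^ 2 : ℝ) : ℂ) := fun y => by
    rw [RCLike.star_def, Complex.mul_conj, Complex.normSq_eq_norm_sq]
  have hdiff : ∀ y, ‖F x‖ ^ 2 ≤ ‖F y‖ ^ 2 + 2 * ‖f‖ * ‖f'‖ := by
    intro y
    have h1 := hsq.2 y x
    simp only [hFF] at h1
    have h2 : |‖F x‖ ^ 2 - ‖F y‖ ^ 2| ≤ 2 * ∫ x, ‖g x‖ * ‖F x‖ := by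
      rw [← norm_eq_abs, ← Complex.norm_real, Complex.ofReal_sub, h1]
      rw [← integral_const_mul]
      refine (intervalIntegral.norm_integral_le_integral_norm_uIoc).trans ?_
      refine (integral_mono (g := fun x => 2 * (‖g x‖ * ‖F x‖))
        (hsq.intervalIntegrable y x).def'.norm (hinner.const_mul 2).integrableOn
        (fun z => ?_)).trans ?_
      · dsimp only
        refine (norm_add_le _ _).trans (le_of_eq ?_)
        rw [norm_mul, norm_mul, norm_star, norm_star]
        ring
      · exact setIntegral_le_integral (hinner.const_mul 2)
          (Eventually.of_forall fun z => by positivity)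
    have h3 := le_abs_self (‖F x‖ ^ 2 - ‖F y‖ ^ 2)
    nlinarith
  -- `|F|²` is integrable on a set of infinite measure, so it takes arbitrarily small values
  by_contra hcon
  push Not at hcon
  set ε := ‖F x‖ ^ 2 - 2 * ‖f‖ * ‖f'‖ with hε
  have hpos : 0 < ε := by linarith
  have hlow : ∀ y, ε ≤ ‖F y‖ ^ 2 := fun y => by linarith [hdiff y]
  have hci : Integrable (fun _ : ℝ => ε) volume := by
    refine hFi.mono (by fun_prop) (Eventually.of_forall fun y => ?_)
    rw [norm_eq_abs, norm_eq_abs, abs_of_pos hpos, abs_of_nonneg (by positivity)]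
    exact hlow y
  rw [integrable_const_iff] at hci
  rcases hci with h0 | h0
  · exact hpos.ne' h0
  · have := h0.measure_univ_lt_top
    simp at this

/-! ### Weak derivatives -/

/-- Weak derivatives in terms of integration by parts against Schwartz functions. -/
theorem isWeakDeriv_iff_integral {f g : L2} :
    IsWeakDeriv f g ↔ ∀ φ : 𝓢(ℝ, ℂ), ∫ x, deriv φ x * f x = -∫ x, φ x * g x := by
  have key : ∀ φ : 𝓢(ℝ, ℂ), (∂_{(1 : ℝ)} (f : 𝓢'(ℝ, ℂ))) φ = -∫ x, deriv φ x * f x := by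
    intro φ
    rw [TemperedDistribution.lineDerivOp_apply_apply, Lp.toTemperedDistribution_apply,
      ← integral_neg]
    refine integral_congr_ae (Eventually.of_forall fun x => ?_)
    simp [SchwartzMap.lineDerivOp_apply_eq_fderiv]
  unfold IsWeakDeriv
  constructor
  · intro h φ
    have h1 := congrArg (fun T : 𝓢'(ℝ, ℂ) => T φ) h
    simp only [key, Lp.toTemperedDistribution_apply] at h1
    rw [← neg_eq_iff_eq_neg, h1]
    rfl
  · intro h
    ext φ
    rw [key, h, neg_neg, Lp.toTemperedDistribution_apply]
    rfl

theorem schwartz_integrable_mul (φ : 𝓢(ℝ, ℂ)) (f : L2) : Integrable fun x => φ x * f x := by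
  have := MemLp.integrable_mul (p := 2) (q := 2) (φ.memLp 2 volume) (Lp.memLp f)
  exact this

theorem deriv_schwartz (φ : 𝓢(ℝ, ℂ)) : ⇑(SchwartzMap.derivCLM ℂ ℂ φ) = deriv φ := by
  ext x; simp

/-- A locally absolutely continuous `L²` function with derivative in `L²` is weakly
differentiable. -/
theorem HasAC.isWeakDeriv {F g : ℝ → ℂ} (h : HasAC F g) {f f' : L2} (hf : f =ᵐ[volume] F)
    (hf' : f' =ᵐ[volume] g) : IsWeakDeriv f f' := by
  rw [isWeakDeriv_iff_integral]
  intro φ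
  have h1 : HasAC φ (deriv φ) := by
    rw [← deriv_schwartz]
    refine hasAC_of_hasDerivAt (fun x => ?_) (SchwartzMap.continuous _)
    rw [deriv_schwartz]
    exact φ.differentiableAt.hasDerivAt
  have h2 := h1.mul h
  have i1 : Integrable fun x => deriv φ x * F x := by
    have := schwartz_integrable_mul (SchwartzMap.derivCLM ℂ ℂ φ) f
    rw [deriv_schwartz] at this
    exact this.congr (hf.mono fun x hx => by simp only [hx])
  have i2 : Integrable fun x => φ x * g x :=
    (schwartz_integrable_mul φ f').congr (hf'.mono fun x hx => by simp only [hx])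
  have e1 : ∫ x, deriv φ x * f x = ∫ x, deriv φ x * F x :=
    integral_congr_ae (hf.mono fun x hx => by simp only [hx])
  have e2 : ∫ x, φ x * f' x = ∫ x, φ x * g x :=
    integral_congr_ae (hf'.mono fun x hx => by simp only [hx])
  rw [e1, e2, ← add_eq_zero_iff_eq_neg, ← integral_add i1 i2]
  have ht := intervalIntegral_tendsto_integral (i1.add i2) tendsto_neg_atTop_atBot tendsto_id
  have hb : Bornology.IsBounded (Set.range F) := by
    rw [isBounded_iff_forall_norm_le]
    refine ⟨√(2 * ‖f‖ * ‖f'‖), ?_⟩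
    rintro _ ⟨x, rfl⟩
    exact Real.le_sqrt_of_sq_le (h.norm_sq_le hf hf' x)
  obtain ⟨C, hC⟩ := isBounded_iff_forall_norm_le.1 hb
  have hz : ∀ l : Filter ℝ, l ≤ cocompact ℝ → Tendsto (fun x => φ x * F x) l (𝓝 0) := by
    intro l hl
    have h0 : Tendsto (fun x => ‖φ x‖ * C) l (𝓝 0) := by
      have := ((φ.tendsto_cocompact).mono_left hl).norm.mul_const C
      simpa using this
    refine squeeze_zero_norm (fun x => ?_) h0
    rw [norm_mul]
    exact mul_le_mul_of_nonneg_left (hC _ ⟨x, rfl⟩) (norm_nonneg _)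
  have hlim : Tendsto (fun R : ℝ => φ R * F R - φ (-R) * F (-R)) atTop (𝓝 (0 - 0)) := by
    refine (hz atTop atTop_le_cocompact).sub ?_
    exact (hz atBot atBot_le_cocompact).comp tendsto_neg_atTop_atBot
  rw [sub_zero] at hlim
  refine tendsto_nhds_unique (ht.congr fun R => ?_) hlim
  exact (h2.2 (-R) R).symm

theorem exists_schwartz_primitive (η : 𝓢(ℝ, ℂ)) (hc : HasCompactSupport η)
    (h0 : ∫ x, η x = 0) :
    ∃ φ : 𝓢(ℝ, ℂ), (∀ x, HasDerivAt φ (η x) x) ∧ HasCompactSupport φ := by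
  obtain ⟨R, hR⟩ := hc.isCompact.isBounded.subset_closedBall (0 : ℝ)
  have hz : ∀ x, R < |x| → η x = 0 := by
    intro x hx
    by_contra hne
    have := hR (subset_tsupport _ hne)
    rw [mem_closedBall_zero_iff, norm_eq_abs] at this
    linarith
  set P : ℝ → ℂ := fun x => ∫ y in (-|R| - 1)..x, η y with hP
  have hd : ∀ x, HasDerivAt P (η x) x := fun x =>
    intervalIntegral.integral_hasDerivAt_right (η.continuous.intervalIntegrable _ _)
      η.continuous.aestronglyMeasurable.stronglyMeasurableAtFilter η.continuous.continuousAt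
  have hRa := le_abs_self R
  have hneg : ∀ x, x ≤ -|R| - 1 → P x = 0 := by
    intro x hx
    rw [hP]
    simp only
    rw [intervalIntegral.integral_symm, neg_eq_zero]
    refine (intervalIntegral.integral_congr (g := fun _ => (0 : ℂ)) fun y hy => ?_).trans (by simp)
    rw [Set.uIcc_of_le hx] at hy
    exact hz y (lt_of_lt_of_le (by linarith [hy.2]) (neg_le_abs y))
  have hpos : ∀ x, |R| + 1 ≤ x → P x = 0 := by
    intro x hx
    rw [← h0, hP]
    simp only
    refine intervalIntegral.integral_eq_integral_of_support_subset fun y hy => ?_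
    by_contra hn
    refine hy (hz y ?_)
    rw [Set.mem_Ioc, not_and_or, not_lt, not_le] at hn
    rcases hn with hn | hn
    · exact lt_of_lt_of_le (by linarith) (neg_le_abs y)
    · exact lt_of_lt_of_le (by linarith) (le_abs_self y)
  have hsupp : HasCompactSupport P := by
    refine HasCompactSupport.intro (isCompact_Icc (a := -|R| - 1) (b := |R| + 1)) fun x hx => ?_
    rw [Set.mem_Icc, not_and_or, not_le, not_le] at hx
    rcases hx with hx | hx
    · exact hneg x hx.le
    · exact hpos x hx.le
  have hcd : ContDiff ℝ (↑(⊤ : ℕ∞)) P := by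
    rw [contDiff_infty_iff_deriv]
    refine ⟨fun x => (hd x).differentiableAt, ?_⟩
    have : deriv P = η := funext fun x => (hd x).deriv
    rw [this]
    exact η.smooth _
  exact ⟨hsupp.toSchwartzMap hcd, hd, hsupp⟩

/-- A weakly differentiable `L²` function is a.e. equal to a primitive of its derivative
(lemma of du Bois-Reymond). -/
theorem IsWeakDeriv.exists_hasAC {f g : L2} (h : IsWeakDeriv f g) :
    ∃ F : ℝ → ℂ, HasAC F g ∧ f =ᵐ[volume] F := by
  rw [isWeakDeriv_iff_integral] at h
  have hgl := locallyIntegrable_L2 g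
  set P : ℝ → ℂ := fun x => ∫ y in (0 : ℝ)..x, g y with hP
  have hPac : HasAC P g := by
    have hii : ∀ u v, IntervalIntegrable g volume u v := fun u v =>
      (hgl.integrableOn_isCompact isCompact_uIcc).intervalIntegrable
    exact ⟨hgl, fun c d => intervalIntegral.integral_interval_sub_left (hii _ _) (hii _ _)⟩
  have hfl := locallyIntegrable_L2 f
  have hHl : LocallyIntegrable fun x => f x - P x := hfl.sub hPac.continuous.locallyIntegrable
  have hint : ∀ {H : ℝ → ℂ} (φ : 𝓢(ℝ, ℂ)), HasCompactSupport φ → LocallyIntegrable H →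
      Integrable fun x => φ x * H x := fun φ hφ hH =>
    hH.integrable_smul_left_of_hasCompactSupport φ.continuous hφ
  -- `f - P` is orthogonal to derivatives of test functions
  have horth : ∀ φ : 𝓢(ℝ, ℂ), HasCompactSupport φ → ∫ x, deriv φ x * (f x - P x) = 0 := by
    intro φ hφ
    have hφd : HasCompactSupport (SchwartzMap.derivCLM ℂ ℂ φ) := by
      rw [deriv_schwartz]; exact hφ.deriv
    have h1 : HasAC φ (deriv φ) := by
      rw [← deriv_schwartz]
      refine hasAC_of_hasDerivAt (fun x => ?_) (SchwartzMap.continuous _)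
      rw [deriv_schwartz]
      exact φ.differentiableAt.hasDerivAt
    have i1 : Integrable fun x => deriv φ x * P x := by
      have := hint _ hφd hPac.continuous.locallyIntegrable
      rwa [deriv_schwartz] at this
    have i0 : Integrable fun x => deriv φ x * f x := by
      have := hint _ hφd hfl
      rwa [deriv_schwartz] at this
    have i2 : Integrable fun x => φ x * g x := hint _ hφ hgl
    have hP0 : ∫ x, (deriv φ x * P x + φ x * g x) = 0 := by
      have ht := intervalIntegral_tendsto_integral (i1.add i2) tendsto_neg_atTop_atBot tendsto_id
      obtain ⟨R, hR⟩ := hφ.isCompact.isBounded.subset_closedBall (0 : ℝ)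
      have hz : ∀ x, R < |x| → φ x = 0 := by
        intro x hx
        by_contra hne
        have := hR (subset_tsupport _ hne)
        rw [mem_closedBall_zero_iff, norm_eq_abs] at this
        linarith
      refine tendsto_nhds_unique ht (tendsto_const_nhds.congr' ?_)
      filter_upwards [eventually_gt_atTop R] with r hr
      have h3 := (h1.mul hPac).2 (-r) r
      beta_reduce at h3
      rw [hz r (lt_of_lt_of_le hr (le_abs_self r)), hz (-r) (by
        rw [abs_neg]; exact lt_of_lt_of_le hr (le_abs_self r))] at h3
      simp only [zero_mul, sub_zero] at h3
      exact h3
    have hs : ∀ x, deriv φ x * (f x - P x) = deriv φ x * f x - deriv φ x * P x := fun x => by ring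
    simp_rw [hs]
    rw [integral_sub i0 i1, h φ]
    rw [integral_add i1 i2] at hP0
    linear_combination -hP0
  -- fix a test function of integral one
  obtain ⟨ρ, hρc, hρ1⟩ : ∃ ρ : 𝓢(ℝ, ℂ), HasCompactSupport ρ ∧ ∫ x, ρ x = 1 := by
    let b : ContDiffBump (0 : ℝ) := ⟨1, 2, one_pos, one_lt_two⟩
    have h1 : HasCompactSupport (Complex.ofRealCLM ∘ b.normed volume) :=
      b.hasCompactSupport_normed.comp_left rfl
    have h2 : ContDiff ℝ (↑(⊤ : ℕ∞)) (Complex.ofRealCLM ∘ b.normed volume) :=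
      Complex.ofRealCLM.contDiff.comp b.contDiff_normed
    refine ⟨h1.toSchwartzMap h2, h1, ?_⟩
    change ∫ x, ((b.normed volume x : ℝ) : ℂ) = 1
    rw [integral_complex_ofReal, b.integral_normed]
    rfl
  set c := ∫ x, ρ x * (f x - P x) with hcdef
  have hae : (fun x => f x - P x) =ᵐ[volume] fun _ => c := by
    refine ae_eq_of_integral_schwartz hHl continuous_const.locallyIntegrable ?_
    intro ψ hψ
    set η : 𝓢(ℝ, ℂ) := ψ - (∫ x, ψ x) • ρ with hη
    have hηc : HasCompactSupport η := by
      have : (η : ℝ → ℂ) = ψ - fun x => (∫ x, ψ x) • ρ x := rfl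
      rw [this]
      exact hψ.sub (hρc.smul_left (f := fun _ => ∫ x, ψ x))
    have hη0 : ∫ x, η x = 0 := by
      have : ∀ x, η x = ψ x - (∫ x, ψ x) * ρ x := fun x => rfl
      simp_rw [this]
      rw [integral_sub ψ.integrable (ρ.integrable.const_mul _), integral_const_mul, hρ1, mul_one,
        sub_self]
    obtain ⟨φ, hφd, hφc⟩ := exists_schwartz_primitive η hηc hη0
    have h1 := horth φ hφc
    have h2 : ∀ x, deriv φ x * (f x - P x) =
        ψ x * (f x - P x) - (∫ x, ψ x) * (ρ x * (f x - P x)) := fun x => by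
      rw [(hφd x).deriv]
      change (ψ x - (∫ x, ψ x) * ρ x) * _ = _
      ring
    simp_rw [h2] at h1
    rw [integral_sub (hint ψ hψ hHl) ((hint ρ hρc hHl).const_mul _), integral_const_mul,
      ← hcdef] at h1
    simp only [smul_eq_mul]
    rw [integral_mul_const]
    linear_combination h1
  refine ⟨fun x => P x + c, ?_, ?_⟩
  · have := hPac.add (hasAC_const c)
    simpa using this
  · filter_upwards [hae] with x hx
    rw [← hx]; ring

/-! ### Weak derivatives and multiplication by `x` under the Fourier transform -/

/-- `k` is the function `x ↦ x f(x)`. -/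
def IsMulX (f k : L2) : Prop := ∀ᵐ x : ℝ, k x = (x : ℂ) * f x

theorem isWeakDeriv_iff_fourier_aux {f g : L2} : IsWeakDeriv f g ↔
    ∀ᵐ ξ : ℝ, (𝓕 g : L2) ξ = 2 * π * Complex.I * ξ * (𝓕 f : L2) ξ := by
  have hinj : Function.Injective (𝓕 : 𝓢'(ℝ, ℂ) → 𝓢'(ℝ, ℂ)) :=
    Function.LeftInverse.injective (g := fun T => 𝓕⁻ T) fun T =>
      FourierTransform.fourierInv_fourier_eq T
  have h1 : IsWeakDeriv f g ↔ 𝓕 (∂_{(1 : ℝ)} (f : 𝓢'(ℝ, ℂ))) = 𝓕 (g : 𝓢'(ℝ, ℂ)) :=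
    ⟨fun h => congrArg _ h, fun h => hinj h⟩
  have htg : Function.HasTemperateGrowth (fun x : ℝ => (inner ℝ x (1 : ℝ) : ℝ)) := by fun_prop
  have hS : ∀ (φ : 𝓢(ℝ, ℂ)), (𝓕 (∂_{(1 : ℝ)} (f : 𝓢'(ℝ, ℂ)))) φ =
      ∫ ξ : ℝ, φ ξ * (2 * π * Complex.I * ξ * (𝓕 f : L2) ξ) := by
    intro φ
    rw [TemperedDistribution.fourier_lineDerivOp_eq, Lp.fourier_toTemperedDistribution_eq]
    change (2 * π * Complex.I) • ((TemperedDistribution.smulLeftCLM ℂ _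
      ((𝓕 f : L2) : 𝓢'(ℝ, ℂ))) φ) = _
    rw [TemperedDistribution.smulLeftCLM_apply_apply, Lp.toTemperedDistribution_apply,
      smul_eq_mul, ← integral_const_mul]
    refine integral_congr_ae (Eventually.of_forall fun x => ?_)
    simp only
    rw [SchwartzMap.smulLeftCLM_apply_apply (by fun_prop)]
    simp
    ring
  have hG : ∀ (φ : 𝓢(ℝ, ℂ)), (𝓕 (g : 𝓢'(ℝ, ℂ))) φ = ∫ ξ : ℝ, φ ξ * (𝓕 g : L2) ξ := by
    intro φ
    rw [Lp.fourier_toTemperedDistribution_eq, Lp.toTemperedDistribution_apply]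
    rfl
  rw [h1]
  constructor
  · intro h
    refine ae_eq_of_integral_schwartz (locallyIntegrable_L2 _) ?_ fun φ _ => ?_
    · have := locallyIntegrable_mul_continuous (locallyIntegrable_L2 (𝓕 f : L2))
        (F := fun ξ : ℝ => 2 * π * Complex.I * ξ) (by fun_prop)
      simpa only [mul_comm] using this
    · simp only [smul_eq_mul]
      rw [← hG, ← hS, h]
  · intro h
    ext φ
    rw [hG, hS]
    exact integral_congr_ae (h.mono fun x hx => by simp only [hx])

/-- Under the Fourier transform, differentiation becomes multiplication by `iξ`. -/
theorem isWeakDeriv_iff_fourier {f g : L2} :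
    IsWeakDeriv f g ↔ IsMulX (fourierL f) (-Complex.I • fourierL g) := by
  rw [isWeakDeriv_iff_fourier_aux, IsMulX]
  have hpi : (2 * π : ℝ) ≠ 0 := by positivity
  have hpi' : ((2 * π)⁻¹ : ℝ) ≠ 0 := by positivity
  have hf : fourierL f =ᵐ[volume] _ := coeFn_dilation (2 * π)⁻¹ hpi' ((√(2 * π))⁻¹ : ℝ) (𝓕 f : L2)
  have hg : fourierL g =ᵐ[volume] _ := coeFn_dilation (2 * π)⁻¹ hpi' ((√(2 * π))⁻¹ : ℝ) (𝓕 g : L2)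
  have hc : (((√(2 * π))⁻¹ : ℝ) : ℂ) ≠ 0 := by
    rw [Complex.ofReal_ne_zero]; positivity
  constructor
  · intro h
    filter_upwards [hf, hg, Lp.coeFn_smul (-Complex.I) (fourierL g), ae_comp_mul_left hpi' h]
      with x h1 h2 h3 h4
    rw [h3, Pi.smul_apply, h1, h2, h4, smul_eq_mul]
    push_cast
    have : (π : ℂ) ≠ 0 := by exact_mod_cast pi_ne_zero
    field_simp
    ring_nf
    simp
  · intro h
    have h' : ∀ᵐ x : ℝ, (𝓕 g : L2) ((2 * π)⁻¹ * x) =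
        2 * π * Complex.I * ((2 * π)⁻¹ * x : ℝ) * (𝓕 f : L2) ((2 * π)⁻¹ * x) := by
      filter_upwards [hf, hg, Lp.coeFn_smul (-Complex.I) (fourierL g), h] with x h1 h2 h3 h4
      rw [h3, Pi.smul_apply, h1, h2, smul_eq_mul] at h4
      have h5 := mul_left_cancel₀ hc (a := (((√(2 * π))⁻¹ : ℝ) : ℂ))
        (b := (𝓕 g : L2) ((2 * π)⁻¹ * x)) (c := Complex.I * x * (𝓕 f : L2) ((2 * π)⁻¹ * x)) (by
          linear_combination (Complex.I) * h4 + (((√(2 * π))⁻¹ : ℝ) : ℂ) *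
            (𝓕 g : L2) ((2 * π)⁻¹ * x) * Complex.I_sq)
      rw [h5]
      push_cast
      have : (π : ℂ) ≠ 0 := by exact_mod_cast pi_ne_zero
      field_simp
    filter_upwards [ae_comp_mul_left hpi h'] with x hx
    have e : (2 * π)⁻¹ * (2 * π * x) = x := by field_simp
    rwa [e] at hx

theorem IsMulX.smul {f k : L2} (h : IsMulX f k) (c : ℂ) : IsMulX (c • f) (c • k) := by
  unfold IsMulX at *
  filter_upwards [h, Lp.coeFn_smul c f, Lp.coeFn_smul c k] with x h1 h2 h3
  rw [h2, h3, Pi.smul_apply, Pi.smul_apply, h1, smul_eq_mul, smul_eq_mul]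
  ring

theorem IsMulX.add {f k f₁ k₁ : L2} (h : IsMulX f k) (h₁ : IsMulX f₁ k₁) :
    IsMulX (f + f₁) (k + k₁) := by
  unfold IsMulX at *
  filter_upwards [h, h₁, Lp.coeFn_add f f₁, Lp.coeFn_add k k₁] with x h1 h2 h3 h4
  rw [h3, h4, Pi.add_apply, Pi.add_apply, h1, h2]
  ring

theorem IsMulX.unique {f k k' : L2} (h : IsMulX f k) (h' : IsMulX f k') : k = k' := by
  refine Lp.ext ?_
  filter_upwards [h, h'] with x h1 h2
  rw [h1, h2]

theorem isMulX_zero : IsMulX 0 0 := by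
  unfold IsMulX
  filter_upwards [Lp.coeFn_zero ℂ 2 (volume : Measure ℝ)] with x hx
  rw [hx]; simp

theorem isMulX_reflect {f k : L2} : IsMulX (reflect f) (-reflect k) ↔ IsMulX f k := by
  have key : ∀ f k : L2, IsMulX f k → IsMulX (reflect f) (-reflect k) := by
    intro f k h
    unfold IsMulX at *
    filter_upwards [coeFn_reflect f, coeFn_reflect k, Lp.coeFn_neg (reflect k),
      ae_comp_mul_left (a := -1) (by norm_num) h] with x h1 h2 h3 h4
    rw [h3, Pi.neg_apply, h1, h2]
    simp only [neg_mul, one_mul] at h4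
    rw [h4]; push_cast; ring
  refine ⟨fun h => ?_, key f k⟩
  have hr : ∀ f, reflect (reflect f) = f := fun f => by
    refine Lp.ext ?_
    filter_upwards [coeFn_reflect (reflect f),
      ae_comp_mul_left (a := -1) (by norm_num) (coeFn_reflect f)] with x h1 h2
    simp only [neg_mul, one_mul, neg_neg] at h2
    rw [h1, h2]
  have := key _ _ h
  rwa [hr, map_neg, hr, neg_neg] at this

/-- Under the Fourier transform, multiplication by `x` becomes `i d/dξ`. -/
theorem isMulX_iff_fourier {f k : L2} :
    IsMulX f k ↔ IsWeakDeriv (fourierL f) (-Complex.I • fourierL k) := by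
  rw [isWeakDeriv_iff_fourier, map_smul, smul_smul, fourierL_fourierL, fourierL_fourierL]
  have : -Complex.I * -Complex.I = -1 := by rw [neg_mul_neg, Complex.I_mul_I]
  rw [this, neg_one_smul, isMulX_reflect]

theorem IsWeakDeriv.smul {f g : L2} (h : IsWeakDeriv f g) (c : ℂ) :
    IsWeakDeriv (c • f) (c • g) := by
  rw [isWeakDeriv_iff_fourier] at *
  have := h.smul c
  rwa [map_smul, map_smul, smul_comm]

theorem IsWeakDeriv.add {f g f₁ g₁ : L2} (h : IsWeakDeriv f g) (h₁ : IsWeakDeriv f₁ g₁) :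
    IsWeakDeriv (f + f₁) (g + g₁) := by
  rw [isWeakDeriv_iff_fourier] at *
  have := h.add h₁
  rwa [map_add, map_add, smul_add]

theorem IsWeakDeriv.sub {f g f₁ g₁ : L2} (h : IsWeakDeriv f g) (h₁ : IsWeakDeriv f₁ g₁) :
    IsWeakDeriv (f - f₁) (g - g₁) := by
  have := h.add (h₁.smul (-1))
  rwa [neg_one_smul, neg_one_smul, ← sub_eq_add_neg, ← sub_eq_add_neg] at this

theorem isWeakDeriv_zero : IsWeakDeriv 0 0 := by
  rw [isWeakDeriv_iff_fourier, map_zero, smul_zero]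
  exact isMulX_zero

theorem IsWeakDeriv.unique {f g g' : L2} (h : IsWeakDeriv f g) (h' : IsWeakDeriv f g') :
    g = g' := by
  rw [isWeakDeriv_iff_fourier] at *
  have h1 := h.unique h'
  have h2 : (-Complex.I) ≠ 0 := neg_ne_zero.2 Complex.I_ne_zero
  exact fourierL.injective (smul_right_injective _ h2 h1)

theorem IsMulX.mulL2 {f k : L2} (h : IsMulX f k) (φ : ℝ →ᵇ ℂ) :
    IsMulX (mulL2 φ f) (mulL2 φ k) := by
  unfold IsMulX at *
  filter_upwards [h, coeFn_mulL2 φ f, coeFn_mulL2 φ k] with x h1 h2 h3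
  rw [h2, h3, h1]; ring

theorem IsWeakDeriv.U {f g : L2} (h : IsWeakDeriv f g) (t : ℝ) :
    IsWeakDeriv (U t f) (U t g) := by
  rw [isWeakDeriv_iff_fourier] at *
  rw [fourierL_U, fourierL_U, ← map_smul]
  exact h.mulL2 _

/-- The product rule. -/
theorem IsWeakDeriv.mulL2 {f g : L2} (h : IsWeakDeriv f g) {φ φ' : ℝ →ᵇ ℂ} (hφ : HasAC φ φ') :
    IsWeakDeriv (mulL2 φ f) (mulL2 φ' f + CubicNLS.mulL2 φ g) := by
  obtain ⟨F, hF, hfF⟩ := h.exists_hasAC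
  refine (hφ.mul hF).isWeakDeriv ?_ ?_
  · filter_upwards [coeFn_mulL2 φ f, hfF] with x h1 h2
    rw [h1, h2]
  · filter_upwards [coeFn_mulL2 φ' f, coeFn_mulL2 φ g, hfF,
      Lp.coeFn_add (CubicNLS.mulL2 φ' f) (CubicNLS.mulL2 φ g)] with x h1 h2 h3 h4
    rw [h4, Pi.add_apply, h1, h2, h3]

/-- The commutation relation `x U(t) = U(t) (x - it∂ₓ)`. -/
theorem isMulX_U {f g k : L2} (h : IsWeakDeriv f g) (hk : IsMulX f k) (t : ℝ) :
    IsMulX (U t f) (U t (k - (Complex.I * t) • g)) := by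
  rw [isMulX_iff_fourier, fourierL_U, fourierL_U]
  rw [isMulX_iff_fourier] at hk
  rw [isWeakDeriv_iff_fourier] at h
  obtain ⟨F, hF, hfF⟩ := hk.exists_hasAC
  have hp : HasAC (freePhase t)
      (fun ξ => (-Complex.I * t * ξ) * freePhase t ξ) := by
    refine hasAC_of_hasDerivAt (fun ξ => ?_) (by fun_prop)
    have h1 : HasDerivAt (fun ξ : ℝ => Complex.exp (Complex.I * ((-(t / 2) * ξ ^ 2 : ℝ) : ℂ)))
        (Complex.exp (Complex.I * ((-(t / 2) * ξ ^ 2 : ℝ) : ℂ)) *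
          (Complex.I * ((-(t / 2) * (2 * ξ) : ℝ) : ℂ))) ξ := by
      refine HasDerivAt.cexp (HasDerivAt.const_mul _ (HasDerivAt.ofReal_comp ?_))
      have := (hasDerivAt_pow 2 ξ).const_mul (-(t / 2))
      simpa using this
    refine h1.congr_deriv ?_
    change _ = (-Complex.I * t * ξ) * Complex.exp (Complex.I * ((-(t / 2) * ξ ^ 2 : ℝ) : ℂ))
    push_cast
    ring
  refine (hp.mul hF).isWeakDeriv ?_ ?_
  · filter_upwards [coeFn_mulL2 (freePhase t) (fourierL f), hfF] with x h1 h2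
    rw [h1, h2]
  · rw [← map_smul]
    filter_upwards [coeFn_mulL2 (freePhase t) (-Complex.I • fourierL (k - (Complex.I * t) • g)),
      hfF, h, Lp.coeFn_smul (-Complex.I) (fourierL (k - (Complex.I * t) • g)),
      Lp.coeFn_sub (fourierL k) ((Complex.I * t) • fourierL g),
      Lp.coeFn_smul (Complex.I * t) (fourierL g), Lp.coeFn_smul (-Complex.I) (fourierL k),
      Lp.coeFn_smul (-Complex.I) (fourierL g)] with x h1 h2 h3 h4 h5 h6 h7 h8
    rw [h1, h4, Pi.smul_apply, map_sub, map_smul, h5, Pi.sub_apply, h6, Pi.smul_apply, h7,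
      Pi.smul_apply, ← h2]
    rw [h8, Pi.smul_apply] at h3
    simp only [smul_eq_mul] at *
    linear_combination -(Complex.I * t * freePhase t x) * h3

/-! ### The Banach space `Σ` -/

/-- The weight `1 / (1 + x²)`. -/
def decayWeight : ℝ →ᵇ ℂ :=
  BoundedContinuousFunction.ofNormedAddCommGroup (fun x : ℝ => (((1 + x ^ 2)⁻¹ : ℝ) : ℂ))
    (Complex.continuous_ofReal.comp
      ((by fun_prop : Continuous fun x : ℝ => 1 + x ^ 2).inv₀ fun x => by positivity)) 1 fun x => by
      rw [Complex.norm_real, norm_eq_abs, abs_of_nonneg (by positivity)]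
      exact inv_le_one_of_one_le₀ (by nlinarith [sq_nonneg x])

/-- The weight `x / (1 + x²)`. -/
def mulXWeight : ℝ →ᵇ ℂ :=
  BoundedContinuousFunction.ofNormedAddCommGroup (fun x : ℝ => ((x * (1 + x ^ 2)⁻¹ : ℝ) : ℂ))
    (Complex.continuous_ofReal.comp (continuous_id.mul
      ((by fun_prop : Continuous fun x : ℝ => 1 + x ^ 2).inv₀ fun x => by positivity))) 1
    fun x => by
      rw [Complex.norm_real, norm_eq_abs, abs_mul, abs_of_nonneg (by positivity : 0 ≤ (1 + x ^ 2)⁻¹),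
        ← div_eq_mul_inv, div_le_one (by positivity)]
      nlinarith [sq_abs x, sq_nonneg (|x| - 1), abs_nonneg x]

/-- Multiplication by `x` as an equality of two bounded operators, which shows that it is a closed
operator. -/
theorem isMulX_iff_weight {f k : L2} :
    IsMulX f k ↔ mulL2 decayWeight k = mulL2 mulXWeight f := by
  have hx : ∀ x : ℝ, decayWeight x ≠ 0 ∧ mulXWeight x = decayWeight x * x := fun x => by
    refine ⟨?_, ?_⟩
    · change (((1 + x ^ 2)⁻¹ : ℝ) : ℂ) ≠ 0
      rw [Complex.ofReal_ne_zero]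
      positivity
    · change ((x * (1 + x ^ 2)⁻¹ : ℝ) : ℂ) = (((1 + x ^ 2)⁻¹ : ℝ) : ℂ) * x
      push_cast; ring
  constructor
  · intro h
    refine Lp.ext ?_
    filter_upwards [h, coeFn_mulL2 decayWeight k, coeFn_mulL2 mulXWeight f] with x h1 h2 h3
    rw [h2, h3, h1, (hx x).2]; ring
  · intro h
    unfold IsMulX
    filter_upwards [coeFn_mulL2 decayWeight k, coeFn_mulL2 mulXWeight f] with x h2 h3
    rw [h, h3, (hx x).2, mul_assoc] at h2
    exact (mul_left_cancel₀ (hx x).1 h2).symm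

theorem isClosed_isMulX : IsClosed {p : L2 × L2 | IsMulX p.1 p.2} := by
  simp_rw [isMulX_iff_weight]
  exact isClosed_eq (by fun_prop) (by fun_prop)

theorem isClosed_isWeakDeriv : IsClosed {p : L2 × L2 | IsWeakDeriv p.1 p.2} := by
  simp_rw [isWeakDeriv_iff_fourier]
  exact isClosed_isMulX.preimage (f := fun p : L2 × L2 => (fourierL p.1, -Complex.I • fourierL p.2))
    (by fun_prop)

/-- `Σ`, realized as the closed space of triples `(f, ∂ₓf, xf)` in `L² × L² × L²`. -/
def sigmaSubmodule : Submodule ℂ (L2 × L2 × L2) where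
  carrier := {p | IsWeakDeriv p.1 p.2.1 ∧ IsMulX p.1 p.2.2}
  add_mem' := fun h h' => ⟨h.1.add h'.1, h.2.add h'.2⟩
  zero_mem' := ⟨isWeakDeriv_zero, isMulX_zero⟩
  smul_mem' := fun c _ h => ⟨h.1.smul c, h.2.smul c⟩

/-- The Banach space `Σ`, with the maximum of the norms of `f`, `∂ₓf` and `xf`. -/
abbrev Sig : Type := sigmaSubmodule

theorem isClosed_sigmaSubmodule : IsClosed (sigmaSubmodule : Set (L2 × L2 × L2)) :=
  (isClosed_isWeakDeriv.preimage
    (f := fun p : L2 × L2 × L2 => (p.1, p.2.1)) (by fun_prop)).inter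
    (isClosed_isMulX.preimage (f := fun p : L2 × L2 × L2 => (p.1, p.2.2)) (by fun_prop))

instance : CompleteSpace Sig := isClosed_sigmaSubmodule.completeSpace_coe

/-- The function underlying an element of `Σ`. -/
def vS : Sig →L[ℂ] L2 := (ContinuousLinearMap.fst ℂ L2 (L2 × L2)).comp sigmaSubmodule.subtypeL

/-- The derivative of an element of `Σ`. -/
def dS : Sig →L[ℂ] L2 :=
  ((ContinuousLinearMap.fst ℂ L2 L2).comp (ContinuousLinearMap.snd ℂ L2 (L2 × L2))).comp
    sigmaSubmodule.subtypeL

/-- The product of an element of `Σ` with `x`. -/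
def xS : Sig →L[ℂ] L2 :=
  ((ContinuousLinearMap.snd ℂ L2 L2).comp (ContinuousLinearMap.snd ℂ L2 (L2 × L2))).comp
    sigmaSubmodule.subtypeL

/-- The element of `Σ` with components `f`, `g = ∂ₓf`, `k = xf`. -/
def mkS (f g k : L2) (h : IsWeakDeriv f g) (hk : IsMulX f k) : Sig := ⟨(f, g, k), h, hk⟩

@[simp] theorem vS_mkS (f g k : L2) (h : IsWeakDeriv f g) (hk : IsMulX f k) :
    vS (mkS f g k h hk) = f := rfl
@[simp] theorem dS_mkS (f g k : L2) (h : IsWeakDeriv f g) (hk : IsMulX f k) :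
    dS (mkS f g k h hk) = g := rfl
@[simp] theorem xS_mkS (f g k : L2) (h : IsWeakDeriv f g) (hk : IsMulX f k) :
    xS (mkS f g k h hk) = k := rfl

theorem isWeakDeriv_S (p : Sig) : IsWeakDeriv (vS p) (dS p) := p.2.1
theorem isMulX_S (p : Sig) : IsMulX (vS p) (xS p) := p.2.2

theorem norm_S (p : Sig) : ‖p‖ = max ‖vS p‖ (max ‖dS p‖ ‖xS p‖) := rfl

theorem norm_S_le {p : Sig} {C : ℝ} (h1 : ‖vS p‖ ≤ C) (h2 : ‖dS p‖ ≤ C) (h3 : ‖xS p‖ ≤ C) :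
    ‖p‖ ≤ C := by
  rw [norm_S]
  exact max_le h1 (max_le h2 h3)

theorem norm_vS_le (p : Sig) : ‖vS p‖ ≤ ‖p‖ := le_max_left _ _
theorem norm_dS_le (p : Sig) : ‖dS p‖ ≤ ‖p‖ := (le_max_left _ _).trans (le_max_right _ _)
theorem norm_xS_le (p : Sig) : ‖xS p‖ ≤ ‖p‖ := (le_max_right _ _).trans (le_max_right _ _)

theorem ext_S {p q : Sig} (h : vS p = vS q) : p = q := by
  have h1 : dS p = dS q := by
    have := isWeakDeriv_S p
    rw [h] at this
    exact this.unique (isWeakDeriv_S q)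
  have h2 : xS p = xS q := by
    have := isMulX_S p
    rw [h] at this
    exact this.unique (isMulX_S q)
  exact Subtype.ext (Prod.ext h (Prod.ext h1 h2))

theorem continuous_to_S {X : Type*} [TopologicalSpace X] {F : X → Sig}
    (h1 : Continuous fun x => vS (F x)) (h2 : Continuous fun x => dS (F x))
    (h3 : Continuous fun x => xS (F x)) : Continuous F :=
  continuous_induced_rng.2 (h1.prodMk (h2.prodMk h3))

/-! ### The continuous representative -/

theorem bcf_eq_of_ae {F G : ℝ → ℂ} (hF : Continuous F) (hG : Continuous G)
    (h : F =ᵐ[volume] G) : F = G := (hF.ae_eq_iff_eq volume hG).1 h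

theorem IsWeakDeriv.ae_norm_sq_le {f g : L2} (h : IsWeakDeriv f g) :
    ∀ᵐ x, ‖f x‖ ^ 2 ≤ 2 * ‖f‖ * ‖g‖ := by
  obtain ⟨F, hF, hfF⟩ := h.exists_hasAC
  filter_upwards [hfF] with x hx
  rw [hx]
  exact hF.norm_sq_le hfF (ae_eq_refl _) x

theorem IsWeakDeriv.exists_bcf {f g : L2} (h : IsWeakDeriv f g) :
    ∃ F : ℝ →ᵇ ℂ, HasAC F g ∧ f =ᵐ[volume] F := by
  obtain ⟨F, hF, hfF⟩ := h.exists_hasAC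
  exact ⟨BoundedContinuousFunction.ofNormedAddCommGroup F hF.continuous (√(2 * ‖f‖ * ‖g‖))
    fun x => Real.le_sqrt_of_sq_le (hF.norm_sq_le hfF (ae_eq_refl _) x), hF, hfF⟩

theorem norm_bcf_sq_le {f g : L2} {F : ℝ →ᵇ ℂ} (hF : HasAC F g) (hfF : f =ᵐ[volume] F) :
    ‖F‖ ^ 2 ≤ 2 * ‖f‖ * ‖g‖ := by
  have h0 : 0 ≤ 2 * ‖f‖ * ‖g‖ := by positivity
  have : ‖F‖ ≤ √(2 * ‖f‖ * ‖g‖) :=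
    (BoundedContinuousFunction.norm_le (Real.sqrt_nonneg _)).2 fun x =>
      Real.le_sqrt_of_sq_le (hF.norm_sq_le hfF (ae_eq_refl _) x)
  calc ‖F‖ ^ 2 ≤ √(2 * ‖f‖ * ‖g‖) ^ 2 := by gcongr
    _ = _ := Real.sq_sqrt h0

theorem bcf_ext_ae {F G : ℝ →ᵇ ℂ} (h : (F : ℝ → ℂ) =ᵐ[volume] G) : F = G :=
  DFunLike.coe_injective (bcf_eq_of_ae F.continuous G.continuous h)

/-- The continuous bounded representative of an element of `Σ`. -/
def ι : Sig →L[ℂ] (ℝ →ᵇ ℂ) :=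
  LinearMap.mkContinuous
    { toFun := fun p => (isWeakDeriv_S p).exists_bcf.choose
      map_add' := fun p q => by
        have h1 := (isWeakDeriv_S p).exists_bcf.choose_spec
        have h2 := (isWeakDeriv_S q).exists_bcf.choose_spec
        have h3 := (isWeakDeriv_S (p + q)).exists_bcf.choose_spec
        refine bcf_ext_ae ?_
        filter_upwards [h1.2, h2.2, h3.2, Lp.coeFn_add (vS p) (vS q)] with x e1 e2 e3 e4
        rw [← e3, map_add, e4, Pi.add_apply, e1, e2]
        rfl
      map_smul' := fun c p => by
        have h1 := (isWeakDeriv_S p).exists_bcf.choose_spec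
        have h3 := (isWeakDeriv_S (c • p)).exists_bcf.choose_spec
        refine bcf_ext_ae ?_
        filter_upwards [h1.2, h3.2, Lp.coeFn_smul c (vS p)] with x e1 e3 e4
        rw [← e3, map_smul, e4, Pi.smul_apply, e1]
        rfl } 2 fun p => by
    have h1 := (isWeakDeriv_S p).exists_bcf.choose_spec
    have h2 := norm_bcf_sq_le h1.1 h1.2
    have h3 : ‖vS p‖ * ‖dS p‖ ≤ ‖p‖ * ‖p‖ :=
      mul_le_mul (norm_vS_le p) (norm_dS_le p) (norm_nonneg _) (norm_nonneg _)
    refine abs_le_of_sq_le_sq' (?_ : _ ≤ (2 * ‖p‖) ^ 2) (by positivity) |>.2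
    change ‖(isWeakDeriv_S p).exists_bcf.choose‖ ^ 2 ≤ _
    nlinarith [norm_nonneg p, mul_self_nonneg ‖p‖]

theorem hasAC_ι (p : Sig) : HasAC (ι p) (dS p) :=
  (isWeakDeriv_S p).exists_bcf.choose_spec.1

theorem ae_eq_ι (p : Sig) : vS p =ᵐ[volume] ι p :=
  (isWeakDeriv_S p).exists_bcf.choose_spec.2

theorem norm_ι_sq_le (p : Sig) : ‖ι p‖ ^ 2 ≤ 2 * ‖vS p‖ * ‖dS p‖ :=
  norm_bcf_sq_le (hasAC_ι p) (ae_eq_ι p)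

theorem norm_ι_le (p : Sig) : ‖ι p‖ ≤ 2 * ‖p‖ := by
  have h3 : ‖vS p‖ * ‖dS p‖ ≤ ‖p‖ * ‖p‖ :=
    mul_le_mul (norm_vS_le p) (norm_dS_le p) (norm_nonneg _) (norm_nonneg _)
  refine abs_le_of_sq_le_sq' (?_ : _ ≤ (2 * ‖p‖) ^ 2) (by positivity) |>.2
  nlinarith [norm_nonneg p, mul_self_nonneg ‖p‖, norm_ι_sq_le p]

theorem norm_le_of_ae {F : ℝ → ℂ} (hF : Continuous F) {C : ℝ} (h : ∀ᵐ x, ‖F x‖ ≤ C) (x : ℝ) :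
    ‖F x‖ ≤ C := by
  have hd : Dense {x | ‖F x‖ ≤ C} := Measure.dense_of_ae h
  have hc : IsClosed {x | ‖F x‖ ≤ C} := isClosed_le hF.norm continuous_const
  have : x ∈ closure {x | ‖F x‖ ≤ C} := hd x
  rwa [hc.closure_eq] at this

theorem norm_ι_le_of_ae {p : Sig} {C : ℝ} (hC : 0 ≤ C) (h : ∀ᵐ x, ‖vS p x‖ ≤ C) : ‖ι p‖ ≤ C := by
  refine (BoundedContinuousFunction.norm_le hC).2 (norm_le_of_ae (ι p).continuous ?_)
  filter_upwards [h, ae_eq_ι p] with x h1 h2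
  rwa [← h2]

theorem ae_norm_le_ι (p : Sig) : ∀ᵐ x, ‖vS p x‖ ≤ ‖ι p‖ := by
  filter_upwards [ae_eq_ι p] with x hx
  rw [hx]
  exact (ι p).norm_coe_le_norm x

/-! ### The Schrödinger group and the Fourier transform on `Σ` -/

/-- The Schrödinger group on `Σ`. -/
def US (t : ℝ) : Sig →ₗ[ℂ] Sig where
  toFun := fun p => mkS (U t (vS p)) (U t (dS p)) (U t (xS p - (Complex.I * t) • dS p))
    ((isWeakDeriv_S p).U t) (isMulX_U (isWeakDeriv_S p) (isMulX_S p) t)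
  map_add' := fun p q => ext_S (by simp [U_add])
  map_smul' := fun c p => ext_S (by simp [U_smul])

@[simp] theorem vS_US (t : ℝ) (p : Sig) : vS (US t p) = U t (vS p) := rfl
@[simp] theorem dS_US (t : ℝ) (p : Sig) : dS (US t p) = U t (dS p) := rfl
@[simp] theorem xS_US (t : ℝ) (p : Sig) :
    xS (US t p) = U t (xS p - (Complex.I * t) • dS p) := rfl

theorem US_zero (p : Sig) : US 0 p = p := ext_S (by simp only [vS_US, U_zero])

theorem US_US_neg (t : ℝ) (p : Sig) : US t (US (-t) p) = p :=
  ext_S (by simp only [vS_US, U_U_neg])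

theorem _root_.Continuous.schrodinger {X : Type*} [TopologicalSpace X] {a : X → ℝ} {f : X → L2}
    (ha : Continuous a) (hf : Continuous f) : Continuous fun x => U (a x) (f x) :=
  Continuous.comp (g := fun p : ℝ × L2 => U p.1 p.2) (f := fun x => (a x, f x))
    continuous_U_uncurry (ha.prodMk hf)

theorem continuous_US_uncurry : Continuous fun p : ℝ × Sig => US p.1 p.2 := by
  have hv : Continuous fun p : ℝ × Sig => vS p.2 := vS.continuous.comp continuous_snd
  have hd : Continuous fun p : ℝ × Sig => dS p.2 := dS.continuous.comp continuous_snd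
  have hx : Continuous fun p : ℝ × Sig => xS p.2 := xS.continuous.comp continuous_snd
  have hc : Continuous fun p : ℝ × Sig => Complex.I * (p.1 : ℂ) := by fun_prop
  have h1 : Continuous fun p : ℝ × Sig => U p.1 (vS p.2) :=
    continuous_fst.schrodinger hv
  have h2 : Continuous fun p : ℝ × Sig => U p.1 (dS p.2) :=
    continuous_fst.schrodinger hd
  have h3 : Continuous fun p : ℝ × Sig => U p.1 (xS p.2 - (Complex.I * (p.1 : ℂ)) • dS p.2) :=
    continuous_fst.schrodinger (hx.sub (hc.smul hd))
  exact continuous_to_S h1 h2 h3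

theorem norm_US_le (t : ℝ) (p : Sig) : ‖US t p‖ ≤ (1 + |t|) * ‖p‖ := by
  have h0 := norm_nonneg p
  have ht := abs_nonneg t
  refine norm_S_le ?_ ?_ ?_
  · rw [vS_US, norm_U]
    nlinarith [norm_vS_le p]
  · rw [dS_US, norm_U]
    nlinarith [norm_dS_le p]
  · rw [xS_US, norm_U]
    refine (norm_sub_le _ _).trans ?_
    rw [norm_smul, norm_mul, Complex.norm_I, one_mul, Complex.norm_real, norm_eq_abs]
    nlinarith [norm_dS_le p, norm_xS_le p]

/-- The Fourier transform on `Σ`: it exchanges `∂ₓ` and `x` up to factors `-i`. -/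
def fourierSigma : Sig ≃ₗ[ℂ] Sig where
  toFun := fun p => mkS (fourierL (vS p)) (-Complex.I • fourierL (xS p))
    (-Complex.I • fourierL (dS p)) (isMulX_iff_fourier.1 (isMulX_S p))
    (isWeakDeriv_iff_fourier.1 (isWeakDeriv_S p))
  map_add' := fun p q => ext_S (by simp)
  map_smul' := fun c p => ext_S (by simp)
  invFun := fun p => mkS (fourierL.symm (vS p)) (Complex.I • fourierL.symm (xS p))
    (Complex.I • fourierL.symm (dS p))
    (by
      rw [isWeakDeriv_iff_fourier, map_smul, smul_smul, LinearIsometryEquiv.apply_symm_apply,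
        LinearIsometryEquiv.apply_symm_apply, neg_mul, Complex.I_mul_I, neg_neg, one_smul]
      exact isMulX_S p)
    (by
      rw [isMulX_iff_fourier, map_smul, smul_smul, LinearIsometryEquiv.apply_symm_apply,
        LinearIsometryEquiv.apply_symm_apply, neg_mul, Complex.I_mul_I, neg_neg, one_smul]
      exact isWeakDeriv_S p)
  left_inv := fun p => ext_S (by simp)
  right_inv := fun p => ext_S (by simp)

/-- The Fourier transform as an isometry of `Σ`. -/
def FS : Sig ≃ₗᵢ[ℂ] Sig where
  toLinearEquiv := fourierSigma
  norm_map' := fun p => by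
    have h1 : vS (fourierSigma p) = fourierL (vS p) := rfl
    have h2 : dS (fourierSigma p) = -Complex.I • fourierL (xS p) := rfl
    have h3 : xS (fourierSigma p) = -Complex.I • fourierL (dS p) := rfl
    rw [norm_S, norm_S, h1, h2, h3]
    simp only [norm_smul, norm_neg, Complex.norm_I, one_mul, LinearIsometryEquiv.norm_map]
    rw [max_comm ‖xS p‖]

@[simp] theorem vS_FS (p : Sig) : vS (FS p) = fourierL (vS p) := rfl
@[simp] theorem dS_FS (p : Sig) : dS (FS p) = -Complex.I • fourierL (xS p) := rfl
@[simp] theorem xS_FS (p : Sig) : xS (FS p) = -Complex.I • fourierL (dS p) := rfl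
@[simp] theorem vS_FS_symm (p : Sig) : vS (FS.symm p) = fourierL.symm (vS p) := rfl
@[simp] theorem dS_FS_symm (p : Sig) :
    dS (FS.symm p) = Complex.I • fourierL.symm (xS p) := rfl
@[simp] theorem xS_FS_symm (p : Sig) :
    xS (FS.symm p) = Complex.I • fourierL.symm (dS p) := rfl

theorem norm_vS_FS (p : Sig) : ‖vS (FS p)‖ = ‖vS p‖ := by simp
theorem norm_dS_FS (p : Sig) : ‖dS (FS p)‖ = ‖xS p‖ := by simp [norm_smul]
theorem norm_xS_FS (p : Sig) : ‖xS (FS p)‖ = ‖dS p‖ := by simp [norm_smul]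

/-! ### The cubic nonlinearity on `Σ` -/

/-- The multiplier `|u|²`. -/
def modSq (u : Sig) : ℝ →ᵇ ℂ := ι u * star (ι u)

theorem modSq_apply (u : Sig) (x : ℝ) : modSq u x = ((‖ι u x‖ ^ 2 : ℝ) : ℂ) := by
  change ι u x * star (ι u x) = _
  rw [RCLike.star_def, Complex.mul_conj, Complex.normSq_eq_norm_sq]

theorem cub_isWeakDeriv (u : Sig) : IsWeakDeriv (mulL2 (modSq u) (vS u))
    ((2 : ℂ) • mulL2 (modSq u) (dS u) + mulL2 (ι u * ι u) (conjL2 (dS u))) := by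
  have h := hasAC_ι u
  refine ((h.mul h.conj).mul h).isWeakDeriv ?_ ?_
  · filter_upwards [coeFn_mulL2 (modSq u) (vS u), ae_eq_ι u] with x h1 h2
    rw [h1, h2]
    rfl
  · filter_upwards [coeFn_mulL2 (modSq u) (dS u), coeFn_mulL2 (ι u * ι u) (conjL2 (dS u)),
      coeFn_conjL2 (dS u), Lp.coeFn_smul (2 : ℂ) (mulL2 (modSq u) (dS u)),
      Lp.coeFn_add ((2 : ℂ) • mulL2 (modSq u) (dS u)) (mulL2 (ι u * ι u) (conjL2 (dS u)))]
      with x h1 h2 h3 h4 h5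
    rw [h5, Pi.add_apply, h4, Pi.smul_apply, h1, h2, h3]
    simp only [modSq, BoundedContinuousFunction.mul_apply, smul_eq_mul]
    change 2 * ((ι u x * star (ι u x)) * dS u x) + _ = _
    ring

/-- The nonlinearity `u ↦ |u|²u` on `Σ`. -/
def cubS (u : Sig) : Sig :=
  mkS (mulL2 (modSq u) (vS u))
    ((2 : ℂ) • mulL2 (modSq u) (dS u) + mulL2 (ι u * ι u) (conjL2 (dS u)))
    (mulL2 (modSq u) (xS u)) (cub_isWeakDeriv u) ((isMulX_S u).mulL2 _)

@[simp] theorem vS_cubS (u : Sig) : vS (cubS u) = mulL2 (modSq u) (vS u) := rfl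
@[simp] theorem dS_cubS (u : Sig) : dS (cubS u) =
    (2 : ℂ) • mulL2 (modSq u) (dS u) + mulL2 (ι u * ι u) (conjL2 (dS u)) := rfl
@[simp] theorem xS_cubS (u : Sig) : xS (cubS u) = mulL2 (modSq u) (xS u) := rfl

theorem norm_star_ι (u : Sig) : ‖star (ι u)‖ = ‖ι u‖ := norm_star _

theorem norm_modSq_le (u : Sig) : ‖modSq u‖ ≤ ‖ι u‖ ^ 2 := by
  refine (norm_mul_le _ _).trans ?_
  rw [norm_star_ι, sq]

theorem norm_modSq_sub_le (u w : Sig) :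
    ‖modSq u - modSq w‖ ≤ (‖ι u‖ + ‖ι w‖) * ‖ι (u - w)‖ := by
  have : modSq u - modSq w = ι (u - w) * star (ι u) + ι w * star (ι (u - w)) := by
    simp only [modSq, map_sub, star_sub]; ring
  rw [this]
  refine (norm_add_le _ _).trans ?_
  refine (add_le_add (norm_mul_le _ _) (norm_mul_le _ _)).trans ?_
  rw [norm_star_ι, norm_star_ι]
  linarith

theorem norm_sq_sub_le (u w : Sig) :
    ‖ι u * ι u - ι w * ι w‖ ≤ (‖ι u‖ + ‖ι w‖) * ‖ι (u - w)‖ := by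
  have : ι u * ι u - ι w * ι w = ι (u - w) * ι u + ι w * ι (u - w) := by
    simp only [map_sub]; ring
  rw [this]
  refine (norm_add_le _ _).trans ?_
  refine (add_le_add (norm_mul_le _ _) (norm_mul_le _ _)).trans ?_
  linarith

/-- Pointwise, `||a|²a - |b|²b| ≤ (|a| + |b|)² |a - b|`. -/
theorem norm_cub_sub_le (a b : ℂ) (r : ℝ) :
    ‖((‖a‖ ^ 2 : ℝ) : ℂ) * (r * a) - ((‖b‖ ^ 2 : ℝ) : ℂ) * (r * b)‖ ≤
      (‖a‖ + ‖b‖) ^ 2 * ‖(r : ℂ) * (a - b)‖ := by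
  have h : ((‖a‖ ^ 2 : ℝ) : ℂ) * (r * a) - ((‖b‖ ^ 2 : ℝ) : ℂ) * (r * b) =
      r * (((‖a‖ ^ 2 : ℝ) : ℂ) * (a - b) + ((‖a‖ ^ 2 - ‖b‖ ^ 2 : ℝ) : ℂ) * b) := by
    push_cast; ring
  rw [h, norm_mul, norm_mul, ← mul_assoc, mul_comm _ ‖(r : ℂ)‖, mul_assoc]
  gcongr
  refine (norm_add_le _ _).trans ?_
  rw [norm_mul, norm_mul, Complex.norm_real, Complex.norm_real, norm_eq_abs, norm_eq_abs,
    abs_of_nonneg (by positivity)]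
  have h1 : |‖a‖ ^ 2 - ‖b‖ ^ 2| ≤ (‖a‖ + ‖b‖) * ‖a - b‖ := by
    rw [sq_sub_sq, abs_mul, abs_of_nonneg (by positivity)]
    gcongr
    exact abs_norm_sub_norm_le a b
  nlinarith [norm_nonneg a, norm_nonneg b, norm_nonneg (a - b),
    mul_le_mul_of_nonneg_right h1 (norm_nonneg b), mul_nonneg (norm_nonneg a) (norm_nonneg (a - b)),
    mul_nonneg (mul_nonneg (norm_nonneg a) (norm_nonneg b)) (norm_nonneg (a - b))]

theorem norm_vS_cubS_sub_le (u w : Sig) :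
    ‖vS (cubS u - cubS w)‖ ≤ (‖ι u‖ + ‖ι w‖) ^ 2 * ‖vS (u - w)‖ := by
  rw [map_sub, map_sub]
  refine norm_le_mul_norm_of_ae ?_
  filter_upwards [coeFn_mulL2 (modSq u) (vS u), coeFn_mulL2 (modSq w) (vS w),
    Lp.coeFn_sub (vS (cubS u)) (vS (cubS w)), Lp.coeFn_sub (vS u) (vS w), ae_eq_ι u, ae_eq_ι w]
    with x h1 h2 h3 h4 h5 h6
  rw [h3, Pi.sub_apply, h4, Pi.sub_apply, vS_cubS, vS_cubS, h1, h2, h5, h6, modSq_apply,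
    modSq_apply]
  have := norm_cub_sub_le (ι u x) (ι w x) 1
  simp only [Complex.ofReal_one, one_mul] at this
  refine this.trans ?_
  gcongr
  · exact (ι u).norm_coe_le_norm x
  · exact (ι w).norm_coe_le_norm x

theorem norm_xS_cubS_sub_le (u w : Sig) :
    ‖xS (cubS u - cubS w)‖ ≤ (‖ι u‖ + ‖ι w‖) ^ 2 * ‖xS (u - w)‖ := by
  rw [map_sub, map_sub]
  refine norm_le_mul_norm_of_ae ?_
  filter_upwards [coeFn_mulL2 (modSq u) (xS u), coeFn_mulL2 (modSq w) (xS w),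
    Lp.coeFn_sub (xS (cubS u)) (xS (cubS w)), Lp.coeFn_sub (xS u) (xS w), ae_eq_ι u, ae_eq_ι w,
    isMulX_S u, isMulX_S w] with x h1 h2 h3 h4 h5 h6 h7 h8
  rw [h3, Pi.sub_apply, h4, Pi.sub_apply, xS_cubS, xS_cubS, h1, h2, h7, h8, h5, h6, modSq_apply,
    modSq_apply, ← mul_sub]
  refine (norm_cub_sub_le (ι u x) (ι w x) x).trans ?_
  gcongr
  · exact (ι u).norm_coe_le_norm x
  · exact (ι w).norm_coe_le_norm x

theorem norm_dS_cubS_sub_le (u w : Sig) :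
    ‖dS (cubS u - cubS w)‖ ≤ 3 * ‖ι u‖ ^ 2 * ‖dS (u - w)‖ +
      3 * ((‖ι u‖ + ‖ι w‖) * ‖ι (u - w)‖) * ‖dS w‖ := by
  have h : dS (cubS u - cubS w) = (2 : ℂ) • mulL2 (modSq u) (dS (u - w)) +
      (2 : ℂ) • mulL2 (modSq u - modSq w) (dS w) + mulL2 (ι u * ι u) (conjL2 (dS (u - w))) +
      mulL2 (ι u * ι u - ι w * ι w) (conjL2 (dS w)) := by
    simp only [map_sub, dS_cubS, sub_apply, smul_sub]
    abel
  rw [h]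
  refine (norm_add₄_le).trans ?_
  rw [norm_smul, norm_smul, Complex.norm_ofNat]
  have h1 := (norm_mulL2_le (modSq u) (dS (u - w))).trans
    (mul_le_mul_of_nonneg_right (norm_modSq_le u) (norm_nonneg _))
  have h2 := (norm_mulL2_le (modSq u - modSq w) (dS w)).trans
    (mul_le_mul_of_nonneg_right (norm_modSq_sub_le u w) (norm_nonneg _))
  have h3 := (norm_mulL2_le (ι u * ι u) (conjL2 (dS (u - w)))).trans
    (mul_le_mul_of_nonneg_right (norm_mul_le _ _) (norm_nonneg _))
  have h4 := (norm_mulL2_le (ι u * ι u - ι w * ι w) (conjL2 (dS w))).trans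
    (mul_le_mul_of_nonneg_right (norm_sq_sub_le u w) (norm_nonneg _))
  rw [norm_conjL2] at h3 h4
  nlinarith

theorem cubS_zero : cubS 0 = 0 := ext_S (by simp)

theorem continuous_cubS : Continuous cubS := by
  have hm : Continuous modSq := by unfold modSq; fun_prop
  refine continuous_to_S ?_ ?_ ?_
  · simp only [vS_cubS]; fun_prop
  · simp only [dS_cubS]; fun_prop
  · simp only [xS_cubS]; fun_prop

/-! ### The nonlinearity in the interaction picture -/

theorem vS_cubS_ae (u : Sig) :
    vS (cubS u) =ᵐ[volume] fun x => ((‖vS u x‖ ^ 2 : ℝ) : ℂ) * vS u x := by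
  rw [vS_cubS]
  filter_upwards [coeFn_mulL2 (modSq u) (vS u), ae_eq_ι u] with x h1 h2
  rw [h1, h2, modSq_apply]

/-- The nonlinearity `f ↦ U(-t)(|U(t)f|²U(t)f)` on `Σ`. -/
def NS (t : ℝ) (f : Sig) : Sig := US (-t) (cubS (US t f))

/-- The sup norm of `U(t)f`. -/
def amp (t : ℝ) (f : Sig) : ℝ := ‖ι (US t f)‖

theorem amp_nonneg (t : ℝ) (f : Sig) : 0 ≤ amp t f := norm_nonneg _

theorem amp_add_le (t : ℝ) (f g : Sig) : amp t (f + g) ≤ amp t f + amp t g := by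
  unfold amp
  rw [map_add, map_add]
  exact norm_add_le _ _

/-- The Fourier-side profile `U(-1/t) f̂`, which describes `U(t)f` up to dilation and phase. -/
def dualS (t : ℝ) (f : Sig) : Sig := US (-t⁻¹) (FS f)

theorem dualS_sub (t : ℝ) (f g : Sig) : dualS t (f - g) = dualS t f - dualS t g := by
  unfold dualS
  rw [map_sub, map_sub]

/-- The factorization of `U(t)f` into a phase, a dilation and the dual profile `U(-1/t)f̂`. -/
theorem vS_US_factor {t : ℝ} (ht : t ≠ 0) (f : Sig) :
    vS (US t f) = schrodingerConst t • mulL2 (freePhase (-t⁻¹)) (dilT t ht (vS (dualS t f))) := by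
  have := U_fourierL_symm ht (fourierL (vS f))
  rw [LinearIsometryEquiv.symm_apply_apply] at this
  exact this

theorem vS_US_factor_ae {t : ℝ} (ht : t ≠ 0) (f : Sig) :
    ∀ᵐ x : ℝ, vS (US t f) x = schrodingerConst t * (freePhase (-t⁻¹) x *
      ((((√|t|)⁻¹ : ℝ) : ℂ) * vS (dualS t f) (t⁻¹ * x))) := by
  rw [vS_US_factor ht f]
  filter_upwards [coeFn_mulL2 (freePhase (-t⁻¹)) (dilT t ht (vS (dualS t f))),
    coeFn_dilT t ht (vS (dualS t f)), Lp.coeFn_smul (schrodingerConst t)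
      (mulL2 (freePhase (-t⁻¹)) (dilT t ht (vS (dualS t f))))] with x h1 h2 h3
  rw [h3, Pi.smul_apply, h1, h2, smul_eq_mul]

theorem norm_freePhase_apply (t x : ℝ) : ‖freePhase t x‖ = 1 := norm_phase_apply _ _ _

theorem norm_vS_US_ae {t : ℝ} (ht : t ≠ 0) (f : Sig) :
    ∀ᵐ x : ℝ, ‖vS (US t f) x‖ = (√|t|)⁻¹ * ‖vS (dualS t f) (t⁻¹ * x)‖ := by
  filter_upwards [vS_US_factor_ae ht f] with x hx
  rw [hx, norm_mul, norm_mul, norm_mul, norm_schrodingerConst ht, norm_freePhase_apply,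
    Complex.norm_real, norm_eq_abs, abs_of_nonneg (by positivity), one_mul, one_mul]

/-- Hence the sup norm of `U(t)f` is `|t|^{-1/2}` times that of the dual profile. -/
theorem amp_eq {t : ℝ} (ht : t ≠ 0) (f : Sig) : amp t f = (√|t|)⁻¹ * ‖ι (dualS t f)‖ := by
  have hs : 0 < √|t| := Real.sqrt_pos.2 (abs_pos.2 ht)
  apply le_antisymm
  · refine norm_ι_le_of_ae (by positivity) ?_
    filter_upwards [norm_vS_US_ae ht f,
      ae_comp_mul_left (inv_ne_zero ht) (ae_norm_le_ι (dualS t f))] with x h1 h2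
    rw [h1]
    gcongr
  · rw [inv_mul_le_iff₀ hs]
    refine norm_ι_le_of_ae (by unfold amp; positivity) ?_
    filter_upwards [ae_comp_mul_left ht (norm_vS_US_ae ht f),
      ae_comp_mul_left ht (ae_norm_le_ι (US t f))] with x h1 h2
    rw [h1, ← mul_assoc, inv_mul_cancel₀ ht, one_mul, inv_mul_le_iff₀ hs] at h2
    exact h2

theorem amp_sq_eq {t : ℝ} (ht : t ≠ 0) (f : Sig) :
    amp t f ^ 2 = |t|⁻¹ * ‖ι (dualS t f)‖ ^ 2 := by
  rw [amp_eq ht, mul_pow, inv_pow, Real.sq_sqrt (abs_nonneg t)]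

/-- The dispersive estimate for `U(t)` on `Σ`. -/
theorem amp_sq_le {t : ℝ} (ht : t ≠ 0) (f : Sig) :
    amp t f ^ 2 ≤ |t|⁻¹ * (2 * ‖vS f‖ * ‖xS f‖) := by
  rw [amp_sq_eq ht]
  have h := norm_ι_sq_le (dualS t f)
  unfold dualS at h
  rw [vS_US, dS_US, norm_U, norm_U, norm_vS_FS, norm_dS_FS] at h
  exact mul_le_mul_of_nonneg_left h (by positivity)

/-- In terms of `f̂`, the nonlinearity takes the form `|t|⁻¹ U(1/t)(|v|²v)` with
`v = U(-1/t)f̂`. -/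
theorem FS_NS {t : ℝ} (ht : t ≠ 0) (f : Sig) :
    FS (NS t f) = ((|t|⁻¹ : ℝ) : ℂ) • US t⁻¹ (cubS (dualS t f)) := by
  refine ext_S ?_
  rw [vS_FS, map_smul, vS_US]
  have key : vS (cubS (US t f)) = ((|t|⁻¹ : ℝ) : ℂ) • U t (fourierL.symm
      (U t⁻¹ (vS (cubS (dualS t f))))) := by
    rw [U_fourierL_symm ht, U_neg_U]
    refine Lp.ext ?_
    filter_upwards [vS_cubS_ae (US t f), norm_vS_US_ae ht f, vS_US_factor_ae ht f,
      ae_comp_mul_left (inv_ne_zero ht) (vS_cubS_ae (dualS t f)),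
      coeFn_mulL2 (freePhase (-t⁻¹)) (dilT t ht (vS (cubS (dualS t f)))),
      coeFn_dilT t ht (vS (cubS (dualS t f))), Lp.coeFn_smul (schrodingerConst t)
        (mulL2 (freePhase (-t⁻¹)) (dilT t ht (vS (cubS (dualS t f))))),
      Lp.coeFn_smul ((|t|⁻¹ : ℝ) : ℂ) (schrodingerConst t •
        (mulL2 (freePhase (-t⁻¹)) (dilT t ht (vS (cubS (dualS t f))))))]
      with x h1 h2 h3 h4 h5 h6 h7 h8
    rw [h8, Pi.smul_apply, h7, Pi.smul_apply, h5, h6, h4, h1, h2, h3, mul_pow, inv_pow,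
      Real.sq_sqrt (abs_nonneg t)]
    simp only [smul_eq_mul]
    push_cast
    ring
  unfold NS
  rw [vS_US, key, U_smul, U_neg_U, map_smul, LinearIsometryEquiv.apply_symm_apply]

theorem US_sub (t : ℝ) (f g : Sig) : US t (f - g) = US t f - US t g := map_sub _ _ _

theorem NS_sub (t : ℝ) (f g : Sig) :
    NS t f - NS t g = US (-t) (cubS (US t f) - cubS (US t g)) := by
  unfold NS
  rw [US_sub]

theorem norm_vS_NS_sub_le (t : ℝ) (f g : Sig) :
    ‖vS (NS t f - NS t g)‖ ≤ (amp t f + amp t g) ^ 2 * ‖vS (f - g)‖ := by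
  rw [NS_sub, vS_US, norm_U]
  refine (norm_vS_cubS_sub_le _ _).trans_eq ?_
  rw [← US_sub, vS_US, norm_U]
  rfl

theorem norm_dS_NS_sub_le (t : ℝ) (f g : Sig) :
    ‖dS (NS t f - NS t g)‖ ≤ 3 * amp t f ^ 2 * ‖dS (f - g)‖ +
      3 * ((amp t f + amp t g) * amp t (f - g)) * ‖dS g‖ := by
  rw [NS_sub, dS_US, norm_U]
  refine (norm_dS_cubS_sub_le _ _).trans_eq ?_
  rw [← US_sub, dS_US, norm_U, dS_US, norm_U]
  rfl

/-- The weighted analogue of `norm_dS_NS_sub_le`, with the same constants: on the Fourier side, by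
`FS_NS`, the weight is a derivative. -/
theorem norm_xS_NS_sub_le {t : ℝ} (ht : t ≠ 0) (f g : Sig) :
    ‖xS (NS t f - NS t g)‖ ≤ 3 * amp t f ^ 2 * ‖xS (f - g)‖ +
      3 * ((amp t f + amp t g) * amp t (f - g)) * ‖xS g‖ := by
  have e : FS (NS t f - NS t g) =
      ((|t|⁻¹ : ℝ) : ℂ) • US t⁻¹ (cubS (dualS t f) - cubS (dualS t g)) := by
    rw [map_sub FS, FS_NS ht, FS_NS ht, US_sub]
    exact (smul_sub _ _ _).symm
  rw [← norm_dS_FS, e, map_smul, norm_smul,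
    Complex.norm_real, norm_eq_abs, abs_of_nonneg (by positivity), dS_US, norm_U]
  have h := norm_dS_cubS_sub_le (dualS t f) (dualS t g)
  rw [← dualS_sub] at h
  have hd : ∀ f, ‖dS (dualS t f)‖ = ‖xS f‖ := fun f => by
    unfold dualS
    rw [dS_US, norm_U, norm_dS_FS]
  rw [hd, hd] at h
  refine (mul_le_mul_of_nonneg_left h (by positivity)).trans_eq ?_
  rw [amp_sq_eq ht, amp_eq ht, amp_eq ht, amp_eq ht]
  have : |t|⁻¹ = (√|t|)⁻¹ * (√|t|)⁻¹ := by
    rw [← mul_inv, Real.mul_self_sqrt (abs_nonneg t)]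
  rw [this]
  ring

theorem NS_zero (t : ℝ) : NS t 0 = 0 := by
  unfold NS
  rw [map_zero, cubS_zero, map_zero]

theorem continuous_NS_uncurry : Continuous fun p : ℝ × Sig => NS p.1 p.2 := by
  have h1 : Continuous fun p : ℝ × Sig => cubS (US p.1 p.2) :=
    continuous_cubS.comp continuous_US_uncurry
  exact Continuous.comp (g := fun p : ℝ × Sig => US p.1 p.2)
    (f := fun p : ℝ × Sig => (-p.1, cubS (US p.1 p.2))) continuous_US_uncurry
    (continuous_fst.neg.prodMk h1)

theorem norm_cubS_sub_le {R : ℝ} {u w : Sig} (hu : ‖u‖ ≤ R) (hw : ‖w‖ ≤ R) :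
    ‖cubS u - cubS w‖ ≤ 36 * R ^ 2 * ‖u - w‖ := by
  have hR : 0 ≤ R := (norm_nonneg u).trans hu
  have iu := (norm_ι_le u).trans (mul_le_mul_of_nonneg_left hu zero_le_two)
  have iw := (norm_ι_le w).trans (mul_le_mul_of_nonneg_left hw zero_le_two)
  have id := norm_ι_le (u - w)
  have hsum : ‖ι u‖ + ‖ι w‖ ≤ 4 * R := by linarith
  have hsq : (‖ι u‖ + ‖ι w‖) ^ 2 ≤ (4 * R) ^ 2 := by gcongr
  have hsq' : ‖ι u‖ ^ 2 ≤ (2 * R) ^ 2 := by gcongr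
  have h0 := norm_nonneg (u - w)
  refine norm_S_le ?_ ?_ ?_
  · refine (norm_vS_cubS_sub_le u w).trans ((mul_le_mul hsq (norm_vS_le _) (norm_nonneg _)
      (by positivity)).trans ?_)
    nlinarith [sq_nonneg R, mul_nonneg (sq_nonneg R) h0]
  · refine (norm_dS_cubS_sub_le u w).trans ?_
    have h1 : 3 * ‖ι u‖ ^ 2 * ‖dS (u - w)‖ ≤ 3 * (2 * R) ^ 2 * ‖u - w‖ :=
      mul_le_mul (by linarith) (norm_dS_le _) (norm_nonneg _) (by positivity)
    have h2 : 3 * ((‖ι u‖ + ‖ι w‖) * ‖ι (u - w)‖) * ‖dS w‖ ≤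
        3 * ((4 * R) * (2 * ‖u - w‖)) * R := by
      gcongr
      exact (norm_dS_le w).trans hw
    nlinarith
  · refine (norm_xS_cubS_sub_le u w).trans ((mul_le_mul hsq (norm_xS_le _) (norm_nonneg _)
      (by positivity)).trans ?_)
    nlinarith [sq_nonneg R, mul_nonneg (sq_nonneg R) h0]

/-- The nonlinearity is Lipschitz on bounded sets, locally uniformly in time. -/
theorem norm_NS_sub_le {T R t : ℝ} (ht : |t| ≤ T) {f g : Sig} (hf : ‖f‖ ≤ R) (hg : ‖g‖ ≤ R) :
    ‖NS t f - NS t g‖ ≤ 36 * (1 + T) ^ 4 * R ^ 2 * ‖f - g‖ := by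
  have hR : 0 ≤ R := (norm_nonneg f).trans hf
  have hT : 0 ≤ T := (abs_nonneg t).trans ht
  have hU : ∀ {s : ℝ} (p : Sig), |s| ≤ T → ‖US s p‖ ≤ (1 + T) * ‖p‖ := fun p hs =>
    (norm_US_le _ p).trans (by gcongr)
  have hb : ∀ {p : Sig}, ‖p‖ ≤ R → ‖US t p‖ ≤ (1 + T) * R := fun hp =>
    (hU _ ht).trans (by gcongr)
  rw [NS_sub]
  have h1 := norm_cubS_sub_le (hb hf) (hb hg)
  rw [← US_sub] at h1
  calc ‖US (-t) (cubS (US t f) - cubS (US t g))‖ ≤ (1 + T) * ‖cubS (US t f) - cubS (US t g)‖ :=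
        hU _ (by rwa [abs_neg])
    _ ≤ (1 + T) * (36 * ((1 + T) * R) ^ 2 * ((1 + T) * ‖f - g‖)) := by
        gcongr
        refine h1.trans ?_
        gcongr
        exact hU _ ht
    _ = _ := by ring

/-! ### Time derivatives of the Schrödinger group in the weak sense -/

theorem inner_L2_eq (f g : L2) : inner ℂ f g = ∫ x, g x * star (f x) := by
  rw [MeasureTheory.L2.inner_def]
  rfl

theorem integrable_inner_L2 (f g : L2) : Integrable fun x => g x * star (f x) :=
  MeasureTheory.L2.integrable_inner f g

theorem inner_U_U (t : ℝ) (f g : L2) : inner ℂ (U t f) (U t g) = inner ℂ f g :=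
  (UL t).inner_map_map f g

theorem inner_U_left (t : ℝ) (f g : L2) : inner ℂ (U t f) g = inner ℂ f (U (-t) g) := by
  rw [← inner_U_U t f, U_U_neg]

theorem inner_mulL2_left (φ : ℝ →ᵇ ℂ) (f g : L2) :
    inner ℂ (mulL2 φ f) g = inner ℂ f (mulL2 (star φ) g) := by
  rw [inner_L2_eq, inner_L2_eq]
  refine integral_congr_ae ?_
  filter_upwards [coeFn_mulL2 φ f, coeFn_mulL2 (star φ) g] with x h1 h2
  rw [h1, h2, star_mul']
  change _ = star (φ x) * g x * _
  ring

/-- Integration by parts. -/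
theorem inner_deriv_left {a a' b b' : L2} (ha : IsWeakDeriv a a') (hb : IsWeakDeriv b b') :
    inner ℂ a' b = -inner ℂ a b' := by
  rw [← fourierL.inner_map_map a' b, ← fourierL.inner_map_map a b', inner_L2_eq, inner_L2_eq,
    ← integral_neg]
  refine integral_congr_ae ?_
  filter_upwards [isWeakDeriv_iff_fourier.1 ha, isWeakDeriv_iff_fourier.1 hb,
    Lp.coeFn_smul (-Complex.I) (fourierL a'), Lp.coeFn_smul (-Complex.I) (fourierL b')]
    with x h1 h2 h3 h4
  rw [h3, Pi.smul_apply, smul_eq_mul] at h1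
  rw [h4, Pi.smul_apply, smul_eq_mul] at h2
  have e1 : fourierL a' x = Complex.I * (x * fourierL a x) := by
    rw [← h1, ← mul_assoc, mul_neg, Complex.I_mul_I, neg_neg, one_mul]
  have e2 : fourierL b' x = Complex.I * (x * fourierL b x) := by
    rw [← h2, ← mul_assoc, mul_neg, Complex.I_mul_I, neg_neg, one_mul]
  rw [e1, e2]
  simp only [RCLike.star_def, map_mul, Complex.conj_I, Complex.conj_ofReal]
  ring

/-- For `a, b ∈ H¹`, the function `⟨a, U(τ)b⟩` is differentiable in `τ`. -/
theorem hasDerivAt_inner_U {a a' b b' : L2} (ha : IsWeakDeriv a a') (hb : IsWeakDeriv b b')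
    (s : ℝ) : HasDerivAt (fun τ => inner ℂ a (U τ b))
      (-(Complex.I / 2) * inner ℂ a' (U s b')) s := by
  have hF : ∀ (c d : L2) (τ : ℝ), inner ℂ c (U τ d) =
      ∫ ξ, freePhase τ ξ * fourierL d ξ * star (fourierL c ξ) := by
    intro c d τ
    rw [← fourierL.inner_map_map, fourierL_U, inner_L2_eq]
    refine integral_congr_ae ?_
    filter_upwards [coeFn_mulL2 (freePhase τ) (fourierL d)] with x hx
    rw [hx]
  simp_rw [hF]
  rw [← integral_const_mul]
  have hint : Integrable fun ξ => fourierL b ξ * star (fourierL a ξ) := integrable_inner_L2 _ _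
  have hint' : Integrable fun ξ => fourierL b' ξ * star (fourierL a' ξ) :=
    integrable_inner_L2 _ _
  have hpc : ∀ τ, AEStronglyMeasurable (fun ξ => freePhase τ ξ) volume := fun τ =>
    (freePhase τ).continuous.aestronglyMeasurable
  have hre : ∀ᵐ ξ, fourierL b' ξ * star (fourierL a' ξ) =
      (ξ : ℂ) ^ 2 * (fourierL b ξ * star (fourierL a ξ)) := by
    filter_upwards [isWeakDeriv_iff_fourier.1 ha, isWeakDeriv_iff_fourier.1 hb,
      Lp.coeFn_smul (-Complex.I) (fourierL a'), Lp.coeFn_smul (-Complex.I) (fourierL b')]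
      with x h1 h2 h3 h4
    rw [h3, Pi.smul_apply, smul_eq_mul] at h1
    rw [h4, Pi.smul_apply, smul_eq_mul] at h2
    have e1 : fourierL a' x = Complex.I * (x * fourierL a x) := by
      rw [← h1, ← mul_assoc, mul_neg, Complex.I_mul_I, neg_neg, one_mul]
    have e2 : fourierL b' x = Complex.I * (x * fourierL b x) := by
      rw [← h2, ← mul_assoc, mul_neg, Complex.I_mul_I, neg_neg, one_mul]
    rw [e1, e2]
    simp only [RCLike.star_def, map_mul, Complex.conj_I, Complex.conj_ofReal]
    linear_combination -(x : ℂ) ^ 2 * (fourierL b x) * (starRingEnd ℂ (fourierL a x)) *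
      Complex.I_mul_I
  refine (hasDerivAt_integral_of_dominated_loc_of_deriv_le
    (F := fun τ ξ => freePhase τ ξ * fourierL b ξ * star (fourierL a ξ))
    (F' := fun τ ξ => -(Complex.I / 2) * (freePhase τ ξ * fourierL b' ξ * star (fourierL a' ξ)))
    (bound := fun ξ => ‖fourierL b' ξ * star (fourierL a' ξ)‖) (s := Set.univ)
    univ_mem ?_ ?_ ?_ ?_ hint'.norm ?_).2
  · refine Eventually.of_forall fun τ => ?_
    simpa only [mul_assoc, Pi.mul_def] using (hpc τ).mul hint.aestronglyMeasurable
  · refine hint.mono ?_ (Eventually.of_forall fun ξ => ?_)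
    · simpa only [mul_assoc, Pi.mul_def] using (hpc s).mul hint.aestronglyMeasurable
    · rw [mul_assoc, norm_mul, norm_freePhase_apply, one_mul]
  · have := ((hpc s).mul hint'.aestronglyMeasurable).const_mul (-(Complex.I / 2))
    simpa only [mul_assoc, Pi.mul_def] using this
  · refine Eventually.of_forall fun ξ τ _ => ?_
    rw [mul_assoc, norm_mul, norm_mul, norm_freePhase_apply, one_mul, norm_neg, norm_div,
      Complex.norm_I, Complex.norm_ofNat]
    linarith [norm_nonneg (fourierL b' ξ * star (fourierL a' ξ))]
  · filter_upwards [hre] with ξ hξ τ _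
    have h1 : HasDerivAt (fun τ : ℝ => freePhase τ ξ)
        (freePhase τ ξ * (Complex.I * ((-(1 / 2) * ξ ^ 2 : ℝ) : ℂ))) τ := by
      refine HasDerivAt.cexp (HasDerivAt.const_mul _ (HasDerivAt.ofReal_comp ?_))
      exact (((hasDerivAt_id τ).div_const 2).neg).mul_const (ξ ^ 2)
    have h2 := (h1.mul_const (fourierL b ξ)).mul_const (star (fourierL a ξ))
    refine h2.congr_deriv ?_
    push_cast
    linear_combination (Complex.I / 2 * freePhase τ ξ) * hξ

theorem hasDerivAt_inner_U_left {a a' b b' : L2} (ha : IsWeakDeriv a a') (hb : IsWeakDeriv b b')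
    (s : ℝ) : HasDerivAt (fun τ => inner ℂ (U τ b) a)
      (Complex.I / 2 * inner ℂ (U s b') a') s := by
  have h := (hasDerivAt_inner_U ha hb s).star
  simp only [RCLike.star_def, inner_conj_symm] at h
  refine h.congr_deriv ?_
  rw [map_mul, inner_conj_symm, map_neg, map_div₀, Complex.conj_I, map_ofNat]
  ring

theorem norm_U_sub_sq (τ : ℝ) (a : L2) :
    ‖U τ a - a‖ ^ 2 = 2 * ‖a‖ ^ 2 - 2 * (inner ℂ a (U τ a)).re := by
  have h := norm_sub_sq (𝕜 := ℂ) (U τ a) a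
  rw [norm_U, ← inner_conj_symm] at h
  have e : RCLike.re ((starRingEnd ℂ) (inner ℂ a (U τ a))) = (inner ℂ a (U τ a)).re :=
    Complex.conj_re _
  rw [e] at h
  rw [h]
  ring

theorem hasDerivAt_norm_U_sub_sq {a a' : L2} (ha : IsWeakDeriv a a') (s : ℝ) :
    HasDerivAt (fun τ => ‖U τ a - a‖ ^ 2) (-(inner ℂ a' (U s a')).im) s := by
  simp_rw [norm_U_sub_sq]
  have h1 := Complex.reCLM.hasFDerivAt.comp_hasDerivAt s (hasDerivAt_inner_U ha ha s)
  have h2 := (h1.const_mul 2).const_sub (2 * ‖a‖ ^ 2)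
  refine h2.congr_deriv ?_
  simp only [Complex.reCLM_apply, Complex.mul_re, Complex.neg_re, Complex.neg_im,
    Complex.div_ofNat_re, Complex.div_ofNat_im, Complex.I_re, Complex.I_im]
  ring

/-- For `a ∈ H¹`, `‖(U(τ) - 1)a‖² = o(τ)`. -/
theorem norm_U_sub_sq_isLittleO {a a' : L2} (ha : IsWeakDeriv a a') :
    HasDerivAt (fun τ => ‖U τ a - a‖ ^ 2) 0 0 := by
  refine (hasDerivAt_norm_U_sub_sq ha 0).congr_deriv ?_
  rw [U_zero, neg_eq_zero]
  exact inner_self_im (𝕜 := ℂ) a'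

theorem norm_U_sub_sq_le {a a' : L2} (ha : IsWeakDeriv a a') (τ : ℝ) :
    ‖U τ a - a‖ ^ 2 ≤ |τ| * ‖a'‖ ^ 2 := by
  have h := Convex.norm_image_sub_le_of_norm_hasDerivWithin_le (s := Set.univ)
    (f := fun τ => ‖U τ a - a‖ ^ 2) (C := ‖a'‖ ^ 2) (x := 0) (y := τ)
    (fun s _ => (hasDerivAt_norm_U_sub_sq ha s).hasDerivWithinAt) (fun s _ => ?_) convex_univ
    trivial trivial
  · simp only [U_zero, sub_self, norm_zero] at h
    rw [norm_eq_abs, norm_eq_abs] at h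
    have := (le_abs_self _).trans h
    rw [sub_zero] at this
    linarith
  · rw [norm_neg, norm_eq_abs]
    refine (Complex.abs_im_le_norm _).trans ((norm_inner_le_norm _ _).trans_eq ?_)
    rw [norm_U, sq]

/-- For `a ∈ H²`, `‖(U(τ) - 1)a‖ ≤ ½|τ| ‖a''‖`. -/
theorem norm_U_sub_le {a a' a'' : L2} (ha : IsWeakDeriv a a') (ha' : IsWeakDeriv a' a'') (τ : ℝ) :
    ‖U τ a - a‖ ≤ |τ| / 2 * ‖a''‖ := by
  rw [← fourierL.norm_map, ← fourierL.norm_map a'', map_sub, fourierL_U]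
  refine norm_le_mul_norm_of_ae ?_
  filter_upwards [isWeakDeriv_iff_fourier.1 ha, isWeakDeriv_iff_fourier.1 ha',
      Lp.coeFn_smul (-Complex.I) (fourierL a'), Lp.coeFn_smul (-Complex.I) (fourierL a''),
      coeFn_mulL2 (freePhase τ) (fourierL a),
      Lp.coeFn_sub (mulL2 (freePhase τ) (fourierL a)) (fourierL a)] with x h1 h2 h3 h4 h5 h6
  rw [h3, Pi.smul_apply, smul_eq_mul] at h1
  rw [h4, Pi.smul_apply, smul_eq_mul] at h2
  have n1 := congrArg norm h1
  have n2 := congrArg norm h2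
  rw [norm_mul, norm_mul, norm_neg, Complex.norm_I, one_mul, Complex.norm_real, norm_eq_abs]
    at n1 n2
  rw [h6, Pi.sub_apply, h5, n2, n1, ← sub_one_mul, norm_mul]
  have hp : ‖freePhase τ x - 1‖ ≤ |τ| / 2 * (|x| * |x|) := by
    have := Real.norm_exp_I_mul_ofReal_sub_one_le (x := -(τ / 2) * x ^ 2)
    refine this.trans_eq ?_
    rw [norm_eq_abs, abs_mul, abs_neg, abs_div, abs_pow, sq, abs_of_pos (two_pos : (0 : ℝ) < 2)]
  calc _ ≤ |τ| / 2 * (|x| * |x|) * ‖fourierL a x‖ := by gcongr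
    _ = _ := by ring

/-- Differentiation of `⟨U(τ)a, φU(τ)b⟩` for a multiplier `φ`. -/
theorem hasDerivAt_inner_U_mul_U {a a' b b' : L2} (ha : IsWeakDeriv a a') (hb : IsWeakDeriv b b')
    {φ φ' : ℝ →ᵇ ℂ} (hφ : HasAC φ φ') (s : ℝ) :
    HasDerivAt (fun τ => inner ℂ (U τ a) (mulL2 φ (U τ b)))
      (Complex.I / 2 * (inner ℂ (U s a') (mulL2 φ' (U s b)) -
        inner ℂ (U s a) (mulL2 φ' (U s b')))) s := by
  have hφs : HasAC (star φ : ℝ →ᵇ ℂ) (star φ' : ℝ →ᵇ ℂ) := hφ.conj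
  -- it suffices to treat `s = 0`
  suffices h0 : ∀ {a a' b b' : L2}, IsWeakDeriv a a' → IsWeakDeriv b b' →
      HasDerivAt (fun τ => inner ℂ (U τ a) (mulL2 φ (U τ b)))
      (Complex.I / 2 * (inner ℂ a' (mulL2 φ' b) - inner ℂ a (mulL2 φ' b'))) 0 by
    have h := h0 (ha.U s) (hb.U s)
    have h' : HasDerivAt (fun τ : ℝ => τ - s) 1 s := (hasDerivAt_id s).sub_const s
    rw [← sub_self s] at h
    have h2 := HasDerivAt.scomp (h := fun τ : ℝ => τ - s) s h h'
    simp only [one_smul] at h2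
    refine h2.congr_of_eventuallyEq (Eventually.of_forall fun τ => ?_)
    simp only [Function.comp, U_U, sub_add_cancel]
  intro a a' b b' ha hb
  have h1 := hasDerivAt_inner_U_left (hb.mulL2 hφ) ha 0
  have h2 := hasDerivAt_inner_U (ha.mulL2 hφs) hb 0
  -- the quadratic remainder
  have h3 : HasDerivAt (fun τ => inner ℂ (U τ a - a) (mulL2 φ (U τ b - b))) 0 0 := by
    have hq : HasDerivAt (fun τ => ‖φ‖ * (‖U τ a - a‖ ^ 2 + ‖U τ b - b‖ ^ 2))
        (‖φ‖ * (0 + 0)) 0 :=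
      ((norm_U_sub_sq_isLittleO ha).add (norm_U_sub_sq_isLittleO hb)).const_mul ‖φ‖
    rw [hasDerivAt_iff_isLittleO] at hq ⊢
    simp only [U_zero, sub_self, norm_zero, map_zero, inner_zero_right, sub_zero, smul_zero,
      add_zero, mul_zero, ne_eq, OfNat.ofNat_ne_zero, not_false_eq_true, zero_pow] at hq ⊢
    refine Asymptotics.IsBigO.trans_isLittleO (Asymptotics.IsBigO.of_bound 1
      (Eventually.of_forall fun τ => ?_)) hq
    rw [one_mul]
    refine le_trans ?_ (le_abs_self _)
    refine (norm_inner_le_norm _ _).trans ?_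
    have := norm_mulL2_le φ (U τ b - b)
    have hn := norm_nonneg (U τ a - a)
    calc ‖U τ a - a‖ * ‖mulL2 φ (U τ b - b)‖ ≤ ‖U τ a - a‖ * (‖φ‖ * ‖U τ b - b‖) := by gcongr
      _ = ‖φ‖ * (‖U τ a - a‖ * ‖U τ b - b‖) := by ring
      _ ≤ ‖φ‖ * (‖U τ a - a‖ ^ 2 + ‖U τ b - b‖ ^ 2) := by
        gcongr
        nlinarith [sq_nonneg (‖U τ a - a‖ - ‖U τ b - b‖), sq_nonneg (‖U τ a - a‖),
          sq_nonneg (‖U τ b - b‖)]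
  have h4 := ((h1.add h2).add h3).sub_const (inner ℂ a (mulL2 φ b))
  have e : ∀ f g : L2, inner ℂ (mulL2 (star φ) f) g = inner ℂ f (mulL2 φ g) := fun f g => by
    rw [inner_mulL2_left, star_star]
  have e' : ∀ f g : L2, inner ℂ (mulL2 (star φ') f) g = inner ℂ f (mulL2 φ' g) := fun f g => by
    rw [inner_mulL2_left, star_star]
  refine (h4.congr_deriv ?_).congr_of_eventuallyEq (Eventually.of_forall fun τ => ?_)
  · rw [U_zero, U_zero, inner_add_right, inner_add_left, e, e']
    ring
  · simp only [Pi.add_apply, e, map_sub, inner_sub_left, inner_sub_right]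
    ring

/-- The commutator of `U(s)` with a multiplier `φ`:
`‖U(-s)φU(s)k - φk‖ ≤ |s| (½‖φ''‖_∞ ‖k‖ + ‖φ'‖_∞ ‖k'‖)`. -/
theorem norm_commutator_le {φ φ' φ'' : ℝ →ᵇ ℂ} (hφ : HasAC φ φ') (hφ' : HasAC φ' φ'')
    {k k' : L2} (hk : IsWeakDeriv k k') (s : ℝ) :
    ‖U (-s) (mulL2 φ (U s k)) - mulL2 φ k‖ ≤ |s| * (1 / 2 * ‖φ''‖ * ‖k‖ + ‖φ'‖ * ‖k'‖) := by
  set C := 1 / 2 * ‖φ''‖ * ‖k‖ + ‖φ'‖ * ‖k'‖ with hC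
  -- test against the difference `Z` itself
  obtain ⟨Z', hZ⟩ : ∃ Z', IsWeakDeriv (U (-s) (mulL2 φ (U s k)) - mulL2 φ k) Z' :=
    ⟨_, (((hk.U s).mulL2 hφ).U (-s)).sub (hk.mulL2 hφ)⟩
  set Z := U (-s) (mulL2 φ (U s k)) - mulL2 φ k with hZdef
  have hder : ∀ τ, ‖Complex.I / 2 * (inner ℂ (U τ Z') (mulL2 φ' (U τ k)) -
        inner ℂ (U τ Z) (mulL2 φ' (U τ k')))‖ ≤ C * ‖Z‖ := by
    intro τ
    rw [inner_deriv_left (hZ.U τ) ((hk.U τ).mulL2 hφ'), inner_add_right]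
    have e : Complex.I / 2 * (-(inner ℂ (U τ Z) (mulL2 φ'' (U τ k)) +
        inner ℂ (U τ Z) (mulL2 φ' (U τ k'))) - inner ℂ (U τ Z) (mulL2 φ' (U τ k'))) =
        -(Complex.I / 2) * inner ℂ (U τ Z) (mulL2 φ'' (U τ k)) -
        Complex.I * inner ℂ (U τ Z) (mulL2 φ' (U τ k')) := by ring
    rw [e]
    refine (norm_sub_le _ _).trans ?_
    rw [norm_mul, norm_mul, norm_neg, norm_div, Complex.norm_I, Complex.norm_ofNat, one_mul]
    have i1 := (norm_inner_le_norm (𝕜 := ℂ) (U τ Z) (mulL2 φ'' (U τ k))).trans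
      (mul_le_mul_of_nonneg_left (norm_mulL2_le _ _) (norm_nonneg _))
    have i2 := (norm_inner_le_norm (𝕜 := ℂ) (U τ Z) (mulL2 φ' (U τ k'))).trans
      (mul_le_mul_of_nonneg_left (norm_mulL2_le _ _) (norm_nonneg _))
    rw [norm_U, norm_U] at i1 i2
    rw [hC]
    nlinarith
  have h := Convex.norm_image_sub_le_of_norm_hasDerivWithin_le (s := Set.univ) (x := 0) (y := s)
    (fun τ _ => (hasDerivAt_inner_U_mul_U hZ hk hφ τ).hasDerivWithinAt) (fun τ _ => hder τ)
    convex_univ trivial trivial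
  have e : inner ℂ (U s Z) (mulL2 φ (U s k)) - inner ℂ (U 0 Z) (mulL2 φ (U 0 k)) =
      inner ℂ Z Z := by
    rw [U_zero, U_zero, inner_U_left, ← inner_sub_right]
  rw [e, inner_self_eq_norm_sq_to_K, norm_pow, RCLike.norm_ofReal, abs_norm, sub_zero,
    norm_eq_abs] at h
  rcases (norm_nonneg Z).eq_or_lt with h0 | h0
  · rw [← h0]; positivity
  · refine le_of_mul_le_mul_right ?_ h0
    nlinarith

/-! ### Global solutions of ordinary differential equations with an a priori bound -/

section ODE

variable {E : Type*} [NormedAddCommGroup E] [NormedSpace ℝ E]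

/-- The radial retraction onto the ball of radius `R`. -/
def radial (R : ℝ) (x : E) : E := (R / max R ‖x‖) • x

theorem radial_of_norm_le {R : ℝ} (hR : 0 < R) {x : E} (hx : ‖x‖ ≤ R) : radial R x = x := by
  rw [radial, max_eq_left hx, div_self hR.ne', one_smul]

theorem norm_radial_le {R : ℝ} (hR : 0 < R) (x : E) : ‖radial R x‖ ≤ R := by
  have hm : 0 < max R ‖x‖ := lt_max_of_lt_left hR
  rw [radial, norm_smul, norm_eq_abs, abs_of_nonneg (by positivity), div_mul_eq_mul_div,
    div_le_iff₀ hm]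
  exact mul_le_mul_of_nonneg_left (le_max_right _ _) hR.le

theorem norm_radial_sub_le {R : ℝ} (hR : 0 < R) (x y : E) :
    ‖radial R x - radial R y‖ ≤ 2 * ‖x - y‖ := by
  have hx : 0 < max R ‖x‖ := lt_max_of_lt_left hR
  have hy : 0 < max R ‖y‖ := lt_max_of_lt_left hR
  have e : radial R x - radial R y =
      (R / max R ‖x‖) • (x - y) + (R / max R ‖x‖ - R / max R ‖y‖) • y := by
    simp only [radial, smul_sub, sub_smul]; abel
  have h1 : R / max R ‖x‖ ≤ 1 := (div_le_one hx).2 (le_max_left _ _)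
  have h2 : |R / max R ‖x‖ - R / max R ‖y‖| * ‖y‖ ≤ ‖x - y‖ := by
    have e2 : R / max R ‖x‖ - R / max R ‖y‖ =
        (R / max R ‖x‖) * ((max R ‖y‖ - max R ‖x‖) / max R ‖y‖) := by
      field_simp
    rw [e2, abs_mul, abs_of_nonneg (by positivity : 0 ≤ R / max R ‖x‖), abs_div, abs_of_pos hy]
    have h3 : |max R ‖y‖ - max R ‖x‖| ≤ ‖x - y‖ := by
      rw [max_comm R, max_comm R]
      refine (abs_max_sub_max_le_abs _ _ _).trans ?_
      rw [norm_sub_rev]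
      exact abs_norm_sub_norm_le y x
    have h4 : |max R ‖y‖ - max R ‖x‖| / max R ‖y‖ * ‖y‖ ≤ |max R ‖y‖ - max R ‖x‖| := by
      rw [div_mul_eq_mul_div, div_le_iff₀ hy]
      exact mul_le_mul_of_nonneg_left (le_max_right _ _) (abs_nonneg _)
    have h5 : 0 ≤ |max R ‖y‖ - max R ‖x‖| / max R ‖y‖ * ‖y‖ := by positivity
    calc _ = R / max R ‖x‖ * (|max R ‖y‖ - max R ‖x‖| / max R ‖y‖ * ‖y‖) := by ring
      _ ≤ 1 * (|max R ‖y‖ - max R ‖x‖| / max R ‖y‖ * ‖y‖) := by gcongr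
      _ ≤ ‖x - y‖ := by linarith
  rw [e]
  refine (norm_add_le _ _).trans ?_
  rw [norm_smul, norm_smul, norm_eq_abs, norm_eq_abs,
    abs_of_nonneg (by positivity : 0 ≤ R / max R ‖x‖)]
  nlinarith [norm_nonneg (x - y), mul_le_mul_of_nonneg_right h1 (norm_nonneg (x - y))]

/-- Uniqueness for a locally Lipschitz differential equation. -/
theorem ode_unique {v : ℝ → E → E}
    (hlip : ∀ T R : ℝ, ∃ K : NNReal, ∀ t, |t| ≤ T → LipschitzOnWith K (v t) (Metric.closedBall 0 R))
    {a b t₀ : ℝ} (ht₀ : t₀ ∈ Set.Ioo a b) {f g : ℝ → E}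
    (hf : ∀ t ∈ Set.Ioo a b, HasDerivAt f (v t (f t)) t)
    (hg : ∀ t ∈ Set.Ioo a b, HasDerivAt g (v t (g t)) t) (h0 : f t₀ = g t₀) :
    Set.EqOn f g (Set.Ioo a b) := by
  intro t ht
  obtain ⟨α, hα1, hα2⟩ := exists_between (lt_min ht₀.1 ht.1)
  obtain ⟨β, hβ1, hβ2⟩ := exists_between (max_lt ht₀.2 ht.2)
  have hsub : Set.Icc α β ⊆ Set.Ioo a b := fun s hs => ⟨hα1.trans_le hs.1, hs.2.trans_lt hβ2⟩
  have hfc : ContinuousOn f (Set.Icc α β) := fun s hs =>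
    (hf s (hsub hs)).continuousAt.continuousWithinAt
  have hgc : ContinuousOn g (Set.Icc α β) := fun s hs =>
    (hg s (hsub hs)).continuousAt.continuousWithinAt
  obtain ⟨R₁, hR₁⟩ := isCompact_Icc.exists_bound_of_continuousOn hfc
  obtain ⟨R₂, hR₂⟩ := isCompact_Icc.exists_bound_of_continuousOn hgc
  obtain ⟨K, hK⟩ := hlip (max |α| |β|) (max R₁ R₂)
  refine ODE_solution_unique_of_mem_Ioo (K := K) (v := v)
    (s := fun _ => Metric.closedBall 0 (max R₁ R₂)) (a := α) (b := β) (t₀ := t₀)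
    (fun s hs => hK s ?_) ⟨hα2.trans_le (min_le_left _ _), (le_max_left _ _).trans_lt hβ1⟩
    (fun s hs => ⟨hf s (hsub (Set.Ioo_subset_Icc_self hs)), ?_⟩)
    (fun s hs => ⟨hg s (hsub (Set.Ioo_subset_Icc_self hs)), ?_⟩) h0
    ⟨hα2.trans_le (min_le_right _ _), (le_max_right _ _).trans_lt hβ1⟩
  · exact abs_le_max_abs_abs hs.1.le hs.2.le
  · rw [mem_closedBall_zero_iff]
    exact (hR₁ s (Set.Ioo_subset_Icc_self hs)).trans (le_max_left _ _)
  · rw [mem_closedBall_zero_iff]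
    exact (hR₂ s (Set.Ioo_subset_Icc_self hs)).trans (le_max_right _ _)

/-- An a priori bound gives solutions on bounded intervals: the equation is solved with the
vector field cut off outside a large ball, and the bound shows that the cutoff is never felt. -/
theorem ode_exists_Ioo [CompleteSpace E] {v : ℝ → E → E}
    (hlip : ∀ T R : ℝ, ∃ K : NNReal, ∀ t, |t| ≤ T → LipschitzOnWith K (v t) (Metric.closedBall 0 R))
    (hcont : ∀ x, Continuous fun t => v t x) {t₀ T R : ℝ} (hT : 0 < T) {x₀ : E}
    (hx₀ : ‖x₀‖ ≤ R)
    (hap : ∀ f : ℝ → E, f t₀ = x₀ → ∀ r, 0 < r → r ≤ T →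
      (∀ t ∈ Set.Ioo (t₀ - r) (t₀ + r), HasDerivAt f (v t (f t)) t) →
      ∀ t ∈ Set.Ioo (t₀ - r) (t₀ + r), ‖f t‖ ≤ R) :
    ∃ f : ℝ → E, f t₀ = x₀ ∧ ∀ t ∈ Set.Ioo (t₀ - T) (t₀ + T), HasDerivAt f (v t (f t)) t := by
  have hR : 0 ≤ R := (norm_nonneg _).trans hx₀
  have hR1 : 0 < R + 1 := by linarith
  obtain ⟨K, hK⟩ := hlip (|t₀| + T) (R + 1)
  have habs : ∀ t ∈ Set.Icc (t₀ - T) (t₀ + T), |t| ≤ |t₀| + T := fun t ht => by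
    have : |t - t₀| ≤ T := abs_le.2 ⟨by linarith [ht.1], by linarith [ht.2]⟩
    calc |t| = |t₀ + (t - t₀)| := by ring_nf
      _ ≤ |t₀| + |t - t₀| := abs_add_le _ _
      _ ≤ _ := by linarith
  obtain ⟨B, hB⟩ := isCompact_Icc.exists_bound_of_continuousOn
    (hcont 0).continuousOn (s := Set.Icc (t₀ - T) (t₀ + T))
  have hB0 : 0 ≤ B := (norm_nonneg _).trans (hB t₀ ⟨by linarith, by linarith⟩)
  have hmem : ∀ x : E, radial (R + 1) x ∈ Metric.closedBall (0 : E) (R + 1) := fun x => by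
    rw [mem_closedBall_zero_iff]; exact norm_radial_le hR1 x
  set L : NNReal := ⟨B + K * (R + 1), by positivity⟩ with hL
  have hbd : ∀ t ∈ Set.Icc (t₀ - T) (t₀ + T), ∀ x, ‖v t (radial (R + 1) x)‖ ≤ L := by
    intro t ht x
    have h1 := (hK t (habs t ht)).norm_sub_le (hmem x)
      (by simp [hR1.le] : (0 : E) ∈ Metric.closedBall (0 : E) (R + 1))
    rw [sub_zero] at h1
    have h2 : (K : ℝ) * ‖radial (R + 1) x‖ ≤ K * (R + 1) := by
      gcongr; exact norm_radial_le hR1 x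
    have h3 := norm_le_norm_add_norm_sub' (v t (radial (R + 1) x)) (v t 0)
    change _ ≤ B + K * (R + 1)
    linarith [hB t ht]
  have hPL : IsPicardLindelof (fun t x => v t (radial (R + 1) x))
      (⟨t₀, by linarith, by linarith⟩ : Set.Icc (t₀ - T) (t₀ + T)) x₀
      (L * ⟨T, hT.le⟩) 0 L (K * 2) := by
    refine ⟨fun t ht => ?_, fun x _ => (hcont _).continuousOn, fun t ht x _ => hbd t ht x, ?_⟩
    · refine LipschitzOnWith.of_dist_le_mul fun x _ y _ => ?_
      rw [dist_eq_norm, dist_eq_norm]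
      refine ((hK t (habs t ht)).norm_sub_le (hmem x) (hmem y)).trans ?_
      push_cast
      rw [mul_assoc]
      gcongr
      exact norm_radial_sub_le hR1 x y
    · have e1 : t₀ + T - t₀ = T := by ring
      have e2 : t₀ - (t₀ - T) = T := by ring
      simp only [e1, e2, max_self, NNReal.coe_zero, sub_zero]
      exact le_refl _
  obtain ⟨f, hf0, hf⟩ := hPL.exists_eq_forall_mem_Icc_hasDerivWithinAt₀
  change f t₀ = x₀ at hf0
  have hfd : ∀ t ∈ Set.Ioo (t₀ - T) (t₀ + T), HasDerivAt f (v t (radial (R + 1) (f t))) t :=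
    fun t ht => (hf t (Set.Ioo_subset_Icc_self ht)).hasDerivAt (Icc_mem_nhds ht.1 ht.2)
  have hfc : ContinuousOn f (Set.Icc (t₀ - T) (t₀ + T)) := fun t ht =>
    (hf t ht).continuousWithinAt
  have main : ∀ r ∈ Set.Icc 0 T, ∀ y ∈ Set.Icc (-T) T, ‖f (t₀ + max (-r) (min y r))‖ ≤ R := by
    refine IsClosed.Icc_subset_of_forall_mem_nhdsWithin (s := {r | ∀ y ∈ Set.Icc (-T) T,
      ‖f (t₀ + max (-r) (min y r))‖ ≤ R}) ?_ ?_ ?_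
    · have : {r | ∀ y ∈ Set.Icc (-T) T, ‖f (t₀ + max (-r) (min y r))‖ ≤ R} ∩ Set.Icc 0 T =
          ⋂ y : Set.Icc (-T) T, (Set.Icc 0 T ∩
            (fun r => ‖f (t₀ + max (-r) (min (y : ℝ) r))‖) ⁻¹' Set.Iic R) := by
        have : Nonempty (Set.Icc (-T) T) := ⟨⟨0, by linarith, hT.le⟩⟩
        ext r
        simp only [Set.mem_inter_iff, Set.mem_ofPred_eq, Set.mem_iInter, Set.mem_preimage,
          Set.mem_Iic, Subtype.forall]
        exact ⟨fun h y hy => ⟨h.2, h.1 y hy⟩, fun h => ⟨fun y hy => (h y hy).2,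
          (h 0 ⟨by linarith, hT.le⟩).1⟩⟩
      rw [this]
      refine isClosed_iInter fun y => ?_
      refine ContinuousOn.preimage_isClosed_of_isClosed ?_ isClosed_Icc isClosed_Iic
      refine (hfc.comp (by fun_prop) fun r hr => ?_).norm
      have h1 : -T ≤ max (-r) (min (y : ℝ) r) := le_max_of_le_left (by linarith [hr.2])
      have h2 : max (-r) (min (y : ℝ) r) ≤ T :=
        max_le (by linarith [hr.1]) ((min_le_right _ _).trans hr.2)
      exact ⟨by linarith, by linarith⟩
    · intro y hy
      have : max (-0) (min y 0) = 0 := by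
        rw [neg_zero]; exact max_eq_left (min_le_right _ _)
      rw [this, add_zero, hf0]
      exact hx₀
    · rintro r ⟨hr, hr0, hrT⟩
      have hin : ∀ τ, |τ - t₀| ≤ r → ‖f τ‖ ≤ R := fun τ hτ => by
        rw [abs_le] at hτ
        have h1 := hr (τ - t₀) ⟨by linarith, by linarith⟩
        rwa [min_eq_left hτ.2, max_eq_right hτ.1, add_sub_cancel] at h1
      have hnear : ∀ τ₀, |τ₀ - t₀| = r → ∀ᶠ τ in 𝓝 τ₀, ‖f τ‖ < R + 1 := fun τ₀ hτ₀ => by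
        have hm : τ₀ ∈ Set.Ioo (t₀ - T) (t₀ + T) := by
          have := abs_le.1 hτ₀.le
          exact ⟨by linarith, by linarith⟩
        have hc : ContinuousAt (fun τ => ‖f τ‖) τ₀ := (hfd τ₀ hm).continuousAt.norm
        exact hc.eventually_lt_const (by linarith [hin τ₀ hτ₀.le])
      obtain ⟨δ₁, hδ₁, h1⟩ := Metric.eventually_nhds_iff.1 (hnear (t₀ + r) (by
        rw [add_sub_cancel_left, abs_of_nonneg hr0]))
      obtain ⟨δ₂, hδ₂, h2⟩ := Metric.eventually_nhds_iff.1 (hnear (t₀ - r) (by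
        rw [sub_sub_cancel_left, abs_neg, abs_of_nonneg hr0]))
      set δ := min (min δ₁ δ₂) (T - r) with hδ
      have hδ0 : 0 < δ := lt_min (lt_min hδ₁ hδ₂) (by linarith)
      have hδ1 : δ ≤ δ₁ := (min_le_left _ _).trans (min_le_left _ _)
      have hδ2 : δ ≤ δ₂ := (min_le_left _ _).trans (min_le_right _ _)
      have hδ3 : δ ≤ T - r := min_le_right _ _
      have hlt : ∀ τ ∈ Set.Ioo (t₀ - (r + δ)) (t₀ + (r + δ)), ‖f τ‖ ≤ R + 1 := by
        intro τ hτ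
        rcases lt_or_ge (t₀ + r) τ with h | h
        · refine (h1 ?_).le
          rw [Real.dist_eq, abs_of_pos (by linarith)]
          linarith [hτ.2]
        rcases lt_or_ge τ (t₀ - r) with h' | h'
        · refine (h2 ?_).le
          rw [Real.dist_eq, abs_of_neg (by linarith)]
          linarith [hτ.1]
        · have := hin τ (abs_le.2 ⟨by linarith, by linarith⟩)
          linarith
      have hbound := hap f hf0 (r + δ) (by linarith) (by linarith) fun t ht => by
        have h3 := hfd t ⟨by linarith [ht.1], by linarith [ht.2]⟩
        rwa [radial_of_norm_le hR1 (hlt t ht)] at h3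
      filter_upwards [Ioo_mem_nhdsGT (by linarith : r < r + δ)] with ρ hρ y _
      have h4 : -ρ ≤ max (-ρ) (min y ρ) := le_max_left _ _
      have h5 : max (-ρ) (min y ρ) ≤ ρ := max_le (by linarith [hρ.1]) (min_le_right _ _)
      exact hbound _ ⟨by linarith [hρ.2], by linarith [hρ.2]⟩
  refine ⟨f, hf0, fun t ht => ?_⟩
  have h1 := main T ⟨hT.le, le_refl _⟩ (t - t₀) ⟨by linarith [ht.1], by linarith [ht.2]⟩
  rw [min_eq_left (by linarith [ht.2]), max_eq_right (by linarith [ht.1]), add_sub_cancel] at h1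
  have h2 := hfd t ht
  rwa [radial_of_norm_le hR1 (by linarith)] at h2

/-- An a priori bound on bounded time intervals gives global solutions. -/
theorem ode_exists_global [CompleteSpace E] {v : ℝ → E → E}
    (hlip : ∀ T R : ℝ, ∃ K : NNReal, ∀ t, |t| ≤ T → LipschitzOnWith K (v t) (Metric.closedBall 0 R))
    (hcont : ∀ x, Continuous fun t => v t x) {t₀ : ℝ} {x₀ : E}
    (hap : ∀ T, 0 < T → ∃ R, ‖x₀‖ ≤ R ∧ ∀ f : ℝ → E, f t₀ = x₀ → ∀ r, 0 < r → r ≤ T →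
      (∀ t ∈ Set.Ioo (t₀ - r) (t₀ + r), HasDerivAt f (v t (f t)) t) →
      ∀ t ∈ Set.Ioo (t₀ - r) (t₀ + r), ‖f t‖ ≤ R) :
    ∃ f : ℝ → E, f t₀ = x₀ ∧ ∀ t, HasDerivAt f (v t (f t)) t := by
  have hex : ∀ n : ℕ, ∃ f : ℝ → E, f t₀ = x₀ ∧
      ∀ t ∈ Set.Ioo (t₀ - (n + 1)) (t₀ + (n + 1)), HasDerivAt f (v t (f t)) t := fun n => by
    obtain ⟨R, hR, h⟩ := hap (n + 1) (by positivity)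
    exact ode_exists_Ioo hlip hcont (by positivity) hR h
  choose f hf0 hf using hex
  have huniq : ∀ m n : ℕ, m ≤ n → Set.EqOn (f m) (f n) (Set.Ioo (t₀ - (m + 1)) (t₀ + (m + 1))) := by
    intro m n hmn
    have hmn' : (m : ℝ) ≤ n := by exact_mod_cast hmn
    have hm0 : (0 : ℝ) ≤ m := by positivity
    refine ode_unique hlip (t₀ := t₀) ⟨by linarith, by linarith⟩ (hf m) (fun t ht => hf n t ?_)
      ((hf0 m).trans (hf0 n).symm)
    exact ⟨by linarith [ht.1], by linarith [ht.2]⟩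
  set F : ℝ → E := fun t => f ⌈|t - t₀|⌉₊ t with hF
  have hFf : ∀ (N : ℕ) t, |t - t₀| ≤ N → F t = f N t := fun N t ht => by
    refine huniq _ N (Nat.ceil_le.2 ht) ?_
    have h1 := abs_le.1 (Nat.le_ceil |t - t₀|)
    exact ⟨by linarith, by linarith⟩
  refine ⟨F, ?_, fun t => ?_⟩
  · rw [hFf 0 t₀ (by simp), hf0]
  · have hN : |t - t₀| < (⌈|t - t₀|⌉₊ + 1 : ℕ) := by
      push_cast
      exact (Nat.le_ceil _).trans_lt (lt_add_one _)
    set N := ⌈|t - t₀|⌉₊ + 1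
    have h1 := abs_lt.1 hN
    have h2 := hf N t ⟨by linarith, by linarith⟩
    rw [← hFf N t hN.le] at h2
    refine h2.congr_of_eventuallyEq ?_
    have hc : Continuous fun s => |s - t₀| := by fun_prop
    filter_upwards [hc.continuousAt.eventually_lt_const hN] with s hs
    exact hFf N s hs.le

end ODE

/-! ### Conservation laws and global solutions -/

/-- The vector field `-iλ U(-t)(|U(t)f|²U(t)f)` of the equation in the interaction picture. -/
def vf (lam t : ℝ) (f : Sig) : Sig := (-(Complex.I * lam)) • NS t f

theorem hasDerivAt_vS {f : ℝ → Sig} {f' : Sig} {t : ℝ} (h : HasDerivAt f f' t) :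
    HasDerivAt (fun τ => vS (f τ)) (vS f') t :=
  (vS.restrictScalars ℝ).hasFDerivAt.comp_hasDerivAt t h

theorem hasDerivAt_dS {f : ℝ → Sig} {f' : Sig} {t : ℝ} (h : HasDerivAt f f' t) :
    HasDerivAt (fun τ => dS (f τ)) (dS f') t :=
  (dS.restrictScalars ℝ).hasFDerivAt.comp_hasDerivAt t h

theorem hasDerivAt_xS {f : ℝ → Sig} {f' : Sig} {t : ℝ} (h : HasDerivAt f f' t) :
    HasDerivAt (fun τ => xS (f τ)) (xS f') t :=
  (xS.restrictScalars ℝ).hasFDerivAt.comp_hasDerivAt t h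

theorem hasDerivAt_normSq {y : ℝ → L2} {y' : L2} {t : ℝ} (h : HasDerivAt y y' t) :
    HasDerivAt (fun τ => ‖y τ‖ ^ 2) (2 * (inner ℂ (y t) y').re) t := by
  have h1 := Complex.reCLM.hasFDerivAt.comp_hasDerivAt t (h.inner ℂ h)
  have e : (fun τ => ‖y τ‖ ^ 2) = Complex.reCLM ∘ fun τ => inner ℂ (y τ) (y τ) := by
    funext τ
    exact (inner_self_eq_norm_sq (𝕜 := ℂ) (y τ)).symm
  rw [e]
  refine h1.congr_deriv ?_
  rw [Complex.reCLM_apply, Complex.add_re, ← inner_conj_symm y', Complex.conj_re]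
  ring

/-- If `|Re⟨y, y'⟩| ≤ M‖y‖`, then `‖y‖` is Lipschitz with constant `M`. -/
theorem norm_le_of_inner_deriv_le {I : Set ℝ} (hI : Convex ℝ I) {y y' : ℝ → L2} {M : ℝ}
    (hM : 0 ≤ M) (h : ∀ t ∈ I, HasDerivAt y (y' t) t)
    (hb : ∀ t ∈ I, |(inner ℂ (y t) (y' t)).re| ≤ M * ‖y t‖) {s t : ℝ} (hs : s ∈ I) (ht : t ∈ I) :
    ‖y t‖ ≤ ‖y s‖ + M * |t - s| := by
  refine le_of_forall_pos_le_add fun ε hε => ?_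
  -- the norm is regularized, as it is not differentiable at `0`
  have hpos : ∀ τ, 0 < ε ^ 2 + ‖y τ‖ ^ 2 := fun τ => by positivity
  have hder : ∀ τ ∈ I, HasDerivWithinAt (fun τ => √(ε ^ 2 + ‖y τ‖ ^ 2))
      (2 * (inner ℂ (y τ) (y' τ)).re / (2 * √(ε ^ 2 + ‖y τ‖ ^ 2))) I τ := fun τ hτ =>
    (((hasDerivAt_normSq (h τ hτ)).const_add (ε ^ 2)).sqrt (hpos τ).ne').hasDerivWithinAt
  have hle : ∀ τ, ‖y τ‖ ≤ √(ε ^ 2 + ‖y τ‖ ^ 2) := fun τ =>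
    Real.le_sqrt_of_sq_le (by nlinarith)
  have h1 := hI.norm_image_sub_le_of_norm_hasDerivWithin_le (C := M) hder (fun τ hτ => ?_) hs ht
  · rw [norm_eq_abs, norm_eq_abs] at h1
    have h2 := (le_abs_self _).trans h1
    have h3 : √(ε ^ 2 + ‖y s‖ ^ 2) ≤ ε + ‖y s‖ := by
      rw [Real.sqrt_le_left (by positivity)]
      nlinarith [norm_nonneg (y s)]
    linarith [hle t]
  · have hs0 : 0 < √(ε ^ 2 + ‖y τ‖ ^ 2) := Real.sqrt_pos.2 (hpos τ)
    rw [norm_eq_abs, mul_div_mul_left _ _ two_ne_zero, abs_div, abs_of_pos hs0, div_le_iff₀ hs0]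
    exact (hb τ hτ).trans (mul_le_mul_of_nonneg_left (hle τ) hM)

/-- `∫ |u|⁴`. -/
def quartic (u : Sig) : ℝ := ∫ x, ‖vS u x‖ ^ 4

theorem integrable_quartic (u : Sig) : Integrable fun x => ‖vS u x‖ ^ 4 := by
  refine ((integrable_norm_sq (vS u)).const_mul (‖ι u‖ ^ 2)).mono
    ((Lp.aestronglyMeasurable (vS u)).norm.pow 4) ?_
  filter_upwards [ae_norm_le_ι u] with x hx
  rw [norm_eq_abs, norm_eq_abs, abs_of_nonneg (by positivity), abs_of_nonneg (by positivity)]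
  calc ‖vS u x‖ ^ 4 = ‖vS u x‖ ^ 2 * ‖vS u x‖ ^ 2 := by ring
    _ ≤ _ := by gcongr

theorem quartic_nonneg (u : Sig) : 0 ≤ quartic u := integral_nonneg fun _ => by positivity

theorem quartic_le (u : Sig) : quartic u ≤ 2 * ‖vS u‖ ^ 3 * ‖dS u‖ := by
  have h1 : quartic u ≤ ‖ι u‖ ^ 2 * ‖vS u‖ ^ 2 := by
    rw [norm_sq_eq_integral, ← integral_const_mul]
    refine integral_mono_ae (integrable_quartic u) ((integrable_norm_sq (vS u)).const_mul _) ?_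
    filter_upwards [ae_norm_le_ι u] with x hx
    calc ‖vS u x‖ ^ 4 = ‖vS u x‖ ^ 2 * ‖vS u x‖ ^ 2 := by ring
      _ ≤ _ := by gcongr
  calc quartic u ≤ ‖ι u‖ ^ 2 * ‖vS u‖ ^ 2 := h1
    _ ≤ (2 * ‖vS u‖ * ‖dS u‖) * ‖vS u‖ ^ 2 := by gcongr; exact norm_ι_sq_le u
    _ = _ := by ring

theorem abs_quartic_pointwise (a b : ℂ) :
    |‖b‖ ^ 4 - ‖a‖ ^ 4 - 4 * ((b - a) * star (((‖a‖ ^ 2 : ℝ) : ℂ) * a)).re| ≤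
      3 * (‖a‖ + ‖b‖) ^ 2 * ‖b - a‖ ^ 2 := by
  have hre : ((b - a) * star (((‖a‖ ^ 2 : ℝ) : ℂ) * a)).re =
      ‖a‖ ^ 2 * ((b - a) * star a).re := by
    rw [star_mul', RCLike.star_def, Complex.conj_ofReal, mul_left_comm, Complex.re_ofReal_mul]
  have hb : ‖b‖ ^ 2 = ‖a‖ ^ 2 + 2 * ((b - a) * star a).re + ‖b - a‖ ^ 2 := by
    rw [← Complex.normSq_eq_norm_sq, ← Complex.normSq_eq_norm_sq, ← Complex.normSq_eq_norm_sq,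
      RCLike.star_def]
    simp only [Complex.normSq_apply, Complex.mul_re, Complex.sub_re, Complex.sub_im,
      Complex.conj_re, Complex.conj_im]
    ring
  have e : ‖b‖ ^ 4 - ‖a‖ ^ 4 - 4 * (‖a‖ ^ 2 * ((b - a) * star a).re) =
      2 * ‖a‖ ^ 2 * ‖b - a‖ ^ 2 + ((‖b‖ - ‖a‖) * (‖b‖ + ‖a‖)) ^ 2 := by
    have e1 : ((b - a) * star a).re = (‖b‖ ^ 2 - ‖a‖ ^ 2 - ‖b - a‖ ^ 2) / 2 := by linarith
    rw [e1]; ring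
  rw [hre, e, abs_of_nonneg (by positivity), mul_pow]
  have h1 : (‖b‖ - ‖a‖) ^ 2 ≤ ‖b - a‖ ^ 2 := by
    rw [← sq_abs]
    gcongr
    exact abs_norm_sub_norm_le b a
  have h2 : ‖a‖ ^ 2 ≤ (‖a‖ + ‖b‖) ^ 2 := by
    gcongr
    linarith [norm_nonneg b]
  nlinarith [mul_le_mul_of_nonneg_right h1 (sq_nonneg (‖b‖ + ‖a‖)),
    mul_le_mul_of_nonneg_right h2 (sq_nonneg ‖b - a‖)]

theorem abs_quartic_sub_le (u w : Sig) :
    |quartic w - quartic u - 4 * (inner ℂ (vS (cubS u)) (vS w - vS u)).re| ≤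
      3 * (‖ι u‖ + ‖ι w‖) ^ 2 * ‖vS w - vS u‖ ^ 2 := by
  have hi := integrable_inner_L2 (vS (cubS u)) (vS w - vS u)
  have e : quartic w - quartic u - 4 * (inner ℂ (vS (cubS u)) (vS w - vS u)).re =
      ∫ x, (‖vS w x‖ ^ 4 - ‖vS u x‖ ^ 4 -
        4 * ((vS w - vS u : L2) x * star (vS (cubS u) x)).re) := by
    have hA : Integrable fun x => ‖vS w x‖ ^ 4 - ‖vS u x‖ ^ 4 :=
      (integrable_quartic w).sub (integrable_quartic u)
    have hB : Integrable fun x => 4 * ((vS w - vS u : L2) x * star (vS (cubS u) x)).re :=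
      hi.re.const_mul 4
    rw [integral_sub hA hB, integral_sub (integrable_quartic w) (integrable_quartic u),
      integral_const_mul, inner_L2_eq]
    congr 2
    exact (Complex.reCLM.integral_comp_comm hi).symm
  rw [e, norm_sq_eq_integral (vS w - vS u), ← integral_const_mul, ← norm_eq_abs]
  refine norm_integral_le_of_norm_le ((integrable_norm_sq (vS w - vS u)).const_mul _) ?_
  filter_upwards [Lp.coeFn_sub (vS w) (vS u), vS_cubS_ae u, ae_norm_le_ι u, ae_norm_le_ι w]
    with x h1 h2 h3 h4
  rw [h1, Pi.sub_apply, h2, norm_eq_abs]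
  refine (abs_quartic_pointwise _ _).trans ?_
  gcongr

theorem norm_sub_sq_hasDerivAt {y : ℝ → L2} {y' : L2} {t : ℝ} (h : HasDerivAt y y' t) :
    HasDerivAt (fun τ => ‖y τ - y t‖ ^ 2) 0 t := by
  refine (hasDerivAt_normSq (h.sub_const (y t))).congr_deriv ?_
  rw [sub_self, inner_zero_left]
  simp

/-- For `c ∈ H¹` and a differentiable curve `f` in `Σ`, the derivative of `⟨c, U(t)f(t)⟩`. -/
theorem hasDerivAt_inner_US {f : ℝ → Sig} {f' : Sig} {t : ℝ} (h : HasDerivAt f f' t) {c c' : L2}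
    (hc : IsWeakDeriv c c') :
    HasDerivAt (fun τ => inner ℂ c (vS (US τ (f τ))))
      (-(Complex.I / 2) * inner ℂ c' (dS (US t (f t))) + inner ℂ c (vS (US t f'))) t := by
  have h1 := hasDerivAt_inner_U hc (isWeakDeriv_S (f t)) t
  have h2 : HasDerivAt (fun τ => inner ℂ (U (-τ) c) (vS (f τ) - vS (f t)))
      (inner ℂ (U (-t) c) (vS f')) t := by
    rw [hasDerivAt_iff_tendsto_slope]
    have hs := (hasDerivAt_vS h).tendsto_slope
    have hU : Tendsto (fun τ => U (-τ) c) (𝓝[≠] t) (𝓝 (U (-t) c)) :=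
      (((continuous_U c).comp continuous_neg).tendsto t).mono_left nhdsWithin_le_nhds
    refine (hU.inner (𝕜 := ℂ) hs).congr fun τ => ?_
    rw [slope_def_module, slope_def_module, sub_self, inner_zero_right, sub_zero,
      inner_smul_right_eq_smul]
  refine ((h1.add h2).congr_deriv ?_).congr_of_eventuallyEq (Eventually.of_forall fun τ => ?_)
  · rw [inner_U_left, neg_neg, dS_US, vS_US]
  · simp only [Pi.add_apply]
    rw [inner_U_left, neg_neg, ← inner_add_right, U_sub, add_sub_cancel, vS_US]

theorem continuousAt_US {f : ℝ → Sig} {t : ℝ} (h : ContinuousAt f t) :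
    ContinuousAt (fun τ => US τ (f τ)) t :=
  ContinuousAt.comp (g := fun p : ℝ × Sig => US p.1 p.2) (f := fun τ => (τ, f τ))
    continuous_US_uncurry.continuousAt (continuousAt_id.prodMk h)

/-- The derivative of the potential energy `∫ |U(t)f(t)|⁴` along a differentiable curve in `Σ`. -/
theorem hasDerivAt_quartic {f : ℝ → Sig} {f' : Sig} {t : ℝ} (h : HasDerivAt f f' t) :
    HasDerivAt (fun τ => quartic (US τ (f τ)))
      (4 * (-(Complex.I / 2) * inner ℂ (dS (cubS (US t (f t)))) (dS (US t (f t))) +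
        inner ℂ (vS (cubS (US t (f t)))) (vS (US t f'))).re) t := by
  set u := US t (f t) with hu
  have h1 := (Complex.reCLM.hasFDerivAt.comp_hasDerivAt t
    (hasDerivAt_inner_US h (isWeakDeriv_S (cubS u)))).const_mul 4
  -- the quadratic remainder
  have h2 : HasDerivAt (fun τ => quartic (US τ (f τ)) - quartic u -
      4 * (inner ℂ (vS (cubS u)) (vS (US τ (f τ)) - vS u)).re) 0 t := by
    have hq : HasDerivAt (fun τ => 2 * (‖U (τ - t) (vS u) - vS u‖ ^ 2 +
        ‖vS (f τ) - vS (f t)‖ ^ 2)) 0 t := by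
      have h3 : HasDerivAt (fun τ => ‖U (τ - t) (vS u) - vS u‖ ^ 2) 0 t := by
        have h4 : HasDerivAt (fun τ => ‖U τ (vS u) - vS u‖ ^ 2) 0 (t - t) := by
          rw [sub_self]
          exact norm_U_sub_sq_isLittleO (isWeakDeriv_S u)
        have h5 := HasDerivAt.scomp (h := fun τ : ℝ => τ - t) t h4 ((hasDerivAt_id t).sub_const t)
        rwa [smul_zero] at h5
      have h6 := (h3.add (norm_sub_sq_hasDerivAt (hasDerivAt_vS h))).const_mul 2
      rwa [add_zero, mul_zero] at h6
    have hbd : ∀ᶠ τ in 𝓝 t, 3 * (‖ι u‖ + ‖ι (US τ (f τ))‖) ^ 2 ≤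
        3 * (‖ι u‖ + (‖ι u‖ + 1)) ^ 2 := by
      have hc : ContinuousAt (fun τ => ‖ι (US τ (f τ))‖) t :=
        (ι.continuous.continuousAt.comp (continuousAt_US h.continuousAt)).norm
      filter_upwards [hc.eventually_lt_const (lt_add_one _)] with τ hτ
      have hle : ‖ι (US τ (f τ))‖ ≤ ‖ι u‖ + 1 := hτ.le
      gcongr
    rw [hasDerivAt_iff_isLittleO] at hq ⊢
    simp only [sub_self, U_zero, norm_zero, inner_zero_right, Complex.zero_re, mul_zero,
      sub_zero, smul_zero, add_zero, ne_eq, OfNat.ofNat_ne_zero, not_false_eq_true, zero_pow,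
      ← hu] at hq ⊢
    refine Asymptotics.IsBigO.trans_isLittleO
      (Asymptotics.IsBigO.of_bound (3 * (‖ι u‖ + (‖ι u‖ + 1)) ^ 2) ?_) hq
    filter_upwards [hbd] with τ hτ
    rw [norm_eq_abs, norm_eq_abs, abs_of_nonneg (a := 2 * _) (by positivity)]
    refine (abs_quartic_sub_le _ _).trans ?_
    refine mul_le_mul hτ ?_ (by positivity) (by positivity)
    have e : vS (US τ (f τ)) - vS u = (U (τ - t) (vS u) - vS u) + U τ (vS (f τ) - vS (f t)) := by
      rw [hu, vS_US, vS_US, U_U, U_sub, sub_add_cancel]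
      abel
    rw [e]
    have h7 := norm_add_le (U (τ - t) (vS u) - vS u) (U τ (vS (f τ) - vS (f t)))
    rw [norm_U] at h7
    nlinarith [norm_nonneg (U (τ - t) (vS u) - vS u + U τ (vS (f τ) - vS (f t))),
      sq_nonneg (‖U (τ - t) (vS u) - vS u‖ - ‖vS (f τ) - vS (f t)‖),
      norm_nonneg (U (τ - t) (vS u) - vS u), norm_nonneg (vS (f τ) - vS (f t))]
  have h8 := (h2.add h1).add_const (quartic u - 4 * (inner ℂ (vS (cubS u)) (vS u)).re)
  refine (h8.congr_deriv ?_).congr_of_eventuallyEq (Eventually.of_forall fun τ => ?_)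
  · rw [zero_add]
    rfl
  · simp only [Pi.add_apply, Function.comp, Complex.reCLM_apply, inner_sub_right, Complex.sub_re]
    ring

theorem inner_mulL2_modSq_im (u : Sig) (f : L2) : (inner ℂ f (mulL2 (modSq u) f)).im = 0 := by
  have h : inner ℂ f (mulL2 (modSq u) f) = ((∫ x, ‖ι u x‖ ^ 2 * ‖f x‖ ^ 2 : ℝ) : ℂ) := by
    rw [inner_L2_eq, ← integral_complex_ofReal]
    refine integral_congr_ae ?_
    filter_upwards [coeFn_mulL2 (modSq u) f] with x hx
    rw [hx, modSq_apply, mul_assoc, RCLike.star_def, Complex.mul_conj, Complex.normSq_eq_norm_sq]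
    push_cast
    rfl
  rw [h, Complex.ofReal_im]

theorem neg_I_mul_re (lam : ℝ) (z : ℂ) : (-(Complex.I * lam) * z).re = lam * z.im := by
  simp

theorem US_NS (t : ℝ) (f : Sig) : US t (NS t f) = cubS (US t f) := by
  unfold NS
  rw [US_US_neg]

theorem NS_vS (t : ℝ) (f : Sig) : vS (NS t f) = U (-t) (vS (cubS (US t f))) := rfl
theorem NS_dS (t : ℝ) (f : Sig) : dS (NS t f) = U (-t) (dS (cubS (US t f))) := rfl

section Solutions

variable {lam : ℝ} {I : Set ℝ} {f : ℝ → Sig}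

/-- Conservation of mass. -/
theorem norm_vS_conserved (hI : Convex ℝ I) (h : ∀ t ∈ I, HasDerivAt f (vf lam t (f t)) t)
    {s t : ℝ} (hs : s ∈ I) (ht : t ∈ I) : ‖vS (f t)‖ ≤ ‖vS (f s)‖ := by
  have := norm_le_of_inner_deriv_le hI (le_refl 0) (fun τ hτ => hasDerivAt_vS (h τ hτ))
    (fun τ hτ => ?_) hs ht
  · linarith
  · rw [zero_mul, abs_nonpos_iff, vf, map_smul, inner_smul_right, neg_I_mul_re, NS_vS,
      ← neg_neg τ, ← inner_U_left, neg_neg, vS_cubS, ← vS_US, inner_mulL2_modSq_im, mul_zero]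

/-- Conservation of energy. Since `U(t)` commutes with `∂`, the kinetic energy is `‖∂f‖²`. -/
theorem energy_conserved (hI : Convex ℝ I) (h : ∀ t ∈ I, HasDerivAt f (vf lam t (f t)) t)
    {s t : ℝ} (hs : s ∈ I) (ht : t ∈ I) :
    ‖dS (f t)‖ ^ 2 + lam * quartic (US t (f t)) = ‖dS (f s)‖ ^ 2 + lam * quartic (US s (f s)) := by
  have hder : ∀ τ ∈ I, HasDerivWithinAt
      (fun τ => ‖dS (f τ)‖ ^ 2 + lam * quartic (US τ (f τ))) 0 I τ := by
    intro τ hτ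
    have h1 := hasDerivAt_normSq (hasDerivAt_dS (h τ hτ))
    have h2 := (hasDerivAt_quartic (h τ hτ)).const_mul lam
    refine ((h1.add h2).congr_deriv ?_).hasDerivWithinAt
    simp only [vf, map_smul]
    rw [vS_US, NS_vS, U_U_neg, inner_smul_right, inner_smul_right, Complex.add_re, neg_I_mul_re,
      neg_I_mul_re, NS_dS, ← neg_neg τ, ← inner_U_left, neg_neg, ← dS_US,
      ← inner_conj_symm (dS (US τ (f τ)))]
    have h3 : (inner ℂ (vS (cubS (US τ (f τ)))) (vS (cubS (US τ (f τ))))).im = 0 :=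
      inner_self_im (𝕜 := ℂ) _
    rw [h3, Complex.conj_im]
    have h4 : ∀ z : ℂ, (-(Complex.I / 2) * z).re = z.im / 2 := fun z => by
      simp only [Complex.mul_re, Complex.neg_re, Complex.neg_im, Complex.div_ofNat_re,
        Complex.div_ofNat_im, Complex.I_re, Complex.I_im]
      ring
    rw [h4]
    ring
  have h1 := hI.norm_image_sub_le_of_norm_hasDerivWithin_le (C := 0) hder (fun τ _ => by simp)
    hs ht
  rw [zero_mul, norm_le_zero_iff, sub_eq_zero] at h1
  exact h1

/-- Energy and mass control `∂f` for both signs of the coupling constant, because the potential energy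
is at most linear in the gradient, by the Gagliardo–Nirenberg inequality `quartic_le`. -/
theorem norm_dS_le_of_solution (hI : Convex ℝ I) (h : ∀ t ∈ I, HasDerivAt f (vf lam t (f t)) t)
    {s t : ℝ} (hs : s ∈ I) (ht : t ∈ I) :
    ‖dS (f t)‖ ≤ ‖dS (f s)‖ + 2 * |lam| * ‖vS (f s)‖ ^ 3 := by
  have h1 := energy_conserved hI h hs ht
  have h2 := quartic_le (US t (f t))
  have h3 := quartic_le (US s (f s))
  rw [vS_US, norm_U, dS_US, norm_U] at h2 h3
  have h4 := quartic_nonneg (US t (f t))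
  have h5 := quartic_nonneg (US s (f s))
  have h6 : ‖vS (f t)‖ ^ 3 ≤ ‖vS (f s)‖ ^ 3 := by
    gcongr; exact norm_vS_conserved hI h hs ht
  set M := ‖vS (f s)‖ ^ 3 with hM
  have hM0 : 0 ≤ M := by positivity
  set d := ‖dS (f t)‖
  set d₀ := ‖dS (f s)‖
  have hd : 0 ≤ d := norm_nonneg _
  have hd₀ : 0 ≤ d₀ := norm_nonneg _
  have h7 : |quartic (US s (f s)) - quartic (US t (f t))| ≤ 2 * M * (d + d₀) := by
    rw [abs_le]
    have h8 : 2 * ‖vS (f t)‖ ^ 3 * d ≤ 2 * M * d := by gcongr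
    have h9 : 0 ≤ M * d := by positivity
    have h10 : 0 ≤ M * d₀ := by positivity
    constructor <;> nlinarith
  have h8 : d ^ 2 - d₀ ^ 2 ≤ |lam| * (2 * M * (d + d₀)) := by
    have : d ^ 2 - d₀ ^ 2 = lam * (quartic (US s (f s)) - quartic (US t (f t))) := by linarith
    rw [this]
    refine (le_abs_self _).trans ?_
    rw [abs_mul]
    gcongr
  rcases (add_nonneg hd hd₀).eq_or_lt with h9 | h9
  · have := abs_nonneg lam
    have : 0 ≤ |lam| * M := by positivity
    nlinarith
  · refine le_of_mul_le_mul_right ?_ h9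
    nlinarith

/-- The weighted norm grows at most linearly in time. -/
theorem norm_xS_le_of_solution (hI : Convex ℝ I) (h : ∀ t ∈ I, HasDerivAt f (vf lam t (f t)) t)
    {s t : ℝ} (hs : s ∈ I) (ht : t ∈ I) :
    ‖xS (f t)‖ ≤ ‖xS (f s)‖ +
      (|s| + |t| + |t - s|) * (‖dS (f s)‖ + 2 * |lam| * ‖vS (f s)‖ ^ 3) := by
  set D := ‖dS (f s)‖ + 2 * |lam| * ‖vS (f s)‖ ^ 3 with hD
  have hD0 : 0 ≤ D := by positivity
  have hdD : ∀ τ ∈ I, ‖dS (f τ)‖ ≤ D := fun τ hτ => norm_dS_le_of_solution hI h hs hτ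
  -- `U(τ) z(τ) = x u(τ)` for `u = U(τ) f`; as `x|u|²u = |u|²(xu)`, the nonlinear term is
  -- orthogonal to `xu` in the real part, and only the commutator of `x` and `∂²` contributes
  set z : ℝ → L2 := fun τ => xS (f τ) - (Complex.I * τ) • dS (f τ) with hz
  have hzU : ∀ τ, xS (US τ (f τ)) = U τ (z τ) := fun τ => rfl
  have hder : ∀ τ ∈ I, HasDerivAt z (xS (vf lam τ (f τ)) - ((Complex.I * τ) • dS (vf lam τ (f τ)) +
      Complex.I • dS (f τ))) τ := by
    intro τ hτ
    refine (hasDerivAt_xS (h τ hτ)).sub ?_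
    have hc : HasDerivAt (fun τ : ℝ => Complex.I * (τ : ℂ)) Complex.I τ := by
      have := (Complex.ofRealCLM.hasDerivAt (x := τ)).const_mul Complex.I
      simpa using this
    exact hc.smul (hasDerivAt_dS (h τ hτ))
  have hval : ∀ τ, xS (vf lam τ (f τ)) - ((Complex.I * τ) • dS (vf lam τ (f τ)) +
      Complex.I • dS (f τ)) =
      (-(Complex.I * lam)) • U (-τ) (xS (cubS (US τ (f τ)))) - Complex.I • dS (f τ) := by
    intro τ
    have e : xS (cubS (US τ (f τ))) = U τ (xS (NS τ (f τ)) - (Complex.I * τ) • dS (NS τ (f τ))) := by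
      rw [← US_NS, xS_US]
    rw [e, U_neg_U, vf, map_smul, map_smul]
    module
  have h1 := norm_le_of_inner_deriv_le hI hD0 hder (fun τ hτ => ?_) hs ht
  · have e1 : ‖xS (f t)‖ ≤ ‖z t‖ + |t| * D := by
      have : xS (f t) = z t + (Complex.I * t) • dS (f t) := by rw [hz]; simp
      rw [this]
      refine (norm_add_le _ _).trans ?_
      rw [norm_smul, norm_mul, Complex.norm_I, one_mul, Complex.norm_real, norm_eq_abs]
      gcongr
      exact hdD t ht
    have e2 : ‖z s‖ ≤ ‖xS (f s)‖ + |s| * D := by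
      refine (norm_sub_le _ _).trans ?_
      rw [norm_smul, norm_mul, Complex.norm_I, one_mul, Complex.norm_real, norm_eq_abs]
      gcongr
      exact hdD s hs
    linarith
  · rw [hval, inner_sub_right, inner_smul_right, inner_smul_right, Complex.sub_re, neg_I_mul_re,
      ← neg_neg τ, ← inner_U_left, neg_neg, xS_cubS, hzU, inner_mulL2_modSq_im, mul_zero,
      zero_sub, abs_neg]
    refine (Complex.abs_re_le_norm _).trans ?_
    rw [norm_mul, Complex.norm_I, one_mul, mul_comm D]
    exact (norm_inner_le_norm _ _).trans (by gcongr; exact hdD τ hτ)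

end Solutions

theorem lipschitz_vf (lam T R : ℝ) :
    ∃ K : NNReal, ∀ t, |t| ≤ T → LipschitzOnWith K (vf lam t) (Metric.closedBall 0 R) := by
  refine ⟨⟨|lam| * (36 * (1 + |T|) ^ 4 * R ^ 2), by positivity⟩, fun t ht =>
    LipschitzOnWith.of_dist_le_mul fun f hf g hg => ?_⟩
  rw [mem_closedBall_zero_iff] at hf hg
  rw [dist_eq_norm, dist_eq_norm, vf, vf]
  have e : (-(Complex.I * lam)) • NS t f - (-(Complex.I * lam)) • NS t g =
      (-(Complex.I * lam)) • (NS t f - NS t g) := (smul_sub _ _ _).symm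
  rw [e, norm_smul, norm_neg, norm_mul, Complex.norm_I, one_mul, Complex.norm_real, norm_eq_abs]
  have := norm_NS_sub_le (ht.trans (le_abs_self T)) hf hg
  change _ ≤ |lam| * (36 * (1 + |T|) ^ 4 * R ^ 2) * ‖f - g‖
  rw [mul_assoc]
  gcongr

theorem continuous_vf_uncurry (lam : ℝ) : Continuous fun p : ℝ × Sig => vf lam p.1 p.2 :=
  (continuous_const_smul (-(Complex.I * (lam : ℂ)))).comp continuous_NS_uncurry

theorem continuous_vf (lam : ℝ) (f : Sig) : Continuous fun t => vf lam t f :=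
  Continuous.comp (g := fun p : ℝ × Sig => vf lam p.1 p.2) (f := fun t => (t, f))
    (continuous_vf_uncurry lam) (continuous_id.prodMk continuous_const)

/-- Global well-posedness in `Σ`, in the interaction picture. -/
theorem exists_global_vf (lam t₀ : ℝ) (f₀ : Sig) :
    ∃ f : ℝ → Sig, f t₀ = f₀ ∧ ∀ t, HasDerivAt f (vf lam t (f t)) t := by
  refine ode_exists_global (lipschitz_vf lam) (continuous_vf lam) fun T hT => ?_
  set D := ‖dS f₀‖ + 2 * |lam| * ‖vS f₀‖ ^ 3 with hD
  have hD0 : 0 ≤ D := by positivity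
  refine ⟨‖f₀‖ + D + (2 * |t₀| + 2 * T) * D, ?_, ?_⟩
  · have : 0 ≤ (2 * |t₀| + 2 * T) * D := by positivity
    linarith
  · intro f hf0 r hr hrT h t ht
    have hI : Convex ℝ (Set.Ioo (t₀ - r) (t₀ + r)) := convex_Ioo _ _
    have h0 : t₀ ∈ Set.Ioo (t₀ - r) (t₀ + r) := ⟨by linarith, by linarith⟩
    have h1 := norm_vS_conserved hI h h0 ht
    have h2 := norm_dS_le_of_solution hI h h0 ht
    have h3 := norm_xS_le_of_solution hI h h0 ht
    rw [hf0] at h1 h2 h3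
    rw [← hD] at h2 h3
    have htt : |t - t₀| ≤ T := abs_le.2 ⟨by linarith [ht.1], by linarith [ht.2]⟩
    have ht' : |t| ≤ |t₀| + T := by
      calc |t| = |t₀ + (t - t₀)| := by ring_nf
        _ ≤ |t₀| + |t - t₀| := abs_add_le _ _
        _ ≤ _ := by linarith
    have h4 : (|t₀| + |t| + |t - t₀|) * D ≤ (2 * |t₀| + 2 * T) * D :=
      mul_le_mul_of_nonneg_right (by linarith) hD0
    have h5 : 0 ≤ (2 * |t₀| + 2 * T) * D := by positivity
    have h6 := norm_vS_le f₀
    have h7 := norm_dS_le f₀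
    have h8 := norm_xS_le f₀
    refine norm_S_le ?_ ?_ ?_
    · linarith
    · linarith [norm_nonneg f₀]
    · linarith

/-! ### The norms of `Σ` and `H¹` and the notion of solution -/

theorem enorm_eq_ofReal_norm (f : L2) : ‖f‖ₑ = ENNReal.ofReal ‖f‖ := (ofReal_norm f).symm

theorem eLpNorm_eq_of_ae {F : ℝ → ℂ} {f : L2} (h : F =ᵐ[volume] f) :
    eLpNorm F 2 volume = ENNReal.ofReal ‖f‖ := by
  rw [eLpNorm_congr_ae h, ← Lp.enorm_def, enorm_eq_ofReal_norm]

theorem weightedDerivNorm_eq (w : ℝ → ℝ) {f g : L2} (h : IsWeakDeriv f g) :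
    weightedDerivNorm w f = eLpNorm (fun x : ℝ => (w x : ℂ) * g x) 2 volume := by
  unfold weightedDerivNorm
  refine le_antisymm (iInf₂_le g h) (le_iInf₂ fun g' h' => ?_)
  rw [h.unique h']

theorem exists_isWeakDeriv_of_lt_top {w : ℝ → ℝ} {f : L2} (h : weightedDerivNorm w f < ∞) :
    ∃ g, IsWeakDeriv f g := by
  by_contra hcon
  push Not at hcon
  unfold weightedDerivNorm at h
  simp [hcon] at h

theorem weightedDerivNorm_one {f g : L2} (h : IsWeakDeriv f g) :
    weightedDerivNorm (fun _ => 1) f = ENNReal.ofReal ‖g‖ := by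
  rw [weightedDerivNorm_eq _ h]
  exact eLpNorm_eq_of_ae (Eventually.of_forall fun x => by simp)

theorem sigmaENorm_vS (p : Sig) :
    sigmaENorm (vS p) = ENNReal.ofReal (‖vS p‖ + ‖dS p‖ + ‖xS p‖) := by
  unfold sigmaENorm
  rw [weightedDerivNorm_one (isWeakDeriv_S p), enorm_eq_ofReal_norm,
    eLpNorm_eq_of_ae (f := xS p) ((isMulX_S p).mono fun x hx => hx.symm),
    ENNReal.ofReal_add (by positivity) (by positivity),
    ENNReal.ofReal_add (by positivity) (by positivity)]

theorem memSigma_vS (p : Sig) : MemSigma (vS p) := by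
  rw [MemSigma, sigmaENorm_vS]
  exact ENNReal.ofReal_lt_top

theorem sigmaNorm_vS (p : Sig) : sigmaNorm (vS p) = ‖vS p‖ + ‖dS p‖ + ‖xS p‖ := by
  rw [sigmaNorm, sigmaENorm_vS, ENNReal.toReal_ofReal (by positivity)]

theorem exists_isMulX {f : L2} (h : eLpNorm (fun x : ℝ => (x : ℂ) * f x) 2 volume < ∞) :
    ∃ k : L2, IsMulX f k := by
  have hm : MemLp (fun x : ℝ => (x : ℂ) * f x) 2 volume :=
    ⟨(Complex.continuous_ofReal.aestronglyMeasurable).mul (Lp.aestronglyMeasurable f), h⟩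
  exact ⟨hm.toLp, hm.coeFn_toLp⟩

theorem MemSigma.exists_vS {f : L2} (h : MemSigma f) : ∃ p : Sig, vS p = f := by
  rw [MemSigma, sigmaENorm] at h
  obtain ⟨h1, h2⟩ := ENNReal.add_lt_top.1 h
  obtain ⟨g, hg⟩ := exists_isWeakDeriv_of_lt_top (ENNReal.add_lt_top.1 h1).2
  obtain ⟨k, hk⟩ := exists_isMulX h2
  exact ⟨mkS f g k hg hk, rfl⟩

theorem cubic_vS (p : Sig) : cubic (vS p) = vS (cubS p) := by
  have h := vS_cubS_ae p
  have hm : MemLp (fun x : ℝ => (‖vS p x‖ ^ 2 : ℂ) * vS p x) 2 volume := by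
    refine (memLp_congr_ae ?_).1 (Lp.memLp (vS (cubS p)))
    filter_upwards [h] with x hx
    rw [hx]
    push_cast
    rfl
  rw [cubic, dif_pos hm]
  refine Lp.ext ?_
  filter_upwards [h, hm.coeFn_toLp] with x hx h2
  rw [h2, hx]
  push_cast
  rfl

theorem vS_intervalIntegral {F : ℝ → Sig} (hF : Continuous F) (a b : ℝ) :
    vS (∫ τ in a..b, F τ) = ∫ τ in a..b, vS (F τ) :=
  ((vS.restrictScalars ℝ).intervalIntegral_comp_comm (hF.intervalIntegrable a b)).symm

theorem continuous_vf_comp (lam : ℝ) {f : ℝ → Sig} (hf : Continuous f) :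
    Continuous fun t => vf lam t (f t) :=
  Continuous.comp (g := fun p : ℝ × Sig => vf lam p.1 p.2) (f := fun t => (t, f t))
    (continuous_vf_uncurry lam) (continuous_id.prodMk hf)

/-- The Duhamel integral in terms of the vector field in `Σ`. -/
theorem duhamel_eq (lam : ℝ) {f : ℝ → Sig} (hf : Continuous f) {u : ℝ → L2}
    (hu : ∀ t, u t = vS (US t (f t))) (t : ℝ) :
    (Complex.I * (lam : ℂ)) • ∫ τ in (0 : ℝ)..t, U (t - τ) (cubic (u τ)) =
      -U t (vS (∫ τ in (0 : ℝ)..t, vf lam τ (f τ))) := by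
  rw [vS_intervalIntegral (continuous_vf_comp lam hf)]
  have h1 : U t (∫ τ in (0 : ℝ)..t, vS (vf lam τ (f τ))) =
      ∫ τ in (0 : ℝ)..t, U t (vS (vf lam τ (f τ))) :=
    (((UL t).toContinuousLinearEquiv : L2 →L[ℂ] L2).intervalIntegral_comp_comm
      ((vS.continuous.comp (continuous_vf_comp lam hf)).intervalIntegrable 0 t)).symm
  rw [h1, ← intervalIntegral.integral_smul, ← intervalIntegral.integral_neg]
  refine intervalIntegral.integral_congr fun τ _ => ?_
  rw [hu, cubic_vS, vf, map_smul, U_smul, NS_vS, U_U, neg_smul, neg_neg, sub_eq_add_neg]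

/-- A curve `f` in `Σ` solving the equation in the interaction picture gives a solution
`U(t)f(t)`. -/
theorem isGlobalSolution_of_hasDerivAt {lam : ℝ} {f : ℝ → Sig}
    (h : ∀ t, HasDerivAt f (vf lam t (f t)) t) :
    IsGlobalSolution lam fun t => vS (US t (f t)) := by
  have hf : Continuous f := continuous_iff_continuousAt.2 fun t => (h t).continuousAt
  have hU : Continuous fun t => US t (f t) :=
    continuous_iff_continuousAt.2 fun t => continuousAt_US hf.continuousAt
  refine ⟨⟨fun t => memSigma_vS _, fun t₀ => ?_⟩, fun t => ?_⟩
  · simp_rw [← map_sub vS, sigmaENorm_vS]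
    rw [← ENNReal.ofReal_zero]
    refine (ENNReal.continuous_ofReal.tendsto 0).comp ?_
    have hd : Continuous fun t => US t (f t) - US t₀ (f t₀) := hU.sub continuous_const
    have hc : Continuous fun t => ‖vS (US t (f t) - US t₀ (f t₀))‖ +
        ‖dS (US t (f t) - US t₀ (f t₀))‖ + ‖xS (US t (f t) - US t₀ (f t₀))‖ :=
      ((vS.continuous.comp hd).norm.add (dS.continuous.comp hd).norm).add
        (xS.continuous.comp hd).norm
    refine (hc.tendsto t₀).trans_eq ?_
    rw [sub_self, map_zero, map_zero, map_zero]
    simp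
  · rw [duhamel_eq lam hf (fun t => rfl) t]
    beta_reduce
    rw [US_zero, vS_US, sub_neg_eq_add, ← U_add, ← map_add]
    congr 2
    have h1 := intervalIntegral.integral_eq_sub_of_hasDerivAt (a := 0) (b := t)
      (fun τ _ => h τ) ((continuous_vf_comp lam hf).intervalIntegrable 0 t)
    rw [h1]
    abel

/-- Every solution has the form `U(t)f(t)`, where `f` solves the equation in the interaction
picture. -/
theorem IsGlobalSolution.exists_hasDerivAt {lam : ℝ} {u : ℝ → L2} (hu : IsGlobalSolution lam u) :
    ∃ f : ℝ → Sig, (∀ t, HasDerivAt f (vf lam t (f t)) t) ∧ ∀ t, u t = vS (US t (f t)) := by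
  obtain ⟨⟨hmem, hcont⟩, hD⟩ := hu
  choose p hp using fun t => (hmem t).exists_vS
  have hpc : Continuous p := by
    refine continuous_iff_continuousAt.2 fun t₀ => ?_
    rw [ContinuousAt, tendsto_iff_norm_sub_tendsto_zero]
    have h1 := hcont t₀
    simp_rw [← hp, ← map_sub vS, sigmaENorm_vS] at h1
    have h2 := (ENNReal.tendsto_toReal ENNReal.zero_ne_top).comp h1
    refine squeeze_zero (fun _ => norm_nonneg _) (fun t => ?_) h2
    simp only [Function.comp]
    rw [ENNReal.toReal_ofReal (by positivity)]
    have a1 := norm_nonneg (vS (p t - p t₀))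
    have a2 := norm_nonneg (dS (p t - p t₀))
    have a3 := norm_nonneg (xS (p t - p t₀))
    exact norm_S_le (by linarith) (by linarith) (by linarith)
  set f : ℝ → Sig := fun t => US (-t) (p t) with hf
  have hfc : Continuous f := Continuous.comp (g := fun p : ℝ × Sig => US p.1 p.2)
    (f := fun t => (-t, p t)) continuous_US_uncurry (continuous_neg.prodMk hpc)
  have hfu : ∀ t, u t = vS (US t (f t)) := fun t => by rw [hf, US_US_neg, hp]
  have hint : ∀ t, f t = f 0 + ∫ τ in (0 : ℝ)..t, vf lam τ (f τ) := fun t => by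
    refine ext_S ?_
    have h1 := hD t
    rw [duhamel_eq lam hfc hfu, hfu t, hfu 0, US_zero, vS_US, sub_neg_eq_add, ← U_add,
      ← map_add] at h1
    exact (UL t).injective h1
  refine ⟨f, fun t => ?_, hfu⟩
  have h1 : HasDerivAt (fun t => f 0 + ∫ τ in (0 : ℝ)..t, vf lam τ (f τ)) (vf lam t (f t)) t :=
    ((continuous_vf_comp lam hfc).integral_hasStrictDerivAt 0 t).hasDerivAt.const_add _
  rwa [← funext hint] at h1

/-- Uniqueness of solutions with a prescribed value at one time. -/
theorem vf_unique {lam t₀ : ℝ} {f g : ℝ → Sig} (hf : ∀ t, HasDerivAt f (vf lam t (f t)) t)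
    (hg : ∀ t, HasDerivAt g (vf lam t (g t)) t) (h : f t₀ = g t₀) : f = g := by
  funext t
  refine ode_unique (lipschitz_vf lam) (a := min t t₀ - 1) (b := max t t₀ + 1) (t₀ := t₀)
    ⟨by linarith [min_le_right t t₀], by linarith [le_max_right t t₀]⟩ (fun s _ => hf s)
    (fun s _ => hg s) h ⟨by linarith [min_le_left t t₀], by linarith [le_max_left t t₀]⟩

theorem IsGlobalSolution.unique {lam : ℝ} {u v : ℝ → L2} (hu : IsGlobalSolution lam u)
    (hv : IsGlobalSolution lam v) (h : u 0 = v 0) : u = v := by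
  obtain ⟨f, hf, hfu⟩ := hu.exists_hasDerivAt
  obtain ⟨g, hg, hgv⟩ := hv.exists_hasDerivAt
  have h0 : f 0 = g 0 := by
    refine ext_S ?_
    rwa [hfu, hgv, US_zero, US_zero] at h
  have := vf_unique hf hg h0
  funext t
  rw [hfu, hgv, this]

/-! ### A calculus of bounds for derivatives -/

/-- `SobBd k b β`: the function `b` has `k` derivatives in `L²`; all of them have `L²` norm at
most `β`, and those of order less than `k` are bounded by `β`. -/
def SobBd : ℕ → (ℝ → ℂ) → ℝ → Prop
  | 0, b, β => ∃ f : L2, f =ᵐ[volume] b ∧ ‖f‖ ≤ β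
  | k + 1, b, β => (∃ f : L2, f =ᵐ[volume] b ∧ ‖f‖ ≤ β) ∧ (∀ x, ‖b x‖ ≤ β) ∧
      ∃ b', HasAC b b' ∧ SobBd k b' β

theorem SobBd.exists_L2 {k : ℕ} {b : ℝ → ℂ} {β : ℝ} (h : SobBd k b β) :
    ∃ f : L2, f =ᵐ[volume] b ∧ ‖f‖ ≤ β := by
  cases k with
  | zero => exact h
  | succ k => exact h.1

theorem SobBd.nonneg {k : ℕ} {b : ℝ → ℂ} {β : ℝ} (h : SobBd k b β) : 0 ≤ β := by
  obtain ⟨f, -, hf⟩ := h.exists_L2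
  exact (norm_nonneg f).trans hf

theorem SobBd.of_succ {k : ℕ} {b : ℝ → ℂ} {β : ℝ} (h : SobBd (k + 1) b β) : SobBd k b β := by
  induction k generalizing b with
  | zero => exact h.1
  | succ k ih =>
    obtain ⟨h1, h2, b', hb, h3⟩ := h
    exact ⟨h1, h2, b', hb, ih h3⟩

theorem SobBd.mono {k : ℕ} {b : ℝ → ℂ} {β γ : ℝ} (h : SobBd k b β) (hβ : β ≤ γ) :
    SobBd k b γ := by
  induction k generalizing b with
  | zero =>
    obtain ⟨f, hf, hn⟩ := h
    exact ⟨f, hf, hn.trans hβ⟩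
  | succ k ih =>
    obtain ⟨⟨f, hf, hn⟩, h2, b', hb, h3⟩ := h
    exact ⟨⟨f, hf, hn.trans hβ⟩, fun x => (h2 x).trans hβ, b', hb, ih h3⟩

theorem exists_L2_add {b c : ℝ → ℂ} {β γ : ℝ} (h : ∃ f : L2, f =ᵐ[volume] b ∧ ‖f‖ ≤ β)
    (h' : ∃ f : L2, f =ᵐ[volume] c ∧ ‖f‖ ≤ γ) :
    ∃ f : L2, f =ᵐ[volume] (fun x => b x + c x) ∧ ‖f‖ ≤ β + γ := by
  obtain ⟨f, hf, hn⟩ := h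
  obtain ⟨g, hg, hm⟩ := h'
  refine ⟨f + g, ?_, (norm_add_le _ _).trans (add_le_add hn hm)⟩
  filter_upwards [hf, hg, Lp.coeFn_add f g] with x h1 h2 h3
  rw [h3, Pi.add_apply, h1, h2]

theorem SobBd.add {k : ℕ} {b c : ℝ → ℂ} {β γ : ℝ} (h : SobBd k b β) (h' : SobBd k c γ) :
    SobBd k (fun x => b x + c x) (β + γ) := by
  induction k generalizing b c with
  | zero => exact exists_L2_add h h'
  | succ k ih =>
    obtain ⟨h1, h2, b', hb, h3⟩ := h
    obtain ⟨h1', h2', c', hc, h3'⟩ := h'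
    exact ⟨exists_L2_add h1 h1', fun x => (norm_add_le _ _).trans (add_le_add (h2 x) (h2' x)), _,
      hb.add hc, ih h3 h3'⟩

theorem SobBd.const_mul {k : ℕ} {b : ℝ → ℂ} {β : ℝ} (h : SobBd k b β) (a : ℂ) :
    SobBd k (fun x => a * b x) (‖a‖ * β) := by
  have key : ∀ {b : ℝ → ℂ}, (∃ f : L2, f =ᵐ[volume] b ∧ ‖f‖ ≤ β) →
      ∃ f : L2, f =ᵐ[volume] (fun x => a * b x) ∧ ‖f‖ ≤ ‖a‖ * β := by
    rintro b ⟨f, hf, hn⟩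
    refine ⟨a • f, ?_, by rw [norm_smul]; gcongr⟩
    filter_upwards [hf, Lp.coeFn_smul a f] with x h1 h2
    rw [h2, Pi.smul_apply, h1, smul_eq_mul]
  induction k generalizing b with
  | zero => exact key h
  | succ k ih =>
    obtain ⟨h1, h2, b', hb, h3⟩ := h
    exact ⟨key h1, fun x => by rw [norm_mul]; gcongr; exact h2 x, _, hb.const_mul a, ih h3⟩

theorem SobBd.conj {k : ℕ} {b : ℝ → ℂ} {β : ℝ} (h : SobBd k b β) :
    SobBd k (fun x => star (b x)) β := by
  have key : ∀ {b : ℝ → ℂ}, (∃ f : L2, f =ᵐ[volume] b ∧ ‖f‖ ≤ β) →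
      ∃ f : L2, f =ᵐ[volume] (fun x => star (b x)) ∧ ‖f‖ ≤ β := by
    rintro b ⟨f, hf, hn⟩
    refine ⟨conjL2 f, ?_, by rwa [norm_conjL2]⟩
    filter_upwards [hf, coeFn_conjL2 f] with x h1 h2
    rw [h2, h1]
  induction k generalizing b with
  | zero => exact key h
  | succ k ih =>
    obtain ⟨h1, h2, b', hb, h3⟩ := h
    exact ⟨key h1, fun x => by rw [norm_star]; exact h2 x, _, hb.conj, ih h3⟩

theorem exists_L2_mul {b c : ℝ → ℂ} {β γ : ℝ} (hγ : 0 ≤ γ)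
    (h : ∃ f : L2, f =ᵐ[volume] b ∧ ‖f‖ ≤ β) (hc : Continuous c) (hb : ∀ x, ‖c x‖ ≤ γ) :
    ∃ f : L2, f =ᵐ[volume] (fun x => b x * c x) ∧ ‖f‖ ≤ β * γ := by
  obtain ⟨f, hf, hn⟩ := h
  set φ : ℝ →ᵇ ℂ := BoundedContinuousFunction.ofNormedAddCommGroup c hc γ hb
  have hφ : ‖φ‖ ≤ γ := (BoundedContinuousFunction.norm_le hγ).2 hb
  refine ⟨mulL2 φ f, ?_, (norm_mulL2_le _ _).trans ?_⟩
  · filter_upwards [hf, coeFn_mulL2 φ f] with x h1 h2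
    rw [h2, h1, mul_comm]
    rfl
  · rw [mul_comm β]
    gcongr

theorem SobBd.mul {k : ℕ} {b c : ℝ → ℂ} {β γ : ℝ} (h : SobBd k b β) (h' : SobBd (k + 1) c γ) :
    SobBd k (fun x => b x * c x) (2 ^ k * (β * γ)) := by
  have hγ := h'.nonneg
  have hβ := h.nonneg
  induction k generalizing b c with
  | zero =>
    obtain ⟨h1', h2', c', hc, h3'⟩ := h'
    rw [pow_zero, one_mul]
    exact exists_L2_mul hγ h hc.continuous h2'
  | succ k ih =>
    have h'' := h'
    have h0 := h
    obtain ⟨h1, h2, b', hb, h3⟩ := h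
    obtain ⟨h1', h2', c', hc, h3'⟩ := h'
    have h2k : (1 : ℝ) ≤ 2 ^ (k + 1) := one_le_pow₀ one_le_two
    have hle : β * γ ≤ 2 ^ (k + 1) * (β * γ) := le_mul_of_one_le_left (by positivity) h2k
    refine ⟨?_, fun x => ?_, _, hb.mul hc, ?_⟩
    · obtain ⟨f, hf, hn⟩ := exists_L2_mul hγ h1 hc.continuous h2'
      exact ⟨f, hf, hn.trans hle⟩
    · rw [norm_mul]
      exact (mul_le_mul (h2 x) (h2' x) (norm_nonneg _) hβ).trans hle
    · refine ((ih h3 h''.of_succ).add (ih h0.of_succ h3')).mono (le_of_eq ?_)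
      rw [pow_succ]; ring

theorem SobBd.mul' {k : ℕ} {b c : ℝ → ℂ} {β γ : ℝ} (h : SobBd (k + 1) b β)
    (h' : SobBd (k + 1) c γ) : SobBd (k + 1) (fun x => b x * c x) (2 ^ (k + 1) * (β * γ)) := by
  have hγ := h'.nonneg
  have hβ := h.nonneg
  have h'' := h'
  have h0 := h
  obtain ⟨h1, h2, b', hb, h3⟩ := h
  obtain ⟨h1', h2', c', hc, h3'⟩ := h'
  have h2k : (1 : ℝ) ≤ 2 ^ (k + 1) := one_le_pow₀ one_le_two
  have hle : β * γ ≤ 2 ^ (k + 1) * (β * γ) := le_mul_of_one_le_left (by positivity) h2k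
  refine ⟨?_, fun x => ?_, _, hb.mul hc, ?_⟩
  · obtain ⟨f, hf, hn⟩ := exists_L2_mul hγ h1 hc.continuous h2'
    exact ⟨f, hf, hn.trans hle⟩
  · rw [norm_mul]
    exact (mul_le_mul (h2 x) (h2' x) (norm_nonneg _) hβ).trans hle
  · have h4 := h3'.mul h0
    have e : (fun x => c' x * b x) = fun x => b x * c' x := funext fun x => mul_comm _ _
    rw [e] at h4
    refine ((h3.mul h'').add h4).mono (le_of_eq ?_)
    rw [pow_succ]; ring

/-- Multiplication by `e^{aφ}` with `|e^{aφ}| = 1`: each derivative costs a factor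
`1 + 4|a|M`. -/
theorem SobBd.mul_exp {φ : ℝ → ℂ} {M : ℝ} (hφ : SobBd 3 φ M) {a : ℂ}
    (hE : ∀ x, ‖Complex.exp (a * φ x)‖ = 1) {k : ℕ} (hk : k ≤ 3) {b : ℝ → ℂ} {β : ℝ}
    (h : SobBd k b β) :
    SobBd k (fun x => b x * Complex.exp (a * φ x)) (β * (1 + 4 * ‖a‖ * M) ^ k) := by
  have hM := hφ.nonneg
  have hφ3 := hφ
  obtain ⟨-, -, φ', hφφ', hφ'⟩ := hφ
  have hφ'c : Continuous φ' := by
    obtain ⟨-, -, φ'', h1, -⟩ := hφ'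
    exact h1.continuous
  have hEac : HasAC (fun x => Complex.exp (a * φ x)) (fun x => Complex.exp (a * φ x) *
      (a * φ' x)) :=
    hasAC_of_hasDerivAt (fun x => ((hφφ'.hasDerivAt hφ'c x).const_mul a).cexp)
      (by have := hφφ'.continuous; fun_prop)
  have hEc : Continuous fun x => Complex.exp (a * φ x) := hEac.continuous
  set Λ := 1 + 4 * ‖a‖ * M with hΛ
  have hΛ1 : 1 ≤ Λ := by
    have : 0 ≤ 4 * ‖a‖ * M := by positivity
    linarith
  have key : ∀ {b : ℝ → ℂ} {β : ℝ}, (∃ f : L2, f =ᵐ[volume] b ∧ ‖f‖ ≤ β) →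
      ∃ f : L2, f =ᵐ[volume] (fun x => b x * Complex.exp (a * φ x)) ∧ ‖f‖ ≤ β := by
    intro b β hb
    have := exists_L2_mul zero_le_one hb hEc (fun x => (hE x).le)
    rwa [mul_one] at this
  induction k generalizing b β with
  | zero =>
    rw [pow_zero, mul_one]
    exact key h
  | succ k ih =>
    have hβ := h.nonneg
    have h0 := h
    obtain ⟨h1, h2, b', hb, h3⟩ := h
    have hle : β ≤ β * Λ ^ (k + 1) := le_mul_of_one_le_right hβ (one_le_pow₀ hΛ1)
    refine ⟨?_, fun x => ?_, _, hb.mul hEac, ?_⟩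
    · obtain ⟨f, hf, hn⟩ := key h1
      exact ⟨f, hf, hn.trans hle⟩
    · rw [norm_mul, hE, mul_one]
      exact (h2 x).trans hle
    · have hφk : SobBd k φ' M := by
        have hk2 : k ≤ 2 := by omega
        interval_cases k
        · exact hφ'.of_succ.of_succ
        · exact hφ'.of_succ
        · exact hφ'
      have h4 := ((h3.add ((hφk.mul h0).const_mul a)).mono (γ := β * Λ) ?_)
      · have h5 := ih (by omega) h4
        have e : (fun x => (b' x + a * (φ' x * b x)) * Complex.exp (a * φ x)) =
            fun x => b' x * Complex.exp (a * φ x) + b x * (Complex.exp (a * φ x) * (a * φ' x)) := by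
          funext x; ring
        rw [e] at h5
        rwa [pow_succ', ← mul_assoc]
      · have hk4 : (2 : ℝ) ^ k ≤ 4 := by
          have hk2 : k ≤ 2 := by omega
          calc (2 : ℝ) ^ k ≤ 2 ^ 2 := pow_le_pow_right₀ one_le_two hk2
            _ = 4 := by norm_num
        have h6 : ‖a‖ * (2 ^ k * (M * β)) ≤ ‖a‖ * (4 * (M * β)) := by gcongr
        rw [hΛ]
        linarith

/-- A chain of three weak derivatives gives the bounds of `SobBd 3`. -/
theorem sobBd_three {f f₁ f₂ f₃ : L2} (h₂ : IsWeakDeriv f₁ f₂)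
    (h₃ : IsWeakDeriv f₂ f₃) {β : ℝ} (n₀ : ‖f‖ ≤ β) (n₁ : ‖f₁‖ ≤ β) (n₂ : ‖f₂‖ ≤ β)
    (n₃ : ‖f₃‖ ≤ β) {F : ℝ → ℂ} (hF : HasAC F f₁) (hf : f =ᵐ[volume] F) :
    SobBd 3 F (2 * β) := by
  have hβ : 0 ≤ β := (norm_nonneg _).trans n₀
  obtain ⟨F₁, hF₁, hf₁⟩ := h₂.exists_hasAC
  obtain ⟨F₂, hF₂, hf₂⟩ := h₃.exists_hasAC
  have hsup : ∀ {f g : L2} {F : ℝ → ℂ}, HasAC F g → f =ᵐ[volume] F → ‖f‖ ≤ β → ‖g‖ ≤ β →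
      ∀ x, ‖F x‖ ≤ 2 * β := by
    intro f g F hF hf hn hn' x
    have h1 := hF.norm_sq_le hf (ae_eq_refl _) x
    refine abs_le_of_sq_le_sq' (?_ : _ ≤ (2 * β) ^ 2) (by positivity) |>.2
    have h2 : ‖f‖ * ‖g‖ ≤ β * β := mul_le_mul hn hn' (norm_nonneg _) hβ
    nlinarith
  have hl : ∀ {f : L2}, ‖f‖ ≤ β → ‖f‖ ≤ 2 * β := fun h => by linarith
  exact ⟨⟨f, hf, hl n₀⟩, hsup hF hf n₀ n₁, F₁, hF.congr_right hf₁, ⟨f₁, hf₁, hl n₁⟩,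
    hsup hF₁ hf₁ n₁ n₂, F₂, hF₁.congr_right hf₂, ⟨f₂, hf₂, hl n₂⟩, hsup hF₂ hf₂ n₂ n₃, f₃, hF₂,
    ⟨f₃, ae_eq_refl _, hl n₃⟩⟩

theorem SobBd.exists_isWeakDeriv {k : ℕ} {b : ℝ → ℂ} {β : ℝ} (h : SobBd (k + 1) b β) {f : L2}
    (hf : f =ᵐ[volume] b) :
    ∃ (b' : ℝ → ℂ) (f' : L2), f' =ᵐ[volume] b' ∧ SobBd k b' β ∧ IsWeakDeriv f f' ∧ ‖f'‖ ≤ β := by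
  obtain ⟨-, -, b', hb, h3⟩ := h
  obtain ⟨f', hf', hn⟩ := h3.exists_L2
  exact ⟨b', f', hf', h3, hb.isWeakDeriv hf hf', hn⟩

/-- The derivatives of `f`, with a separate bound for each order. -/
theorem exists_isWeakDeriv_three {b : ℝ → ℂ} {β₁ β₂ β₃ : ℝ} (h₁ : SobBd 1 b β₁)
    (h₂ : SobBd 2 b β₂) (h₃ : SobBd 3 b β₃) {f : L2} (hf : f =ᵐ[volume] b) :
    ∃ f₁ f₂ f₃ : L2, IsWeakDeriv f f₁ ∧ IsWeakDeriv f₁ f₂ ∧ IsWeakDeriv f₂ f₃ ∧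
      ‖f₁‖ ≤ β₁ ∧ ‖f₂‖ ≤ β₂ ∧ ‖f₃‖ ≤ β₃ := by
  obtain ⟨-, f₁, -, -, hd₁, hn₁⟩ := h₁.exists_isWeakDeriv hf
  obtain ⟨c₁, e₁, he₁, hc₁, hd₂, -⟩ := h₂.exists_isWeakDeriv hf
  obtain ⟨-, e₂, -, -, hd₂', hn₂⟩ := hc₁.exists_isWeakDeriv he₁
  obtain ⟨d₁, g₁, hg₁, hq₁, hd₃, -⟩ := h₃.exists_isWeakDeriv hf
  obtain ⟨d₂, g₂, hg₂, hq₂, hd₃', -⟩ := hq₁.exists_isWeakDeriv hg₁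
  obtain ⟨-, g₃, -, -, hd₃'', hn₃⟩ := hq₂.exists_isWeakDeriv hg₂
  have u1 := hd₁.unique hd₂
  have u2 := hd₁.unique hd₃
  subst u1
  subst u2
  have u3 := hd₂'.unique hd₃'
  subst u3
  exact ⟨f₁, e₂, g₃, hd₁, hd₂', hd₃'', hn₁, hn₂, hn₃⟩

/-! ### The modified profile -/

/-- Evaluation of bounded continuous functions at a point. -/
def evalHom (x : ℝ) : (ℝ →ᵇ ℂ) →+* ℂ where
  toFun := fun φ => φ x
  map_one' := rfl
  map_mul' := fun _ _ => rfl
  map_zero' := rfl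
  map_add' := fun _ _ => rfl

/-- The phase factor `e^{iθ|p|²}`. -/
def phaseFactor (p : Sig) (θ : ℝ) : ℝ →ᵇ ℂ :=
  NormedSpace.exp (θ • (Complex.I • modSq p))

theorem phaseFactor_apply (p : Sig) (θ x : ℝ) :
    phaseFactor p θ x = Complex.exp ((Complex.I * θ) * modSq p x) := by
  have h := NormedSpace.map_exp (evalHom x) (BoundedContinuousFunction.evalCLM ℂ x).continuous
    (θ • (Complex.I • modSq p))
  change phaseFactor p θ x = NormedSpace.exp ((θ : ℝ) • (Complex.I • modSq p x)) at h
  rw [h, ← Complex.exp_eq_exp_ℂ, Complex.real_smul, smul_eq_mul]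
  congr 1
  ring

theorem norm_phaseFactor_apply (p : Sig) (θ x : ℝ) : ‖phaseFactor p θ x‖ = 1 := by
  rw [phaseFactor_apply, modSq_apply]
  have : Complex.I * (θ : ℂ) * ((‖ι p x‖ ^ 2 : ℝ) : ℂ) =
      ((θ * ‖ι p x‖ ^ 2 : ℝ) : ℂ) * Complex.I := by
    push_cast; ring
  rw [this, Complex.norm_exp_ofReal_mul_I]

theorem norm_phaseFactor_le (p : Sig) (θ : ℝ) : ‖phaseFactor p θ‖ ≤ 1 :=
  (BoundedContinuousFunction.norm_le zero_le_one).2 fun x => (norm_phaseFactor_apply p θ x).le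

theorem norm_mulL2_phaseFactor_le (p : Sig) (θ : ℝ) (f : L2) :
    ‖mulL2 (phaseFactor p θ) f‖ ≤ ‖f‖ :=
  (norm_mulL2_le _ _).trans
    (mul_le_of_le_one_left (norm_nonneg f) (norm_phaseFactor_le p θ))

theorem hasDerivAt_phaseFactor (p : Sig) (θ : ℝ) :
    HasDerivAt (phaseFactor p) (phaseFactor p θ * (Complex.I • modSq p)) θ :=
  hasDerivAt_exp_smul_const (𝕂 := ℝ) (Complex.I • modSq p) θ

theorem continuous_phaseFactor (p : Sig) : Continuous (phaseFactor p) :=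
  continuous_iff_continuousAt.2 fun θ => (hasDerivAt_phaseFactor p θ).continuousAt

theorem hasAC_phaseFactor {p : Sig} {φ' : ℝ →ᵇ ℂ} (hφ : HasAC (modSq p) φ') (θ : ℝ) :
    HasAC (phaseFactor p θ) ((Complex.I * θ) • (φ' * phaseFactor p θ) : ℝ →ᵇ ℂ) := by
  refine hasAC_of_hasDerivAt (fun x => ?_) (BoundedContinuousFunction.continuous _)
  have h := ((hφ.hasDerivAt φ'.continuous x).const_mul (Complex.I * θ)).cexp
  have e : (phaseFactor p θ : ℝ → ℂ) = fun x => Complex.exp ((Complex.I * θ) * modSq p x) :=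
    funext fun x => phaseFactor_apply p θ x
  rw [e]
  refine h.congr_deriv ?_
  change _ = (Complex.I * θ) * (φ' x * phaseFactor p θ x)
  rw [phaseFactor_apply]
  ring

/-- The profile `p e^{iθ|p|²}`, as an element of `Σ`. -/
def profileS (p : Sig) (φ' : ℝ →ᵇ ℂ) (hφ : HasAC (modSq p) φ') (θ : ℝ) : Sig :=
  mkS (mulL2 (phaseFactor p θ) (vS p))
    (mulL2 ((Complex.I * θ) • (φ' * phaseFactor p θ)) (vS p) + mulL2 (phaseFactor p θ) (dS p))
    (mulL2 (phaseFactor p θ) (xS p)) ((isWeakDeriv_S p).mulL2 (hasAC_phaseFactor hφ θ))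
    ((isMulX_S p).mulL2 _)

section Profile

variable {p : Sig} {φ' : ℝ →ᵇ ℂ} (hφ : HasAC (modSq p) φ')

theorem vS_profileS (θ : ℝ) :
    vS (profileS p φ' hφ θ) = mulL2 (phaseFactor p θ) (vS p) := rfl

theorem xS_profileS (θ : ℝ) :
    xS (profileS p φ' hφ θ) = mulL2 (phaseFactor p θ) (xS p) := rfl

theorem dS_profileS (θ : ℝ) : dS (profileS p φ' hφ θ) =
    mulL2 ((Complex.I * θ) • (φ' * phaseFactor p θ)) (vS p) + mulL2 (phaseFactor p θ) (dS p) := rfl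

theorem continuous_profileS : Continuous (profileS p φ' hφ) := by
  have hE := continuous_phaseFactor p
  refine continuous_to_S ?_ ?_ ?_
  · simp only [vS_profileS]; fun_prop
  · simp only [dS_profileS]; fun_prop
  · simp only [xS_profileS]; fun_prop

theorem ι_profileS (θ x : ℝ) : ι (profileS p φ' hφ θ) x = phaseFactor p θ x * ι p x := by
  have h : ι (profileS p φ' hφ θ) = phaseFactor p θ * ι p := by
    refine bcf_ext_ae ?_
    filter_upwards [ae_eq_ι (profileS p φ' hφ θ), ae_eq_ι p,
      coeFn_mulL2 (phaseFactor p θ) (vS p)] with x h1 h2 h3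
    rw [← h1, vS_profileS, h3, h2]
    rfl
  rw [h]
  rfl

theorem norm_ι_profileS_le (θ : ℝ) : ‖ι (profileS p φ' hφ θ)‖ ≤ ‖ι p‖ := by
  refine (BoundedContinuousFunction.norm_le (norm_nonneg _)).2 fun x => ?_
  rw [ι_profileS, norm_mul, norm_phaseFactor_apply, one_mul]
  exact (ι p).norm_coe_le_norm x

theorem modSq_profileS (θ : ℝ) : modSq (profileS p φ' hφ θ) = modSq p := by
  ext x
  rw [modSq_apply, modSq_apply, ι_profileS, norm_mul, norm_phaseFactor_apply, one_mul]

theorem norm_vS_profileS_le (θ : ℝ) : ‖vS (profileS p φ' hφ θ)‖ ≤ ‖vS p‖ :=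
  norm_mulL2_phaseFactor_le _ _ _

theorem norm_xS_profileS_le (θ : ℝ) : ‖xS (profileS p φ' hφ θ)‖ ≤ ‖xS p‖ :=
  norm_mulL2_phaseFactor_le _ _ _

theorem hasDerivAt_profileS (θ : ℝ) : HasDerivAt (profileS p φ' hφ)
    (Complex.I • cubS (profileS p φ' hφ θ)) θ := by
  have hc : Continuous fun s => Complex.I • cubS (profileS p φ' hφ s) :=
    (continuous_cubS.comp (continuous_profileS hφ)).const_smul Complex.I
  have hder : ∀ s, HasDerivAt (fun s => vS (profileS p φ' hφ s))
      (vS (Complex.I • cubS (profileS p φ' hφ s))) s := by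
    intro s
    have h1 := ((mulL2.flip (vS p)).restrictScalars ℝ).hasFDerivAt.comp_hasDerivAt s
      (hasDerivAt_phaseFactor p s)
    refine h1.congr_deriv ?_
    change mulL2 (phaseFactor p s * (Complex.I • modSq p)) (vS p) = _
    rw [map_smul, vS_cubS, modSq_profileS, vS_profileS, ← mulL2_mul]
    have e : phaseFactor p s * (Complex.I • modSq p) =
        Complex.I • (modSq p * phaseFactor p s) := by
      rw [mul_smul_comm, mul_comm]
    rw [e, map_smul]
    rfl
  have hint : ∀ s, profileS p φ' hφ s = profileS p φ' hφ 0 +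
      ∫ τ in (0 : ℝ)..s, Complex.I • cubS (profileS p φ' hφ τ) := by
    intro s
    refine ext_S ?_
    rw [map_add, vS_intervalIntegral hc]
    have h2 := intervalIntegral.integral_eq_sub_of_hasDerivAt (a := 0) (b := s)
      (fun τ _ => hder τ) ((vS.continuous.comp hc).intervalIntegrable 0 s)
    rw [h2]
    abel
  have h1 : HasDerivAt (fun s => profileS p φ' hφ 0 +
      ∫ τ in (0 : ℝ)..s, Complex.I • cubS (profileS p φ' hφ τ))
      (Complex.I • cubS (profileS p φ' hφ θ)) θ :=
    (hc.integral_hasStrictDerivAt 0 θ).hasDerivAt.const_add _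
  rwa [← funext hint] at h1

theorem norm_dS_profileS_le (θ : ℝ) :
    ‖dS (profileS p φ' hφ θ)‖ ≤ |θ| * ‖mulL2 φ' (vS p)‖ + ‖dS p‖ := by
  rw [dS_profileS]
  refine (norm_add_le _ _).trans (add_le_add ?_ (norm_mulL2_phaseFactor_le _ _ _))
  rw [map_smul]
  change ‖(Complex.I * θ) • mulL2 (φ' * phaseFactor p θ) (vS p)‖ ≤ _
  rw [norm_smul, norm_mul, Complex.norm_I, one_mul, Complex.norm_real, norm_eq_abs,
    mul_comm φ', mulL2_mul]
  gcongr
  exact norm_mulL2_phaseFactor_le _ _ _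

end Profile

/-- The profile `ŵ` of the statement. -/
theorem wHat_eq (lam : ℝ) {um : L2} {p : Sig} (hp : vS p = fourierHat um) {φ' : ℝ →ᵇ ℂ}
    (hφ : HasAC (modSq p) φ') (t : ℝ) :
    wHat lam um t = vS (profileS p φ' hφ (lam * Real.log |t|)) := by
  refine Lp.ext ?_
  rw [vS_profileS]
  unfold wHat phaseMul
  filter_upwards [(memLp_phase (fourierHat um) ((((Lp.aestronglyMeasurable
    (fourierHat um)).norm.pow 2).const_mul lam).mul_const (Real.log |t|))).coeFn_toLp,
    coeFn_mulL2 (phaseFactor p (lam * Real.log |t|)) (vS p), ae_eq_ι p] with x h1 h2 h3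
  refine h1.trans ?_
  rw [h2, phaseFactor_apply, modSq_apply, ← h3, hp]
  simp only [Pi.pow_apply]
  push_cast
  ring_nf

theorem u₂_eq (lam : ℝ) {um : L2} {p : Sig} (hp : vS p = fourierHat um) {φ' : ℝ →ᵇ ℂ}
    (hφ : HasAC (modSq p) φ') (t : ℝ) :
    u₂ lam um t = vS (US t (FS.symm (profileS p φ' hφ (lam * Real.log |t|)))) := by
  rw [u₂, fourierHatInv_eq, wHat_eq lam hp hφ]
  rfl

/-! ### Regularity of the asymptotic profile -/

theorem exists_L2_of_norm_le {F G : ℝ → ℂ} (hF : AEStronglyMeasurable F volume)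
    (h : ∀ᵐ x, ‖F x‖ ≤ ‖G x‖) (hG : eLpNorm G 2 volume < ∞) :
    ∃ k : L2, k =ᵐ[volume] F ∧ ‖k‖ ≤ (eLpNorm G 2 volume).toReal := by
  have hm : MemLp F 2 volume := ⟨hF, (eLpNorm_mono_ae h).trans_lt hG⟩
  refine ⟨hm.toLp, hm.coeFn_toLp, ?_⟩
  rw [Lp.norm_toLp]
  exact ENNReal.toReal_mono hG.ne (eLpNorm_mono_ae h)

theorem one_le_japanese (x : ℝ) : 1 ≤ japanese x :=
  Real.one_le_sqrt.2 (by nlinarith [sq_nonneg x])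

theorem abs_le_japanese (x : ℝ) : |x| ≤ japanese x :=
  Real.abs_le_sqrt (by linarith)

theorem aestronglyMeasurable_pow_mul (k : ℕ) (f : L2) :
    AEStronglyMeasurable (fun x : ℝ => (x : ℂ) ^ k * f x) volume :=
  (Complex.continuous_ofReal.pow k).aestronglyMeasurable.mul (Lp.aestronglyMeasurable f)

/-- The profile `û₋` of a state `u₋ ∈ 𝓗` has three derivatives in `L²`, and `ξû₋` has one. -/
theorem MemCalH.exists_profile {um : L2} (h : MemCalH um) :
    ∃ (p : Sig) (g₂ g₃ k₁ : L2), vS p = fourierHat um ∧ IsWeakDeriv (dS p) g₂ ∧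
      IsWeakDeriv g₂ g₃ ∧ IsWeakDeriv (xS p) k₁ ∧ ‖vS p‖ ≤ calHNorm um ∧
      ‖dS p‖ ≤ calHNorm um ∧ ‖xS p‖ ≤ calHNorm um ∧ ‖g₂‖ ≤ calHNorm um ∧
      ‖g₃‖ ≤ calHNorm um ∧ ‖k₁‖ ≤ calHNorm um := by
  rw [MemCalH, calHENorm] at h
  obtain ⟨h1, h2⟩ := ENNReal.add_lt_top.1 h
  obtain ⟨f', hf'⟩ := exists_isWeakDeriv_of_lt_top h1
  rw [weightedDerivNorm_eq _ hf'] at h1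
  have e1 : (eLpNorm (fun x : ℝ => (japanese x : ℂ) * f' x) 2 volume).toReal ≤ calHNorm um := by
    rw [calHNorm, calHENorm, weightedDerivNorm_eq _ hf']
    exact ENNReal.toReal_mono (ENNReal.add_lt_top.2 ⟨h1, h2⟩).ne le_self_add
  have e2 : (eLpNorm (fun x : ℝ => (japanese x ^ 3 : ℂ) * um x) 2 volume).toReal ≤
      calHNorm um := by
    rw [calHNorm, calHENorm, weightedDerivNorm_eq _ hf']
    exact ENNReal.toReal_mono (ENNReal.add_lt_top.2 ⟨h1, h2⟩).ne le_add_self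
  have hd : ∀ k ≤ 1, ∃ q : L2, q =ᵐ[volume] (fun x : ℝ => (x : ℂ) ^ k * f' x) ∧
      ‖q‖ ≤ calHNorm um := by
    intro k hk
    have hle : ∀ x : ℝ, ‖(x : ℂ) ^ k * f' x‖ ≤ ‖(japanese x : ℂ) * f' x‖ := by
      intro x
      rw [norm_mul, norm_mul, norm_pow, Complex.norm_real, Complex.norm_real, norm_eq_abs,
        norm_eq_abs, abs_of_nonneg (zero_le_one.trans (one_le_japanese x))]
      refine mul_le_mul_of_nonneg_right ?_ (norm_nonneg _)
      calc |x| ^ k ≤ japanese x ^ k := pow_le_pow_left₀ (abs_nonneg x) (abs_le_japanese x) k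
        _ ≤ japanese x ^ 1 := pow_le_pow_right₀ (one_le_japanese x) hk
        _ = _ := pow_one _
    obtain ⟨q, hq, hn⟩ := exists_L2_of_norm_le (aestronglyMeasurable_pow_mul k f')
      (Eventually.of_forall hle) h1
    exact ⟨q, hq, hn.trans e1⟩
  have hx : ∀ k ≤ 3, ∃ q : L2, q =ᵐ[volume] (fun x : ℝ => (x : ℂ) ^ k * um x) ∧
      ‖q‖ ≤ calHNorm um := by
    intro k hk
    have hle : ∀ x : ℝ, ‖(x : ℂ) ^ k * um x‖ ≤ ‖(japanese x ^ 3 : ℂ) * um x‖ := by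
      intro x
      rw [norm_mul, norm_mul, norm_pow, norm_pow, Complex.norm_real, Complex.norm_real,
        norm_eq_abs, norm_eq_abs, abs_of_nonneg (zero_le_one.trans (one_le_japanese x))]
      refine mul_le_mul_of_nonneg_right ?_ (norm_nonneg _)
      calc |x| ^ k ≤ japanese x ^ k := pow_le_pow_left₀ (abs_nonneg x) (abs_le_japanese x) k
        _ ≤ japanese x ^ 3 := pow_le_pow_right₀ (one_le_japanese x) hk
    obtain ⟨q, hq, hn⟩ := exists_L2_of_norm_le (aestronglyMeasurable_pow_mul k um)
      (Eventually.of_forall hle) h2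
    exact ⟨q, hq, hn.trans e2⟩
  obtain ⟨q0, hq0, n0⟩ := hx 0 (by norm_num)
  obtain ⟨q1, hq1, n1⟩ := hx 1 (by norm_num)
  obtain ⟨q2, hq2, n2⟩ := hx 2 (by norm_num)
  obtain ⟨q3, hq3, n3⟩ := hx 3 (by norm_num)
  obtain ⟨d0, hd0, m0⟩ := hd 0 (by norm_num)
  obtain ⟨d1, hd1, m1⟩ := hd 1 le_rfl
  obtain rfl : q0 = um := Lp.ext (hq0.trans (Eventually.of_forall fun x => by simp))
  obtain rfl : d0 = f' := Lp.ext (hd0.trans (Eventually.of_forall fun x => by simp))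
  have x1 : IsMulX q0 q1 := hq1.mono fun x hx => by simpa using hx
  have x2 : IsMulX q1 q2 := by
    filter_upwards [hq1, hq2] with x h1 h2
    rw [h1, h2]; ring
  have x3 : IsMulX q2 q3 := by
    filter_upwards [hq2, hq3] with x h1 h2
    rw [h1, h2]; ring
  have y1 : IsMulX d0 d1 := hd1.mono fun x hx => by simpa using hx
  refine ⟨FS (mkS q0 d0 q1 hf' x1), -Complex.I • -Complex.I • fourierL q2,
    -Complex.I • -Complex.I • -Complex.I • fourierL q3, -Complex.I • -Complex.I • fourierL d1,
    rfl, ?_, ?_, ?_, ?_, ?_, ?_, ?_, ?_, ?_⟩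
  · exact (isMulX_iff_fourier.1 x2).smul _
  · exact ((isMulX_iff_fourier.1 x3).smul _).smul _
  · exact (isMulX_iff_fourier.1 y1).smul _
  · rwa [norm_vS_FS]
  · rwa [norm_dS_FS]
  · rwa [norm_xS_FS]
  · simpa [norm_smul] using n2
  · simpa [norm_smul] using n3
  · simpa [norm_smul] using m1

theorem norm_le_of_h1ENorm_le {p : Sig} {δ : ℝ} (hδ : 0 ≤ δ)
    (h : h1ENorm (vS p) ≤ ENNReal.ofReal δ) : ‖vS p‖ ≤ δ ∧ ‖dS p‖ ≤ δ := by
  rw [h1ENorm, weightedDerivNorm_one (isWeakDeriv_S p), enorm_eq_ofReal_norm,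
    ← ENNReal.ofReal_pow (norm_nonneg _), ← ENNReal.ofReal_pow (norm_nonneg _),
    ← ENNReal.ofReal_add (by positivity) (by positivity),
    ENNReal.ofReal_rpow_of_nonneg (by positivity) (by positivity), ← Real.sqrt_eq_rpow,
    ENNReal.ofReal_le_ofReal_iff hδ] at h
  have hs := Real.sqrt_le_iff.1 h
  constructor <;> refine abs_le_of_sq_le_sq' ?_ hδ |>.2 <;>
    nlinarith [hs.2, sq_nonneg ‖vS p‖, sq_nonneg ‖dS p‖]

/-- A profile `p = û₋` of size `m` in the norm of `𝓗` and of size `d` in `H¹`, together with the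
first two derivatives of `|p|²` and the derivative of `ξp`. -/
structure Profile (m d : ℝ) where
  /-- The profile. -/
  p : Sig
  /-- The derivative of `|p|²`. -/
  φ' : ℝ →ᵇ ℂ
  /-- The second derivative of `|p|²`. -/
  φ'' : ℝ →ᵇ ℂ
  /-- The derivative of `ξp`. -/
  k₁ : L2
  hasAC : HasAC (modSq p) φ'
  hasAC' : HasAC φ' φ''
  isWeakDeriv_xS : IsWeakDeriv (xS p) k₁
  norm_φ'_le : ‖φ'‖ ≤ 32 * m ^ 2
  norm_φ''_le : ‖φ''‖ ≤ 32 * m ^ 2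
  norm_vS_le : ‖vS p‖ ≤ m
  norm_xS_le : ‖xS p‖ ≤ m
  norm_k₁_le : ‖k₁‖ ≤ m
  norm_vS_le' : ‖vS p‖ ≤ d
  norm_dS_le' : ‖dS p‖ ≤ d
  d_le_one : d ≤ 1
  sobBd : SobBd 3 (ι p) (2 * m)
  sobBd_modSq : SobBd 3 (modSq p) (32 * m ^ 2)

/-- The weights in the norm of `𝓗` become derivatives of `û₋`. -/
theorem MemCalH.exists_profile' {um : L2} (h : MemCalH um) {δ : ℝ} (hδ : 0 ≤ δ) (hδ' : δ ≤ 1)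
    (h' : h1ENorm (fourierHat um) ≤ ENNReal.ofReal δ) :
    ∃ D : Profile (calHNorm um) δ, vS D.p = fourierHat um := by
  obtain ⟨p, g₂, g₃, k₁, hp, h2, h3, hk, n0, n1, nx, n2, n3, nk⟩ := h.exists_profile
  rw [← hp] at h'
  obtain ⟨d0, d1⟩ := norm_le_of_h1ENorm_le hδ h'
  have hs : SobBd 3 (ι p) (2 * calHNorm um) :=
    sobBd_three h2 h3 n0 n1 n2 n3 (hasAC_ι p) (ae_eq_ι p)
  have hφ : SobBd 3 (modSq p) (32 * calHNorm um ^ 2) := by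
    have := hs.mul' hs.conj
    refine SobBd.mono this (le_of_eq ?_)
    ring
  have hφ0 := hφ
  obtain ⟨-, -, b, hb, -, bb, c, hc, -, bc, e, he, -⟩ := hφ
  have hM : 0 ≤ 32 * calHNorm um ^ 2 := by positivity
  exact ⟨⟨p, BoundedContinuousFunction.ofNormedAddCommGroup b hc.continuous _ bb,
    BoundedContinuousFunction.ofNormedAddCommGroup c he.continuous _ bc, k₁, hb, hc, hk,
    BoundedContinuousFunction.norm_ofNormedAddCommGroup_le _ hM _,
    BoundedContinuousFunction.norm_ofNormedAddCommGroup_le _ hM _,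
    n0, nx, nk, d0, d1, hδ', hs, hφ0⟩, hp⟩

namespace Profile

variable {m d : ℝ}

theorem m_nonneg (D : Profile m d) : 0 ≤ m := (norm_nonneg _).trans D.norm_vS_le

theorem d_nonneg (D : Profile m d) : 0 ≤ d := (norm_nonneg _).trans D.norm_vS_le'

variable (D : Profile m d)

/-- The modified profile `p e^{iθ|p|²}`. -/
def G (θ : ℝ) : Sig := profileS D.p D.φ' D.hasAC θ

theorem norm_xS_G_le (θ : ℝ) : ‖xS (D.G θ)‖ ≤ m :=
  (norm_xS_profileS_le D.hasAC θ).trans D.norm_xS_le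

theorem norm_ι_p_sq_le : ‖ι D.p‖ ^ 2 ≤ 2 * d ^ 2 := by
  refine (norm_ι_sq_le D.p).trans ?_
  have := mul_le_mul D.norm_vS_le' D.norm_dS_le' (norm_nonneg _) D.d_nonneg
  nlinarith

theorem norm_ι_G_sq_le (θ : ℝ) : ‖ι (D.G θ)‖ ^ 2 ≤ 2 * d ^ 2 :=
  (pow_le_pow_left₀ (norm_nonneg _) (norm_ι_profileS_le D.hasAC θ) 2).trans D.norm_ι_p_sq_le

theorem norm_ι_G_le (θ : ℝ) : ‖ι (D.G θ)‖ ≤ 2 * m := by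
  refine (norm_ι_profileS_le D.hasAC θ).trans ?_
  exact (BoundedContinuousFunction.norm_le (by linarith [D.m_nonneg])).2 D.sobBd.2.1

/-- The product rule expresses `(|p|²)' p` through `∂(|p|²p)` and `|p|²∂p`, so that it is small
with `d`, whereas the sup norm of `φ'` is only controlled by `m`. -/
theorem norm_mulL2_φ'_le : ‖mulL2 D.φ' (vS D.p)‖ ≤ 8 * d ^ 3 := by
  have h1 := ((isWeakDeriv_S D.p).mulL2 D.hasAC).unique (isWeakDeriv_S (cubS D.p))
  have h2 : ‖dS (cubS D.p)‖ ≤ 3 * ‖ι D.p‖ ^ 2 * ‖dS D.p‖ := by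
    have := norm_dS_cubS_sub_le D.p 0
    rwa [cubS_zero, sub_zero, sub_zero, map_zero dS, norm_zero, mul_zero, add_zero] at this
  have h3 : ‖mulL2 (modSq D.p) (dS D.p)‖ ≤ ‖ι D.p‖ ^ 2 * ‖dS D.p‖ :=
    (norm_mulL2_le _ _).trans (by gcongr; exact norm_modSq_le _)
  rw [eq_sub_of_add_eq h1]
  refine (norm_sub_le _ _).trans ?_
  have h4 := mul_le_mul D.norm_ι_p_sq_le D.norm_dS_le' (norm_nonneg _)
    (by positivity : (0 : ℝ) ≤ 2 * d ^ 2)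
  nlinarith

/-- The `H¹` norm of the modified profile grows at most linearly in the phase. -/
theorem norm_dS_G_le (θ : ℝ) : ‖dS (D.G θ)‖ ≤ d * (1 + 8 * |θ|) := by
  refine (norm_dS_profileS_le D.hasAC θ).trans ?_
  have h1 := D.norm_mulL2_φ'_le
  have h2 : d ^ 3 ≤ d := by
    have := pow_le_pow_of_le_one D.d_nonneg D.d_le_one (show 1 ≤ 3 by norm_num)
    rwa [pow_one] at this
  have h3 : |θ| * ‖mulL2 D.φ' (vS D.p)‖ ≤ |θ| * (8 * d) := by gcongr; linarith
  linarith [D.norm_dS_le']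

theorem norm_exp_phase (θ x : ℝ) : ‖Complex.exp ((Complex.I * θ) * modSq D.p x)‖ = 1 := by
  rw [← phaseFactor_apply, norm_phaseFactor_apply]

theorem norm_I_mul (θ : ℝ) : ‖Complex.I * (θ : ℂ)‖ = |θ| := by
  rw [norm_mul, Complex.norm_I, one_mul, Complex.norm_real, norm_eq_abs]

/-- The derivatives of the modified profile. -/
theorem exists_deriv_G (θ : ℝ) : ∃ G₂ G₃ : L2, IsWeakDeriv (dS (D.G θ)) G₂ ∧
    IsWeakDeriv G₂ G₃ ∧ ‖dS (D.G θ)‖ ≤ 2 * m * (1 + 128 * |θ| * m ^ 2) ∧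
    ‖G₂‖ ≤ 2 * m * (1 + 128 * |θ| * m ^ 2) ^ 2 ∧
    ‖G₃‖ ≤ 2 * m * (1 + 128 * |θ| * m ^ 2) ^ 3 := by
  have hE := D.norm_exp_phase θ
  have key : ∀ k ≤ 3, SobBd k (ι D.p) (2 * m) → SobBd k
      (fun x => ι D.p x * Complex.exp ((Complex.I * θ) * modSq D.p x))
      (2 * m * (1 + 128 * |θ| * m ^ 2) ^ k) := fun k hk h => by
    refine (D.sobBd_modSq.mul_exp hE hk h).mono (le_of_eq ?_)
    rw [norm_I_mul]
    ring
  have hf : vS (D.G θ) =ᵐ[volume]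
      (fun x => ι D.p x * Complex.exp ((Complex.I * θ) * modSq D.p x)) := by
    filter_upwards [ae_eq_ι (D.G θ)] with x hx
    rw [hx, G, ι_profileS, phaseFactor_apply, mul_comm]
  obtain ⟨G₁, G₂, G₃, w1, w2, w3, n1, n2, n3⟩ := exists_isWeakDeriv_three
    (key 1 (by norm_num) D.sobBd.of_succ.of_succ) (key 2 (by norm_num) D.sobBd.of_succ)
    (key 3 le_rfl D.sobBd) hf
  obtain rfl := (isWeakDeriv_S (D.G θ)).unique w1
  exact ⟨G₂, G₃, w2, w3, by rwa [pow_one] at n1, n2, n3⟩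

/-- The derivatives of the cubic nonlinearity of the modified profile. -/
theorem exists_deriv_cubS_G (θ : ℝ) : ∃ c₂ c₃ : L2, IsWeakDeriv (dS (cubS (D.G θ))) c₂ ∧
    IsWeakDeriv c₂ c₃ ∧ ‖c₂‖ ≤ 512 * m ^ 3 * (1 + 128 * |θ| * m ^ 2) ^ 2 ∧
    ‖c₃‖ ≤ 512 * m ^ 3 * (1 + 128 * |θ| * m ^ 2) ^ 3 := by
  have hE := D.norm_exp_phase θ
  have hs : SobBd 3 (fun x => modSq D.p x * ι D.p x) (512 * m ^ 3) := by
    have := D.sobBd_modSq.mul' D.sobBd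
    refine SobBd.mono this (le_of_eq ?_)
    ring
  have key : ∀ k ≤ 3, SobBd k (fun x => modSq D.p x * ι D.p x) (512 * m ^ 3) → SobBd k
      (fun x => modSq D.p x * ι D.p x * Complex.exp ((Complex.I * θ) * modSq D.p x))
      (512 * m ^ 3 * (1 + 128 * |θ| * m ^ 2) ^ k) := fun k hk h => by
    refine (D.sobBd_modSq.mul_exp hE hk h).mono (le_of_eq ?_)
    rw [norm_I_mul]
    ring
  have hf : vS (cubS (D.G θ)) =ᵐ[volume]
      (fun x => modSq D.p x * ι D.p x * Complex.exp ((Complex.I * θ) * modSq D.p x)) := by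
    rw [vS_cubS, G, modSq_profileS]
    filter_upwards [ae_eq_ι (D.G θ), coeFn_mulL2 (modSq D.p) (vS (D.G θ))] with x hx h2
    refine h2.trans ?_
    rw [hx, G, ι_profileS, phaseFactor_apply]
    ring
  obtain ⟨c₁, c₂, c₃, w1, w2, w3, n1, n2, n3⟩ := exists_isWeakDeriv_three
    (key 1 (by norm_num) hs.of_succ.of_succ) (key 2 (by norm_num) hs.of_succ)
    (key 3 le_rfl hs) hf
  obtain rfl := (isWeakDeriv_S (cubS (D.G θ))).unique w1
  exact ⟨c₂, c₃, w2, w3, n2, n3⟩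

/-- The derivative of `ξ` times the modified profile. -/
theorem exists_deriv_xS_G (θ : ℝ) : ∃ k : L2, IsWeakDeriv (xS (D.G θ)) k ∧
    ‖k‖ ≤ m * (1 + 128 * |θ| * m ^ 2) := by
  refine ⟨_, D.isWeakDeriv_xS.mulL2 (hasAC_phaseFactor D.hasAC θ), ?_⟩
  have hm := D.m_nonneg
  refine (norm_add_le _ _).trans ?_
  have h1 := (norm_mulL2_phaseFactor_le D.p θ D.k₁).trans D.norm_k₁_le
  have h2 : ‖mulL2 ((Complex.I * θ) • (D.φ' * phaseFactor D.p θ) : ℝ →ᵇ ℂ) (xS D.p)‖ ≤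
      |θ| * (32 * m ^ 2 * m) := by
    rw [map_smul]
    change ‖(Complex.I * (θ : ℂ)) • mulL2 (D.φ' * phaseFactor D.p θ) (xS D.p)‖ ≤ _
    rw [norm_smul, norm_I_mul, mulL2_mul]
    gcongr
    refine (norm_mulL2_le _ _).trans (mul_le_mul D.norm_φ'_le ?_ (norm_nonneg _) (by positivity))
    exact (norm_mulL2_phaseFactor_le _ _ _).trans D.norm_xS_le
  have h3 : 0 ≤ |θ| * m ^ 3 := by positivity
  nlinarith

end Profile

/-! ### The remainder in the asymptotic equation -/

/-- Two derivatives give `U(s) - 1` the full size `s`. -/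
theorem norm_vS_US_sub_le (s : ℝ) {G : Sig} {G₂ : L2} (hG : IsWeakDeriv (dS G) G₂) :
    ‖vS (US s G - G)‖ ≤ |s| / 2 * ‖G₂‖ := by
  rw [map_sub, vS_US]
  exact norm_U_sub_le (isWeakDeriv_S G) hG s

theorem norm_dS_US_sub_le (s : ℝ) {G : Sig} {G₂ G₃ : L2} (hG : IsWeakDeriv (dS G) G₂)
    (hG' : IsWeakDeriv G₂ G₃) : ‖dS (US s G - G)‖ ≤ |s| / 2 * ‖G₃‖ := by
  rw [map_sub, dS_US]
  exact norm_U_sub_le hG hG' s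

theorem norm_ι_US_sub_sq_le (s : ℝ) {G : Sig} {G₂ G₃ : L2} (hG : IsWeakDeriv (dS G) G₂)
    (hG' : IsWeakDeriv G₂ G₃) :
    ‖ι (US s G - G)‖ ^ 2 ≤ 2 * (|s| / 2 * ‖G₂‖) * (|s| / 2 * ‖G₃‖) := by
  refine (norm_ι_sq_le _).trans ?_
  gcongr
  · exact norm_vS_US_sub_le s hG
  · exact norm_dS_US_sub_le s hG hG'

theorem amp_le_add (s : ℝ) (G : Sig) : amp s G ≤ ‖ι G‖ + ‖ι (US s G - G)‖ := by
  have : ι (US s G) = ι G + ι (US s G - G) := by rw [map_sub]; abel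
  rw [amp, this]
  exact norm_add_le _ _

/-- For small `s`, the nonlinearity `NS s` is close to `cubS` on elements with a second derivative. -/
theorem norm_vS_NS_sub_cubS_le (s : ℝ) {G : Sig} {G₂ c₂ : L2} (hG : IsWeakDeriv (dS G) G₂)
    (hc : IsWeakDeriv (dS (cubS G)) c₂) :
    ‖vS (NS s G - cubS G)‖ ≤
      (amp s G + ‖ι G‖) ^ 2 * (|s| / 2 * ‖G₂‖) + |s| / 2 * ‖c₂‖ := by
  have e : vS (NS s G - cubS G) = U (-s) (vS (cubS (US s G) - cubS G)) +
      (U (-s) (vS (cubS G)) - vS (cubS G)) := by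
    rw [map_sub, map_sub, U_sub]
    simp only [NS, vS_US]
    abel
  rw [e]
  refine (norm_add_le _ _).trans (add_le_add ?_ ?_)
  · rw [norm_U]
    refine (norm_vS_cubS_sub_le _ _).trans ?_
    exact mul_le_mul_of_nonneg_left (norm_vS_US_sub_le s hG) (by positivity)
  · have := norm_U_sub_le (isWeakDeriv_S (cubS G)) hc (-s)
    rwa [abs_neg] at this

/-- The same in the derivative norm, at the price of a third derivative. -/
theorem norm_dS_NS_sub_cubS_le (s : ℝ) {G : Sig} {G₂ G₃ c₂ c₃ : L2}
    (hG : IsWeakDeriv (dS G) G₂) (hG' : IsWeakDeriv G₂ G₃)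
    (hc : IsWeakDeriv (dS (cubS G)) c₂) (hc' : IsWeakDeriv c₂ c₃) :
    ‖dS (NS s G - cubS G)‖ ≤ 3 * amp s G ^ 2 * (|s| / 2 * ‖G₃‖) +
      3 * ((amp s G + ‖ι G‖) * ‖ι (US s G - G)‖) * ‖dS G‖ + |s| / 2 * ‖c₃‖ := by
  have e : dS (NS s G - cubS G) = U (-s) (dS (cubS (US s G) - cubS G)) +
      (U (-s) (dS (cubS G)) - dS (cubS G)) := by
    rw [map_sub, map_sub, U_sub]
    simp only [NS, dS_US]
    abel
  rw [e]
  refine (norm_add_le _ _).trans (add_le_add ?_ ?_)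
  · rw [norm_U]
    refine (norm_dS_cubS_sub_le _ _).trans (add_le_add ?_ le_rfl)
    exact mul_le_mul_of_nonneg_left (norm_dS_US_sub_le s hG hG') (by positivity)
  · have := norm_U_sub_le hc hc' (-s)
    rwa [abs_neg] at this

/-- The weighted remainder: the commutator of `U(s)` with the multiplication by `|G|²` is
controlled without a third derivative of the weighted function. -/
theorem norm_xS_NS_sub_cubS_le (s : ℝ) {G : Sig} {G₂ k : L2} {φ' φ'' : ℝ →ᵇ ℂ}
    (hG : IsWeakDeriv (dS G) G₂) (hφ : HasAC (modSq G) φ') (hφ' : HasAC φ' φ'')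
    (hk : IsWeakDeriv (xS G) k) {κ : ℝ} (hκ : 2 * ‖xS G‖ * ‖k‖ ≤ κ ^ 2) (hκ0 : 0 ≤ κ) :
    ‖xS (NS s G - cubS G)‖ ≤ 4 * |s| * amp s G ^ 2 * ‖dS G‖ +
      (amp s G + ‖ι G‖) * κ * (|s| / 2 * ‖G₂‖) +
      |s| * (1 / 2 * ‖φ''‖ * ‖xS G‖ + ‖φ'‖ * ‖k‖) := by
  set v := US s G with hv
  have hA : ‖ι v‖ = amp s G := rfl
  have hI : ‖Complex.I * (s : ℂ)‖ = |s| := Profile.norm_I_mul s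
  have e : xS (NS s G - cubS G) =
      (U (-s) ((Complex.I * s) • dS (cubS v) -
          (Complex.I * s) • mulL2 (modSq v) (U s (dS G))) +
        U (-s) (mulL2 (modSq v - modSq G) (U s (xS G)))) +
      (U (-s) (mulL2 (modSq G) (U s (xS G))) - mulL2 (modSq G) (xS G)) := by
    rw [map_sub xS, NS, xS_US, ← hv, xS_cubS, xS_cubS]
    have h1 : xS v = U s (xS G) - (Complex.I * s) • U s (dS G) := by
      rw [hv, xS_US, U_sub, U_smul]
    rw [h1, map_sub mulL2, map_sub (mulL2 (modSq v)), map_smul]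
    have h2 : (Complex.I * ((-s : ℝ) : ℂ)) • dS (cubS v) = -((Complex.I * s) • dS (cubS v)) := by
      rw [Complex.ofReal_neg, mul_neg, neg_smul]
    simp only [sub_apply, h2, sub_neg_eq_add, U_add, U_sub]
    abel
  rw [e]
  refine (norm_add_le _ _).trans (add_le_add ((norm_add_le _ _).trans (add_le_add ?_ ?_)) ?_)
  · rw [norm_U, ← smul_sub, norm_smul, hI]
    have h1 : ‖dS (cubS v)‖ ≤ 3 * amp s G ^ 2 * ‖dS G‖ := by
      have := norm_dS_cubS_sub_le v 0
      rw [cubS_zero, sub_zero, sub_zero, map_zero dS, norm_zero, mul_zero, add_zero, hA, hv,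
        dS_US, norm_U] at this
      exact this
    have h2 : ‖mulL2 (modSq v) (U s (dS G))‖ ≤ amp s G ^ 2 * ‖dS G‖ := by
      refine (norm_mulL2_le _ _).trans ?_
      rw [norm_U]
      exact mul_le_mul_of_nonneg_right (norm_modSq_le v) (norm_nonneg _)
    calc |s| * ‖dS (cubS v) - mulL2 (modSq v) (U s (dS G))‖
        ≤ |s| * (3 * amp s G ^ 2 * ‖dS G‖ + amp s G ^ 2 * ‖dS G‖) := by
          gcongr
          exact (norm_sub_le _ _).trans (add_le_add h1 h2)
      _ = _ := by ring
  · rw [norm_U]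
    refine le_trans ?_ (mul_le_mul_of_nonneg_left (norm_vS_US_sub_le s hG)
      (mul_nonneg (add_nonneg (amp_nonneg s G) (norm_nonneg _)) hκ0))
    rw [← hv]
    refine norm_le_mul_norm_of_ae ?_
    filter_upwards [coeFn_mulL2 (modSq v - modSq G) (U s (xS G)), (hk.U s).ae_norm_sq_le,
      ae_eq_ι (v - G)] with x h1 h2 h3
    rw [norm_U, norm_U] at h2
    have hw : ‖U s (xS G) x‖ ≤ κ := abs_le_of_sq_le_sq' (h2.trans hκ) hκ0 |>.2
    have hd : ‖(modSq v - modSq G) x‖ ≤ (amp s G + ‖ι G‖) * ‖vS (v - G) x‖ := by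
      have e1 : (modSq v - modSq G) x =
          ι (v - G) x * star (ι v x) + ι G x * star (ι (v - G) x) := by
        have : modSq v - modSq G = ι (v - G) * star (ι v) + ι G * star (ι (v - G)) := by
          simp only [modSq, map_sub, star_sub]; ring
        rw [this]
        rfl
      rw [e1, h3]
      refine (norm_add_le _ _).trans ?_
      rw [norm_mul, norm_mul, norm_star, norm_star, ← hA]
      have := (ι v).norm_coe_le_norm x
      have := (ι G).norm_coe_le_norm x
      nlinarith [norm_nonneg (ι (v - G) x)]
    rw [h1, norm_mul]
    calc ‖(modSq v - modSq G) x‖ * ‖U s (xS G) x‖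
        ≤ (amp s G + ‖ι G‖) * ‖vS (v - G) x‖ * κ :=
          mul_le_mul hd hw (norm_nonneg _) (mul_nonneg
            (add_nonneg (amp_nonneg s G) (norm_nonneg _)) (norm_nonneg _))
      _ = _ := by ring
  · exact norm_commutator_le hφ hφ' hk s

namespace Profile

variable {m d : ℝ} (D : Profile m d)

theorem hasAC_modSq_G (θ : ℝ) : HasAC (modSq (D.G θ)) D.φ' := by
  rw [G, modSq_profileS]
  exact D.hasAC

/-- The size of the remainder, for the modified profile with phase `θ` and a small time `s`. -/
theorem norm_NS_sub_cubS_le {θ s : ℝ} {Λ : ℝ} (hΛ : 1 + 128 * |θ| * m ^ 2 ≤ Λ)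
    (hs : |s| * Λ ^ 3 ≤ 1) :
    ‖vS (NS s (D.G θ) - cubS (D.G θ))‖ ≤ 400 * |s| * m ^ 3 * Λ ^ 2 ∧
    ‖dS (NS s (D.G θ) - cubS (D.G θ))‖ ≤ 400 * |s| * m ^ 3 * Λ ^ 4 ∧
    ‖xS (NS s (D.G θ) - cubS (D.G θ))‖ ≤ 400 * |s| * m ^ 3 * Λ ^ 4 := by
  have hm := D.m_nonneg
  have hs0 := abs_nonneg s
  have hl0 : 1 ≤ 1 + 128 * |θ| * m ^ 2 := by
    have : 0 ≤ 128 * |θ| * m ^ 2 := by positivity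
    linarith
  have hl1 : 1 ≤ Λ := hl0.trans hΛ
  have hl : 0 ≤ Λ := zero_le_one.trans hl1
  obtain ⟨G₂, G₃, w2, w3, n1, n2, n3⟩ := D.exists_deriv_G θ
  obtain ⟨c₂, c₃, y2, y3, q2, q3⟩ := D.exists_deriv_cubS_G θ
  obtain ⟨k, hk, nk⟩ := D.exists_deriv_xS_G θ
  set G := D.G θ with hGdef
  have hpow : ∀ n : ℕ, (1 + 128 * |θ| * m ^ 2) ^ n ≤ Λ ^ n := fun n =>
    pow_le_pow_left₀ (zero_le_one.trans hl0) hΛ n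
  replace n1 : ‖dS G‖ ≤ 2 * m * Λ := n1.trans (by gcongr)
  replace n2 : ‖G₂‖ ≤ 2 * m * Λ ^ 2 := n2.trans (by have := hpow 2; gcongr)
  replace n3 : ‖G₃‖ ≤ 2 * m * Λ ^ 3 := n3.trans (by have := hpow 3; gcongr)
  replace q2 : ‖c₂‖ ≤ 512 * m ^ 3 * Λ ^ 2 := q2.trans (by have := hpow 2; gcongr)
  replace q3 : ‖c₃‖ ≤ 512 * m ^ 3 * Λ ^ 3 := q3.trans (by have := hpow 3; gcongr)
  replace nk : ‖k‖ ≤ m * Λ := nk.trans (by gcongr)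
  have nx : ‖xS G‖ ≤ m := D.norm_xS_G_le θ
  have h0 : ‖ι G‖ ≤ 2 * m := D.norm_ι_G_le θ
  have he : ‖ι (US s G - G)‖ ≤ 2 * |s| * m * Λ ^ 3 := by
    refine abs_le_of_sq_le_sq' ((norm_ι_US_sub_sq_le s w2 w3).trans ?_) (by positivity) |>.2
    calc 2 * (|s| / 2 * ‖G₂‖) * (|s| / 2 * ‖G₃‖)
        ≤ 2 * (|s| / 2 * (2 * m * Λ ^ 2)) * (|s| / 2 * (2 * m * Λ ^ 3)) := by gcongr
      _ = 2 * |s| ^ 2 * m ^ 2 * Λ ^ 5 := by ring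
      _ ≤ 2 * |s| ^ 2 * m ^ 2 * Λ ^ 6 :=
          mul_le_mul_of_nonneg_left (pow_le_pow_right₀ hl1 (by norm_num)) (by positivity)
      _ ≤ 4 * (|s| ^ 2 * m ^ 2 * Λ ^ 6) := by
          have : 0 ≤ |s| ^ 2 * m ^ 2 * Λ ^ 6 := by positivity
          linarith
      _ = _ := by ring
  have hA : amp s G ≤ 4 * m := by
    refine (amp_le_add s G).trans ?_
    have : 2 * |s| * m * Λ ^ 3 = 2 * m * (|s| * Λ ^ 3) := by ring
    nlinarith
  have hA0 := amp_nonneg s G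
  have hS : amp s G + ‖ι G‖ ≤ 6 * m := by linarith
  have hΛp : ∀ {n l : ℕ}, n ≤ l → Λ ^ n ≤ Λ ^ l := fun h => pow_le_pow_right₀ hl1 h
  refine ⟨?_, ?_, ?_⟩
  · refine (norm_vS_NS_sub_cubS_le s w2 y2).trans ?_
    calc _ ≤ (6 * m) ^ 2 * (|s| / 2 * (2 * m * Λ ^ 2)) + |s| / 2 * (512 * m ^ 3 * Λ ^ 2) := by
          gcongr
      _ = 292 * (|s| * m ^ 3 * Λ ^ 2) := by ring
      _ ≤ 400 * (|s| * m ^ 3 * Λ ^ 2) := by gcongr; norm_num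
      _ = _ := by ring
  · refine (norm_dS_NS_sub_cubS_le s w2 w3 y2 y3).trans ?_
    calc _ ≤ 3 * (4 * m) ^ 2 * (|s| / 2 * (2 * m * Λ ^ 3)) +
          3 * (6 * m * (2 * |s| * m * Λ ^ 3)) * (2 * m * Λ) +
          |s| / 2 * (512 * m ^ 3 * Λ ^ 3) := by gcongr
      _ = 304 * (|s| * m ^ 3) * Λ ^ 3 + 72 * (|s| * m ^ 3) * Λ ^ 4 := by ring
      _ ≤ 304 * (|s| * m ^ 3) * Λ ^ 4 + 72 * (|s| * m ^ 3) * Λ ^ 4 := by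
          have := hΛp (show 3 ≤ 4 by norm_num)
          gcongr
      _ = 376 * (|s| * m ^ 3 * Λ ^ 4) := by ring
      _ ≤ 400 * (|s| * m ^ 3 * Λ ^ 4) := by gcongr; norm_num
      _ = _ := by ring
  · have hκ : 2 * ‖xS G‖ * ‖k‖ ≤ (2 * m * Λ) ^ 2 := by
      calc 2 * ‖xS G‖ * ‖k‖ ≤ 2 * m * (m * Λ) := by gcongr
        _ = 2 * (m ^ 2 * Λ ^ 1) := by ring
        _ ≤ 4 * (m ^ 2 * Λ ^ 2) := by
          have := hΛp (show 1 ≤ 2 by norm_num)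
          gcongr
          norm_num
        _ = _ := by ring
    refine (norm_xS_NS_sub_cubS_le s w2 (D.hasAC_modSq_G θ) D.hasAC' hk hκ
      (by positivity)).trans ?_
    have hf := D.norm_φ'_le
    have hf' := D.norm_φ''_le
    calc _ ≤ 4 * |s| * (4 * m) ^ 2 * (2 * m * Λ) +
          6 * m * (2 * m * Λ) * (|s| / 2 * (2 * m * Λ ^ 2)) +
          |s| * (1 / 2 * (32 * m ^ 2) * m + 32 * m ^ 2 * (m * Λ)) := by gcongr
      _ = |s| * m ^ 3 * (160 * Λ ^ 1 + 12 * Λ ^ 3 + 16 * Λ ^ 0) := by ring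
      _ ≤ |s| * m ^ 3 * (160 * Λ ^ 4 + 12 * Λ ^ 4 + 16 * Λ ^ 4) := by
          have h1 := hΛp (show 1 ≤ 4 by norm_num)
          have h2 := hΛp (show 3 ≤ 4 by norm_num)
          have h3 := hΛp (show 0 ≤ 4 by norm_num)
          gcongr
      _ = 188 * (|s| * m ^ 3 * Λ ^ 4) := by ring
      _ ≤ 400 * (|s| * m ^ 3 * Λ ^ 4) := by gcongr; norm_num
      _ = _ := by ring

/-- The modified profile stays small in the sup norm under the flow, uniformly in a time `s` that
is small with respect to the phase. -/
theorem amp_G_le {θ s : ℝ} (hs : |s| * (1 + 8 * |θ|) ^ 4 ≤ 1) : amp s (D.G θ) ≤ 4 * d := by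
  have hd := D.d_nonneg
  set G := D.G θ with hGdef
  have h0 : ‖ι G‖ ≤ 2 * d :=
    abs_le_of_sq_le_sq' (by nlinarith [D.norm_ι_G_sq_le θ]) (by positivity) |>.2
  have n1 : ‖dS G‖ ≤ d * (1 + 8 * |θ|) := D.norm_dS_G_le θ
  have hv : ‖vS (US s G - G)‖ ≤ √|s| * ‖dS G‖ := by
    rw [map_sub, vS_US]
    refine abs_le_of_sq_le_sq' ?_ (by positivity) |>.2
    rw [mul_pow, Real.sq_sqrt (abs_nonneg s)]
    exact norm_U_sub_sq_le (isWeakDeriv_S G) s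
  have hd' : ‖dS (US s G - G)‖ ≤ 2 * ‖dS G‖ := by
    rw [map_sub, dS_US]
    refine (norm_sub_le _ _).trans ?_
    rw [norm_U]
    linarith
  have hsq : √|s| * (1 + 8 * |θ|) ^ 2 ≤ 1 := by
    refine abs_le_of_sq_le_sq' ?_ zero_le_one |>.2
    rw [mul_pow, Real.sq_sqrt (abs_nonneg s), ← pow_mul, one_pow]
    exact hs
  have he : ‖ι (US s G - G)‖ ≤ 2 * d := by
    refine abs_le_of_sq_le_sq' ((norm_ι_sq_le _).trans ?_) (by positivity) |>.2
    calc 2 * ‖vS (US s G - G)‖ * ‖dS (US s G - G)‖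
        ≤ 2 * (√|s| * (d * (1 + 8 * |θ|))) * (2 * (d * (1 + 8 * |θ|))) := by
          gcongr
          · exact hv.trans (by gcongr)
          · exact hd'.trans (by gcongr)
      _ = 4 * d ^ 2 * (√|s| * (1 + 8 * |θ|) ^ 2) := by ring
      _ ≤ 4 * d ^ 2 * 1 := by gcongr
      _ = _ := by ring
  linarith [amp_le_add s G]

end Profile

/-! ### Constants -/

/-- A constant, at least `1`, dominating the dependence on the coupling constant. The factor `128` is
that of the phase in `Profile.exists_deriv_G`. -/
def slope (lam : ℝ) : ℝ := 1 + 128 * |lam|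

/-- The smallness required of the profile in `H¹`: it makes the factor `252 a δ` of `bnd_NS_sub`,
multiplied by the coupling constant, at most `1/4`. -/
def smallness (lam : ℝ) : ℝ := (1008 * slope lam ^ 2)⁻¹

/-- The square root of the time beyond which the modified profile is a good approximation. The factor
`16^8` absorbs powers of the logarithm by `log_pow_le`; the others come from `correction_le`. -/
def rootTime (lam m : ℝ) : ℝ := 16 ^ 8 * 1600 * 1008 * slope lam ^ 7 * (1 + m) ^ 11

/-- The size of the remainder in the equation of the modified profile. -/
def remainderSize (lam m : ℝ) : ℝ := 400 * slope lam ^ 4 * m ^ 3 * (1 + m) ^ 8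

theorem one_le_slope (lam : ℝ) : 1 ≤ slope lam := by
  unfold slope
  linarith [abs_nonneg lam]

theorem abs_le_slope (lam : ℝ) : |lam| ≤ slope lam := by
  unfold slope
  linarith [abs_nonneg lam]

theorem smallness_pos (lam : ℝ) : 0 < smallness lam := by
  have := one_le_slope lam
  unfold smallness
  positivity

theorem smallness_mul (lam : ℝ) : 1008 * slope lam ^ 2 * smallness lam = 1 := by
  have := one_le_slope lam
  unfold smallness
  field_simp

theorem smallness_le_one (lam : ℝ) : smallness lam ≤ 1 := by
  have h1 := one_le_pow₀ (one_le_slope lam) (n := 2)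
  nlinarith [smallness_mul lam, smallness_pos lam]

theorem remainderSize_nonneg (lam : ℝ) {m : ℝ} (hm : 0 ≤ m) : 0 ≤ remainderSize lam m := by
  have := one_le_slope lam
  unfold remainderSize
  positivity

theorem rootTime_ge (lam : ℝ) {m : ℝ} (hm : 0 ≤ m) : 16 ^ 8 ≤ rootTime lam m := by
  have h1 := one_le_pow₀ (one_le_slope lam) (n := 7)
  have h2 := one_le_pow₀ (show (1 : ℝ) ≤ 1 + m by linarith) (n := 11)
  unfold rootTime
  calc (16 : ℝ) ^ 8 = 16 ^ 8 * 1 * 1 * 1 * 1 := by norm_num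
    _ ≤ _ := by gcongr <;> norm_num

theorem log_pow_le {x : ℝ} (hx : 0 < x) (h : 0 ≤ Real.log x) :
    Real.log x ^ 8 ≤ 16 ^ 8 * √x := by
  have h1 := Real.log_le_rpow_div hx.le (show (0 : ℝ) < 1 / 16 by norm_num)
  calc Real.log x ^ 8 ≤ (x ^ (1 / 16 : ℝ) / (1 / 16)) ^ 8 := pow_le_pow_left₀ h h1 8
    _ = 16 ^ 8 * (x ^ (1 / 16 : ℝ)) ^ 8 := by ring
    _ = 16 ^ 8 * √x := by
      rw [Real.sqrt_eq_rpow, ← Real.rpow_mul_natCast hx.le]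
      norm_num

section LargeTime

variable {lam m t : ℝ}

theorem abs_of_large (ht : t ≤ -(rootTime lam m) ^ 2) : |t| = -t :=
  abs_of_nonpos (ht.trans (by nlinarith [sq_nonneg (rootTime lam m)]))

theorem rootTime_le_sqrt (ht : t ≤ -(rootTime lam m) ^ 2) :
    rootTime lam m ≤ √|t| :=
  Real.le_sqrt_of_sq_le (by rw [abs_of_large ht]; linarith)

theorem neg_of_large (hm : 0 ≤ m) (ht : t ≤ -(rootTime lam m) ^ 2) : t < 0 := by
  have := rootTime_ge lam hm
  have h2 : 0 < rootTime lam m ^ 2 := by positivity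
  linarith

theorem eight_le_log (hm : 0 ≤ m) (ht : t ≤ -(rootTime lam m) ^ 2) : 8 ≤ Real.log |t| := by
  have h1 := rootTime_ge lam hm
  rw [Real.le_log_iff_exp_le (abs_pos.2 (neg_of_large hm ht).ne), abs_of_large ht]
  have h2 : Real.exp 8 ≤ 3 ^ 8 := by
    have : Real.exp 8 = Real.exp 1 ^ 8 := by rw [← Real.exp_nat_mul]; norm_num
    rw [this]
    exact pow_le_pow_left₀ (Real.exp_pos _).le (by linarith [Real.exp_one_lt_d9]) 8
  nlinarith

theorem log_pow_le_of_large (hm : 0 ≤ m) (ht : t ≤ -(rootTime lam m) ^ 2) {n : ℕ} (hn : n ≤ 8) :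
    Real.log |t| ^ n ≤ 16 ^ 8 * √|t| := by
  have h8 := eight_le_log hm ht
  exact (pow_le_pow_right₀ (by linarith) hn).trans
    (log_pow_le (abs_pos.2 (neg_of_large hm ht).ne) (by linarith))

/-- Beyond the threshold, powers of `log |t|` are dominated by `|t|`. -/
theorem mul_log_pow_le {c : ℝ} (hm : 0 ≤ m) (ht : t ≤ -(rootTime lam m) ^ 2) {n : ℕ} (hn : n ≤ 8)
    (hc0 : 0 ≤ c) (hc : c * 16 ^ 8 ≤ rootTime lam m) : c * Real.log |t| ^ n ≤ |t| := by
  calc c * Real.log |t| ^ n ≤ c * (16 ^ 8 * √|t|) := by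
        have := log_pow_le_of_large hm ht hn
        gcongr
    _ = c * 16 ^ 8 * √|t| := by ring
    _ ≤ √|t| * √|t| := by
        have := hc.trans (rootTime_le_sqrt ht)
        gcongr
    _ = |t| := Real.mul_self_sqrt (abs_nonneg t)

theorem pow_mul_pow_le_rootTime (hm : 0 ≤ m) {j k : ℕ} (hj : j ≤ 7) (hk : k ≤ 11) :
    slope lam ^ j * (1 + m) ^ k * 16 ^ 8 ≤ rootTime lam m := by
  have h1 := pow_le_pow_right₀ (one_le_slope lam) hj
  have h2 := pow_le_pow_right₀ (show (1 : ℝ) ≤ 1 + m by linarith) hk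
  have h0 := one_le_slope lam
  unfold rootTime
  calc slope lam ^ j * (1 + m) ^ k * 16 ^ 8 ≤ slope lam ^ 7 * (1 + m) ^ 11 * 16 ^ 8 := by gcongr
    _ = 16 ^ 8 * 1 * slope lam ^ 7 * (1 + m) ^ 11 := by ring
    _ ≤ 16 ^ 8 * (1600 * 1008) * slope lam ^ 7 * (1 + m) ^ 11 := by gcongr; norm_num
    _ = _ := by ring

/-- The correction to the modified profile is small beyond the threshold. -/
theorem correction_le (hm : 0 ≤ m) (ht : t ≤ -(rootTime lam m) ^ 2) {n : ℕ} (hn : n ≤ 8) :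
    4 * |lam| * remainderSize lam m / |t| * Real.log |t| ^ n ≤ smallness lam := by
  have hs := one_le_slope lam
  have ht0 : 0 < |t| := abs_pos.2 (neg_of_large hm ht).ne
  have hB := remainderSize_nonneg lam hm
  have key := mul_log_pow_le (c := 1600 * 1008 * slope lam ^ 7 * (1 + m) ^ 11) hm ht hn
    (by positivity) (le_of_eq (by unfold rootTime; ring))
  have hlog : 0 ≤ Real.log |t| ^ n := pow_nonneg (by linarith [eight_le_log hm ht]) n
  have h1 : 4 * |lam| * remainderSize lam m ≤ 1600 * slope lam ^ 5 * (1 + m) ^ 11 := by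
    unfold remainderSize
    calc 4 * |lam| * (400 * slope lam ^ 4 * m ^ 3 * (1 + m) ^ 8)
        ≤ 4 * slope lam * (400 * slope lam ^ 4 * (1 + m) ^ 3 * (1 + m) ^ 8) := by
          have := abs_le_slope lam
          gcongr
          linarith
      _ = _ := by ring
  rw [div_mul_eq_mul_div, div_le_iff₀ ht0]
  have h2 : 1600 * slope lam ^ 5 * (1 + m) ^ 11 =
      smallness lam * (1600 * 1008 * slope lam ^ 7 * (1 + m) ^ 11) := by
    have := smallness_mul lam
    linear_combination (-1600 * slope lam ^ 5 * (1 + m) ^ 11) * this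
  calc 4 * |lam| * remainderSize lam m * Real.log |t| ^ n
      ≤ 1600 * slope lam ^ 5 * (1 + m) ^ 11 * Real.log |t| ^ n := by gcongr
    _ = smallness lam * (1600 * 1008 * slope lam ^ 7 * (1 + m) ^ 11 * Real.log |t| ^ n) := by
        rw [h2]; ring
    _ ≤ _ := mul_le_mul_of_nonneg_left key (smallness_pos lam).le

end LargeTime

/-! ### The approximate solution in the interaction picture -/

theorem norm_vS_FS_symm (p : Sig) : ‖vS (FS.symm p)‖ = ‖vS p‖ := by
  rw [← norm_vS_FS, LinearIsometryEquiv.apply_symm_apply]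

theorem hasDerivAt_FS_symm {f : ℝ → Sig} {f' : Sig} {t : ℝ} (h : HasDerivAt f f' t) :
    HasDerivAt (fun τ => FS.symm (f τ)) (FS.symm f') t :=
  ((FS.symm.toContinuousLinearEquiv : Sig →L[ℂ] Sig).restrictScalars
    ℝ).hasFDerivAt.comp_hasDerivAt t h

theorem norm_xS_FS_symm (p : Sig) : ‖xS (FS.symm p)‖ = ‖dS p‖ := by
  rw [← norm_dS_FS, LinearIsometryEquiv.apply_symm_apply]

theorem norm_dS_FS_symm (p : Sig) : ‖dS (FS.symm p)‖ = ‖xS p‖ := by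
  rw [← norm_xS_FS, LinearIsometryEquiv.apply_symm_apply]

namespace Profile

variable {m d : ℝ} (D : Profile m d) (lam : ℝ)

/-- The approximate solution `𝓕⁻¹(p e^{iλ|p|² log|t|})`, in the interaction picture. -/
def W (t : ℝ) : Sig := FS.symm (D.G (lam * Real.log |t|))

/-- The remainder in the equation satisfied by the approximate solution. -/
def R (t : ℝ) : Sig :=
  NS t (D.W lam t) - ((|t|⁻¹ : ℝ) : ℂ) • FS.symm (cubS (D.G (lam * Real.log |t|)))

theorem continuousOn_phase : ContinuousOn (fun t : ℝ => lam * Real.log |t|) (Set.Iio 0) := by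
  refine continuousOn_const.mul (ContinuousOn.log continuous_abs.continuousOn fun t ht => ?_)
  exact (abs_pos.2 (ne_of_lt ht)).ne'

theorem continuousOn_G :
    ContinuousOn (fun t => D.G (lam * Real.log |t|)) (Set.Iio 0) :=
  (continuous_profileS D.hasAC).comp_continuousOn (continuousOn_phase lam)

theorem continuousOn_W : ContinuousOn (D.W lam) (Set.Iio 0) :=
  FS.symm.continuous.comp_continuousOn (D.continuousOn_G lam)

theorem _root_.ContinuousOn.NS {s : Set ℝ} {f : ℝ → Sig} (hf : ContinuousOn f s) :
    ContinuousOn (fun t => CubicNLS.NS t (f t)) s :=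
  Continuous.comp_continuousOn (g := fun p : ℝ × Sig => CubicNLS.NS p.1 p.2)
    (f := fun t => (t, f t)) continuous_NS_uncurry (continuousOn_id.prodMk hf)

theorem continuousOn_R : ContinuousOn (D.R lam) (Set.Iio 0) := by
  have h1 : ContinuousOn (fun t : ℝ => ((|t|⁻¹ : ℝ) : ℂ)) (Set.Iio 0) :=
    Complex.continuous_ofReal.comp_continuousOn
      (continuous_abs.continuousOn.inv₀ fun t ht => (abs_pos.2 (ne_of_lt ht)).ne')
  have h2 : ContinuousOn (fun t => FS.symm (cubS (D.G (lam * Real.log |t|)))) (Set.Iio 0) :=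
    (FS.symm.continuous.comp continuous_cubS).comp_continuousOn (D.continuousOn_G lam)
  have h3 := h1.smul h2
  exact (D.continuousOn_W lam).NS.sub h3

/-- The approximate solution solves the equation of `vf` up to the remainder: its Fourier transform
solves `v' = -iλ|t|⁻¹|v|²v` exactly. -/
theorem hasDerivAt_W {t : ℝ} (ht : t < 0) :
    HasDerivAt (D.W lam) ((-(Complex.I * lam)) • (NS t (D.W lam t) - D.R lam t)) t := by
  have h1 : HasDerivAt (fun t : ℝ => lam * Real.log |t|) (lam * t⁻¹) t := by
    simp only [Real.log_abs]
    exact (Real.hasDerivAt_log ht.ne).const_mul lam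
  have h2 : HasDerivAt (fun t => D.G (lam * Real.log |t|))
      ((lam * t⁻¹) • Complex.I • cubS (D.G (lam * Real.log |t|))) t :=
    HasDerivAt.scomp (g₁ := D.G) (h := fun t => lam * Real.log |t|) t
      (hasDerivAt_profileS D.hasAC (lam * Real.log |t|)) h1
  have h3 := hasDerivAt_FS_symm h2
  refine h3.congr_deriv ?_
  have e : NS t (D.W lam t) - D.R lam t =
      ((|t|⁻¹ : ℝ) : ℂ) • FS.symm (cubS (D.G (lam * Real.log |t|))) := sub_sub_cancel _ _
  rw [e]
  rw [show |t|⁻¹ = (-t)⁻¹ by rw [abs_of_neg ht]]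
  generalize cubS (D.G (lam * Real.log |t|)) = c
  have e2 : ((lam * t⁻¹ : ℝ) • Complex.I • c : Sig) =
      (-(Complex.I * lam)) • (((-t)⁻¹ : ℝ) : ℂ) • c := by
    have e3 : ((lam * t⁻¹ : ℝ) • Complex.I • c : Sig) =
        ((lam * t⁻¹ : ℝ) : ℂ) • Complex.I • c := rfl
    rw [e3, smul_smul, smul_smul]
    congr 1
    rw [inv_neg]
    push_cast
    ring
  rw [e2, map_smul, map_smul]

theorem norm_vS_W_le' (t : ℝ) : ‖vS (D.W lam t)‖ ≤ m := by
  rw [W, norm_vS_FS_symm]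
  exact (norm_vS_profileS_le D.hasAC _).trans D.norm_vS_le

theorem norm_dS_W_le (t : ℝ) : ‖dS (D.W lam t)‖ ≤ m := by
  rw [W, norm_dS_FS_symm]
  exact D.norm_xS_G_le _

variable {lam}

/-- The weighted norm in terms of the small size `d`, as the contraction argument requires. -/
theorem norm_xS_W_le {t : ℝ} (ht : 1 ≤ Real.log |t|) :
    ‖xS (D.W lam t)‖ ≤ d * (slope lam * Real.log |t|) := by
  rw [W, norm_xS_FS_symm]
  refine (D.norm_dS_G_le _).trans (mul_le_mul_of_nonneg_left ?_ D.d_nonneg)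
  rw [abs_mul, abs_of_nonneg (zero_le_one.trans ht), slope]
  nlinarith [abs_nonneg lam]

/-- The weighted norm in terms of the size `m`, a factor which the final estimate has to retain. -/
theorem norm_xS_W_le' {t : ℝ} (ht : 1 ≤ Real.log |t|) :
    ‖xS (D.W lam t)‖ ≤ 2 * m * (slope lam * (1 + m) ^ 2 * Real.log |t|) := by
  have hm := D.m_nonneg
  rw [W, norm_xS_FS_symm]
  obtain ⟨-, -, -, -, h, -⟩ := D.exists_deriv_G (lam * Real.log |t|)
  refine h.trans (mul_le_mul_of_nonneg_left ?_ (by positivity))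
  rw [abs_mul, abs_of_nonneg (zero_le_one.trans ht), slope]
  have h0 : 0 ≤ |lam| * Real.log |t| := mul_nonneg (abs_nonneg _) (by linarith)
  have h1 : m ^ 2 ≤ (1 + m) ^ 2 := by gcongr; linarith
  have h2 : 1 ≤ (1 + m) ^ 2 := one_le_pow₀ (by linarith)
  nlinarith [mul_le_mul h2 ht zero_le_one (by positivity)]

/-- The sup norm of the approximate solution is controlled by the small size `d` alone. -/
theorem amp_W_le {t : ℝ} (ht : t ≤ -(rootTime lam m) ^ 2) :
    amp t (D.W lam t) ≤ (√|t|)⁻¹ * (4 * d) := by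
  have hm := D.m_nonneg
  have h8 := eight_le_log hm ht
  have ht0 := (neg_of_large hm ht).ne
  rw [amp_eq ht0]
  refine mul_le_mul_of_nonneg_left ?_ (by positivity)
  have e : ‖ι (dualS t (D.W lam t))‖ = amp (-t⁻¹) (D.G (lam * Real.log |t|)) := by
    rw [dualS, W, LinearIsometryEquiv.apply_symm_apply, amp]
  rw [e]
  refine D.amp_G_le ?_
  rw [abs_neg, abs_inv, abs_mul, abs_of_nonneg (show 0 ≤ Real.log |t| by linarith)]
  have h0 := pow_mul_pow_le_rootTime (lam := lam) hm (show 4 ≤ 7 by norm_num)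
    (show 0 ≤ 11 by norm_num)
  rw [pow_zero, mul_one] at h0
  have h1 := mul_log_pow_le (c := slope lam ^ 4) (n := 4) hm ht (by norm_num)
    (by have := one_le_slope lam; positivity) h0
  rw [inv_mul_le_iff₀ (abs_pos.2 ht0), mul_one]
  refine le_trans ?_ h1
  rw [← mul_pow]
  have hl : 0 ≤ |lam| * Real.log |t| := mul_nonneg (abs_nonneg _) (by linarith)
  refine pow_le_pow_left₀ (by positivity) ?_ 4
  rw [slope]
  nlinarith

/-- On the Fourier side, the remainder is the error made by replacing `NS s` by `cubS` at the small
time `s = -1/t`. -/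
theorem FS_R {t : ℝ} (ht : t ≠ 0) : FS (D.R lam t) = ((|t|⁻¹ : ℝ) : ℂ) •
    (NS (-t⁻¹) (D.G (lam * Real.log |t|)) - cubS (D.G (lam * Real.log |t|))) := by
  rw [R, map_sub FS, FS_NS ht, map_smul, LinearIsometryEquiv.apply_symm_apply, dualS, W,
    LinearIsometryEquiv.apply_symm_apply, NS, neg_neg]
  exact (smul_sub _ _ _).symm

/-- The remainder is of size `O(log^4|t| / t²)` in `Σ`, and `O(log²|t| / t²)` in `L²`. -/
theorem norm_R_le {t : ℝ} (ht : t ≤ -(rootTime lam m) ^ 2) :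
    ‖vS (D.R lam t)‖ ≤ remainderSize lam m / t ^ 2 * Real.log |t| ^ 2 ∧
    ‖xS (D.R lam t)‖ ≤ remainderSize lam m / t ^ 2 * Real.log |t| ^ 4 ∧
    ‖dS (D.R lam t)‖ ≤ remainderSize lam m / t ^ 2 * Real.log |t| ^ 4 := by
  have hm := D.m_nonneg
  have hs := one_le_slope lam
  have h8 := eight_le_log hm ht
  have ht0 := (neg_of_large hm ht).ne
  have hta : 0 < |t| := abs_pos.2 ht0
  set L := Real.log |t| with hL
  have hΛ : 1 + 128 * |lam * L| * m ^ 2 ≤ slope lam * (1 + m) ^ 2 * L := by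
    rw [abs_mul, abs_of_nonneg (show 0 ≤ L by linarith), slope]
    have h0 : 0 ≤ |lam| * L := mul_nonneg (abs_nonneg _) (by linarith)
    have h1 : m ^ 2 ≤ (1 + m) ^ 2 := by gcongr; linarith
    have h2 : 1 ≤ (1 + m) ^ 2 := one_le_pow₀ (by linarith)
    nlinarith [mul_le_mul h2 (show 1 ≤ L by linarith) zero_le_one (by positivity)]
  have hsm : |(-t⁻¹)| * (slope lam * (1 + m) ^ 2 * L) ^ 3 ≤ 1 := by
    rw [abs_neg, abs_inv, inv_mul_le_iff₀ hta, mul_one]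
    have h1 := mul_log_pow_le (c := slope lam ^ 3 * (1 + m) ^ 6) (n := 3) hm ht (by norm_num)
      (by positivity) (pow_mul_pow_le_rootTime (lam := lam) hm (by norm_num) (by norm_num))
    refine le_trans (le_of_eq ?_) h1
    ring
  obtain ⟨b1, b2, b3⟩ := D.norm_NS_sub_cubS_le hΛ hsm
  have hc : ‖((|t|⁻¹ : ℝ) : ℂ)‖ = |t|⁻¹ := by
    rw [Complex.norm_real, norm_eq_abs, abs_of_nonneg (by positivity)]
  have hst : |(-t⁻¹)| = |t|⁻¹ := by rw [abs_neg, abs_inv]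
  have hsq : |t|⁻¹ * |t|⁻¹ = (t ^ 2)⁻¹ := by rw [← mul_inv, ← sq, sq_abs]
  have e2 : |t|⁻¹ * (400 * |(-t⁻¹)| * m ^ 3 * (slope lam * (1 + m) ^ 2 * L) ^ 2) ≤
      remainderSize lam m / t ^ 2 * L ^ 2 := by
    calc _ = (t ^ 2)⁻¹ * (400 * (slope lam ^ 2) * m ^ 3 * (1 + m) ^ 4 * L ^ 2) := by
          rw [hst, ← hsq]; ring
      _ ≤ (t ^ 2)⁻¹ * (400 * (slope lam ^ 4) * m ^ 3 * (1 + m) ^ 8 * L ^ 2) := by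
          have h1 := pow_le_pow_right₀ hs (show 2 ≤ 4 by norm_num)
          have h2 := pow_le_pow_right₀ (show 1 ≤ 1 + m by linarith) (show 4 ≤ 8 by norm_num)
          gcongr
      _ = _ := by rw [remainderSize]; ring
  have e4 : |t|⁻¹ * (400 * |(-t⁻¹)| * m ^ 3 * (slope lam * (1 + m) ^ 2 * L) ^ 4) =
      remainderSize lam m / t ^ 2 * L ^ 4 := by
    rw [hst, remainderSize, div_eq_inv_mul, ← hsq]
    ring
  refine ⟨?_, ?_, ?_⟩
  · rw [← norm_vS_FS, D.FS_R ht0, map_smul, norm_smul, hc]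
    exact (mul_le_mul_of_nonneg_left b1 (by positivity)).trans e2
  · rw [← norm_dS_FS, D.FS_R ht0, map_smul, norm_smul, hc, ← e4]
    exact mul_le_mul_of_nonneg_left b2 (by positivity)
  · rw [← norm_xS_FS, D.FS_R ht0, map_smul, norm_smul, hc, ← e4]
    exact mul_le_mul_of_nonneg_left b3 (by positivity)

end Profile

/-! ### Integration from time `-∞` -/

/-- An explicit primitive dominating that of `log^k|s| / s²`. -/
theorem hasDerivAt_tail (k : ℕ) {s : ℝ} (hs : s < 0) :
    HasDerivAt (fun s : ℝ => 2 * Real.log |s| ^ k / |s|)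
      (2 * (Real.log |s| ^ k - k * Real.log |s| ^ (k - 1)) / s ^ 2) s := by
  have h1 := (((Real.hasDerivAt_log hs.ne).pow k).mul (hasDerivAt_inv hs.ne)).const_mul (-2)
  have h2 : HasDerivAt (fun s : ℝ => -2 * (Real.log s ^ k * s⁻¹))
      (2 * (Real.log |s| ^ k - k * Real.log |s| ^ (k - 1)) / s ^ 2) s := by
    refine h1.congr_deriv ?_
    rw [Real.log_abs]
    simp only [Pi.pow_apply]
    field_simp
    ring
  refine h2.congr_of_eventuallyEq ?_
  filter_upwards [Iio_mem_nhds hs] with r hr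
  rw [abs_of_neg hr, Real.log_neg_eq_log]
  have : r ≠ 0 := ne_of_lt hr
  field_simp

/-- The lower order term is absorbed because `2k ≤ 8 ≤ log|s|`. -/
theorem le_deriv_tail {k : ℕ} (hk : k ≤ 4) {s : ℝ} (h8 : 8 ≤ Real.log |s|) :
    Real.log |s| ^ k / s ^ 2 ≤ 2 * (Real.log |s| ^ k - k * Real.log |s| ^ (k - 1)) / s ^ 2 := by
  refine div_le_div_of_nonneg_right ?_ (sq_nonneg s)
  rcases k with _ | k
  · norm_num
  · have hk' : ((k + 1 : ℕ) : ℝ) ≤ 4 := by exact_mod_cast hk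
    have hp : 0 ≤ Real.log |s| ^ k := by positivity
    rw [Nat.add_sub_cancel, pow_succ]
    nlinarith

theorem log_mono_of_neg {t b : ℝ} (hb : b < 0) (ht : t ≤ b) : Real.log |b| ≤ Real.log |t| := by
  refine Real.log_le_log (abs_pos.2 hb.ne) ?_
  rw [abs_of_neg hb, abs_of_neg (ht.trans_lt hb)]
  linarith

theorem integrableOn_tail {k : ℕ} (hk : k ≤ 4) {t : ℝ} (ht : t < 0) (h8 : 8 ≤ Real.log |t|) :
    IntegrableOn (fun s : ℝ => Real.log |s| ^ k / s ^ 2) (Set.Iic t) ∧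
      ∫ s in Set.Iic t, Real.log |s| ^ k / s ^ 2 ≤ 2 * Real.log |t| ^ k / |t| := by
  have hneg : ∀ {s}, s ≤ t → s < 0 := fun h => lt_of_le_of_lt h ht
  have h8' : ∀ {s}, s ≤ t → 8 ≤ Real.log |s| := fun h => h8.trans (log_mono_of_neg ht h)
  have hc0 : ContinuousOn (fun s : ℝ => Real.log |s|) (Set.Iic t) :=
    ContinuousOn.log continuous_abs.continuousOn fun s hs => (abs_pos.2 (hneg hs).ne).ne'
  have hc : ContinuousOn (fun s : ℝ => Real.log |s| ^ k / s ^ 2) (Set.Iic t) :=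
    (hc0.pow k).div (by fun_prop) fun s hs => pow_ne_zero 2 (hneg hs).ne
  have hint : ∀ a, IntervalIntegrable (fun s : ℝ => Real.log |s| ^ k / s ^ 2) volume
      (min a t) t := fun a => (hc.mono (by
        rw [Set.uIcc_of_le (min_le_right a t)]
        exact fun s hs => hs.2)).intervalIntegrable
  have hbound : ∀ a ≤ t, ∫ s in a..t, Real.log |s| ^ k / s ^ 2 ≤ 2 * Real.log |t| ^ k / |t| := by
    intro a ha
    have hda : ∀ s ∈ Set.uIcc a t, HasDerivAt (fun s : ℝ => 2 * Real.log |s| ^ k / |s|)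
        (2 * (Real.log |s| ^ k - k * Real.log |s| ^ (k - 1)) / s ^ 2) s := fun s hs => by
      rw [Set.uIcc_of_le ha] at hs
      exact hasDerivAt_tail k (hneg hs.2)
    have hci : IntervalIntegrable (fun s : ℝ => 2 * (Real.log |s| ^ k -
        k * Real.log |s| ^ (k - 1)) / s ^ 2) volume a t := by
      refine ContinuousOn.intervalIntegrable ?_
      rw [Set.uIcc_of_le ha]
      have hc1 := hc0.mono (Set.Icc_subset_Iic_self : Set.Icc a t ⊆ _)
      exact (continuousOn_const.mul ((hc1.pow k).sub (continuousOn_const.mul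
        (hc1.pow (k - 1))))).div (by fun_prop) fun s hs => pow_ne_zero 2 (hneg hs.2).ne
    have hi := hint a
    rw [min_eq_left ha] at hi
    calc ∫ s in a..t, Real.log |s| ^ k / s ^ 2
        ≤ ∫ s in a..t, 2 * (Real.log |s| ^ k - k * Real.log |s| ^ (k - 1)) / s ^ 2 :=
          intervalIntegral.integral_mono_on ha hi hci fun s hs => le_deriv_tail hk (h8' hs.2)
      _ = 2 * Real.log |t| ^ k / |t| - 2 * Real.log |a| ^ k / |a| :=
          intervalIntegral.integral_eq_sub_of_hasDerivAt hda hci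
      _ ≤ _ := by
          have : 0 ≤ Real.log |a| := by linarith [h8' ha]
          have : 0 ≤ 2 * Real.log |a| ^ k / |a| := by positivity
          linarith
  have hnn : ∀ s ≤ t, 0 ≤ Real.log |s| ^ k / s ^ 2 := fun s hs => by
    have : 0 ≤ Real.log |s| := by linarith [h8' hs]
    positivity
  have hI : IntegrableOn (fun s : ℝ => Real.log |s| ^ k / s ^ 2) (Set.Iic t) := by
    refine integrableOn_Iic_of_intervalIntegral_norm_bounded (l := atBot)
      (a := fun a : ℝ => min a t) (2 * Real.log |t| ^ k / |t|) t
      (fun a => (intervalIntegrable_iff_integrableOn_Ioc_of_le (min_le_right a t)).1 (hint a))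
      ?_ (Eventually.of_forall fun a => ?_)
    · exact tendsto_atBot_mono (fun a => min_le_left a t) tendsto_id
    · refine le_trans (le_of_eq ?_) (hbound (min a t) (min_le_right a t))
      refine intervalIntegral.integral_congr fun s hs => ?_
      rw [Set.uIcc_of_le (min_le_right a t)] at hs
      exact norm_of_nonneg (hnn s hs.2)
  refine ⟨hI, ?_⟩
  exact le_of_tendsto (intervalIntegral_tendsto_integral_Iic t hI tendsto_id)
    ((eventually_le_atBot t).mono fun a ha => hbound a ha)

theorem tail_integral_bound {E : Type*} [NormedAddCommGroup E] [NormedSpace ℝ E] {g : ℝ → E}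
    {k : ℕ} (hk : k ≤ 4) {t c : ℝ} (ht : t < 0) (h8 : 8 ≤ Real.log |t|)
    (hg : ∀ s ≤ t, ‖g s‖ ≤ c / s ^ 2 * Real.log |s| ^ k) :
    ‖∫ s in Set.Iic t, g s‖ ≤ 2 * c / |t| * Real.log |t| ^ k := by
  obtain ⟨hI, hle⟩ := integrableOn_tail hk ht h8
  have hc : 0 ≤ c := by
    have h1 := (norm_nonneg _).trans (hg t le_rfl)
    have h2 : 0 < Real.log |t| ^ k := by positivity
    have h3 : 0 ≤ c / t ^ 2 := nonneg_of_mul_nonneg_left h1 h2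
    have h4 : 0 < t ^ 2 := by have := ht.ne; positivity
    have := mul_nonneg h3 h4.le
    rwa [div_mul_cancel₀ _ h4.ne'] at this
  have h := norm_integral_le_of_norm_le (hI.const_mul c) (f := g) (by
    filter_upwards [ae_restrict_mem measurableSet_Iic] with s hs
    refine (hg s hs).trans (le_of_eq ?_)
    ring)
  refine h.trans ?_
  rw [integral_const_mul]
  calc c * ∫ s in Set.Iic t, Real.log |s| ^ k / s ^ 2
      ≤ c * (2 * Real.log |t| ^ k / |t|) := mul_le_mul_of_nonneg_left hle hc
    _ = _ := by ring

/-- The bounds `‖p‖ ≤ cL²`, `‖xp‖ ≤ cL⁴`, `‖∂p‖ ≤ c(1+m)L⁴`. The better bound of the `L²` norm is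
what allows a growth of `W` in `Σ` like `log|t|` to be compensated. -/
def Bnd (m L c : ℝ) (p : Sig) : Prop :=
  ‖vS p‖ ≤ c * L ^ 2 ∧ ‖xS p‖ ≤ c * L ^ 4 ∧ ‖dS p‖ ≤ c * (1 + m) * L ^ 4

theorem Bnd.add {m L c c' : ℝ} {p q : Sig} (h : Bnd m L c p) (h' : Bnd m L c' q) :
    Bnd m L (c + c') (p + q) := by
  refine ⟨?_, ?_, ?_⟩ <;> rw [map_add] <;> refine (norm_add_le _ _).trans ?_
  · linarith [h.1, h'.1]
  · linarith [h.2.1, h'.2.1]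
  · linarith [h.2.2, h'.2.2]

theorem Bnd.mono {m L c c' : ℝ} (hm : 0 ≤ m) {p : Sig} (h : Bnd m L c p) (hc : c ≤ c') :
    Bnd m L c' p := by
  refine ⟨h.1.trans ?_, h.2.1.trans ?_, h.2.2.trans ?_⟩ <;> gcongr

theorem bnd_zero {m L c : ℝ} (hm : 0 ≤ m) (hc : 0 ≤ c) : Bnd m L c 0 := by
  refine ⟨?_, ?_, ?_⟩ <;> rw [map_zero, norm_zero] <;> positivity

theorem Bnd.norm_le {m L c : ℝ} (hm : 0 ≤ m) (hL : 1 ≤ L) {p : Sig} (h : Bnd m L c p) :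
    ‖p‖ ≤ c * (1 + m) * L ^ 4 := by
  have h2 : 0 < L ^ 2 := by positivity
  have hc : 0 ≤ c := nonneg_of_mul_nonneg_left ((norm_nonneg _).trans h.1) h2
  have h1 : c * L ^ 4 ≤ c * (1 + m) * L ^ 4 := by
    gcongr
    nlinarith
  refine norm_S_le ?_ (h.2.2) (h.2.1.trans h1)
  refine h.1.trans (le_trans ?_ h1)
  have := pow_le_pow_right₀ hL (show 2 ≤ 4 by norm_num)
  gcongr

section Tail

variable {m b c : ℝ} {F : ℝ → Sig}

theorem Bnd.integrableOn (hm : 0 ≤ m) (hb : b < 0) (h8 : 8 ≤ Real.log |b|)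
    (hF : ContinuousOn F (Set.Iio b))
    (h : ∀ t < b, Bnd m (Real.log |t|) (c / t ^ 2) (F t)) {t : ℝ} (ht : t < b) :
    IntegrableOn F (Set.Iic t) := by
  have hI := (integrableOn_tail (k := 4) le_rfl (ht.trans hb)
    (h8.trans (log_mono_of_neg hb ht.le))).1.const_mul (c * (1 + m))
  refine hI.mono' ((hF.mono fun s hs => lt_of_le_of_lt hs ht).aestronglyMeasurable
    measurableSet_Iic) ?_
  filter_upwards [ae_restrict_mem measurableSet_Iic] with s hs
  have hsb : s < b := lt_of_le_of_lt hs ht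
  refine ((h s hsb).norm_le hm (by linarith [log_mono_of_neg hb hsb.le])).trans (le_of_eq ?_)
  ring

/-- The bounds of the primitive vanishing at `-∞`. -/
theorem Bnd.integral (hm : 0 ≤ m) (hb : b < 0) (h8 : 8 ≤ Real.log |b|)
    (hF : ContinuousOn F (Set.Iio b))
    (h : ∀ t < b, Bnd m (Real.log |t|) (c / t ^ 2) (F t)) {t : ℝ} (ht : t < b) :
    Bnd m (Real.log |t|) (2 * c / |t|) (∫ s in Set.Iic t, F s) := by
  have hI := Bnd.integrableOn hm hb h8 hF h ht
  have ht0 := ht.trans hb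
  have h8' := h8.trans (log_mono_of_neg hb ht.le)
  have hlt : ∀ {s}, s ≤ t → s < b := fun hs => lt_of_le_of_lt hs ht
  refine ⟨?_, ?_, ?_⟩
  · rw [← ContinuousLinearMap.integral_comp_comm vS hI]
    exact tail_integral_bound (by norm_num) ht0 h8' fun s hs => (h s (hlt hs)).1
  · rw [← ContinuousLinearMap.integral_comp_comm xS hI]
    exact tail_integral_bound (by norm_num) ht0 h8' fun s hs => (h s (hlt hs)).2.1
  · rw [← ContinuousLinearMap.integral_comp_comm dS hI]
    have := tail_integral_bound (k := 4) (g := fun s => dS (F s)) (c := c * (1 + m))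
      (by norm_num) ht0 h8' fun s hs => ((h s (hlt hs)).2.2).trans (le_of_eq (by ring))
    refine this.trans (le_of_eq (by ring))

theorem hasDerivAt_tail_integral (hF : ContinuousOn F (Set.Iio b))
    (hI : ∀ t < b, IntegrableOn F (Set.Iic t)) {t : ℝ} (ht : t < b) :
    HasDerivAt (fun t => ∫ s in Set.Iic t, F s) (F t) t := by
  have h1 : HasDerivAt (fun u => (∫ s in Set.Iic t, F s) + ∫ s in t..u, F s) (F t) t :=
    (intervalIntegral.integral_hasDerivAt_right IntervalIntegrable.refl
      (hF.stronglyMeasurableAtFilter isOpen_Iio t ht)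
      (hF.continuousAt (Iio_mem_nhds ht))).const_add _
  refine h1.congr_of_eventuallyEq ?_
  filter_upwards [Iio_mem_nhds ht] with u hu
  rw [← intervalIntegral.integral_Iic_sub_Iic (hI t ht) (hI u hu)]
  abel

end Tail

/-! ### A fixed point argument near time `-∞` -/

/-- Picard iteration from `-∞`: if a vector field contracts the bounds `Bnd`, then it has an
integral curve subject to these bounds. -/
theorem exists_solution_of_contracting {m b K : ℝ} (hm : 0 ≤ m) (hK : 0 ≤ K) (hb : b < 0)
    (h8 : 8 ≤ Real.log |b|) {V : ℝ → Sig → Sig}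
    (hc : ∀ h : ℝ → Sig, ContinuousOn h (Set.Iio b) →
      ContinuousOn (fun t => V t (h t)) (Set.Iio b))
    (h0 : ∀ t < b, Bnd m (Real.log |t|) (K / 4 / t ^ 2) (V t 0))
    (hV : ∀ t < b, ∀ (p q : Sig) (η : ℝ), 0 ≤ η → Bnd m (Real.log |t|) (K / |t|) p →
      Bnd m (Real.log |t|) (K / |t|) q → Bnd m (Real.log |t|) (η / |t|) (p - q) →
      Bnd m (Real.log |t|) (η / 4 / t ^ 2) (V t p - V t q)) :
    ∃ h : ℝ → Sig, (∀ t < b, Bnd m (Real.log |t|) (K / |t|) (h t)) ∧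
      ∀ t < b, HasDerivAt h (V t (h t)) t := by
  have hL : ∀ {t}, t < b → 8 ≤ Real.log |t| := fun ht => h8.trans (log_mono_of_neg hb ht.le)
  have hneg : ∀ {t}, t < b → t < 0 := fun ht => ht.trans hb
  have hVK : ∀ t < b, ∀ p, Bnd m (Real.log |t|) (K / |t|) p →
      Bnd m (Real.log |t|) (K / 2 / t ^ 2) (V t p) := by
    intro t ht p hp
    have h1 := hV t ht p 0 K hK hp (bnd_zero hm (by positivity)) (by rwa [sub_zero])
    have h2 := h1.add (h0 t ht)
    rw [sub_add_cancel] at h2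
    convert h2 using 1
    ring
  set Φ : (ℝ → Sig) → ℝ → Sig := fun h t => ∫ s in Set.Iic t, V s (h s) with hΦ
  have hint : ∀ h : ℝ → Sig, ContinuousOn h (Set.Iio b) →
      (∀ t < b, Bnd m (Real.log |t|) (K / |t|) (h t)) → ∀ t < b,
      IntegrableOn (fun t => V t (h t)) (Set.Iic t) := fun h hh hB t ht =>
    Bnd.integrableOn hm hb h8 (hc h hh) (fun s hs => hVK s hs _ (hB s hs)) ht
  have hΦd : ∀ h : ℝ → Sig, ContinuousOn h (Set.Iio b) →
      (∀ t < b, Bnd m (Real.log |t|) (K / |t|) (h t)) → ∀ t < b,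
      HasDerivAt (Φ h) (V t (h t)) t := fun h hh hB t ht =>
    hasDerivAt_tail_integral (hc h hh) (hint h hh hB) ht
  have hΦc : ∀ h : ℝ → Sig, ContinuousOn h (Set.Iio b) →
      (∀ t < b, Bnd m (Real.log |t|) (K / |t|) (h t)) → ContinuousOn (Φ h) (Set.Iio b) :=
    fun h hh hB t ht => (hΦd h hh hB t ht).continuousAt.continuousWithinAt
  have hΦB : ∀ h : ℝ → Sig, ContinuousOn h (Set.Iio b) →
      (∀ t < b, Bnd m (Real.log |t|) (K / |t|) (h t)) → ∀ t < b,
      Bnd m (Real.log |t|) (K / |t|) (Φ h t) := fun h hh hB t ht => by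
    have := Bnd.integral hm hb h8 (hc h hh) (fun s hs => hVK s hs _ (hB s hs)) ht
    convert this using 1
    ring
  have hΦL : ∀ (h k : ℝ → Sig) (η : ℝ), 0 ≤ η → ContinuousOn h (Set.Iio b) →
      (∀ t < b, Bnd m (Real.log |t|) (K / |t|) (h t)) → ContinuousOn k (Set.Iio b) →
      (∀ t < b, Bnd m (Real.log |t|) (K / |t|) (k t)) →
      (∀ t < b, Bnd m (Real.log |t|) (η / |t|) (h t - k t)) → ∀ t < b,
      Bnd m (Real.log |t|) (η / 2 / |t|) (Φ h t - Φ k t) := by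
    intro h k η hη hh hB hk hB' hd t ht
    have e : Φ h t - Φ k t = ∫ s in Set.Iic t, (V s (h s) - V s (k s)) :=
      (integral_sub (hint h hh hB t ht) (hint k hk hB' t ht)).symm
    rw [e]
    have := Bnd.integral (F := fun s => V s (h s) - V s (k s)) hm hb h8
      ((hc h hh).sub (hc k hk))
      (fun s hs => hV s hs _ _ η hη (hB s hs) (hB' s hs) (hd s hs)) ht
    convert this using 1
    ring
  set u : ℕ → ℝ → Sig := fun n => Φ^[n] 0 with hu
  have hus : ∀ n, u (n + 1) = Φ (u n) := fun n => Function.iterate_succ_apply' Φ n 0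
  have hu0 : ContinuousOn (u 0) (Set.Iio b) ∧
      ∀ t < b, Bnd m (Real.log |t|) (K / |t|) (u 0 t) :=
    ⟨continuousOn_const, fun t _ => bnd_zero hm (by positivity)⟩
  have huK : ∀ n, ContinuousOn (u n) (Set.Iio b) ∧
      ∀ t < b, Bnd m (Real.log |t|) (K / |t|) (u n t) := by
    intro n
    induction n with
    | zero => exact hu0
    | succ n ih =>
      rw [hus]
      exact ⟨hΦc _ ih.1 ih.2, hΦB _ ih.1 ih.2⟩
  have hud : ∀ n, ∀ t < b, Bnd m (Real.log |t|) (K * (1 / 2) ^ n / |t|) (u (n + 1) t - u n t) := by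
    intro n
    induction n with
    | zero =>
      intro t ht
      have e : u 0 t = 0 := rfl
      rw [e, sub_zero, pow_zero, mul_one]
      exact (huK 1).2 t ht
    | succ n ih =>
      intro t ht
      rw [hus (n + 1), hus n]
      have h1 := hΦL (u (n + 1)) (u n) (K * (1 / 2) ^ n) (by positivity) (huK _).1 (huK _).2
        (huK _).1 (huK _).2 ih t ht
      rw [hus n] at h1
      convert h1 using 1
      ring
  have hdist : ∀ t < b, ∀ n, dist (u n t) (u (n + 1) t) ≤
      K / |t| * (1 + m) * Real.log |t| ^ 4 * (1 / 2) ^ n := by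
    intro t ht n
    rw [dist_comm, dist_eq_norm]
    refine ((hud n t ht).norm_le hm (by linarith [hL ht])).trans (le_of_eq ?_)
    ring
  have hlim : ∀ t, ∃ y, t < b → Tendsto (fun n => u n t) atTop (𝓝 y) := by
    intro t
    by_cases ht : t < b
    · obtain ⟨y, hy⟩ := cauchySeq_tendsto_of_complete
        (cauchySeq_of_le_geometric (1 / 2) _ (by norm_num) (hdist t ht))
      exact ⟨y, fun _ => hy⟩
    · exact ⟨0, fun h => absurd h ht⟩
  choose h hh using hlim
  have hcomp : ∀ (A : Sig →L[ℂ] L2) (t C : ℝ), t < b →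
      (∀ n, ‖A (u (n + 1) t - u n t)‖ ≤ C * (1 / 2) ^ n) →
      ∀ n, ‖A (u n t - h t)‖ ≤ 2 * C * (1 / 2) ^ n := by
    intro A t C ht hA n
    have h1 := dist_le_of_le_geometric_of_tendsto (1 / 2) C (by norm_num)
      (f := fun n => A (u n t)) (fun n => by
        rw [dist_comm, dist_eq_norm, ← map_sub]
        exact hA n) ((A.continuous.tendsto _).comp (hh t ht)) n
    rw [dist_eq_norm, ← map_sub] at h1
    refine h1.trans (le_of_eq ?_)
    ring
  have hdiff : ∀ n, ∀ t < b,
      Bnd m (Real.log |t|) (2 * K * (1 / 2) ^ n / |t|) (u n t - h t) := by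
    intro n t ht
    refine ⟨?_, ?_, ?_⟩
    · refine (hcomp vS t (K / |t| * Real.log |t| ^ 2) ht (fun n => ?_) n).trans
        (le_of_eq (by ring))
      exact (hud n t ht).1.trans (le_of_eq (by ring))
    · refine (hcomp xS t (K / |t| * Real.log |t| ^ 4) ht (fun n => ?_) n).trans
        (le_of_eq (by ring))
      exact (hud n t ht).2.1.trans (le_of_eq (by ring))
    · refine (hcomp dS t (K / |t| * (1 + m) * Real.log |t| ^ 4) ht (fun n => ?_) n).trans
        (le_of_eq (by ring))
      exact (hud n t ht).2.2.trans (le_of_eq (by ring))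
  have hhB : ∀ t < b, Bnd m (Real.log |t|) (K / |t|) (h t) := by
    intro t ht
    have hcl : ∀ (A : Sig →L[ℂ] L2) (C : ℝ), (∀ n, ‖A (u n t)‖ ≤ C) → ‖A (h t)‖ ≤ C :=
      fun A C hA => le_of_tendsto (((A.continuous.tendsto _).comp (hh t ht)).norm)
        (Eventually.of_forall hA)
    exact ⟨hcl vS _ fun n => ((huK n).2 t ht).1, hcl xS _ fun n => ((huK n).2 t ht).2.1,
      hcl dS _ fun n => ((huK n).2 t ht).2.2⟩
  have hgeo : Tendsto (fun n : ℕ => ((1 : ℝ) / 2) ^ n) atTop (𝓝 0) :=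
    tendsto_pow_atTop_nhds_zero_of_lt_one (by norm_num) (by norm_num)
  have hhc : ContinuousOn h (Set.Iio b) := by
    -- the convergence is uniform because `log⁴|t| / |t|` is bounded
    have hunif : TendstoUniformlyOn u h atTop (Set.Iio b) := by
      rw [Metric.tendstoUniformlyOn_iff]
      intro ε hε
      have h1 : Tendsto (fun n : ℕ => 2 * K * (1 + m) * 16 ^ 8 * (1 / 2) ^ n) atTop (𝓝 0) := by
        simpa using hgeo.const_mul (2 * K * (1 + m) * 16 ^ 8)
      filter_upwards [h1.eventually (gt_mem_nhds hε)] with n hn t ht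
      rw [dist_comm, dist_eq_norm]
      refine lt_of_le_of_lt (((hdiff n t ht).norm_le hm (by linarith [hL ht])).trans ?_) hn
      have hta : 0 < |t| := abs_pos.2 (hneg ht).ne
      have hL8 := hL ht
      have h2 : Real.log |t| ^ 4 ≤ 16 ^ 8 * |t| := by
        have h1t : 1 ≤ |t| := by
          by_contra hlt
          have := Real.log_nonpos hta.le (not_le.1 hlt).le
          linarith
        have hs : √|t| ≤ |t| := Real.sqrt_le_iff.2 ⟨hta.le, by nlinarith⟩
        calc Real.log |t| ^ 4 ≤ Real.log |t| ^ 8 :=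
              pow_le_pow_right₀ (by linarith) (by norm_num)
          _ ≤ 16 ^ 8 * √|t| := log_pow_le hta (by linarith)
          _ ≤ _ := by gcongr
      calc 2 * K * (1 / 2) ^ n / |t| * (1 + m) * Real.log |t| ^ 4
          ≤ 2 * K * (1 / 2) ^ n / |t| * (1 + m) * (16 ^ 8 * |t|) := by gcongr
        _ = _ := by field_simp
    exact hunif.continuousOn (Eventually.of_forall fun n => (huK n).1).frequently
  have hfix : ∀ t < b, Φ h t = h t := by
    intro t ht
    have h1 : Tendsto (fun n => u (n + 1) t) atTop (𝓝 (h t)) :=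
      (hh t ht).comp (tendsto_add_atTop_nat 1)
    refine tendsto_nhds_unique ?_ h1
    rw [tendsto_iff_norm_sub_tendsto_zero]
    refine squeeze_zero (fun _ => norm_nonneg _) (fun n => ?_)
      (by
        have h2 := hgeo.const_mul (K / |t| * (1 + m) * Real.log |t| ^ 4)
        rwa [mul_zero] at h2)
    rw [hus]
    have h2 := hΦL (u n) h (2 * K * (1 / 2) ^ n) (by positivity) (huK n).1 (huK n).2 hhc hhB
      (hdiff n) t ht
    refine (h2.norm_le hm (by linarith [hL ht])).trans (le_of_eq ?_)
    ring
  refine ⟨h, hhB, fun t ht => ?_⟩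
  refine (hΦd h hhc hhB t ht).congr_of_eventuallyEq ?_
  filter_upwards [Iio_mem_nhds ht] with s hs
  exact (hfix s hs).symm

/-! ### Solutions with prescribed asymptotics at time `-∞` -/

theorem inv_sqrt_mul_self (t : ℝ) : (√|t|)⁻¹ * (√|t|)⁻¹ = |t|⁻¹ := by
  rw [← mul_inv, Real.mul_self_sqrt (abs_nonneg t)]

/-- Interpolating between the bounds `L²` and `L⁴` gives the power `L³` in the dispersive estimate;
the remaining power of `L` compensates for the growth of `xW`. -/
theorem Bnd.amp_le {m L c t : ℝ} (hL : 0 ≤ L) (hc : 0 ≤ c) (ht : t ≠ 0) {p : Sig}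
    (h : Bnd m L c p) : amp t p ≤ (√|t|)⁻¹ * (2 * (c * L ^ 3)) := by
  refine abs_le_of_sq_le_sq' ((amp_sq_le ht p).trans ?_) (by positivity) |>.2
  calc |t|⁻¹ * (2 * ‖vS p‖ * ‖xS p‖) ≤ |t|⁻¹ * (2 * (c * L ^ 2) * (c * L ^ 4)) := by
        have h1 := h.1
        have h2 := h.2.1
        gcongr
    _ = (√|t|)⁻¹ * (√|t|)⁻¹ * (2 * (c ^ 2 * L ^ 6)) := by rw [inv_sqrt_mul_self]; ring
    _ ≤ (√|t|)⁻¹ * (√|t|)⁻¹ * (4 * (c ^ 2 * L ^ 6)) := by gcongr; norm_num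
    _ = _ := by ring

theorem Bnd.smul {m L c : ℝ} {p : Sig} (h : Bnd m L c p) (z : ℂ) :
    Bnd m L (‖z‖ * c) (z • p) := by
  refine ⟨?_, ?_, ?_⟩ <;> rw [map_smul, norm_smul]
  · exact (mul_le_mul_of_nonneg_left h.1 (norm_nonneg z)).trans (le_of_eq (by ring))
  · exact (mul_le_mul_of_nonneg_left h.2.1 (norm_nonneg z)).trans (le_of_eq (by ring))
  · exact (mul_le_mul_of_nonneg_left h.2.2 (norm_nonneg z)).trans (le_of_eq (by ring))

/-- The nonlinearity preserves the bounds `Bnd`, with a gain of `|t|⁻¹` and of a small constant,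
although `xg` may grow like `L`. -/
theorem bnd_NS_sub {m L e δ a t : ℝ} {f g : Sig} (hm : 0 ≤ m) (hL : 1 ≤ L) (he : 0 ≤ e)
    (hδ : 0 < δ) (hδ1 : δ ≤ 1) (ha : 1 ≤ a) (ht : t ≠ 0)
    (hf : amp t f ≤ (√|t|)⁻¹ * (6 * δ)) (hg : amp t g ≤ (√|t|)⁻¹ * (6 * δ))
    (hfg : Bnd m L e (f - g)) (hgx : ‖xS g‖ ≤ 2 * (δ * (a * L))) (hgd : ‖dS g‖ ≤ 2 * (1 + m)) :
    Bnd m L (|t|⁻¹ * e * (252 * a * δ)) (NS t f - NS t g) := by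
  have hd := hfg.amp_le (by linarith) he ht
  have hrr := inv_sqrt_mul_self t
  have ht1 : 0 ≤ |t|⁻¹ * e := by positivity
  set r := (√|t|)⁻¹ with hr
  have hr0 : 0 ≤ r := by positivity
  have hA0 := amp_nonneg t f
  have hA1 := amp_nonneg t g
  have hA2 := amp_nonneg t (f - g)
  have hAA : amp t f + amp t g ≤ r * (12 * δ) := by linarith
  have hδ2 : δ ^ 2 ≤ δ := by nlinarith
  have hδa : δ ≤ a * δ := le_mul_of_one_le_left hδ.le ha
  have haδ : a * δ ^ 2 ≤ a * δ := mul_le_mul_of_nonneg_left hδ2 (by linarith)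
  obtain ⟨b1, b2, b3⟩ := hfg
  refine ⟨?_, ?_, ?_⟩
  · calc _ ≤ (amp t f + amp t g) ^ 2 * ‖vS (f - g)‖ := norm_vS_NS_sub_le t f g
      _ ≤ (r * (12 * δ)) ^ 2 * (e * L ^ 2) := by gcongr
      _ = |t|⁻¹ * e * (144 * δ ^ 2) * L ^ 2 := by rw [← hrr]; ring
      _ ≤ |t|⁻¹ * e * (252 * a * δ) * L ^ 2 :=
          mul_le_mul_of_nonneg_right (mul_le_mul_of_nonneg_left (by linarith) ht1) (by positivity)
  · calc _ ≤ 3 * amp t f ^ 2 * ‖xS (f - g)‖ +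
          3 * ((amp t f + amp t g) * amp t (f - g)) * ‖xS g‖ := norm_xS_NS_sub_le ht f g
      _ ≤ 3 * (r * (6 * δ)) ^ 2 * (e * L ^ 4) +
          3 * (r * (12 * δ) * (r * (2 * (e * L ^ 3)))) * (2 * (δ * (a * L))) := by gcongr
      _ = |t|⁻¹ * e * (108 * δ ^ 2 + 144 * (a * δ ^ 2)) * L ^ 4 := by rw [← hrr]; ring
      _ ≤ |t|⁻¹ * e * (252 * a * δ) * L ^ 4 :=
          mul_le_mul_of_nonneg_right (mul_le_mul_of_nonneg_left (by linarith) ht1) (by positivity)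
  · have h34 : e * L ^ 3 ≤ e * L ^ 4 :=
      mul_le_mul_of_nonneg_left (pow_le_pow_right₀ hL (by norm_num)) he
    have hd' : amp t (f - g) ≤ r * (2 * (e * L ^ 4)) :=
      hd.trans (mul_le_mul_of_nonneg_left (by linarith) hr0)
    calc _ ≤ 3 * amp t f ^ 2 * ‖dS (f - g)‖ +
          3 * ((amp t f + amp t g) * amp t (f - g)) * ‖dS g‖ := norm_dS_NS_sub_le t f g
      _ ≤ 3 * (r * (6 * δ)) ^ 2 * (e * (1 + m) * L ^ 4) +
          3 * (r * (12 * δ) * (r * (2 * (e * L ^ 4)))) * (2 * (1 + m)) := by gcongr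
      _ = |t|⁻¹ * e * (108 * δ ^ 2 + 144 * δ) * ((1 + m) * L ^ 4) := by rw [← hrr]; ring
      _ ≤ |t|⁻¹ * e * (252 * a * δ) * ((1 + m) * L ^ 4) :=
          mul_le_mul_of_nonneg_right (mul_le_mul_of_nonneg_left (by linarith) ht1) (by positivity)
      _ = _ := by ring

theorem norm_neg_I_mul (lam : ℝ) : ‖-(Complex.I * (lam : ℂ))‖ = |lam| := by
  rw [norm_neg, Profile.norm_I_mul]

theorem abs_mul_smallness_le (lam : ℝ) : |lam| * (252 * slope lam * smallness lam) ≤ 1 / 4 := by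
  have h := smallness_mul lam
  have h1 := mul_le_mul_of_nonneg_right (abs_le_slope lam)
    (show 0 ≤ 252 * slope lam * smallness lam from
      mul_nonneg (by linarith [one_le_slope lam]) (smallness_pos lam).le)
  linarith

/-- The size of the difference between the solution and the approximate solution. -/
def correctionSize (lam m : ℝ) : ℝ := 4 * |lam| * remainderSize lam m

theorem correctionSize_nonneg (lam : ℝ) {m : ℝ} (hm : 0 ≤ m) : 0 ≤ correctionSize lam m := by
  have := remainderSize_nonneg lam hm
  unfold correctionSize
  positivity

namespace Profile

variable {lam m : ℝ} (D : Profile m (smallness lam))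

/-- The vector field of the equation satisfied by the difference between a solution and the
approximate solution. -/
def diffField (lam : ℝ) {m d : ℝ} (D : Profile m d) (t : ℝ) (h : Sig) : Sig :=
  (-(Complex.I * lam)) • (NS t (D.W lam t + h) - NS t (D.W lam t) + D.R lam t)

theorem diffField_sub {d : ℝ} (D : Profile m d) (t : ℝ) (p q : Sig) :
    diffField lam D t p - diffField lam D t q =
      (-(Complex.I * lam)) • (NS t (D.W lam t + p) - NS t (D.W lam t + q)) := by
  unfold diffField
  have e : NS t (D.W lam t + p) - NS t (D.W lam t + q) =
      (NS t (D.W lam t + p) - NS t (D.W lam t) + D.R lam t) -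
      (NS t (D.W lam t + q) - NS t (D.W lam t) + D.R lam t) := by abel
  rw [e]
  exact (smul_sub _ _ _).symm

theorem diffField_zero {d : ℝ} (D : Profile m d) (t : ℝ) :
    diffField lam D t 0 = (-(Complex.I * lam)) • D.R lam t := by
  rw [diffField, add_zero, sub_self, zero_add]

theorem continuousOn_diffField {d b : ℝ} (D : Profile m d) (hb : b ≤ 0) {h : ℝ → Sig}
    (hh : ContinuousOn h (Set.Iio b)) :
    ContinuousOn (fun t => diffField lam D t (h t)) (Set.Iio b) := by
  have hs : Set.Iio b ⊆ Set.Iio 0 := Set.Iio_subset_Iio hb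
  have hW := (D.continuousOn_W lam).mono hs
  exact ((((hW.add hh).NS.sub hW.NS).add ((D.continuousOn_R lam).mono hs)).const_smul
    (-(Complex.I * (lam : ℂ))))

theorem amp_add_le_of_bnd {t : ℝ} (ht : t ≤ -(rootTime lam m) ^ 2) {p : Sig}
    (hp : Bnd m (Real.log |t|) (correctionSize lam m / |t|) p) :
    amp t (D.W lam t + p) ≤ (√|t|)⁻¹ * (6 * smallness lam) := by
  have hm := D.m_nonneg
  have h8 := eight_le_log hm ht
  have hK := correctionSize_nonneg lam hm
  have h1 := hp.amp_le (by linarith) (by positivity) (neg_of_large hm ht).ne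
  have h2 := correction_le (lam := lam) hm ht (show 3 ≤ 8 by norm_num)
  change correctionSize lam m / |t| * _ ≤ _ at h2
  have h3 := D.amp_W_le ht
  calc amp t (D.W lam t + p) ≤ _ := amp_add_le t _ _
    _ ≤ (√|t|)⁻¹ * (4 * smallness lam) + (√|t|)⁻¹ * (2 * smallness lam) := by
        refine add_le_add h3 (h1.trans ?_)
        gcongr
    _ = _ := by ring

theorem bnd_diffField_zero {t : ℝ} (ht : t ≤ -(rootTime lam m) ^ 2) :
    Bnd m (Real.log |t|) (correctionSize lam m / 4 / t ^ 2) (diffField lam D t 0) := by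
  have hm := D.m_nonneg
  have h8 := eight_le_log hm ht
  have hB := remainderSize_nonneg lam hm
  obtain ⟨h1, h2, h3⟩ := D.norm_R_le ht
  rw [D.diffField_zero]
  refine ⟨?_, ?_, ?_⟩ <;> rw [map_smul, norm_smul, norm_neg_I_mul, correctionSize]
  · refine (mul_le_mul_of_nonneg_left h1 (abs_nonneg lam)).trans (le_of_eq (by ring))
  · refine (mul_le_mul_of_nonneg_left h2 (abs_nonneg lam)).trans (le_of_eq (by ring))
  · refine (mul_le_mul_of_nonneg_left h3 (abs_nonneg lam)).trans ?_
    have : 0 ≤ |lam| * (remainderSize lam m / t ^ 2) * Real.log |t| ^ 4 := by positivity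
    calc _ = |lam| * (remainderSize lam m / t ^ 2) * Real.log |t| ^ 4 * 1 := by ring
      _ ≤ |lam| * (remainderSize lam m / t ^ 2) * Real.log |t| ^ 4 * (1 + m) := by
          gcongr
          linarith
      _ = _ := by ring

/-- The contraction property: `smallness` makes the factor of `bnd_NS_sub` at most `1/4`. -/
theorem bnd_diffField_sub {t : ℝ} (ht : t ≤ -(rootTime lam m) ^ 2) {p q : Sig} {η : ℝ}
    (hη : 0 ≤ η) (hp : Bnd m (Real.log |t|) (correctionSize lam m / |t|) p)
    (hq : Bnd m (Real.log |t|) (correctionSize lam m / |t|) q)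
    (hpq : Bnd m (Real.log |t|) (η / |t|) (p - q)) :
    Bnd m (Real.log |t|) (η / 4 / t ^ 2) (diffField lam D t p - diffField lam D t q) := by
  have hm := D.m_nonneg
  have h8 := eight_le_log hm ht
  have hs := one_le_slope lam
  have ht0 := (neg_of_large hm ht).ne
  have hta : 0 < |t| := abs_pos.2 ht0
  have hδ := smallness_pos lam
  have hcor := correction_le (lam := lam) hm ht (show 4 ≤ 8 by norm_num)
  change correctionSize lam m / |t| * _ ≤ _ at hcor
  have hgx : ‖xS (D.W lam t + q)‖ ≤ 2 * (smallness lam * (slope lam * Real.log |t|)) := by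
    rw [map_add]
    refine (norm_add_le _ _).trans ?_
    have h1 : smallness lam ≤ smallness lam * (slope lam * Real.log |t|) :=
      le_mul_of_one_le_right hδ.le (by nlinarith)
    linarith [hq.2.1, D.norm_xS_W_le (lam := lam) (t := t) (by linarith)]
  have hgd : ‖dS (D.W lam t + q)‖ ≤ 2 * (1 + m) := by
    rw [map_add]
    refine (norm_add_le _ _).trans ?_
    have h1 : correctionSize lam m / |t| * (1 + m) * Real.log |t| ^ 4 ≤ 1 * (1 + m) := by
      calc _ = correctionSize lam m / |t| * Real.log |t| ^ 4 * (1 + m) := by ring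
        _ ≤ _ := mul_le_mul_of_nonneg_right (hcor.trans (smallness_le_one lam)) (by linarith)
    linarith [hq.2.2, D.norm_dS_W_le lam t]
  have efg : (D.W lam t + p) - (D.W lam t + q) = p - q := by abel
  have key := bnd_NS_sub (e := η / |t|) hm (by linarith) (by positivity) hδ (smallness_le_one lam) hs ht0
    (D.amp_add_le_of_bnd ht hp) (D.amp_add_le_of_bnd ht hq) (by rwa [efg]) hgx hgd
  have hc : |lam| * (|t|⁻¹ * (η / |t|) * (252 * slope lam * smallness lam)) ≤ η / 4 / t ^ 2 := by
    calc |lam| * (|t|⁻¹ * (η / |t|) * (252 * slope lam * smallness lam))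
        = |t|⁻¹ * (η / |t|) * (|lam| * (252 * slope lam * smallness lam)) := by ring
      _ ≤ |t|⁻¹ * (η / |t|) * (1 / 4) :=
          mul_le_mul_of_nonneg_left (abs_mul_smallness_le lam) (by positivity)
      _ = η / 4 / t ^ 2 := by
          rw [← sq_abs t]
          field_simp
  rw [D.diffField_sub]
  refine Bnd.mono hm ?_ hc
  have := key.smul (-(Complex.I * (lam : ℂ)))
  rwa [norm_neg_I_mul] at this

/-- There is a global solution asymptotic to the approximate solution at time `-∞`. -/
theorem exists_asymptotic_solution : ∃ f : ℝ → Sig,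
    (∀ t, HasDerivAt f (vf lam t (f t)) t) ∧ ∀ t < -(rootTime lam m) ^ 2,
      Bnd m (Real.log |t|) (correctionSize lam m / |t|) (f t - D.W lam t) := by
  have hm := D.m_nonneg
  have hb := neg_of_large (lam := lam) hm le_rfl
  have h8 := eight_le_log (lam := lam) hm le_rfl
  obtain ⟨h, hB, hd⟩ := exists_solution_of_contracting (V := diffField lam D) hm
    (correctionSize_nonneg lam hm) hb h8 (fun h hh => D.continuousOn_diffField hb.le hh)
    (fun t ht => D.bnd_diffField_zero ht.le)
    (fun t ht p q η hη hp hq hpq => D.bnd_diffField_sub ht.le hη hp hq hpq)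
  set b := -(rootTime lam m) ^ 2 with hbdef
  have hsol : ∀ t < b, HasDerivAt (fun t => D.W lam t + h t)
      (vf lam t (D.W lam t + h t)) t := by
    intro t ht
    refine ((D.hasDerivAt_W lam (ht.trans hb)).add (hd t ht)).congr_deriv ?_
    rw [diffField, vf]
    have e : NS t (D.W lam t + h t) = (NS t (D.W lam t) - D.R lam t) +
        (NS t (D.W lam t + h t) - NS t (D.W lam t) + D.R lam t) := by abel
    conv_rhs => rw [e]
    exact (smul_add _ _ _).symm
  obtain ⟨f, hf0, hf⟩ := exists_global_vf lam (b - 1) (D.W lam (b - 1) + h (b - 1))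
  refine ⟨f, hf, fun t ht => ?_⟩
  have e : f t = D.W lam t + h t := by
    refine ode_unique (f := f) (g := fun t => D.W lam t + h t) (lipschitz_vf lam)
      (a := min t (b - 1) - 1) (b := b) (t₀ := b - 1)
      ⟨by linarith [min_le_right t (b - 1)], by linarith⟩ (fun s _ => hf s)
      (fun s hs => hsol s hs.2) hf0 ⟨by linarith [min_le_left t (b - 1)], ht⟩
  rw [e, add_sub_cancel_left]
  exact hB t ht

end Profile

/-! ### Polynomial bounds -/

/-- `0 ≤ e(m) ≤ c m^k (1+m)^N` for some constants `c` and `N`. -/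
def PolyBd (k : ℕ) (e : ℝ → ℝ) : Prop :=
  ∃ (c : ℝ) (N : ℕ), 0 ≤ c ∧ ∀ m, 0 ≤ m → 0 ≤ e m ∧ e m ≤ c * m ^ k * (1 + m) ^ N

namespace PolyBd

variable {k j : ℕ} {e e' : ℝ → ℝ}

theorem add (h : PolyBd k e) (h' : PolyBd k e') : PolyBd k fun m => e m + e' m := by
  obtain ⟨c, N, hc, h⟩ := h
  obtain ⟨c', N', hc', h'⟩ := h'
  refine ⟨c + c', N + N', by positivity, fun m hm => ⟨add_nonneg (h m hm).1 (h' m hm).1, ?_⟩⟩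
  have h1 := pow_le_pow_right₀ (show 1 ≤ 1 + m by linarith) (Nat.le_add_right N N')
  have h2 := pow_le_pow_right₀ (show 1 ≤ 1 + m by linarith) (Nat.le_add_left N' N)
  calc e m + e' m ≤ c * m ^ k * (1 + m) ^ N + c' * m ^ k * (1 + m) ^ N' :=
        add_le_add (h m hm).2 (h' m hm).2
    _ ≤ c * m ^ k * (1 + m) ^ (N + N') + c' * m ^ k * (1 + m) ^ (N + N') := by gcongr
    _ = _ := by ring

theorem mul (h : PolyBd k e) (h' : PolyBd j e') : PolyBd (k + j) fun m => e m * e' m := by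
  obtain ⟨c, N, hc, h⟩ := h
  obtain ⟨c', N', hc', h'⟩ := h'
  refine ⟨c * c', N + N', by positivity, fun m hm => ⟨mul_nonneg (h m hm).1 (h' m hm).1, ?_⟩⟩
  calc e m * e' m ≤ (c * m ^ k * (1 + m) ^ N) * (c' * m ^ j * (1 + m) ^ N') :=
        mul_le_mul (h m hm).2 (h' m hm).2 (h' m hm).1 (by positivity)
    _ = _ := by ring

theorem pow (h : PolyBd k e) (n : ℕ) : PolyBd (k * n) fun m => e m ^ n := by
  obtain ⟨c, N, hc, h⟩ := h
  refine ⟨c ^ n, N * n, by positivity, fun m hm => ⟨pow_nonneg (h m hm).1 n, ?_⟩⟩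
  refine (pow_le_pow_left₀ (h m hm).1 (h m hm).2 n).trans (le_of_eq ?_)
  rw [mul_pow, mul_pow, ← pow_mul, ← pow_mul]

theorem lower (h : PolyBd k e) (hj : j ≤ k) : PolyBd j e := by
  obtain ⟨c, N, hc, h⟩ := h
  refine ⟨c, k - j + N, hc, fun m hm => ⟨(h m hm).1, (h m hm).2.trans ?_⟩⟩
  have h1 : m ^ k ≤ m ^ j * (1 + m) ^ (k - j) := by
    calc m ^ k = m ^ j * m ^ (k - j) := by rw [← pow_add, Nat.add_sub_cancel' hj]
      _ ≤ _ := by gcongr; linarith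
  calc c * m ^ k * (1 + m) ^ N ≤ c * (m ^ j * (1 + m) ^ (k - j)) * (1 + m) ^ N := by gcongr
    _ = _ := by rw [pow_add]; ring

theorem const {a : ℝ} (ha : 0 ≤ a) : PolyBd 0 fun _ => a :=
  ⟨a, 0, ha, fun m _ => ⟨ha, by simp⟩⟩

theorem id : PolyBd 1 fun m => m := ⟨1, 0, zero_le_one, fun m hm => ⟨hm, by simp⟩⟩

theorem one_add : PolyBd 0 fun m => 1 + m :=
  ⟨1, 1, zero_le_one, fun m hm => ⟨by linarith, by simp⟩⟩

end PolyBd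

theorem polyBd_rootTime (lam : ℝ) : PolyBd 0 (rootTime lam) := by
  have h := one_le_slope lam
  refine ⟨16 ^ 8 * 1600 * 1008 * slope lam ^ 7, 11, by positivity, fun m hm => ⟨?_, ?_⟩⟩
  · unfold rootTime; positivity
  · rw [rootTime, pow_zero, mul_one]

theorem polyBd_correctionSize (lam : ℝ) : PolyBd 3 (correctionSize lam) := by
  have h := one_le_slope lam
  refine ⟨4 * |lam| * (400 * slope lam ^ 4), 8, by positivity,
    fun m hm => ⟨correctionSize_nonneg lam hm, le_of_eq ?_⟩⟩
  rw [correctionSize, remainderSize]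
  ring

/-! ### The estimate up to bounded times -/

/-- The modulus of a time beyond the threshold, where the asymptotic bounds hold and from which the
solution is followed up to bounded times. -/
def startTime (lam m : ℝ) : ℝ := 2 * rootTime lam m ^ 2

/-- A bound of `f` and `∂f` at the starting time. -/
def startBound (lam m : ℝ) : ℝ := m + correctionSize lam m * (1 + m)

/-- A bound of `∂f` at all times. -/
def derivBound (lam m : ℝ) : ℝ := startBound lam m + 2 * |lam| * startBound lam m ^ 3

/-- A bound of `xf` at the starting time. -/
def weightBound (lam m : ℝ) : ℝ :=
  2 * m * (slope lam * (1 + m) ^ 2 * startTime lam m) + correctionSize lam m * (1 + m)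

/-- A bound of the solution and the approximate solution in `Σ`. -/
def totalBound (lam m : ℝ) : ℝ :=
  derivBound lam m + weightBound lam m + 3 * startTime lam m * derivBound lam m

/-- A bound of the difference of the solution and the approximate solution in `Σ`. -/
def diffBound (lam m : ℝ) : ℝ :=
  correctionSize lam m * (1 + m) + |lam| * (36 * (1 + startTime lam m) ^ 4 *
    totalBound lam m ^ 3 + 36 * totalBound lam m ^ 3) * startTime lam m

theorem polyBd_startTime (lam : ℝ) : PolyBd 0 (startTime lam) :=
  (PolyBd.const zero_le_two).mul ((polyBd_rootTime lam).pow 2)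

theorem polyBd_correctionSize_mul (lam : ℝ) :
    PolyBd 3 fun m => correctionSize lam m * (1 + m) :=
  (polyBd_correctionSize lam).mul PolyBd.one_add

theorem polyBd_startBound (lam : ℝ) : PolyBd 1 (startBound lam) :=
  PolyBd.id.add ((polyBd_correctionSize_mul lam).lower (by norm_num))

theorem polyBd_derivBound (lam : ℝ) : PolyBd 1 (derivBound lam) := by
  have h1 := (PolyBd.const (show 0 ≤ 2 * |lam| by positivity)).mul ((polyBd_startBound lam).pow 3)
  exact (polyBd_startBound lam).add (h1.lower (by norm_num))

theorem polyBd_weightBound (lam : ℝ) : PolyBd 1 (weightBound lam) := by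
  have h1 := ((PolyBd.const zero_le_two).mul PolyBd.id).mul
    (((PolyBd.const (zero_le_one.trans (one_le_slope lam))).mul (PolyBd.one_add.pow 2)).mul
      (polyBd_startTime lam))
  exact (h1.lower (by norm_num)).add ((polyBd_correctionSize_mul lam).lower (by norm_num))

theorem polyBd_totalBound (lam : ℝ) : PolyBd 1 (totalBound lam) := by
  have h1 := ((PolyBd.const (show (0 : ℝ) ≤ 3 by norm_num)).mul (polyBd_startTime lam)).mul
    (polyBd_derivBound lam)
  exact ((polyBd_derivBound lam).add (polyBd_weightBound lam)).add (h1.lower (by norm_num))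

theorem polyBd_diffBound (lam : ℝ) : PolyBd 3 (diffBound lam) := by
  have h0 := (PolyBd.const (zero_le_one (α := ℝ))).add (polyBd_startTime lam)
  have h1 := ((PolyBd.const (show (0 : ℝ) ≤ 36 by norm_num)).mul (h0.pow 4)).mul
    ((polyBd_totalBound lam).pow 3)
  have h2 := (PolyBd.const (show (0 : ℝ) ≤ 36 by norm_num)).mul ((polyBd_totalBound lam).pow 3)
  have h3 := ((PolyBd.const (abs_nonneg lam)).mul
    ((h1.lower (j := 3) (by norm_num)).add (h2.lower (j := 3) (by norm_num)))).mul
    (polyBd_startTime lam)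
  exact (polyBd_correctionSize_mul lam).add (h3.lower (by norm_num))

theorem PolyBd.nonneg {k : ℕ} {e : ℝ → ℝ} (h : PolyBd k e) {m : ℝ} (hm : 0 ≤ m) : 0 ≤ e m := by
  obtain ⟨c, N, -, h⟩ := h
  exact (h m hm).1

theorem norm_NS_le {T R t : ℝ} (ht : |t| ≤ T) {f : Sig} (hf : ‖f‖ ≤ R) :
    ‖NS t f‖ ≤ 36 * (1 + T) ^ 4 * R ^ 3 := by
  have hR : 0 ≤ R := (norm_nonneg f).trans hf
  have hT : 0 ≤ T := (abs_nonneg t).trans ht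
  have h := norm_NS_sub_le ht hf (g := 0) (by rwa [norm_zero])
  rw [NS_zero, sub_zero, sub_zero] at h
  calc _ ≤ 36 * (1 + T) ^ 4 * R ^ 2 * ‖f‖ := h
    _ ≤ 36 * (1 + T) ^ 4 * R ^ 2 * R := by gcongr
    _ = _ := by ring

theorem norm_cubS_le {R : ℝ} {f : Sig} (hf : ‖f‖ ≤ R) : ‖cubS f‖ ≤ 36 * R ^ 3 := by
  have hR : 0 ≤ R := (norm_nonneg f).trans hf
  have h := norm_cubS_sub_le hf (w := 0) (by rwa [norm_zero])
  rw [cubS_zero, sub_zero, sub_zero] at h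
  calc _ ≤ 36 * R ^ 2 * ‖f‖ := h
    _ ≤ 36 * R ^ 2 * R := by gcongr
    _ = _ := by ring

theorem one_le_log_of_le {t : ℝ} (ht : t ≤ -10) : 1 ≤ Real.log |t| := by
  have hta : |t| = -t := abs_of_neg (by linarith)
  rw [Real.le_log_iff_exp_le (by rw [hta]; linarith), hta]
  linarith [Real.exp_one_lt_d9]

namespace Profile

variable {lam m : ℝ} (D : Profile m (smallness lam)) {f : ℝ → Sig}

/-- On a bounded time interval the size of the difference is controlled by the conservation laws
of the equation. -/
theorem norm_sub_W_le (hf : ∀ t, HasDerivAt f (vf lam t (f t)) t)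
    (h : ∀ t < -(rootTime lam m) ^ 2,
      Bnd m (Real.log |t|) (correctionSize lam m / |t|) (f t - D.W lam t))
    {t : ℝ} (ht : -(rootTime lam m) ^ 2 ≤ t) (ht10 : t ≤ -10) :
    ‖f t - D.W lam t‖ ≤ diffBound lam m := by
  have hm := D.m_nonneg
  have hX := rootTime_ge lam hm
  have hX2 : 0 < rootTime lam m ^ 2 := by positivity
  have hs := one_le_slope lam
  have hK := correctionSize_nonneg lam hm
  set t₀ := -startTime lam m with ht₀
  have ht₀X : t₀ < -(rootTime lam m) ^ 2 := by rw [ht₀, startTime]; linarith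
  have hT0 : 0 < startTime lam m := by rw [startTime]; linarith
  have habs : |t₀| = startTime lam m := by rw [ht₀, abs_neg, abs_of_pos hT0]
  have h8 := eight_le_log hm ht₀X.le
  have hI : ∀ τ ∈ Set.Icc t₀ (-10), |τ| ≤ startTime lam m ∧ Real.log |τ| ≤ startTime lam m ∧
      1 ≤ Real.log |τ| ∧ τ < 0 ∧ 1 ≤ |τ| := by
    intro τ hτ
    have h1 : |τ| = -τ := abs_of_neg (by linarith [hτ.2])
    have h2 : |τ| ≤ startTime lam m := by rw [h1]; linarith [hτ.1]
    exact ⟨h2, (Real.log_le_self (abs_nonneg τ)).trans h2, one_le_log_of_le hτ.2,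
      by linarith [hτ.2], by rw [h1]; linarith [hτ.2]⟩
  have h0mem : t₀ ∈ Set.Icc t₀ (-10) := ⟨le_rfl, by linarith⟩
  have htmem : t ∈ Set.Icc t₀ (-10) := ⟨by linarith, ht10⟩
  -- the difference at the starting time
  have hstart : ‖f t₀ - D.W lam t₀‖ ≤ correctionSize lam m * (1 + m) := by
    refine ((h t₀ ht₀X).norm_le hm (by linarith)).trans ?_
    have h1 := mul_log_pow_le (lam := lam) (c := 1) hm ht₀X.le (show 4 ≤ 8 by norm_num)
      zero_le_one (by rwa [one_mul])
    rw [one_mul] at h1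
    have hpos : 0 < |t₀| := by rw [habs]; exact hT0
    calc _ ≤ correctionSize lam m / |t₀| * (1 + m) * |t₀| := by gcongr
      _ = _ := by field_simp
  have hadd : ∀ A : Sig →L[ℂ] L2, (∀ p, ‖A p‖ ≤ ‖p‖) →
      ‖A (f t₀)‖ ≤ ‖A (D.W lam t₀)‖ + correctionSize lam m * (1 + m) := by
    intro A hA
    have e : A (f t₀) = A (D.W lam t₀) + A (f t₀ - D.W lam t₀) := by
      rw [← map_add, add_sub_cancel]
    rw [e]
    exact (norm_add_le _ _).trans (add_le_add le_rfl ((hA _).trans hstart))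
  have hv0 : ‖vS (f t₀)‖ ≤ startBound lam m :=
    (hadd vS CubicNLS.norm_vS_le).trans (add_le_add (D.norm_vS_W_le' lam t₀) le_rfl)
  have hd0 : ‖dS (f t₀)‖ ≤ startBound lam m :=
    (hadd dS CubicNLS.norm_dS_le).trans (add_le_add (D.norm_dS_W_le lam t₀) le_rfl)
  have hxW : ∀ τ ∈ Set.Icc t₀ (-10), ‖xS (D.W lam τ)‖ ≤
      2 * m * (slope lam * (1 + m) ^ 2 * startTime lam m) := by
    intro τ hτ
    have h3 := (hI τ hτ).2.1
    refine (D.norm_xS_W_le' (hI τ hτ).2.2.1).trans ?_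
    gcongr
  have hx0 : ‖xS (f t₀)‖ ≤ weightBound lam m :=
    (hadd xS CubicNLS.norm_xS_le).trans (add_le_add (hxW t₀ h0mem) le_rfl)
  -- the solution and the approximate solution on the interval
  have hsb := (polyBd_startBound lam).nonneg hm
  have hwb := (polyBd_weightBound lam).nonneg hm
  have hdb := (polyBd_derivBound lam).nonneg hm
  have hsd : startBound lam m ≤ derivBound lam m := by
    rw [derivBound]
    have : 0 ≤ 2 * |lam| * startBound lam m ^ 3 := by positivity
    linarith
  have hTd : 0 ≤ 3 * startTime lam m * derivBound lam m := by positivity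
  have hcv : Convex ℝ (Set.Icc t₀ (-10)) := convex_Icc _ _
  have hDle : ‖dS (f t₀)‖ + 2 * |lam| * ‖vS (f t₀)‖ ^ 3 ≤ derivBound lam m := by
    rw [derivBound]
    gcongr
  have hfT : ∀ τ ∈ Set.Icc t₀ (-10), ‖f τ‖ ≤ totalBound lam m := by
    intro τ hτ
    have h1 := norm_vS_conserved hcv (fun s _ => hf s) h0mem hτ
    have h2 := norm_dS_le_of_solution hcv (fun s _ => hf s) h0mem hτ
    have h3 := norm_xS_le_of_solution hcv (fun s _ => hf s) h0mem hτ
    have h4 : |t₀| + |τ| + |τ - t₀| ≤ 3 * startTime lam m := by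
      rw [habs, abs_of_nonneg (show 0 ≤ τ - t₀ by linarith [hτ.1]), abs_of_neg (hI τ hτ).2.2.2.1,
        ht₀]
      linarith
    have h5 : (|t₀| + |τ| + |τ - t₀|) * (‖dS (f t₀)‖ + 2 * |lam| * ‖vS (f t₀)‖ ^ 3) ≤
        3 * startTime lam m * derivBound lam m :=
      mul_le_mul h4 hDle (by positivity) (by positivity)
    unfold totalBound
    exact norm_S_le (by linarith) (by linarith) (by linarith)
  have hWT : ∀ τ ∈ Set.Icc t₀ (-10), ‖D.W lam τ‖ ≤ totalBound lam m := by
    intro τ hτ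
    have h1 : m ≤ startBound lam m := by
      rw [startBound]
      have : 0 ≤ correctionSize lam m * (1 + m) := by positivity
      linarith
    have h2 : ‖xS (D.W lam τ)‖ ≤ weightBound lam m := by
      refine (hxW τ hτ).trans ?_
      rw [weightBound]
      have : 0 ≤ correctionSize lam m * (1 + m) := by positivity
      linarith
    unfold totalBound
    exact norm_S_le (by linarith [D.norm_vS_W_le' lam τ]) (by linarith [D.norm_dS_W_le lam τ])
      (by linarith)
  -- integrate the derivative of the difference
  have hder : ∀ τ ∈ Set.Icc t₀ (-10), HasDerivWithinAt (fun τ => f τ - D.W lam τ)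
      (vf lam τ (f τ) - (-(Complex.I * lam)) • (NS τ (D.W lam τ) - D.R lam τ))
      (Set.Icc t₀ (-10)) τ := fun τ hτ =>
    ((hf τ).sub (D.hasDerivAt_W lam (hI τ hτ).2.2.2.1)).hasDerivWithinAt
  have hbd : ∀ τ ∈ Set.Icc t₀ (-10),
      ‖vf lam τ (f τ) - (-(Complex.I * lam)) • (NS τ (D.W lam τ) - D.R lam τ)‖ ≤
      |lam| * (36 * (1 + startTime lam m) ^ 4 * totalBound lam m ^ 3 +
        36 * totalBound lam m ^ 3) := by
    intro τ hτ
    have e : NS τ (D.W lam τ) - D.R lam τ =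
        ((|τ|⁻¹ : ℝ) : ℂ) • FS.symm (cubS (D.G (lam * Real.log |τ|))) := sub_sub_cancel _ _
    rw [e, mul_add]
    refine (norm_sub_le _ _).trans (add_le_add ?_ ?_)
    · rw [vf, norm_smul, norm_neg_I_mul]
      exact mul_le_mul_of_nonneg_left (norm_NS_le (hI τ hτ).1 (hfT τ hτ)) (abs_nonneg lam)
    · rw [norm_smul, norm_neg_I_mul, norm_smul, Complex.norm_real, norm_eq_abs,
        abs_of_nonneg (inv_nonneg.2 (abs_nonneg τ)), LinearIsometryEquiv.norm_map]
      have hG : ‖D.G (lam * Real.log |τ|)‖ ≤ totalBound lam m := by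
        have := hWT τ hτ
        rwa [W, LinearIsometryEquiv.norm_map] at this
      refine mul_le_mul_of_nonneg_left ?_ (abs_nonneg lam)
      calc |τ|⁻¹ * ‖cubS (D.G (lam * Real.log |τ|))‖ ≤ 1 * (36 * totalBound lam m ^ 3) :=
            mul_le_mul (inv_le_one_of_one_le₀ (hI τ hτ).2.2.2.2) (norm_cubS_le hG)
              (norm_nonneg _) zero_le_one
        _ = _ := one_mul _
  have hmv := hcv.norm_image_sub_le_of_norm_hasDerivWithin_le hder hbd h0mem htmem
  have h9 : ‖t - t₀‖ ≤ startTime lam m := by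
    rw [norm_eq_abs, abs_of_nonneg (by linarith), ht₀]
    linarith
  have htb := (polyBd_totalBound lam).nonneg hm
  calc ‖f t - D.W lam t‖ = ‖(f t₀ - D.W lam t₀) +
        ((f t - D.W lam t) - (f t₀ - D.W lam t₀))‖ := by congr 1; abel
    _ ≤ _ := norm_add_le _ _
    _ ≤ diffBound lam m := add_le_add hstart (hmv.trans
        (mul_le_mul_of_nonneg_left h9 (by positivity)))

/-- The estimate of the difference for all times `t ≤ -10`. -/
theorem norm_sum_le (hf : ∀ t, HasDerivAt f (vf lam t (f t)) t)
    (h : ∀ t < -(rootTime lam m) ^ 2,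
      Bnd m (Real.log |t|) (correctionSize lam m / |t|) (f t - D.W lam t))
    {t : ℝ} (ht : t ≤ -10) :
    ‖vS (f t - D.W lam t)‖ + ‖dS (f t - D.W lam t)‖ + ‖xS (f t - D.W lam t)‖ ≤
      3 * (correctionSize lam m * (1 + m) + diffBound lam m * startTime lam m) *
        (Real.log |t| ^ 4 / |t|) := by
  have hm := D.m_nonneg
  have hL := one_le_log_of_le ht
  have hta : 0 < |t| := abs_pos.2 (by linarith)
  have hK := correctionSize_nonneg lam hm
  have hDB := (polyBd_diffBound lam).nonneg hm
  have hT := (polyBd_startTime lam).nonneg hm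
  have key : ‖f t - D.W lam t‖ ≤
      (correctionSize lam m * (1 + m) + diffBound lam m * startTime lam m) *
        (Real.log |t| ^ 4 / |t|) := by
    rcases lt_or_ge t (-(rootTime lam m) ^ 2) with h1 | h1
    · refine ((h t h1).norm_le hm hL).trans ?_
      calc _ = (correctionSize lam m * (1 + m) + 0) * (Real.log |t| ^ 4 / |t|) := by ring
        _ ≤ _ := by
          have : 0 ≤ diffBound lam m * startTime lam m := by positivity
          gcongr
    · refine (D.norm_sub_W_le hf h h1 ht).trans ?_
      have h2 : |t| ≤ startTime lam m := by
        rw [abs_of_neg (by linarith), startTime]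
        nlinarith [sq_nonneg (rootTime lam m)]
      have h3 : 1 ≤ Real.log |t| ^ 4 := one_le_pow₀ hL
      calc diffBound lam m = diffBound lam m * |t| * (1 / |t|) := by field_simp
        _ ≤ diffBound lam m * startTime lam m * (Real.log |t| ^ 4 / |t|) := by gcongr
        _ ≤ _ := by
          have : 0 ≤ correctionSize lam m * (1 + m) := by positivity
          gcongr
          linarith
  have h1 := CubicNLS.norm_vS_le (f t - D.W lam t)
  have h2 := CubicNLS.norm_dS_le (f t - D.W lam t)
  have h3 := CubicNLS.norm_xS_le (f t - D.W lam t)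
  linarith

end Profile

/-- The constant in the final estimate is `m³` times a polynomial in `m`. -/
theorem polyBd_estimate (lam : ℝ) : PolyBd 3 fun m =>
    3 * (correctionSize lam m * (1 + m) + diffBound lam m * startTime lam m) := by
  have h1 := (PolyBd.const (show (0 : ℝ) ≤ 3 by norm_num)).mul
    ((polyBd_correctionSize_mul lam).add
      (((polyBd_diffBound lam).mul (polyBd_startTime lam)).lower (j := 3) (by norm_num)))
  exact h1.lower (by norm_num)

/-! ### Uniqueness of the asymptotic state -/

theorem tendsto_log_pow_div (n : ℕ) :
    Tendsto (fun t : ℝ => Real.log |t| ^ n / |t|) atBot (𝓝 0) :=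
  (isLittleO_pow_log_id_atTop (n := n)).tendsto_div_nhds_zero.comp tendsto_abs_atBot_atTop

namespace Profile

variable {lam m : ℝ} (D : Profile m (smallness lam)) {f g : ℝ → Sig}

/-- Any solution satisfying the asymptotic estimate has small dispersive amplitude near `-∞`. -/
theorem eventually_amp_le {M : ℝ} (hM : 0 ≤ M)
    (h : ∀ t ≤ -10, ‖vS (f t - D.W lam t)‖ ≤ M * (Real.log |t| ^ 4 / |t|) ∧
      ‖xS (f t - D.W lam t)‖ ≤ M * (Real.log |t| ^ 4 / |t|)) :
    ∀ᶠ t in atBot, amp t (f t) ≤ (√|t|)⁻¹ * (6 * smallness lam) := by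
  have h1 : Tendsto (fun t : ℝ => M * (Real.log |t| ^ 4 / |t|)) atBot (𝓝 0) := by
    have := (tendsto_log_pow_div 4).const_mul M
    rwa [mul_zero] at this
  filter_upwards [h1.eventually (gt_mem_nhds (smallness_pos lam)), eventually_le_atBot (-10),
    eventually_le_atBot (-(rootTime lam m) ^ 2)] with t h2 h3 h4
  obtain ⟨hv, hx⟩ := h t h3
  set e := M * (Real.log |t| ^ 4 / |t|) with he
  have he0 : 0 ≤ e := (norm_nonneg _).trans hv
  have hh : amp t (f t - D.W lam t) ≤ (√|t|)⁻¹ * (2 * e) := by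
    refine abs_le_of_sq_le_sq' ((amp_sq_le (by linarith) _).trans ?_) (by positivity) |>.2
    calc _ ≤ |t|⁻¹ * (2 * e * e) := by gcongr
      _ = (√|t|)⁻¹ * (√|t|)⁻¹ * (2 * e ^ 2) := by rw [inv_sqrt_mul_self]; ring
      _ ≤ (√|t|)⁻¹ * (√|t|)⁻¹ * (4 * e ^ 2) := by gcongr; norm_num
      _ = _ := by ring
  calc amp t (f t) = amp t (D.W lam t + (f t - D.W lam t)) := by rw [add_sub_cancel]
    _ ≤ _ := amp_add_le t _ _
    _ ≤ (√|t|)⁻¹ * (4 * smallness lam) + (√|t|)⁻¹ * (2 * smallness lam) := by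
        refine add_le_add (D.amp_W_le h4) (hh.trans ?_)
        gcongr
    _ = _ := by ring

/-- A solution is determined by its approximate solution at time `-∞`: the quantity
`|t| ‖f(t) - g(t)‖²` does not increase, and tends to `0` at `-∞`. -/
theorem eq_of_asymptotic (hf : ∀ t, HasDerivAt f (vf lam t (f t)) t)
    (hg : ∀ t, HasDerivAt g (vf lam t (g t)) t) {M : ℝ} (hM : 0 ≤ M)
    (hfM : ∀ t ≤ -10, ‖vS (f t - D.W lam t)‖ ≤ M * (Real.log |t| ^ 4 / |t|) ∧
      ‖xS (f t - D.W lam t)‖ ≤ M * (Real.log |t| ^ 4 / |t|))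
    (hgM : ∀ t ≤ -10, ‖vS (g t - D.W lam t)‖ ≤ M * (Real.log |t| ^ 4 / |t|) ∧
      ‖xS (g t - D.W lam t)‖ ≤ M * (Real.log |t| ^ 4 / |t|)) : f = g := by
  obtain ⟨b, hb⟩ := eventually_atBot.1
    (((D.eventually_amp_le hM hfM).and (D.eventually_amp_le hM hgM)).and
      (eventually_le_atBot (-10)))
  set y : ℝ → L2 := fun t => vS (f t - g t) with hy
  have hyd : ∀ t, HasDerivAt y (vS (vf lam t (f t) - vf lam t (g t))) t := fun t =>
    hasDerivAt_vS ((hf t).sub (hg t))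
  set z : ℝ → ℝ := fun t => -t * ‖y t‖ ^ 2 with hz
  have hzd : ∀ t, HasDerivAt z (-1 * ‖y t‖ ^ 2 +
      -t * (2 * (inner ℂ (y t) (vS (vf lam t (f t) - vf lam t (g t)))).re)) t := fun t =>
    (hasDerivAt_id t).neg.mul (hasDerivAt_normSq (hyd t))
  have hanti : AntitoneOn z (Set.Iic b) := by
    refine antitoneOn_of_deriv_nonpos (convex_Iic b)
      (fun t _ => (hzd t).continuousAt.continuousWithinAt)
      (fun t _ => (hzd t).differentiableAt.differentiableWithinAt) fun t ht => ?_
    rw [interior_Iic] at ht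
    obtain ⟨⟨h1, h2⟩, h3⟩ := hb t (le_of_lt ht)
    rw [(hzd t).deriv]
    have hta : |t| = -t := abs_of_neg (by linarith)
    have hta0 : 0 < |t| := by rw [hta]; linarith
    have hδ := smallness_pos lam
    have hN : ‖vS (vf lam t (f t) - vf lam t (g t))‖ ≤
        |lam| * ((144 * smallness lam ^ 2) * |t|⁻¹ * ‖y t‖) := by
      have e : vf lam t (f t) - vf lam t (g t) =
          (-(Complex.I * lam)) • (NS t (f t) - NS t (g t)) := (smul_sub _ _ _).symm
      rw [e, map_smul, norm_smul, norm_neg_I_mul]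
      refine mul_le_mul_of_nonneg_left ((norm_vS_NS_sub_le t _ _).trans ?_) (abs_nonneg lam)
      have hA := amp_nonneg t (f t)
      have hA' := amp_nonneg t (g t)
      calc (amp t (f t) + amp t (g t)) ^ 2 * ‖y t‖
          ≤ ((√|t|)⁻¹ * (6 * smallness lam) + (√|t|)⁻¹ * (6 * smallness lam)) ^ 2 * ‖y t‖ := by
            gcongr
        _ = 144 * smallness lam ^ 2 * ((√|t|)⁻¹ * (√|t|)⁻¹) * ‖y t‖ := by ring
        _ = _ := by rw [inv_sqrt_mul_self]
    have hre : (inner ℂ (y t) (vS (vf lam t (f t) - vf lam t (g t)))).re ≤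
        ‖y t‖ * (|lam| * ((144 * smallness lam ^ 2) * |t|⁻¹ * ‖y t‖)) :=
      (Complex.re_le_norm _).trans ((norm_inner_le_norm _ _).trans
        (mul_le_mul_of_nonneg_left hN (norm_nonneg _)))
    have hsm : 288 * |lam| * smallness lam ^ 2 ≤ 1 := by
      have h4 := abs_mul_smallness_le lam
      have h5 := smallness_le_one lam
      have h6 := one_le_slope lam
      have h7 : |lam| * smallness lam ^ 2 ≤ |lam| * (slope lam * smallness lam) := by
        gcongr
        nlinarith
      nlinarith
    have h8 := mul_le_mul_of_nonneg_left hre (show 0 ≤ 2 * |t| by positivity)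
    have h9 : 2 * |t| * (‖y t‖ * (|lam| * ((144 * smallness lam ^ 2) * |t|⁻¹ * ‖y t‖))) =
        (288 * |lam| * smallness lam ^ 2) * ‖y t‖ ^ 2 := by
      field_simp
      ring
    have h10 : (288 * |lam| * smallness lam ^ 2) * ‖y t‖ ^ 2 ≤ 1 * ‖y t‖ ^ 2 := by gcongr
    rw [← hta]
    linarith
  have hzlim : Tendsto (fun t : ℝ => 4 * M ^ 2 * (Real.log |t| ^ 8 / |t|)) atBot (𝓝 0) := by
    have := (tendsto_log_pow_div 8).const_mul (4 * M ^ 2)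
    rwa [mul_zero] at this
  have hzb : ∀ t ≤ b, z t ≤ 0 := by
    intro t ht
    refine ge_of_tendsto hzlim ?_
    filter_upwards [eventually_le_atBot t] with s hs
    have hsb := hs.trans ht
    have hs10 := (hb s hsb).2
    refine (hanti hsb ht hs).trans ?_
    have hta : |s| = -s := abs_of_neg (by linarith)
    have hta0 : 0 < |s| := by rw [hta]; linarith
    have hys : ‖y s‖ ≤ 2 * (M * (Real.log |s| ^ 4 / |s|)) := by
      have e : y s = vS (f s - D.W lam s) - vS (g s - D.W lam s) := by
        change vS (f s - g s) = _
        rw [← map_sub, sub_sub_sub_cancel_right]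
      rw [e]
      refine (norm_sub_le _ _).trans ?_
      linarith [(hfM s hs10).1, (hgM s hs10).1]
    calc z s = |s| * ‖y s‖ ^ 2 := by rw [hz, hta]
      _ ≤ |s| * (2 * (M * (Real.log |s| ^ 4 / |s|))) ^ 2 := by gcongr
      _ = _ := by
        field_simp
        ring
  have hyb : y b = 0 := by
    have h1 := hzb b le_rfl
    have h2 := (hb b le_rfl).2
    have h3 : ‖y b‖ ^ 2 ≤ 0 := by
      rw [hz] at h1
      nlinarith [sq_nonneg ‖y b‖]
    exact norm_eq_zero.1 (pow_eq_zero_iff two_ne_zero |>.1 (le_antisymm h3 (sq_nonneg _)))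
  refine vf_unique hf hg (t₀ := b) (ext_S ?_)
  change vS (f b - g b) = 0 at hyb
  rw [map_sub] at hyb
  exact sub_eq_zero.1 hyb

end Profile

/-! ### The wave operator -/

/-- The difference that the estimate measures is a difference in the interaction picture. -/
theorem sub_u₂_eq {lam m d : ℝ} (D : Profile m d) {um : L2} (hp : vS D.p = fourierHat um)
    (t : ℝ) (q : Sig) : U (-t) (vS (US t q) - u₂ lam um t) = vS (q - D.W lam t) := by
  have h : u₂ lam um t = vS (US t (D.W lam t)) := u₂_eq lam hp D.hasAC t
  rw [h, ← map_sub, ← map_sub, vS_US, U_neg_U]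

end CubicNLS

end

theorem proposition3p1 (lam : ℝ) :
    ∃ δ₀ : ℝ, 0 < δ₀ ∧ ∃ C : ℝ, 0 < C ∧ ∃ P : Polynomial ℝ,
      ∀ um : L2, MemCalH um → h1ENorm (fourierHat um) ≤ ENNReal.ofReal δ₀ →
        ∃ u₀ : L2, MemSigma u₀ ∧
          (∃ u : ℝ → L2, IsGlobalSolution lam u ∧ u 0 = u₀ ∧
            (∀ v : ℝ → L2, IsGlobalSolution lam v → v 0 = u₀ → v = u) ∧
            WaveEstimate lam C P um u) ∧
          (∀ u₀' : L2, MemSigma u₀' →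
            (∃ u : ℝ → L2, IsGlobalSolution lam u ∧ u 0 = u₀' ∧ WaveEstimate lam C P um u) →
            u₀' = u₀) := by
  obtain ⟨c, N, hc, hcN⟩ := polyBd_estimate lam
  refine ⟨smallness lam, smallness_pos lam, c + 1, by linarith, (1 + Polynomial.X) ^ N,
    fun um hum hδ => ?_⟩
  obtain ⟨D, hp⟩ := hum.exists_profile' (smallness_pos lam).le (smallness_le_one lam) hδ
  obtain ⟨f, hf, hfB⟩ := D.exists_asymptotic_solution
  have hm := D.m_nonneg
  have hP : ((1 + Polynomial.X) ^ N : Polynomial ℝ).eval (calHNorm um) =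
      (1 + calHNorm um) ^ N := by simp
  have hbd := (hcN (calHNorm um) hm).2
  obtain ⟨M, hM⟩ : ∃ M, M = (c + 1) * calHNorm um ^ 3 * (1 + calHNorm um) ^ N := ⟨_, rfl⟩
  have hM0 : 0 ≤ M := by rw [hM]; positivity
  have hcM : c * calHNorm um ^ 3 * (1 + calHNorm um) ^ N ≤ M := by
    rw [hM]
    gcongr
    linarith
  have hest : ∀ t ≤ -10, ‖vS (f t - D.W lam t)‖ + ‖dS (f t - D.W lam t)‖ +
      ‖xS (f t - D.W lam t)‖ ≤ M * (Real.log |t| ^ 4 / |t|) := by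
    intro t ht
    have hL := one_le_log_of_le ht
    refine (D.norm_sum_le hf hfB ht).trans (mul_le_mul_of_nonneg_right ?_ (by positivity))
    exact hbd.trans hcM
  have hcomp : ∀ q : ℝ → Sig, (∀ t ≤ -10, ‖vS (q t - D.W lam t)‖ + ‖dS (q t - D.W lam t)‖ +
      ‖xS (q t - D.W lam t)‖ ≤ M * (Real.log |t| ^ 4 / |t|)) → ∀ t ≤ -10,
      ‖vS (q t - D.W lam t)‖ ≤ M * (Real.log |t| ^ 4 / |t|) ∧
      ‖xS (q t - D.W lam t)‖ ≤ M * (Real.log |t| ^ 4 / |t|) := fun q hq t ht => by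
    have h1 := norm_nonneg (vS (q t - D.W lam t))
    have h2 := norm_nonneg (dS (q t - D.W lam t))
    have h3 := norm_nonneg (xS (q t - D.W lam t))
    have h4 := hq t ht
    exact ⟨by linarith, by linarith⟩
  have hsol := isGlobalSolution_of_hasDerivAt hf
  refine ⟨vS (US 0 (f 0)), memSigma_vS _, ⟨fun t => vS (US t (f t)), hsol, rfl,
    fun v hv hv0 => hv.unique hsol hv0, fun t ht => ?_⟩, ?_⟩
  · rw [sub_u₂_eq D hp, sigmaNorm_vS]
    refine ⟨memSigma_vS _, ?_⟩
    rw [hP, ← hM]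
    exact hest t ht
  · rintro u₀' - ⟨u, hu, rfl, hW⟩
    -- in the interaction picture, any competitor is an integral curve with the same asymptotics
    obtain ⟨g, hg, hgu⟩ := hu.exists_hasDerivAt
    have hgest : ∀ t ≤ -10, ‖vS (g t - D.W lam t)‖ + ‖dS (g t - D.W lam t)‖ +
        ‖xS (g t - D.W lam t)‖ ≤ M * (Real.log |t| ^ 4 / |t|) := by
      intro t ht
      have h := (hW t ht).2
      rwa [hgu, sub_u₂_eq D hp, sigmaNorm_vS, hP, ← hM] at h
    rw [hgu, D.eq_of_asymptotic hg hf hM0 (hcomp g hgest) (hcomp f hest)]
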